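/- Let $G$ be an \emph{outerplanar triangulated $st$-digraph} with $n\ge 2$ vertices, i.e. a finite simple acyclic digraph with exactly one source and exactly one sink, given with a planar embedding in which all vertices lie on the boundary of the external face and every internal face is a triangle. An \emph{upward topological $2$-page book embedding} of $G$ is a drawing of $G$ without edge crossings in which the vertices are distinct points of a vertical line (the spine), every edge is monotonically increasing in the upward direction and consists of arcs that lie alternately in the left and in the right of the two half-planes (pages) bounded by the spine, and the embedding of $G$ (the clockwise order of the edges around each vertex, and the external face) is preserved; a \emph{spine crossing} is a point at which an edge passes from one page to the other. There is an algorithm that, given $G$ (by its half-edge data structure), computes in $O(n)$ time on a random access machine with words of $O(\log n)$ bits an upward topological $2$-page book embedding of $G$ with at most one spine crossing per edge, whose number of spine crossings is minimum among all upward topological $2$-page book embeddings of $G$ with at most one spine crossing per edge, together with this number of spine crossings. -/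

import Mathlib

/-! ### A random access machine with a step count -/

namespace RAM

/-- Memory: scalar registers and arrays of natural numbers. -/
structure State where
  var : ℕ → ℕ
  arr : ℕ → ℕ → ℕ

/-- `x := m`. -/
def State.setVar (σ : State) (x m : ℕ) : State :=
  { σ with var := Function.update σ.var x m }

/-- `a[i] := m`. -/
def State.setArr (σ : State) (a i m : ℕ) : State :=
  { σ with arr := Function.update σ.arr a (Function.update (σ.arr a) i m) }

/-- Expressions; `get a e` reads the cell `e` of the array `a`.
Only addition and truncated subtraction are available. -/
inductive Expr where
  | lit (k : ℕ)
  | var (x : ℕ)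
  | get (a : ℕ) (e : Expr)
  | add (e f : Expr)
  | sub (e f : Expr)

def Expr.eval (σ : State) : Expr → ℕ
  | .lit k => k
  | .var x => σ.var x
  | .get a e => σ.arr a (e.eval σ)
  | .add e f => e.eval σ + f.eval σ
  | .sub e f => e.eval σ - f.eval σ

inductive Test where
  | le (e f : Expr)
  | eq (e f : Expr)
  | not (b : Test)
  | and (b c : Test)

def Test.eval (σ : State) : Test → Prop
  | .le e f => e.eval σ ≤ f.eval σ
  | .eq e f => e.eval σ = f.eval σ
  | .not b => ¬ b.eval σ
  | .and b c => b.eval σ ∧ c.eval σ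

inductive Cmd where
  | skip
  | assign (x : ℕ) (e : Expr)
  | store (a : ℕ) (i e : Expr)
  | seq (c d : Cmd)
  | ite (b : Test) (c d : Cmd)
  | while (b : Test) (c : Cmd)

/-- `Runs W c σ σ' T`: started in `σ`, the program `c` halts in `σ'` after `T` steps, and every
number that it writes to memory is at most `W`. Every assignment, every store and every evaluation
of a test is one step; the expressions and tests in a program have constant size. -/
inductive Runs (W : ℕ) : Cmd → State → State → ℕ → Prop
  | skip (σ : State) : Runs W .skip σ σ 0
  | assign (x : ℕ) (e : Expr) (σ : State) (h : e.eval σ ≤ W) :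
      Runs W (.assign x e) σ (σ.setVar x (e.eval σ)) 1
  | store (a : ℕ) (i e : Expr) (σ : State) (h : e.eval σ ≤ W) :
      Runs W (.store a i e) σ (σ.setArr a (i.eval σ) (e.eval σ)) 1
  | seq {c d : Cmd} {σ₁ σ₂ σ₃ : State} {T₁ T₂ : ℕ}
      (hc : Runs W c σ₁ σ₂ T₁) (hd : Runs W d σ₂ σ₃ T₂) :
      Runs W (.seq c d) σ₁ σ₃ (T₁ + T₂)
  | ite_true {b : Test} {c d : Cmd} {σ₁ σ₂ : State} {T : ℕ}
      (hb : b.eval σ₁) (hc : Runs W c σ₁ σ₂ T) : Runs W (.ite b c d) σ₁ σ₂ (T + 1)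
  | ite_false {b : Test} {c d : Cmd} {σ₁ σ₂ : State} {T : ℕ}
      (hb : ¬ b.eval σ₁) (hd : Runs W d σ₁ σ₂ T) : Runs W (.ite b c d) σ₁ σ₂ (T + 1)
  | while_false {b : Test} {c : Cmd} {σ : State}
      (hb : ¬ b.eval σ) : Runs W (.while b c) σ σ 1
  | while_true {b : Test} {c : Cmd} {σ₁ σ₂ σ₃ : State} {T₁ T₂ : ℕ}
      (hb : b.eval σ₁) (hc : Runs W c σ₁ σ₂ T₁) (hw : Runs W (.while b c) σ₂ σ₃ T₂) :
      Runs W (.while b c) σ₁ σ₃ (T₁ + T₂ + 1)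

end RAM

/-! ### Embedded digraphs -/

/-- A finite simple digraph on the vertices `0, …, n - 1` with a combinatorial embedding: the
neighbours (both along outgoing and along incoming arcs) of every vertex in clockwise order, and
the external face, which is given by a half-edge that has it on its left. -/
structure EmbeddedDigraph (n : ℕ) where
  arc : Fin n → Fin n → Bool
  asymm : ∀ u v, arc u v = true → arc v u = false
  rot : Fin n → List (Fin n)
  rot_nodup : ∀ v, (rot v).Nodup
  mem_rot : ∀ v w, w ∈ rot v ↔ (arc v w = true ∨ arc w v = true)
  outer : Fin n × Fin n
  outer_mem : outer.2 ∈ rot outer.1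

namespace EmbeddedDigraph

variable {n : ℕ}

/-- The next half-edge along the boundary of the face on the left of the half-edge `d`: at the
head `d.2`, continue with the neighbour that follows `d.1` in clockwise order. -/
def faceNext (G : EmbeddedDigraph n) (d : Fin n × Fin n) : Fin n × Fin n :=
  (d.2, (G.rot d.2).formPerm d.1)

/-- The face on the left of the half-edge `d`, as the set of its boundary half-edges. -/
def face (G : EmbeddedDigraph n) (d : Fin n × Fin n) : Set (Fin n × Fin n) :=
  {e | ∃ k : ℕ, G.faceNext^[k] d = e}

def faces (G : EmbeddedDigraph n) : Set (Set (Fin n × Fin n)) :=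
  {F | ∃ v, ∃ w ∈ G.rot v, F = G.face (v, w)}

/-- The arcs, as a finite set of pairs (tail, head). -/
def arcs (G : EmbeddedDigraph n) : Finset (Fin n × Fin n) :=
  Finset.univ.filter fun d => G.arc d.1 d.2 = true

def Connected (G : EmbeddedDigraph n) : Prop :=
  ∀ u v, Relation.ReflTransGen (fun a b => b ∈ G.rot a) u v

/-- The rotation system is connected and has genus zero (Euler's formula). -/
def IsPlane (G : EmbeddedDigraph n) : Prop :=
  G.Connected ∧ n + G.faces.ncard = G.arcs.card + 2

def Acyclic (G : EmbeddedDigraph n) : Prop :=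
  ∀ v, ¬ Relation.TransGen (fun a b => G.arc a b = true) v v

def IsSource (G : EmbeddedDigraph n) (v : Fin n) : Prop := ∀ u, G.arc u v = false

def IsSink (G : EmbeddedDigraph n) (v : Fin n) : Prop := ∀ u, G.arc v u = false

def OnExternalFace (G : EmbeddedDigraph n) (v : Fin n) : Prop :=
  ∃ w, (v, w) ∈ G.face G.outer

/-- Planar st-digraphs. -/
structure IsPlanarST (G : EmbeddedDigraph n) : Prop where
  plane : G.IsPlane
  acyclic : G.Acyclic
  source : ∃! s, G.IsSource s
  sink : ∃! t, G.IsSink t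
  source_external : ∀ s, G.IsSource s → G.OnExternalFace s
  sink_external : ∀ t, G.IsSink t → G.OnExternalFace t

/-- Outerplanar triangulated st-digraphs: all vertices are on the boundary of the external face,
and all other faces are triangles. -/
structure IsOuterplanarTriangulatedST (G : EmbeddedDigraph n) : Prop where
  planarST : G.IsPlanarST
  outerplanar : ∀ v, G.OnExternalFace v
  triangulated : ∀ F ∈ G.faces, F ≠ G.face G.outer → F.ncard = 3

end EmbeddedDigraph

/-! ### Upward topological 2-page book embeddings -/

/-- A drawing on a vertical spine, whose points are numbered upwards, with a left page (`true`) and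
a right page (`false`): the place of every vertex on the spine; for every arc `u → v`, the points
at which it crosses the spine, in the order from `u` to `v`, and the page on which it leaves `u`.
The arc changes the page at each of its spine crossings, and it meets the spine nowhere else. -/
structure BookDrawing (n : ℕ) where
  pos : Fin n → ℕ
  crossings : Fin n → Fin n → List ℕ
  firstPage : Fin n → Fin n → Bool

namespace BookDrawing

variable {n : ℕ}

/-- The segments (lower end, upper end, page) of a curve on the book from the spine point `a` to
the spine point `b` which leaves `a` on the page `p` and crosses the spine at the listed points. -/
def segmentsAux : ℕ → List ℕ → ℕ → Bool → List (ℕ × ℕ × Bool)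
  | a, [], b, p => [(a, b, p)]
  | a, c :: cs, b, p => (a, c, p) :: segmentsAux c cs b (!p)

def segments (D : BookDrawing n) (u v : Fin n) : List (ℕ × ℕ × Bool) :=
  segmentsAux (D.pos u) (D.crossings u v) (D.pos v) (D.firstPage u v)

/-- The segment with which the arc `u → v` leaves `u`. -/
def firstSegment (D : BookDrawing n) (u v : Fin n) : ℕ × ℕ × Bool :=
  (D.segments u v).headD (0, 0, true)

/-- The segment with which the arc `u → v` enters `v`. -/
def lastSegment (D : BookDrawing n) (u v : Fin n) : ℕ × ℕ × Bool :=
  (D.segments u v).getLastD (0, 0, true)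

end BookDrawing

namespace EmbeddedDigraph

variable {n : ℕ}

/-- `D` is an upward topological 2-page book embedding of the digraph `G`: every arc runs
monotonically upwards, the vertices and the spine crossings of the arcs are distinct points of the
spine, and segments on the same page do not cross. -/
structure IsUpwardBookEmbedding (G : EmbeddedDigraph n) (D : BookDrawing n) : Prop where
  pos_injective : Function.Injective D.pos
  upward : ∀ u v, G.arc u v = true →
    (D.pos u :: (D.crossings u v ++ [D.pos v])).Pairwise (· < ·)
  crossing_ne_vertex : ∀ u v, G.arc u v = true → ∀ c ∈ D.crossings u v, ∀ w, c ≠ D.pos w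
  crossing_disjoint : ∀ u v u' v', G.arc u v = true → G.arc u' v' = true → (u, v) ≠ (u', v') →
    ∀ c ∈ D.crossings u v, c ∉ D.crossings u' v'
  planar : ∀ u v u' v', G.arc u v = true → G.arc u' v' = true →
    ∀ e ∈ D.segments u v, ∀ e' ∈ D.segments u' v', e.2.2 = e'.2.2 →
      ¬ (e.1 < e'.1 ∧ e'.1 < e.2.1 ∧ e.2.1 < e'.2.1)

/-- The direction in which the edge between `v` and its neighbour `w` leaves the point `v` in the
drawing, as a key that increases clockwise, starting from the downward direction of the spine:
first the edges that come from below on the left page (the inner arcs first), then those that go up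
on the left page (the outer arcs first), then those that go up on the right page (the inner arcs
first), then those that come from below on the right page (the outer arcs first). -/
def direction (G : EmbeddedDigraph n) (D : BookDrawing n) (v w : Fin n) : ℕ ×ₗ ℤ :=
  if G.arc v w = true then
    if (D.firstSegment v w).2.2 = true then toLex (1, -((D.firstSegment v w).2.1 : ℤ))
    else toLex (2, ((D.firstSegment v w).2.1 : ℤ))
  else
    if (D.lastSegment w v).2.2 = true then toLex (0, -((D.lastSegment w v).1 : ℤ))
    else toLex (3, ((D.lastSegment w v).1 : ℤ))

/-- The drawing `D` preserves the embedding of `G`: the clockwise cyclic order of the edges around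
every vertex is the given one, and so is the external face; the latter contains the corner below
the lowest vertex, which is on the left of the first edge there in clockwise order. -/
structure PreservesEmbedding (G : EmbeddedDigraph n) (D : BookDrawing n) : Prop where
  rotation : ∀ v, ∃ L : List (Fin n), L.IsRotated (G.rot v) ∧
    L.Pairwise fun a b => G.direction D v a < G.direction D v b
  external : ∀ v, (∀ u, D.pos v ≤ D.pos u) →
    ∀ w ∈ G.rot v, (∀ w' ∈ G.rot v, G.direction D v w ≤ G.direction D v w') →
      (v, w) ∈ G.face G.outer

/-- Upward topological 2-page book embeddings of the embedded digraph `G` with at most one spine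
crossing per edge. -/
structure IsOneCrossingBookEmbedding (G : EmbeddedDigraph n) (D : BookDrawing n) : Prop where
  book : G.IsUpwardBookEmbedding D
  preserves : G.PreservesEmbedding D
  atMostOne : ∀ u v, G.arc u v = true → (D.crossings u v).length ≤ 1

/-- The total number of spine crossings. -/
def numSpineCrossings (G : EmbeddedDigraph n) (D : BookDrawing n) : ℕ :=
  ∑ d ∈ G.arcs, (D.crossings d.1 d.2).length

/-! ### Input and output format -/

/-- All half-edges (origin, target), grouped by origin, each group in clockwise order. -/
def halfEdges (G : EmbeddedDigraph n) : List (Fin n × Fin n) :=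
  (List.finRange n).flatMap fun v => (G.rot v).map fun w => (v, w)

/-- The embedded digraph as a half-edge data structure in the memory of the machine. Half-edges are
referred to by their index in `halfEdges`.
Register 0 holds `n`, register 1 the half-edge that marks the external face.
Array 0: the index of the first half-edge at vertex `v` (and, for `v = n`, the number of half-edges).
Array 1: the target of a half-edge. Array 2: whether the half-edge is directed from its origin to
its target (1) or from its target to its origin (0). Array 3: the opposite half-edge.
Everything else is 0. -/
def input (G : EmbeddedDigraph n) : RAM.State where
  var x := if x = 0 then n else if x = 1 then G.halfEdges.idxOf G.outer else 0
  arr a k :=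
    if a = 0 then
      if k ≤ n then (((List.finRange n).take k).map fun u => (G.rot u).length).sum else 0
    else if a = 1 then G.halfEdges[k]?.elim 0 fun d => d.2.val
    else if a = 2 then G.halfEdges[k]?.elim 0 fun d => if G.arc d.1 d.2 = true then 1 else 0
    else if a = 3 then G.halfEdges[k]?.elim 0 fun d => G.halfEdges.idxOf (d.2, d.1)
    else 0

/-- The drawing that is read off from the final memory of the machine.
Array 4: the place of vertex `v` on the spine. Arrays 5 and 6, at the index of the half-edge `(u, v)`
of an arc `u → v`: the spine crossing of the arc, or 0 if it has none (as a crossing is above `u`,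
its place is never 0), and the page on which the arc leaves `u` (1 for left, 0 for right). -/
def output (G : EmbeddedDigraph n) (σ : RAM.State) : BookDrawing n where
  pos v := σ.arr 4 v
  crossings u v :=
    if σ.arr 5 (G.halfEdges.idxOf (u, v)) = 0 then [] else [σ.arr 5 (G.halfEdges.idxOf (u, v))]
  firstPage u v := σ.arr 6 (G.halfEdges.idxOf (u, v)) == 1

end EmbeddedDigraph

namespace EmbeddedDigraph

variable {n : ℕ} {G : EmbeddedDigraph n}

/-! ### Half-edges and the face permutation -/

/-! Structure of the embedding. A corner is a pair of consecutive half-edges of a face. It is flat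
if both follow their arcs or both run against them, and a turn otherwise. By acyclicity every face
has a lower and an upper turn, and every vertex other than the source and the sink has a flat corner
of each kind. The number of corners is twice the number of arcs, and by Euler's formula these lower
bounds already add up to it, so all of them are equalities (`corner_counts`). This single count
yields bimodality, the left and the right boundary, and the possible shapes of a triangle.

A tree of arcs. The entry half-edge of an arc has on its left the face that lies towards the
boundary side of the tail. Exactly one half-edge of each triangle is an entry (`entry_unique`,
`exists_entry`), and the other two, reversed, are entries again (`triangle`). Where a block ends at
a cut vertex, its last arc gets the first right boundary arc of the next block as a further child.
Thus the arcs form a rooted tree, which is enumerated breadth first, and another use of Euler's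
formula shows that each triangle contributes a vertex that has not been seen before
(`visited_nodup`).

Two bits per arc. A curve with at most one spine crossing is determined, up to positions, by the
page on which it leaves its tail and the page on which it enters its head. Both are recorded
relative to the side of the entry; there is a crossing exactly if the two bits differ. Consider a
triangle `a → b → c`, `a → c` with `b` on the side `q`. In every admissible drawing no segment on
page `q` passes `b` (`Realizes.exposed`), and then planarity forces three conditions: if `ac` leaves
`a` on `q`, so does `ab`; if `ac` enters `c` on `q`, so does `bc`; and `ac` is not on `q` at both
ends (`IsBook.triangle`, `Realizes.isPaging`).

Conversely these local conditions suffice. The triangles are inserted one at a time: a third vertex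
between the ends of the base goes next to one of the ends (`MidStep.drawn_succ`), a third vertex
above the base goes on top of everything (`TopStep.drawn_succ`), and a new block is stacked on the
old ones (`Drawn.extend_top`). The invariant `ArcSystem.Drawn` keeps the drawing planar and the
unexplored sides accessible. The arcs come out in the right order at the turns of all triangles
(`cornerOrder`), and that is enough for the whole rotation system and the external face
(`SortedCorners.preservesEmbedding`).

Optimization. The minimum number of crossings is therefore the minimum, over all assignments of two
bits to the nodes of a tree subject to conditions at each node and its children, of the number of
nodes with different bits. A table with four values per node solves this: every admissible
assignment costs at least the root value (`BlockForest.le_cost`), and a choice from the root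
downwards attains it (`BlockForest.cost_of_choice`).

Machine. In the breadth-first order children have larger indices than parents, so the table is
filled by counting down and the choice is made by counting up. The spine is a doubly linked list, in
which an insertion takes constant time, and one traversal at the end gives the positions. Every loop
makes linearly many passes over a body without loops, and all numbers written are linear in `n`
(`reaches_bookProgram`). -/

/-- The pair `d` is a half-edge of `G`. -/
def IsHalfEdge (G : EmbeddedDigraph n) (d : Fin n × Fin n) : Prop := d.2 ∈ G.rot d.1

/-- The half-edge `d` points in the direction of its arc. -/
def dir (G : EmbeddedDigraph n) (d : Fin n × Fin n) : Bool := G.arc d.1 d.2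

lemma isHalfEdge_iff {d : Fin n × Fin n} :
    G.IsHalfEdge d ↔ (G.arc d.1 d.2 = true ∨ G.arc d.2 d.1 = true) := G.mem_rot _ _

lemma IsHalfEdge.swap {d : Fin n × Fin n} (h : G.IsHalfEdge d) : G.IsHalfEdge d.swap := by
  rw [isHalfEdge_iff] at *; exact h.symm

lemma IsHalfEdge.dir_swap {d : Fin n × Fin n} (h : G.IsHalfEdge d) :
    G.dir d.swap = !G.dir d := by
  rw [isHalfEdge_iff] at h
  unfold dir
  rcases h with h | h
  · simp [h, G.asymm _ _ h]
  · simp [h, G.asymm _ _ h]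

lemma isHalfEdge_of_dir {d : Fin n × Fin n} (h : G.dir d = true) : G.IsHalfEdge d :=
  isHalfEdge_iff.2 (Or.inl h)

lemma IsHalfEdge.arc_of_dir_false {d : Fin n × Fin n} (h : G.IsHalfEdge d)
    (hd : G.dir d = false) : G.arc d.2 d.1 = true := by
  have := h.dir_swap; rw [hd] at this; exact this

lemma IsHalfEdge.fst_ne_snd {d : Fin n × Fin n} (h : G.IsHalfEdge d) : d.1 ≠ d.2 := by
  intro e
  rw [isHalfEdge_iff, e] at h
  have h' : G.arc d.2 d.2 = true := by tauto
  simpa [h'] using G.asymm _ _ h'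

/-- The face permutation. -/
def facePerm (G : EmbeddedDigraph n) : Equiv.Perm (Fin n × Fin n) where
  toFun := G.faceNext
  invFun d := ((G.rot d.1).formPerm⁻¹ d.2, d.1)
  left_inv d := by simp [faceNext]
  right_inv d := by simp [faceNext]

lemma facePerm_apply (d : Fin n × Fin n) :
    G.facePerm d = (d.2, (G.rot d.2).formPerm d.1) := rfl

@[simp] lemma facePerm_apply_fst (d : Fin n × Fin n) : (G.facePerm d).1 = d.2 := rfl

@[simp] lemma facePerm_symm_apply_snd (d : Fin n × Fin n) : (G.facePerm.symm d).2 = d.1 := rfl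

lemma isHalfEdge_facePerm {d : Fin n × Fin n} :
    G.IsHalfEdge (G.facePerm d) ↔ G.IsHalfEdge d := by
  have h : G.IsHalfEdge d ↔ G.IsHalfEdge d.swap :=
    ⟨fun h => h.swap, fun h => by simpa using h.swap⟩
  rw [h]
  exact List.formPerm_mem_iff_mem

lemma isHalfEdge_facePerm_symm {d : Fin n × Fin n} :
    G.IsHalfEdge (G.facePerm.symm d) ↔ G.IsHalfEdge d := by
  rw [← isHalfEdge_facePerm, Equiv.apply_symm_apply]

lemma mem_face_iff {d e : Fin n × Fin n} : e ∈ G.face d ↔ G.facePerm.SameCycle d e := by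
  constructor
  · rintro ⟨k, hk⟩
    refine ⟨k, ?_⟩
    rw [zpow_natCast, Equiv.Perm.coe_pow]; exact hk
  · intro h
    obtain ⟨k, -, hk⟩ := h.exists_pow_eq'
    exact ⟨k, by rw [← hk, Equiv.Perm.coe_pow]; rfl⟩

lemma face_eq_iff {d e : Fin n × Fin n} : G.face d = G.face e ↔ G.facePerm.SameCycle d e := by
  constructor
  · intro h
    rw [← mem_face_iff, h, mem_face_iff]
  · intro h; ext x
    rw [mem_face_iff, mem_face_iff]
    exact ⟨fun h' => h.symm.trans h', fun h' => h.trans h'⟩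

lemma sameCycle_isHalfEdge {d e : Fin n × Fin n} (h : G.facePerm.SameCycle d e) :
    G.IsHalfEdge d ↔ G.IsHalfEdge e := by
  obtain ⟨k, -, rfl⟩ := h.exists_pow_eq'
  clear h
  induction k with
  | zero => simp
  | succ k ih => rw [pow_succ', Equiv.Perm.mul_apply, isHalfEdge_facePerm, ih]

/-- A discrete intermediate value principle on a cycle of a permutation. It is used along faces to
find turns, and along rotations to find flat corners. -/
lemma exists_change {α : Type*} [Finite α] (σ : Equiv.Perm α) {P : α → Prop} {x y : α}
    (h : σ.SameCycle x y) (hx : P x) (hy : ¬ P y) :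
    ∃ z, σ.SameCycle x z ∧ P z ∧ ¬ P (σ z) := by
  obtain ⟨k, -, rfl⟩ := h.exists_pow_eq'
  induction k with
  | zero => exact absurd hx hy
  | succ k ih =>
    by_cases hk : P ((σ ^ k) x)
    · exact ⟨(σ ^ k) x, ⟨k, by simp⟩, hk, by rwa [pow_succ', Equiv.Perm.mul_apply] at hy⟩
    · exact ih ⟨k, by simp⟩ hk

/-- Both directions occur around every face. -/
lemma exists_dir_of_acyclic (hG : G.Acyclic) {d : Fin n × Fin n} (hd : G.IsHalfEdge d) (p : Bool) :
    ∃ e, G.facePerm.SameCycle d e ∧ G.dir e = p := by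
  by_contra! hcon
  have hall : ∀ k : ℕ, G.dir ((G.facePerm ^ k) d) = !p := by
    intro k
    have := hcon ((G.facePerm ^ k) d) ⟨k, by simp⟩
    cases p <;> simpa using this
  have hH : ∀ k : ℕ, G.IsHalfEdge ((G.facePerm ^ k) d) := fun k =>
    (sameCycle_isHalfEdge ⟨k, by simp⟩).1 hd
  -- After as many steps as the order of the permutation, the walk around the face is back at `d`.
  -- If all its half-edges had the same direction, it would be a directed cycle, read forwards or
  -- backwards.
  have hpos : 0 < orderOf G.facePerm := orderOf_pos _
  have hlast : (G.facePerm ^ orderOf G.facePerm) d = d := by rw [pow_orderOf_eq_one]; rfl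
  have step : ∀ k : ℕ, ((G.facePerm ^ (k + 1)) d).1 = ((G.facePerm ^ k) d).2 := by
    intro k; rw [pow_succ', Equiv.Perm.mul_apply]; rfl
  cases p with
  | false =>
    have : ∀ k : ℕ, 0 < k → Relation.TransGen (fun a b => G.arc a b = true) d.1
        ((G.facePerm ^ k) d).1 := by
      intro k hk
      induction k with
      | zero => omega
      | succ k ih =>
        have ha : G.arc ((G.facePerm ^ k) d).1 ((G.facePerm ^ k) d).2 = true := hall k
        rw [step]
        rcases Nat.eq_zero_or_pos k with rfl | h
        · exact .single ha
        · exact (ih h).tail ha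
    have h := this _ hpos
    rw [hlast] at h
    exact hG _ h
  | true =>
    have : ∀ k : ℕ, 0 < k → Relation.TransGen (fun a b => G.arc a b = true)
        ((G.facePerm ^ k) d).1 d.1 := by
      intro k hk
      induction k with
      | zero => omega
      | succ k ih =>
        have ha : G.arc ((G.facePerm ^ k) d).2 ((G.facePerm ^ k) d).1 = true :=
          (hH k).arc_of_dir_false (hall k)
        rw [step]
        rcases Nat.eq_zero_or_pos k with rfl | h
        · exact .single ha
        · exact .head ha (ih h)
    have h := this _ hpos
    rw [hlast] at h
    exact hG _ h

lemma exists_turn_of_acyclic (hG : G.Acyclic) {d : Fin n × Fin n} (hd : G.IsHalfEdge d)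
    (p : Bool) :
    ∃ e, G.facePerm.SameCycle d e ∧ G.dir e = p ∧ G.dir (G.facePerm e) = !p := by
  obtain ⟨x, hx, hxp⟩ := exists_dir_of_acyclic hG hd p
  obtain ⟨y, hy, hyp⟩ := exists_dir_of_acyclic hG hd (!p)
  obtain ⟨z, hz, hzp, hz'⟩ := exists_change G.facePerm (P := fun e => G.dir e = p)
    (hx.symm.trans hy) hxp (by rw [hyp]; cases p <;> simp)
  exact ⟨z, hx.trans hz, hzp, by cases p <;> simpa using hz'⟩

/-- Around `v` the incoming and the outgoing edges both occur, so in clockwise order there is a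
change from each kind to the other. The corner at such a change is flat, because the half-edge
leaving `v` is the reversal of the one whose direction was compared. -/
lemma exists_flat {v : Fin n} {u w : Fin n} (hu : G.arc u v = true) (hw : G.arc v w = true)
    (p : Bool) :
    ∃ d, G.IsHalfEdge d ∧ d.2 = v ∧ G.dir d = p ∧ G.dir (G.facePerm d) = p := by
  have hmem : ∀ {x}, G.arc x v = true ∨ G.arc v x = true ↔ x ∈ G.rot v := by
    intro x; rw [mem_rot]; tauto
  have hcyc := (G.rot_nodup v).isCycleOn_formPerm
  have key : ∀ x ∈ G.rot v, ∀ y ∈ G.rot v, G.dir (x, v) = p → G.dir (y, v) = !p →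
      ∃ d, G.IsHalfEdge d ∧ d.2 = v ∧ G.dir d = p ∧ G.dir (G.facePerm d) = p := by
    intro x hx y hy hxp hyp
    obtain ⟨z, hz, hzp, hz'⟩ := exists_change (G.rot v).formPerm
      (P := fun z => G.dir (z, v) = p) (hcyc.2 hx hy) hxp
        (by rw [hyp]; cases p <;> simp)
    have hzm : z ∈ G.rot v := by
      obtain ⟨k, -, rfl⟩ := hz.exists_pow_eq'
      clear hzp hz' hz
      induction k with
      | zero => simpa using hx
      | succ k ih => rw [pow_succ', Equiv.Perm.mul_apply]; exact List.formPerm_mem_iff_mem.2 ih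
    have hH : G.IsHalfEdge (z, v) := IsHalfEdge.swap (d := (v, z)) hzm
    refine ⟨(z, v), hH, rfl, hzp, ?_⟩
    have h2 : G.IsHalfEdge ((G.rot v).formPerm z, v) :=
      IsHalfEdge.swap (d := (v, _)) (List.formPerm_mem_iff_mem.2 hzm)
    have h3 := h2.dir_swap
    have h4 : G.facePerm (z, v) = (v, (G.rot v).formPerm z) := rfl
    rw [h4]
    rw [Prod.swap_prod_mk] at h3
    rw [h3]
    cases p <;> simpa using hz'
  have hu' : G.dir (u, v) = true := hu
  have hw' : G.dir (w, v) = false := G.asymm _ _ hw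
  cases p with
  | true => exact key u (hmem.1 (.inl hu)) w (hmem.1 (.inr hw)) hu' hw'
  | false => exact key w (hmem.1 (.inr hw)) u (hmem.1 (.inl hu)) hw' hu'

/-! ### Counting corners -/

/-- The corners of `G`: the corner after `d` at the vertex `d.2`, whose two sides have the
directions `p` and `q`. -/
noncomputable def corners (G : EmbeddedDigraph n) (p q : Bool) : Finset (Fin n × Fin n) := by
  classical
  exact Finset.univ.filter fun d => G.IsHalfEdge d ∧ G.dir d = p ∧ G.dir (G.facePerm d) = q

lemma mem_corners {p q : Bool} {d : Fin n × Fin n} :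
    d ∈ G.corners p q ↔ G.IsHalfEdge d ∧ G.dir d = p ∧ G.dir (G.facePerm d) = q := by
  simp [corners]

lemma card_corners_add :
    (G.corners true true).card + (G.corners false false).card + (G.corners true false).card
      + (G.corners false true).card = 2 * G.arcs.card := by
  classical
  have h1 : (G.corners true true).card + (G.corners true false).card = G.arcs.card := by
    rw [← Finset.card_union_of_disjoint]
    · congr 1; ext d
      simp only [Finset.mem_union, mem_corners, arcs, Finset.mem_filter, Finset.mem_univ, true_and]
      constructor
      · rintro (h | h) <;> exact h.2.1
      · intro h
        have h' : G.dir d = true := h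
        have := isHalfEdge_of_dir h'
        cases hh : G.dir (G.facePerm d) <;> simp [this, h']
    · rw [Finset.disjoint_left]; intro d; simp only [mem_corners]
      rintro ⟨-, -, h⟩ ⟨-, -, h'⟩; simp [h] at h'
  have h2 : (G.corners false false).card + (G.corners false true).card = G.arcs.card := by
    rw [← Finset.card_union_of_disjoint, ← Finset.card_image_of_injective G.arcs Prod.swap_injective]
    · congr 1; ext d
      simp only [Finset.mem_union, mem_corners, arcs, Finset.mem_filter, Finset.mem_univ, true_and,
        Finset.mem_image]
      constructor
      · rintro (h | h) <;> exact ⟨d.swap, h.1.arc_of_dir_false h.2.1, by simp⟩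
      · rintro ⟨e, he, rfl⟩
        have h' : G.dir e = true := he
        have h3 := isHalfEdge_of_dir h'
        have := h3.dir_swap
        rw [h'] at this
        cases hh : G.dir (G.facePerm e.swap) <;> simp [this, h3.swap]
    · rw [Finset.disjoint_left]; intro d; simp only [mem_corners]
      rintro ⟨-, -, h⟩ ⟨-, -, h'⟩; simp [h] at h'
  omega

/-- Every vertex that is neither the source nor the sink has both an incoming and an outgoing arc,
hence a flat corner of the given kind by `exists_flat`; only two vertices are lost. -/
lemma le_card_flat (hG : G.IsPlanarST) (p : Bool) :
    n ≤ ((G.corners p p).image Prod.snd).card + 2 := by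
  classical
  obtain ⟨s, hs, hs'⟩ := hG.source
  obtain ⟨t, ht, ht'⟩ := hG.sink
  have hsub : (Finset.univ \ {s, t} : Finset (Fin n)) ⊆ (G.corners p p).image Prod.snd := by
    intro v hv
    simp only [Finset.mem_sdiff, Finset.mem_univ, true_and, Finset.mem_insert,
      Finset.mem_singleton, not_or] at hv
    have h1 : ¬ G.IsSource v := fun h => hv.1 (hs' v h)
    have h2 : ¬ G.IsSink v := fun h => hv.2 (ht' v h)
    simp only [IsSource, IsSink, not_forall, Bool.not_eq_false] at h1 h2
    obtain ⟨u, hu⟩ := h1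
    obtain ⟨w, hw⟩ := h2
    obtain ⟨d, hd, hv, h⟩ := exists_flat hu hw p
    exact Finset.mem_image.2 ⟨d, mem_corners.2 ⟨hd, h⟩, hv⟩
  have h1 := Finset.card_le_card hsub
  have h2 := Finset.le_card_sdiff ({s, t} : Finset (Fin n)) Finset.univ
  have h3 := Finset.card_le_two (a := s) (b := t)
  simp only [Finset.card_univ, Fintype.card_fin] at h2
  omega

lemma ncard_faces_le (hG : G.Acyclic) (p : Bool) :
    by classical exact G.faces.ncard ≤ ((G.corners p (!p)).image G.face).card := by
  classical
  show G.faces.ncard ≤ ((G.corners p (!p)).image G.face).card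
  rw [← Set.ncard_coe_finset]
  apply Set.ncard_le_ncard _ (Finset.finite_toSet _)
  rintro F ⟨v, w, hw, rfl⟩
  obtain ⟨e, he, hep⟩ := exists_turn_of_acyclic hG (d := (v, w)) hw p
  rw [Finset.mem_coe, Finset.mem_image]
  exact ⟨e, mem_corners.2 ⟨(sameCycle_isHalfEdge he).1 hw, hep⟩, (face_eq_iff.2 he).symm⟩

/-- The four kinds of corners number at least `n - 2`, `n - 2`, `f` and `f`, where `f` is the number
of faces, and together twice the number of arcs, which is `2 (n + f - 2)` by Euler's formula. Hence
equality holds everywhere: flat corners of one kind are determined by their vertices, and turns of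
one kind by their faces. -/
lemma corner_counts (hG : G.IsPlanarST) (p : Bool) :
    (∀ d ∈ G.corners p p, ∀ e ∈ G.corners p p, d.2 = e.2 → d = e) ∧
    (∀ d ∈ G.corners p (!p), ∀ e ∈ G.corners p (!p), G.face d = G.face e → d = e) := by
  classical
  have hsum := G.card_corners_add
  have hE := hG.plane.2
  have f1 := le_card_flat hG true
  have f2 := le_card_flat hG false
  have f3 : G.faces.ncard ≤ ((G.corners true false).image G.face).card :=
    ncard_faces_le hG.acyclic true
  have f4 : G.faces.ncard ≤ ((G.corners false true).image G.face).card :=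
    ncard_faces_le hG.acyclic false
  have g1 := Finset.card_image_le (s := G.corners true true) (f := Prod.snd)
  have g2 := Finset.card_image_le (s := G.corners false false) (f := Prod.snd)
  have g3 := Finset.card_image_le (s := G.corners true false) (f := G.face)
  have g4 := Finset.card_image_le (s := G.corners false true) (f := G.face)
  have inj1 : ∀ {q}, ((G.corners q q).image Prod.snd).card = (G.corners q q).card →
      ∀ d ∈ G.corners q q, ∀ e ∈ G.corners q q, d.2 = e.2 → d = e := by
    intro q h d hd e he hde
    exact Finset.card_image_iff.1 h hd he hde
  have inj2 : ∀ {q r}, ((G.corners q r).image G.face).card = (G.corners q r).card →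
      ∀ d ∈ G.corners q r, ∀ e ∈ G.corners q r, G.face d = G.face e → d = e := by
    intro q r h d hd e he hde
    exact Finset.card_image_iff.1 h hd he hde
  cases p with
  | true => exact ⟨inj1 (by omega), inj2 (by simp only [Bool.not_true]; omega)⟩
  | false => exact ⟨inj1 (by omega), inj2 (by simp only [Bool.not_false]; omega)⟩

lemma flat_unique (hG : G.IsPlanarST) {p : Bool} {d e : Fin n × Fin n}
    (hd : G.IsHalfEdge d) (hd1 : G.dir d = p) (hd2 : G.dir (G.facePerm d) = p)
    (he : G.IsHalfEdge e) (he1 : G.dir e = p) (he2 : G.dir (G.facePerm e) = p)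
    (h : d.2 = e.2) : d = e :=
  (corner_counts hG p).1 d (mem_corners.2 ⟨hd, hd1, hd2⟩) e (mem_corners.2 ⟨he, he1, he2⟩) h

lemma turn_unique (hG : G.IsPlanarST) {p : Bool} {d e : Fin n × Fin n}
    (hd : G.IsHalfEdge d) (hd1 : G.dir d = p) (hd2 : G.dir (G.facePerm d) = !p)
    (he1 : G.dir e = p) (he2 : G.dir (G.facePerm e) = !p)
    (h : G.facePerm.SameCycle d e) : d = e :=
  (corner_counts hG p).2 d (mem_corners.2 ⟨hd, hd1, hd2⟩) e
    (mem_corners.2 ⟨(sameCycle_isHalfEdge h).1 hd, he1, he2⟩) (face_eq_iff.2 h)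

/-! ### The external face and the sides of the vertices -/

/-- The half-edge `d` is on the boundary of the external face. -/
def Ext (G : EmbeddedDigraph n) (d : Fin n × Fin n) : Prop := d ∈ G.face G.outer

/-- The vertex `v` is on the left (`true`) or right (`false`) boundary of `G`. -/
def OnSide (G : EmbeddedDigraph n) (p : Bool) (v : Fin n) : Prop :=
  ∃ d, G.Ext d ∧ G.dir d = p ∧ (d.1 = v ∨ d.2 = v)

open Classical in
/-- The side of a vertex; vertices on both sides count as left. -/
noncomputable def side (G : EmbeddedDigraph n) (v : Fin n) : Bool := decide (G.OnSide true v)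

/-- The tail of the arc of a half-edge. -/
def tail (G : EmbeddedDigraph n) (d : Fin n × Fin n) : Fin n := if G.dir d = true then d.1 else d.2

/-- The head of the arc of a half-edge. -/
def head (G : EmbeddedDigraph n) (d : Fin n × Fin n) : Fin n := if G.dir d = true then d.2 else d.1

/-- The entry half-edge of an arc: it points upwards if and only if the tail of the arc is left. -/
def IsEntry (G : EmbeddedDigraph n) (d : Fin n × Fin n) : Prop :=
  G.IsHalfEdge d ∧ G.dir d = G.side (G.tail d)

lemma ext_iff_sameCycle {d : Fin n × Fin n} : G.Ext d ↔ G.facePerm.SameCycle G.outer d :=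
  mem_face_iff

lemma Ext.isHalfEdge {d : Fin n × Fin n} (h : G.Ext d) : G.IsHalfEdge d :=
  (sameCycle_isHalfEdge (ext_iff_sameCycle.1 h)).1 G.outer_mem

lemma ext_facePerm {d : Fin n × Fin n} : G.Ext (G.facePerm d) ↔ G.Ext d := by
  rw [ext_iff_sameCycle, ext_iff_sameCycle, Equiv.Perm.sameCycle_apply_right]

lemma ext_facePerm_symm {d : Fin n × Fin n} : G.Ext (G.facePerm.symm d) ↔ G.Ext d := by
  rw [← ext_facePerm, Equiv.apply_symm_apply]

lemma Ext.sameCycle {d e : Fin n × Fin n} (hd : G.Ext d) (he : G.Ext e) :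
    G.facePerm.SameCycle d e :=
  (ext_iff_sameCycle.1 hd).symm.trans (ext_iff_sameCycle.1 he)

lemma side_eq_true {v : Fin n} : G.side v = true ↔ G.OnSide true v := by simp [side]

lemma tail_swap {d : Fin n × Fin n} (h : G.IsHalfEdge d) : G.tail d.swap = G.tail d := by
  unfold tail; rw [h.dir_swap]; cases G.dir d <;> simp

lemma head_swap {d : Fin n × Fin n} (h : G.IsHalfEdge d) : G.head d.swap = G.head d := by
  unfold head; rw [h.dir_swap]; cases G.dir d <;> simp

lemma IsHalfEdge.arc {d : Fin n × Fin n} (h : G.IsHalfEdge d) :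
    G.arc (G.tail d) (G.head d) = true := by
  unfold tail head
  cases hd : G.dir d
  · simpa using h.arc_of_dir_false hd
  · exact hd

lemma isEntry_or_swap {d : Fin n × Fin n} (h : G.IsHalfEdge d) :
    G.IsEntry d ∨ G.IsEntry d.swap := by
  unfold IsEntry
  rw [tail_swap h, h.dir_swap]
  simp only [h, h.swap, true_and]
  cases G.dir d <;> cases G.side (G.tail d) <;> simp

lemma IsEntry.not_swap {d : Fin n × Fin n} (h : G.IsEntry d) : ¬ G.IsEntry d.swap := by
  unfold IsEntry at *
  rw [tail_swap h.1, h.1.dir_swap, ← h.2]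
  cases G.dir d <;> simp

lemma eq_or_eq_swap_of_arc_eq {d e : Fin n × Fin n} (hd : G.IsHalfEdge d)
    (ht : G.tail d = G.tail e) (hh : G.head d = G.head e) : d = e ∨ d = e.swap := by
  unfold tail head at *
  cases h1 : G.dir d <;> cases h2 : G.dir e <;> simp only [h1, h2, if_true, if_false,
    Bool.false_eq_true] at ht hh
  · left; ext1 <;> assumption
  · right; ext1 <;> simp [*]
  · right; ext1 <;> simp [*]
  · left; ext1 <;> assumption

lemma IsEntry.eq_of_arc_eq {d e : Fin n × Fin n} (hd : G.IsEntry d) (he : G.IsEntry e)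
    (ht : G.tail d = G.tail e) (hh : G.head d = G.head e) : d = e := by
  rcases eq_or_eq_swap_of_arc_eq hd.1 ht hh with h | h
  · exact h
  · exact absurd (h ▸ hd) he.not_swap

/-- The external face has turns at the source and at the sink, as both lie on it, and by
`turn_unique` it has no others. At any other vertex the external boundary therefore runs straight
through, on the given side. -/
lemma IsPlanarST.onSide_flat (hG : G.IsPlanarST) {p : Bool} {v u w : Fin n}
    (h : G.OnSide p v) (hu : G.arc u v = true) (hw : G.arc v w = true) :
    ∃ d, G.Ext d ∧ G.dir d = p ∧ G.dir (G.facePerm d) = p ∧ d.2 = v := by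
  obtain ⟨s, hs, hs'⟩ := hG.source
  obtain ⟨t, ht, ht'⟩ := hG.sink
  have hvs : v ≠ s := by rintro rfl; simpa [hu] using hs u
  have hvt : v ≠ t := by rintro rfl; simpa [hw] using ht w
  obtain ⟨ws, hws⟩ := hG.source_external s hs
  obtain ⟨wt, hwt⟩ := hG.sink_external t ht
  replace hws : G.Ext (s, ws) := hws
  replace hwt : G.Ext (t, wt) := hwt
  have ds1 : G.dir (s, ws) = true := by
    by_contra hc
    have := hws.isHalfEdge.arc_of_dir_false (by simpa using hc)
    simp [hs ws] at this
  have ds2 : G.dir (G.facePerm.symm (s, ws)) = false := by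
    have h1 := hs (G.facePerm.symm (s, ws)).1
    exact h1
  have dt1 : G.dir (t, wt) = false := ht wt
  have dt2 : G.dir (G.facePerm.symm (t, wt)) = true := by
    by_contra hc
    have := (ext_facePerm_symm.2 hwt).isHalfEdge.arc_of_dir_false (by simpa using hc)
    have h2 : G.arc (G.facePerm.symm (t, wt)).2 (G.facePerm.symm (t, wt)).1 = false := ht _
    rw [h2] at this; exact Bool.false_ne_true this
  -- a turn of the external face is at `s` or at `t`
  have turn : ∀ e, G.Ext e → e.2 = v → G.dir e = G.dir (G.facePerm e) := by
    intro e he hev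
    by_contra hne
    cases h1 : G.dir e
    · have h2 : G.dir (G.facePerm e) = true := by rw [h1] at hne; simpa using hne
      have := turn_unique hG (p := false) he.isHalfEdge h1 (by simpa using h2) ds2
        (by simpa using ds1) (he.sameCycle (ext_facePerm_symm.2 hws))
      rw [this] at hev; exact hvs hev.symm
    · have h2 : G.dir (G.facePerm e) = false := by rw [h1] at hne; simpa using hne
      have := turn_unique hG (p := true) he.isHalfEdge h1 (by simpa using h2) dt2
        (by simpa using dt1) (he.sameCycle (ext_facePerm_symm.2 hwt))
      rw [this] at hev; exact hvt hev.symm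
  obtain ⟨d, hd, hdp, hv | hv⟩ := h
  · have he := ext_facePerm_symm.2 hd
    have := turn _ he hv
    rw [Equiv.apply_symm_apply] at this
    exact ⟨_, he, this.trans hdp, by rw [Equiv.apply_symm_apply]; exact hdp, hv⟩
  · grind

/-- An internal flat corner at a vertex shows that the vertex is not on that side. -/
lemma IsPlanarST.not_onSide (hG : G.IsPlanarST) {p : Bool} {d : Fin n × Fin n}
    (hd : G.IsHalfEdge d) (hext : ¬ G.Ext d) (h1 : G.dir d = p) (h2 : G.dir (G.facePerm d) = p) :
    ¬ G.OnSide p d.2 := by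
  intro hon
  have hd2 : G.IsHalfEdge (G.facePerm d) := isHalfEdge_facePerm.2 hd
  have : ∃ u w, G.arc u d.2 = true ∧ G.arc d.2 w = true := by
    cases p with
    | true => exact ⟨d.1, (G.facePerm d).2, h1, h2⟩
    | false => exact ⟨(G.facePerm d).2, d.1, hd2.arc_of_dir_false h2, hd.arc_of_dir_false h1⟩
  obtain ⟨u, w, hu, hw⟩ := this
  obtain ⟨e, he, he1, he2, hev⟩ := hG.onSide_flat hon hu hw
  exact hext (flat_unique hG hd h1 h2 he.isHalfEdge he1 he2 hev.symm ▸ he)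

/-! ### Sides of the vertices and triangularity of the internal faces. -/

namespace IsOuterplanarTriangulatedST

variable (hG : G.IsOuterplanarTriangulatedST)
include hG

lemma onSide_or (v : Fin n) : G.OnSide true v ∨ G.OnSide false v := by
  obtain ⟨w, hw⟩ := hG.outerplanar v
  cases h : G.dir (v, w)
  · exact .inr ⟨_, hw, h, .inl rfl⟩
  · exact .inl ⟨_, hw, h, .inl rfl⟩

lemma onSide_side (v : Fin n) : G.OnSide (G.side v) v := by
  cases h : G.side v
  · rcases hG.onSide_or v with h' | h'
    · rw [← side_eq_true, h] at h'; simp at h'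
    · exact h'
  · exact side_eq_true.1 h

lemma side_eq_of_not_onSide {p : Bool} {v : Fin n} (h : ¬ G.OnSide p v) : G.side v = !p := by
  have := hG.onSide_side v
  cases p <;> cases h' : G.side v <;> simp_all

lemma onSide_not_of_not {p : Bool} {v : Fin n} (h : ¬ G.OnSide p v) : G.OnSide (!p) v := by
  rw [← hG.side_eq_of_not_onSide h]; exact hG.onSide_side v

/-- Internal faces are triangles. -/
lemma facePerm_cube {d : Fin n × Fin n} (hd : G.IsHalfEdge d) (hext : ¬ G.Ext d) :
    G.facePerm (G.facePerm (G.facePerm d)) = d := by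
  have h3 : (G.face d).ncard = 3 := by
    refine hG.triangulated _ ⟨d.1, d.2, hd, rfl⟩ fun h => hext ?_
    rw [ext_iff_sameCycle]; exact (face_eq_iff.1 h).symm
  have hper : Function.minimalPeriod G.facePerm d = 3 := by
    rw [← h3]
    have hpos : 0 < Function.minimalPeriod G.facePerm d :=
      Function.minimalPeriod_pos_of_mem_periodicPts
        (Function.Injective.mem_periodicPts G.facePerm.injective d)
    have : G.face d = ↑((Finset.range (Function.minimalPeriod G.facePerm d)).image
        fun k => G.facePerm^[k] d) := by
      ext e
      simp only [Finset.coe_image, Set.mem_image, Finset.coe_range, Set.mem_Iio]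
      constructor
      · rintro ⟨k, hk⟩
        refine ⟨k % _, Nat.mod_lt _ hpos, ?_⟩
        rw [Function.iterate_mod_minimalPeriod_eq]; exact hk
      · rintro ⟨k, -, hk⟩; exact ⟨k, hk⟩
    rw [this, Set.ncard_coe_finset, Finset.card_image_of_injOn, Finset.card_range]
    intro i hi j hj hij
    simp only [Finset.coe_range, Set.mem_Iio] at hi hj
    exact (Function.iterate_eq_iterate_iff_of_lt_minimalPeriod hi hj).1 hij
  have := Function.isPeriodicPt_minimalPeriod G.facePerm d
  rw [hper] at this
  exact this

lemma sameCycle_internal {d e : Fin n × Fin n} (hd : G.IsHalfEdge d) (hext : ¬ G.Ext d)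
    (h : G.facePerm.SameCycle d e) :
    e = d ∨ e = G.facePerm d ∨ e = G.facePerm (G.facePerm d) := by
  obtain ⟨k, -, rfl⟩ := h.exists_pow_eq'
  clear h
  induction k with
  | zero => simp
  | succ k ih =>
    rw [pow_succ', Equiv.Perm.mul_apply]
    rcases ih with h | h | h <;> rw [h]
    · simp
    · simp
    · left; exact hG.facePerm_cube hd hext

end IsOuterplanarTriangulatedST

/-! ### The tree of entry half-edges -/

/-- The child of the entry half-edge `d` for the side of its triangle at the tail of `d`. -/
def tailKid (G : EmbeddedDigraph n) (d : Fin n × Fin n) : Fin n × Fin n :=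
  if G.dir d = true then (G.facePerm (G.facePerm d)).swap else (G.facePerm d).swap

/-- The child of the entry half-edge `d` for the side of its triangle at the head of `d`. -/
def headKid (G : EmbeddedDigraph n) (d : Fin n × Fin n) : Fin n × Fin n :=
  if G.dir d = true then (G.facePerm d).swap else (G.facePerm (G.facePerm d)).swap

/-- The third vertex of the triangle of the entry half-edge `d`. -/
def apex (G : EmbeddedDigraph n) (d : Fin n × Fin n) : Fin n := (G.facePerm d).2

/-- The apex of the triangle at `d` is between the ends of the arc of `d`. -/
def MidApex (G : EmbeddedDigraph n) (d : Fin n × Fin n) : Prop :=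
  G.dir (G.headKid d) = G.dir d

/-- The half-edge of the arc of `d` with the arc on its left. -/
def rightHalf (G : EmbeddedDigraph n) (d : Fin n × Fin n) : Fin n × Fin n :=
  if G.dir d = true then d.swap else d

/-- The next block starts at the head of the arc of `d`. -/
def EndsBlock (G : EmbeddedDigraph n) (d : Fin n × Fin n) : Prop :=
  G.Ext (G.rightHalf d) ∧ G.OnSide true (G.rightHalf d).1 ∧
    G.dir (G.facePerm.symm (G.rightHalf d)) = false

/-- The root arc of the next block. -/
def blockKid (G : EmbeddedDigraph n) (d : Fin n × Fin n) : Fin n × Fin n :=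
  (G.facePerm.symm (G.rightHalf d)).swap

-- A side of the triangle is reversed because the child is to explore the face beyond that side. The
-- optional last child strings the blocks together into a single tree; it can also occur at an arc
-- without a triangle.
open Classical in
noncomputable def kids (G : EmbeddedDigraph n) (d : Fin n × Fin n) : List (Fin n × Fin n) :=
  (if G.Ext d then [] else [G.tailKid d, G.headKid d]) ++
    (if G.EndsBlock d then [G.blockKid d] else [])

/-- The arc of `d` is on the ladder between the two sides, or it is the root of its block. -/
def OnLadder (G : EmbeddedDigraph n) (d : Fin n × Fin n) : Prop :=
  G.side (G.head d) ≠ G.dir d ∨ (G.dir d = true ∧ G.Ext d.swap)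

/-- The condition places the lower turn of the external face at the reversal of `d`, so `d` is the
arc with which the right boundary leaves the source. -/
def IsRoot (G : EmbeddedDigraph n) (d : Fin n × Fin n) : Prop :=
  G.IsEntry d ∧ G.Ext d.swap ∧ G.dir (G.facePerm d.swap) = true

lemma rightHalf_eq {d : Fin n × Fin n} : G.rightHalf d = (G.head d, G.tail d) := by
  unfold rightHalf head tail; cases G.dir d <;> simp [Prod.swap]

namespace IsOuterplanarTriangulatedST

variable (hG : G.IsOuterplanarTriangulatedST)
include hG

/-- The shape of the triangle of an entry half-edge. -/
lemma triangle {d : Fin n × Fin n} (hd : G.IsEntry d) (hext : ¬ G.Ext d) :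
    G.IsEntry (G.tailKid d) ∧ G.IsEntry (G.headKid d) ∧
    G.tail (G.tailKid d) = G.tail d ∧ G.head (G.tailKid d) = G.apex d ∧
    G.dir (G.tailKid d) = G.dir d ∧
    ((G.MidApex d ∧ ¬ G.OnSide (!G.dir d) (G.apex d) ∧
        G.tail (G.headKid d) = G.apex d ∧ G.head (G.headKid d) = G.head d ∧
        G.dir (G.headKid d) = G.dir d) ∨
      (¬ G.MidApex d ∧ ¬ G.OnSide (G.dir d) (G.head d) ∧
        G.tail (G.headKid d) = G.head d ∧ G.head (G.headKid d) = G.apex d ∧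
        G.dir (G.headKid d) = !G.dir d)) := by
  obtain ⟨hH, hside⟩ := hd
  have hP := hG.planarST
  set e := G.facePerm d with he
  set f := G.facePerm e with hf
  have hfd : G.facePerm f = d := hG.facePerm_cube hH hext
  have hHe : G.IsHalfEdge e := isHalfEdge_facePerm.2 hH
  have hHf : G.IsHalfEdge f := isHalfEdge_facePerm.2 hHe
  have hxe : ¬ G.Ext e := fun h => hext (ext_facePerm.1 h)
  have hxf : ¬ G.Ext f := fun h => hxe (ext_facePerm.1 h)
  have e1 : e.1 = d.2 := rfl
  have f1 : f.1 = e.2 := rfl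
  have f2 : f.2 = d.1 := by rw [← hfd]; rfl
  have de := hHe.dir_swap
  have df := hHf.dir_swap
  have hse := hHe.swap
  have hsf := hHf.swap
  -- An internal flat corner excludes its vertex from the corresponding side of the boundary. This
  -- decides the side of the middle vertex of the triangle, and thus in which direction the arc from
  -- that vertex is entered.
  have flat : ∀ {x p}, G.IsHalfEdge x → ¬ G.Ext x → G.dir x = p → G.dir (G.facePerm x) = p →
    ¬ G.OnSide p x.2 := fun h1 h2 h3 h4 => hP.not_onSide h1 h2 h3 h4
  -- the three half-edges do not all have the same direction
  obtain ⟨x, hx, hxd⟩ := exists_dir_of_acyclic hP.acyclic hH (!G.dir d)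
  have hx' := hG.sameCycle_internal hH hext hx
  rw [← he, ← hf] at hx'
  have hneg : ¬ (G.dir e = G.dir d ∧ G.dir f = G.dir d) := by grind
  cases hdd : G.dir d with
  | true =>
    have hside' : G.side d.1 = true := by rw [← hdd, hside]; simp [tail, hdd]
    have hon : G.OnSide true d.1 := side_eq_true.1 hside'
    have hk1 : G.tailKid d = f.swap := by simp [tailKid, hdd, hf, he]
    have hk2 : G.headKid d = e.swap := by simp [headKid, hdd, he]
    have hfdir : G.dir f = false := by grind
    have hfs : G.dir f.swap = true := by rw [df, hfdir]; rfl
    have htd : G.tail d = d.1 := by simp [tail, hdd]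
    have hhd : G.head d = d.2 := by simp [head, hdd]
    have htf : G.tail f.swap = d.1 := by simp [tail, hfs, f2]
    have hhf : G.head f.swap = e.2 := by simp [head, hfs, f1]
    have hmid : G.MidApex d ↔ G.dir e = false := by
      unfold MidApex; rw [hk2, de, hdd]; simp
    refine ⟨?_, ?_, ?_, ?_, ?_, ?_⟩
    · rw [hk1]; exact ⟨hsf, by rw [hfs, htf, hside']⟩
    · rw [hk2]; refine ⟨hse, ?_⟩
      cases hed : G.dir e with
      | true =>
        have h1 := flat hH hext hdd hed
        have h2 := hG.side_eq_of_not_onSide h1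
        rw [de, hed, tail_swap hHe]; simp [tail, hed, e1, h2]
      | false =>
        have h1 := flat hHe hxe hed hfdir
        have h2 := hG.side_eq_of_not_onSide h1
        rw [de, hed, tail_swap hHe]; simp [tail, hed, h2]
    · rw [hk1, htf, htd]
    · rw [hk1, hhf]; rfl
    · rw [hk1, hfs]
    · cases hed : G.dir e with
      | true =>
        right
        have h1 := flat hH hext hdd hed
        have hes : G.dir e.swap = false := by rw [de, hed]; rfl
        rw [hmid, hk2, hhd]
        refine ⟨by simp [hed], h1, ?_, ?_, by rw [hes]; rfl⟩
        · simp [tail, hes, e1]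
        · simp [head, hes, apex, ← he]
      | false =>
        left
        have h1 := flat hHe hxe hed hfdir
        have hes : G.dir e.swap = true := by rw [de, hed]; rfl
        rw [hmid, hk2, hhd]
        refine ⟨hed, h1, ?_, ?_, by rw [hes]⟩
        · simp [tail, hes, apex, ← he]
        · simp [head, hes, e1]
  | false =>
    have hside' : G.side d.2 = false := by rw [← hdd, hside]; simp [tail, hdd]
    have hon : G.OnSide false d.2 := by have := hG.onSide_side d.2; rwa [hside'] at this
    have hk1 : G.tailKid d = e.swap := by simp [tailKid, hdd, he]
    have hk2 : G.headKid d = f.swap := by simp [headKid, hdd, he, hf]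
    have hedir : G.dir e = true := by grind
    have hes : G.dir e.swap = false := by rw [de, hedir]; rfl
    have htd : G.tail d = d.2 := by simp [tail, hdd]
    have hhd : G.head d = d.1 := by simp [head, hdd]
    have hte : G.tail e.swap = d.2 := by simp [tail, hes, e1]
    have hhe : G.head e.swap = e.2 := by simp [head, hes]
    have hmid : G.MidApex d ↔ G.dir f = true := by
      unfold MidApex; rw [hk2, df, hdd]; simp
    refine ⟨?_, ?_, ?_, ?_, ?_, ?_⟩
    · rw [hk1]; exact ⟨hse, by rw [hes, hte, hside']⟩
    · rw [hk2]; refine ⟨hsf, ?_⟩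
      cases hfd' : G.dir f with
      | true =>
        have h1 := flat hHe hxe hedir hfd'
        have h2 := hG.side_eq_of_not_onSide h1
        rw [df, hfd', tail_swap hHf]; simp [tail, hfd', f1, h2]
      | false =>
        have h1 := flat hHf hxf hfd' (by rw [hfd]; exact hdd)
        have h2 := hG.side_eq_of_not_onSide h1
        rw [df, hfd', tail_swap hHf]; simp [tail, hfd', h2]
    · rw [hk1, hte, htd]
    · rw [hk1, hhe]; rfl
    · rw [hk1, hes]
    · cases hfd' : G.dir f with
      | true =>
        left
        have h1 := flat hHe hxe hedir hfd'
        have hfs : G.dir f.swap = false := by rw [df, hfd']; rfl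
        rw [hmid, hk2, hhd]
        refine ⟨hfd', h1, ?_, ?_, by rw [hfs]⟩
        · simp [tail, hfs, apex, ← he, f1]
        · simp [head, hfs, f2]
      | false =>
        right
        have h1 := flat hHf hxf hfd' (by rw [hfd]; exact hdd)
        have hfs : G.dir f.swap = true := by rw [df, hfd']; rfl
        rw [hmid, hk2, hhd]
        refine ⟨by simp [hfd'], by rwa [f2] at h1, ?_, ?_, by rw [hfs]; rfl⟩
        · simp [tail, hfs, f2]
        · simp [head, hfs, apex, ← he, f1]

lemma kids_swap {d : Fin n × Fin n} :
    (G.tailKid d = (G.facePerm d).swap ∧ G.headKid d = (G.facePerm (G.facePerm d)).swap) ∨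
    (G.headKid d = (G.facePerm d).swap ∧ G.tailKid d = (G.facePerm (G.facePerm d)).swap) := by
  unfold tailKid headKid
  cases G.dir d <;> simp

/-- By `triangle` the reversals of the other two half-edges of the face are entries, and a half-edge
and its reversal are never both entries. -/
lemma entry_unique {d e : Fin n × Fin n} (hd : G.IsEntry d) (hext : ¬ G.Ext d)
    (he : G.IsEntry e) (h : G.facePerm.SameCycle d e) : d = e := by
  have ht := hG.triangle hd hext
  rcases hG.sameCycle_internal hd.1 hext h with rfl | rfl | rfl
  · rfl
  · rcases hG.kids_swap (d := d) with ⟨h1, h2⟩ | ⟨h1, h2⟩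
    · exact absurd (h1 ▸ ht.1) he.not_swap
    · exact absurd (h1 ▸ ht.2.1) he.not_swap
  · rcases hG.kids_swap (d := d) with ⟨h1, h2⟩ | ⟨h1, h2⟩
    · exact absurd (h2 ▸ ht.2.1) he.not_swap
    · exact absurd (h2 ▸ ht.1) he.not_swap

/-- At the lower turn of the face a half-edge pointing down is followed by one pointing up, and both
arcs have the vertex of the turn as their tail. One of the two directions agrees with the side of
that vertex. -/
lemma exists_entry {d : Fin n × Fin n} (hd : G.IsHalfEdge d) (hext : ¬ G.Ext d) :
    ∃ e, G.facePerm.SameCycle d e ∧ G.IsEntry e := by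
  obtain ⟨x, hx, hxp⟩ := exists_dir_of_acyclic hG.planarST.acyclic hd true
  obtain ⟨y, hy, hyp⟩ := exists_dir_of_acyclic hG.planarST.acyclic hd false
  -- two consecutive half-edges with a common tail
  obtain ⟨z, hz, hz1, hz2⟩ := exists_change G.facePerm (P := fun e => G.dir e = false)
    (hy.symm.trans hx) hyp (by simp [hxp])
  have hz3 : G.dir (G.facePerm z) = true := by simpa using hz2
  have hz' := hy.trans hz
  have hzH := (sameCycle_isHalfEdge hz').1 hd
  have t1 : G.tail z = z.2 := by simp [tail, hz1]
  have t2 : G.tail (G.facePerm z) = z.2 := by simp [tail, hz3]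
  cases hs : G.side z.2
  · exact ⟨z, hz', hzH, by rw [t1, hz1, hs]⟩
  · exact ⟨G.facePerm z, hz'.apply_right, isHalfEdge_facePerm.2 hzH, by rw [t2, hz3, hs]⟩

/-- The head of `d` is on both sides of the boundary and counts as left, so the next arc of the
right boundary is entered in its upward direction. -/
lemma blockKid_spec {d : Fin n × Fin n} (hd : G.IsHalfEdge d) (h : G.EndsBlock d) :
    G.IsEntry (G.blockKid d) ∧ G.dir (G.blockKid d) = true ∧ G.Ext (G.blockKid d).swap ∧
    G.tail (G.blockKid d) = G.head d ∧ G.facePerm (G.blockKid d).swap = G.rightHalf d ∧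
    G.OnLadder d := by
  obtain ⟨h1, h2, h3⟩ := h
  have hx : G.Ext (G.facePerm.symm (G.rightHalf d)) := ext_facePerm_symm.2 h1
  have hdir : G.dir (G.blockKid d) = true := by
    unfold blockKid; rw [hx.isHalfEdge.dir_swap, h3]; rfl
  have hfst : (G.blockKid d).1 = G.head d := by
    unfold blockKid; rw [Prod.fst_swap, facePerm_symm_apply_snd, rightHalf_eq]
  have htail : G.tail (G.blockKid d) = G.head d := by unfold tail; rw [if_pos hdir, hfst]
  rw [rightHalf_eq] at h2
  have h2' := side_eq_true.2 h2
  refine ⟨⟨hx.isHalfEdge.swap, ?_⟩, hdir, ?_, htail, ?_, ?_⟩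
  · rw [hdir, htail]; exact h2'.symm
  · simpa [blockKid] using hx
  · simp [blockKid]
  · unfold OnLadder
    cases hdd : G.dir d
    · left; rw [h2']; simp
    · right; simp only [rightHalf, hdd, if_true] at h1; exact ⟨rfl, h1⟩

lemma mem_kids {d e : Fin n × Fin n} : e ∈ G.kids d ↔
    (¬ G.Ext d ∧ (e = G.tailKid d ∨ e = G.headKid d)) ∨ (G.EndsBlock d ∧ e = G.blockKid d) := by
  unfold kids
  by_cases h1 : G.Ext d <;> by_cases h2 : G.EndsBlock d <;> simp [h1, h2, or_assoc]

/-- The reversal of a triangle child belongs to the triangle of its parent, whereas that of a block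
child belongs to the external face. This separates the two kinds of children, and in the first case
the face identifies the parent. -/
lemma not_ext_swap_kid {d e : Fin n × Fin n} (hext : ¬ G.Ext d)
    (h : e = G.tailKid d ∨ e = G.headKid d) :
    ¬ G.Ext e.swap ∧ G.facePerm.SameCycle d e.swap := by
  have h1 : ¬ G.Ext (G.facePerm d) := fun h => hext (ext_facePerm.1 h)
  have h2 : ¬ G.Ext (G.facePerm (G.facePerm d)) := fun h => h1 (ext_facePerm.1 h)
  have h3 : G.facePerm.SameCycle d (G.facePerm d) := (Equiv.Perm.SameCycle.refl _ _).apply_right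
  rcases hG.kids_swap (d := d) with ⟨k1, k2⟩ | ⟨k1, k2⟩ <;> rcases h with rfl | rfl
  · rw [k1]; exact ⟨h1, h3⟩
  · rw [k2]; exact ⟨h2, h3.apply_right⟩
  · rw [k2]; exact ⟨h2, h3.apply_right⟩
  · rw [k1]; exact ⟨h1, h3⟩

lemma isEntry_of_mem_kids {d e : Fin n × Fin n} (hd : G.IsEntry d) (h : e ∈ G.kids d) :
    G.IsEntry e := by
  rcases hG.mem_kids.1 h with ⟨hx, rfl | rfl⟩ | ⟨hb, rfl⟩
  · exact (hG.triangle hd hx).1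
  · exact (hG.triangle hd hx).2.1
  · exact (hG.blockKid_spec hd.1 hb).1

/-- If the reversal of `e` is internal, its face determines the parent by `entry_unique`. If it is
external, its successor on the external face is the downward half-edge of the parent's arc. -/
lemma kids_disjoint {d d' e : Fin n × Fin n} (hd : G.IsEntry d) (hd' : G.IsEntry d')
    (h : e ∈ G.kids d) (h' : e ∈ G.kids d') : d = d' := by
  rcases hG.mem_kids.1 h with ⟨hx, hk⟩ | ⟨hb, hk⟩ <;>
    rcases hG.mem_kids.1 h' with ⟨hx', hk'⟩ | ⟨hb', hk'⟩
  · obtain ⟨-, h1⟩ := hG.not_ext_swap_kid hx hk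
    obtain ⟨-, h2⟩ := hG.not_ext_swap_kid hx' hk'
    exact hG.entry_unique hd hx hd' (h1.trans h2.symm)
  · exact absurd (hk' ▸ (hG.blockKid_spec hd'.1 hb').2.2.1) (hG.not_ext_swap_kid hx hk).1
  · exact absurd (hk ▸ (hG.blockKid_spec hd.1 hb).2.2.1) (hG.not_ext_swap_kid hx' hk').1
  · have h1 := (hG.blockKid_spec hd.1 hb).2.2.2.2.1
    have h2 := (hG.blockKid_spec hd'.1 hb').2.2.2.2.1
    rw [← hk] at h1; rw [← hk', h1, rightHalf_eq, rightHalf_eq] at h2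
    exact hd.eq_of_arc_eq hd' (congrArg Prod.snd h2) (congrArg Prod.fst h2)

lemma tailKid_ne_headKid {d : Fin n × Fin n} (hd : G.IsEntry d) (hext : ¬ G.Ext d) :
    G.tailKid d ≠ G.headKid d := by
  intro h
  have hne : G.facePerm d ≠ G.facePerm (G.facePerm d) := by
    intro h
    have h1 := congrArg Prod.fst h
    exact (isHalfEdge_facePerm.2 hd.1).fst_ne_snd h1
  rcases hG.kids_swap (d := d) with ⟨k1, k2⟩ | ⟨k1, k2⟩ <;> rw [k1, k2] at h
  · exact hne (Prod.swap_injective h)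
  · exact hne (Prod.swap_injective h).symm

lemma kids_nodup {d : Fin n × Fin n} (hd : G.IsEntry d) : (G.kids d).Nodup := by
  unfold kids
  by_cases h1 : G.Ext d <;> by_cases h2 : G.EndsBlock d <;> simp only [h1, h2, if_true, if_false,
    List.nil_append, List.append_nil, List.nodup_nil, List.nodup_singleton]
  · have hb := (hG.blockKid_spec hd.1 h2).2.2.1
    have n1 : G.tailKid d ≠ G.blockKid d := fun h =>
      (hG.not_ext_swap_kid h1 (.inl rfl)).1 (h ▸ hb)
    have n2 : G.headKid d ≠ G.blockKid d := fun h =>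
      (hG.not_ext_swap_kid h1 (.inr rfl)).1 (h ▸ hb)
    simp [n1, n2, hG.tailKid_ne_headKid hd h1]
  · simp [hG.tailKid_ne_headKid hd h1]

/-- On the external face the reversal of the root is followed by a half-edge pointing up, but the
reversal of a block child is followed by one pointing down. -/
lemma root_not_mem_kids {d r : Fin n × Fin n} (hr : G.IsRoot r) (hd : G.IsEntry d) :
    r ∉ G.kids d := by
  intro h
  rcases hG.mem_kids.1 h with ⟨hx, hk⟩ | ⟨hb, rfl⟩
  · exact (hG.not_ext_swap_kid hx hk).1 hr.2.1
  · have h1 := hr.2.2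
    rw [(hG.blockKid_spec hd.1 hb).2.2.2.2.1] at h1
    have := hd.1.arc
    rw [rightHalf_eq] at h1
    have h2 := G.asymm _ _ this
    simp [dir, h2] at h1

lemma dir_of_ext_swap {d : Fin n × Fin n} (hd : G.IsEntry d) (h : G.Ext d.swap) :
    G.dir d = true := by
  by_contra hc
  have hc' : G.dir d = false := by simpa using hc
  have h1 : G.side (G.tail d) = true :=
    side_eq_true.2 ⟨d.swap, h, by rw [hd.1.dir_swap, hc']; rfl, by simp [tail, hc']⟩
  rw [hd.2, h1] at hc'; simp at hc'

lemma exists_root : ∃ r, G.IsRoot r := by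
  obtain ⟨e, he, h1, h2⟩ := exists_turn_of_acyclic hG.planarST.acyclic G.outer_mem false
  have hx : G.Ext e := ext_iff_sameCycle.2 he
  have hdir : G.dir e.swap = true := by rw [hx.isHalfEdge.dir_swap, h1]; rfl
  refine ⟨e.swap, ⟨hx.isHalfEdge.swap, ?_⟩, by simpa using hx, by simpa using h2⟩
  rw [hdir]
  symm
  refine side_eq_true.2 ⟨G.facePerm e, ext_facePerm.2 hx, by simpa using h2, .inl ?_⟩
  simp [tail, hdir]

/-- If the reversal of `e` is external, its successor points down, since otherwise both `e` and the
root would give the lower turn of the external face; the arc of this successor is the parent. If it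
is internal, the entry of its triangle is the parent. -/
lemma exists_parent {e r : Fin n × Fin n} (hr : G.IsRoot r) (he : G.IsEntry e) (hne : e ≠ r) :
    ∃ d, G.IsEntry d ∧ e ∈ G.kids d := by
  by_cases hx : G.Ext e.swap
  · set z := G.facePerm e.swap with hz
    have hzx : G.Ext z := ext_facePerm.2 hx
    have hed := hG.dir_of_ext_swap he hx
    have hes : G.dir e.swap = false := by rw [he.1.dir_swap, hed]; rfl
    cases hzd : G.dir z
    · have hz1 : z.1 = e.1 := rfl
      have key : ∀ d, G.IsEntry d → G.rightHalf d = z → e ∈ G.kids d := by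
        intro d hd hdz
        refine hG.mem_kids.2 (.inr ⟨⟨by rw [hdz]; exact hzx, ?_, ?_⟩, ?_⟩)
        · rw [hdz, hz1, ← side_eq_true]
          have := he.2
          rw [hed] at this; simpa [tail, hed] using this.symm
        · rw [hdz, hz]; simp [hes]
        · unfold blockKid; rw [hdz, hz]; simp
      have hzs : G.dir z.swap = true := by rw [hzx.isHalfEdge.dir_swap, hzd]; rfl
      rcases isEntry_or_swap hzx.isHalfEdge with h | h
      · exact ⟨z, h, key z h (by simp [rightHalf, hzd])⟩
      · exact ⟨z.swap, h, key _ h (by simp [rightHalf, hzs])⟩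
    · exfalso
      have hrs : G.dir r.swap = false := by
        rw [hr.1.1.dir_swap, hG.dir_of_ext_swap hr.1 hr.2.1]; rfl
      have := turn_unique hG.planarST (p := false) hx.isHalfEdge hes (by simpa using hzd) hrs
        (by simpa using hr.2.2) (hx.sameCycle hr.2.1)
      exact hne (Prod.swap_injective this)
  · obtain ⟨d, hd, hde⟩ := hG.exists_entry he.1.swap hx
    have hdx : ¬ G.Ext d := fun h => hx
      (ext_iff_sameCycle.2 ((ext_iff_sameCycle.1 h).trans hd.symm))
    refine ⟨d, hde, hG.mem_kids.2 (.inl ⟨hdx, ?_⟩)⟩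
    rcases hG.sameCycle_internal hde.1 hdx hd.symm with h | h | h
    · exact absurd (h ▸ hde) he.not_swap
    · have h' : e = (G.facePerm d).swap := by rw [← h]; simp
      rcases hG.kids_swap (d := d) with ⟨k1, k2⟩ | ⟨k1, k2⟩ <;> simp [h', k1]
    · have h' : e = (G.facePerm (G.facePerm d)).swap := by rw [← h]; simp
      rcases hG.kids_swap (d := d) with ⟨k1, k2⟩ | ⟨k1, k2⟩ <;> simp [h', k2]

end IsOuterplanarTriangulatedST

end EmbeddedDigraph

/-! ### Breadth-first enumeration of a finite forest -/

section BreadthFirst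

variable {α : Type*}

/-- The queue of a breadth-first search from `r` after `k` steps. -/
def bfsQueue (kids : α → List α) (r : α) : ℕ → List α
  | 0 => [r]
  | k + 1 => bfsQueue kids r k ++ ((bfsQueue kids r k)[k]?.toList.flatMap kids)

/-- `q 0, …, q (m - 1)` is a breadth-first enumeration; the children of `q k` are enumerated
from the index `first k` on. -/
structure IsBreadthFirst (kids : α → List α) (r : α) (m : ℕ) (q : ℕ → α) (first : ℕ → ℕ) :
    Prop where
  root : q 0 = r
  first_zero : first 0 = 1
  lt_first : ∀ k < m, k < first k
  first_succ : ∀ k < m, first (k + 1) = first k + (kids (q k)).length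
  kid : ∀ k < m, ∀ i (h : i < (kids (q k)).length), q (first k + i) = (kids (q k))[i]
  first_last : first m = m
  injOn : ∀ j < m, ∀ k < m, q j = q k → j = k

lemma IsBreadthFirst.first_le {kids : α → List α} {r : α} {m : ℕ} {q : ℕ → α} {first : ℕ → ℕ}
    (h : IsBreadthFirst kids r m q first) {k l : ℕ} (hkl : k ≤ l) (hl : l ≤ m) :
    first k ≤ first l := by
  induction l with
  | zero => rw [Nat.le_zero.1 hkl]
  | succ l ih =>
    rcases Nat.lt_or_ge k (l + 1) with h' | h'
    · have := ih (by omega) (by omega)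
      have := h.first_succ l (by omega)
      omega
    · rw [le_antisymm hkl h']

lemma IsBreadthFirst.pos {kids : α → List α} {r : α} {m : ℕ} {q : ℕ → α} {first : ℕ → ℕ}
    (h : IsBreadthFirst kids r m q first) : 0 < m := by
  rcases Nat.eq_zero_or_pos m with rfl | hm
  · have := h.first_zero; have := h.first_last; omega
  · exact hm

lemma bfsQueue_prefix (kids : α → List α) (r : α) {k l : ℕ} (h : k ≤ l) :
    bfsQueue kids r k <+: bfsQueue kids r l := by
  induction l with
  | zero => rw [Nat.le_zero.1 h]
  | succ l ih =>
    rcases Nat.lt_or_ge k (l + 1) with h' | h'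
    · exact (ih (by omega)).trans (List.prefix_append _ _)
    · rw [le_antisymm h h']

lemma mem_bfsQueue {kids : α → List α} {r : α} {k : ℕ} {e : α} (h : e ∈ bfsQueue kids r k) :
    e = r ∨ ∃ j < k, ∃ d, (bfsQueue kids r k)[j]? = some d ∧ e ∈ kids d := by
  induction k with
  | zero => left; simpa [bfsQueue] using h
  | succ k ih =>
    have hpre : ∀ (j : ℕ) d, (bfsQueue kids r k)[j]? = some d →
        (bfsQueue kids r (k + 1))[j]? = some d := by
      intro j d hj
      have hlt := (List.getElem?_eq_some_iff.1 hj).1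
      rw [bfsQueue, List.getElem?_append_left hlt, hj]
    rw [bfsQueue, List.mem_append] at h
    rcases h with h | h
    · grind
    · grind

lemma bfsQueue_forall {kids : α → List α} {r : α} {P : α → Prop} (hr : P r)
    (hk : ∀ d, P d → ∀ e ∈ kids d, P e) (k : ℕ) : ∀ e ∈ bfsQueue kids r k, P e := by
  induction k with
  | zero => intro e he; rw [bfsQueue, List.mem_singleton] at he; exact he ▸ hr
  | succ k ih =>
    intro e he
    rw [bfsQueue, List.mem_append] at he
    rcases he with he | he
    · exact ih e he
    · grind

/-- A repeated element would have two parents or be a child of the element at two positions; both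
are excluded, since parents are unique, positions have different elements by induction, and each
position is expanded once. -/
lemma bfsQueue_nodup {kids : α → List α} {r : α} {P : α → Prop} (hr : P r)
    (hk : ∀ d, P d → ∀ e ∈ kids d, P e) (hnd : ∀ d, P d → (kids d).Nodup)
    (hroot : ∀ d, P d → r ∉ kids d)
    (hdis : ∀ d d' e, P d → P d' → e ∈ kids d → e ∈ kids d' → d = d') (k : ℕ) :
    (bfsQueue kids r k).Nodup := by
  induction k with
  | zero => simp [bfsQueue]
  | succ k ih =>
    have hP := bfsQueue_forall hr hk k
    rw [bfsQueue]
    cases hd : (bfsQueue kids r k)[k]? with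
    | none => simpa using ih
    | some d =>
      have hPd := hP d (List.mem_of_getElem? hd)
      simp only [Option.toList_some, List.flatMap_cons, List.flatMap_nil, List.append_nil]
      refine List.nodup_append'.2 ⟨ih, hnd d hPd, ?_⟩
      intro e he he'
      rcases mem_bfsQueue he with rfl | ⟨j, hj, d', hd', he''⟩
      · exact hroot d hPd he'
      · have := hdis d d' e hPd (hP d' (List.mem_of_getElem? hd')) he' he''
        subst this
        obtain ⟨h1, h2⟩ := List.getElem?_eq_some_iff.1 hd
        obtain ⟨h3, h4⟩ := List.getElem?_eq_some_iff.1 hd'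
        have := (List.Nodup.getElem_inj_iff ih).1 (h2.trans h4.symm)
        omega

/-- A forest with one root on a finite type has a breadth-first enumeration. -/
lemma exists_isBreadthFirst [Fintype α] {kids : α → List α} {r : α} {P : α → Prop} (hr : P r)
    (hk : ∀ d, P d → ∀ e ∈ kids d, P e) (hnd : ∀ d, P d → (kids d).Nodup)
    (hroot : ∀ d, P d → r ∉ kids d)
    (hdis : ∀ d d' e, P d → P d' → e ∈ kids d → e ∈ kids d' → d = d')
    (hpar : ∀ e, P e → e ≠ r → ∃ d, P d ∧ e ∈ kids d)
    (rank : α → ℕ) (hrank : ∀ d e, P d → e ∈ kids d → rank d < rank e) :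
    ∃ m q first, IsBreadthFirst kids r m q first ∧ (∀ k < m, P (q k)) ∧
      ∀ e, P e → ∃ k < m, q k = e := by
  classical
  have hnod := bfsQueue_nodup hr hk hnd hroot hdis
  have hex : ∃ m, (bfsQueue kids r m).length ≤ m :=
    ⟨Fintype.card α, (hnod _).length_le_card⟩
  let m := Nat.find hex
  have hm1 : (bfsQueue kids r m).length ≤ m := Nat.find_spec hex
  have hm2 : ∀ k < m, k < (bfsQueue kids r k).length := by
    intro k hkm; have := Nat.find_min hex hkm; omega
  have hlen : ∀ {k l}, k ≤ l → (bfsQueue kids r k).length ≤ (bfsQueue kids r l).length :=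
    fun h => (bfsQueue_prefix kids r h).length_le
  have hm0 : m ≠ 0 := by
    intro h
    rw [h] at hm1; simp [bfsQueue] at hm1
  have hm : (bfsQueue kids r m).length = m := by grind
  let q : ℕ → α := fun k => (bfsQueue kids r m)[k]?.getD r
  have hq : ∀ k ≤ m, ∀ j d, (bfsQueue kids r k)[j]? = some d → q j = d := by
    intro k hkm j d hj
    have hlt := (List.getElem?_eq_some_iff.1 hj).1
    have := (List.prefix_iff_getElem?.1 (bfsQueue_prefix kids r hkm)) j hlt
    show (bfsQueue kids r m)[j]?.getD r = d
    rw [this]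
    simpa using (List.getElem?_eq_some_iff.1 hj).2
  have hq' : ∀ k ≤ m, ∀ j < (bfsQueue kids r k).length, (bfsQueue kids r k)[j]? = some (q j) := by
    grind
  have hsucc : ∀ k < m, bfsQueue kids r (k + 1) = bfsQueue kids r k ++ kids (q k) := by
    intro k hkm
    rw [bfsQueue, hq' k hkm.le k (hm2 k hkm)]; simp
  have hBF : IsBreadthFirst kids r m q fun k => (bfsQueue kids r k).length :=
    { root := hq 0 (by omega) 0 r (by simp [bfsQueue])
      first_zero := by simp [bfsQueue]
      lt_first := hm2
      first_succ := fun k hkm => by rw [hsucc k hkm, List.length_append]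
      kid := by
        intro k hkm i hi
        refine hq (k + 1) hkm _ _ ?_
        rw [hsucc k hkm, List.getElem?_append_right (by omega)]
        simp [hi]
      first_last := hm
      injOn := by
        intro j hj k hk' hjk
        have h1 := hq' m le_rfl j (by omega)
        have h2 := hq' m le_rfl k (by omega)
        obtain ⟨a1, a2⟩ := List.getElem?_eq_some_iff.1 h1
        obtain ⟨b1, b2⟩ := List.getElem?_eq_some_iff.1 h2
        exact (List.Nodup.getElem_inj_iff (hnod m)).1 (by rw [a2, b2, hjk]) }
  have hmem : ∀ k < m, q k ∈ bfsQueue kids r m := fun k hkm =>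
    List.mem_of_getElem? (hq' m le_rfl k (by omega))
  refine ⟨m, q, _, hBF, fun k hkm => bfsQueue_forall hr hk m _ (hmem k hkm), ?_⟩
  -- Completeness goes by induction on the rank: a parent has smaller rank than its child, so it has
  -- been enumerated, and its expansion enumerates the child.
  suffices h : ∀ N, ∀ e, P e → rank e = N → ∃ k < m, q k = e from fun e he => h _ e he rfl
  intro N
  induction N using Nat.strong_induction_on with
  | _ N ih =>
    intro e he hN
    by_cases her : e = r
    · exact ⟨0, by omega, by rw [her]; exact hBF.root⟩
    · obtain ⟨d, hd, hed⟩ := hpar e he her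
      obtain ⟨k, hkm, rfl⟩ := ih (rank d) (hN ▸ hrank d e hd hed) d hd rfl
      obtain ⟨i, hi, rfl⟩ := List.getElem_of_mem hed
      refine ⟨_, ?_, hBF.kid k hkm i hi⟩
      have h1 := hBF.first_succ k hkm
      have h2 := hBF.first_le (k := k + 1) hkm le_rfl
      have h3 := hBF.first_last
      omega

end BreadthFirst

/-! ### The breadth-first enumeration of the arcs and the count of the vertices. -/

namespace EmbeddedDigraph

variable {n : ℕ} {G : EmbeddedDigraph n}

/-- The height of a vertex is the number of its proper ancestors. -/
lemma Acyclic.exists_height (hG : G.Acyclic) :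
    ∃ h : Fin n → ℕ, (∀ v, h v < n) ∧ ∀ u v, G.arc u v = true → h u < h v := by
  classical
  refine ⟨fun v => (Finset.univ.filter fun u =>
    Relation.TransGen (fun a b => G.arc a b = true) u v).card, ?_, ?_⟩
  · intro v
    have : (Finset.univ.filter fun u =>
        Relation.TransGen (fun a b => G.arc a b = true) u v) ⊂ Finset.univ := by
      rw [Finset.ssubset_univ_iff]
      intro h
      have := Finset.mem_univ v
      rw [← h, Finset.mem_filter] at this
      exact hG v this.2
    simpa using Finset.card_lt_card this
  · intro u v huv
    apply Finset.card_lt_card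
    rw [Finset.ssubset_iff_of_subset]
    · exact ⟨u, by simpa using .single huv, by simpa using hG u⟩
    · grind

namespace IsOuterplanarTriangulatedST

variable (hG : G.IsOuterplanarTriangulatedST)
include hG

/-- How the ladder continues at the children of an entry half-edge. -/
lemma ladder_kids {d : Fin n × Fin n} (hd : G.IsEntry d) (hext : ¬ G.Ext d) :
    (G.MidApex d → ¬ G.OnLadder (G.tailKid d) ∧ (G.OnLadder (G.headKid d) → G.OnLadder d)) ∧
    (¬ G.MidApex d → G.OnLadder d ∧ ¬ (G.OnLadder (G.tailKid d) ∧ G.OnLadder (G.headKid d))) := by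
  obtain ⟨-, -, t1, t2, t3, h⟩ := hG.triangle hd hext
  have hx1 := (hG.not_ext_swap_kid hext (.inl rfl)).1
  have hx2 := (hG.not_ext_swap_kid hext (.inr rfl)).1
  have l1 : G.OnLadder (G.tailKid d) ↔ G.side (G.apex d) ≠ G.dir d := by
    unfold OnLadder; rw [t2, t3]; tauto
  have l2 : G.OnLadder (G.headKid d) ↔ G.side (G.head (G.headKid d)) ≠ G.dir (G.headKid d) := by
    unfold OnLadder; tauto
  rw [l1, l2]
  rcases h with ⟨hm, h1, h2, h3, h4⟩ | ⟨hm, h1, h2, h3, h4⟩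
  · refine ⟨fun _ => ⟨?_, ?_⟩, fun h => absurd hm h⟩
    · rw [hG.side_eq_of_not_onSide h1]; simp
    · rw [h3, h4]; exact .inl
  · refine ⟨fun h => absurd h hm, fun _ => ⟨?_, ?_⟩⟩
    · left; rw [hG.side_eq_of_not_onSide h1]; cases G.dir d <;> simp
    · grind

/-- Along the ladder the ends of the arcs move up, so the sum of their heights increases. Off the
ladder the third vertex is always between the ends and the children stay off the ladder, so the
difference of the heights decreases. The offset `3 * n` ranks every arc off the ladder after all
arcs on it, and the ladder is never entered again. -/
lemma exists_rank : ∃ rank : Fin n × Fin n → ℕ,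
    ∀ d e, G.IsEntry d → e ∈ G.kids d → rank d < rank e := by
  classical
  obtain ⟨h, hn, harc⟩ := hG.planarST.acyclic.exists_height
  refine ⟨fun d => if G.OnLadder d then h (G.tail d) + h (G.head d)
    else 3 * n - (h (G.head d) - h (G.tail d)), ?_⟩
  intro d e hd he
  have hk := (hG.isEntry_of_mem_kids hd he).1.arc
  have a1 := harc _ _ hd.1.arc
  have a2 := harc _ _ hk
  have b1 := hn (G.tail d)
  have b2 := hn (G.head d)
  have b3 := hn (G.tail e)
  have b4 := hn (G.head e)
  rcases hG.mem_kids.1 he with ⟨hx, he⟩ | ⟨hb, rfl⟩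
  · obtain ⟨k1, k2, t1, t2, t3, ht⟩ := hG.triangle hd hx
    obtain ⟨l1, l2⟩ := hG.ladder_kids hd hx
    have c1 := harc _ _ k1.1.arc
    have c2 := harc _ _ k2.1.arc
    rcases ht with ⟨hm, -, h2, h3, -⟩ | ⟨hm, -, h2, h3, -⟩
    · grind
    · grind
  · obtain ⟨-, s2, s3, s4, -, s5⟩ := hG.blockKid_spec hd.1 hb
    have hl : G.OnLadder (G.blockKid d) := .inr ⟨s2, s3⟩
    simp only [s5, hl, if_true, s4] at *
    omega

/-- The arcs of `G`, as entry half-edges, in breadth-first order. -/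
lemma exists_order {r : Fin n × Fin n} (hr : G.IsRoot r) :
    ∃ m q first, IsBreadthFirst G.kids r m q first ∧ (∀ k < m, G.IsEntry (q k)) ∧
      ∀ e, G.IsEntry e → ∃ k < m, q k = e := by
  obtain ⟨rank, hrank⟩ := hG.exists_rank
  exact exists_isBreadthFirst hr.1 (fun d hd e he => hG.isEntry_of_mem_kids hd he)
    (fun d hd => hG.kids_nodup hd) (fun d hd => hG.root_not_mem_kids hr hd)
    (fun d d' e hd hd' h h' => hG.kids_disjoint hd hd' h h')
    (fun e he hne => hG.exists_parent hr he hne) rank hrank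

end IsOuterplanarTriangulatedST

open Classical in
/-- The vertices that are new at the children of `d`. -/
noncomputable def freshVertices (G : EmbeddedDigraph n) (d : Fin n × Fin n) : List (Fin n) :=
  (if G.Ext d then [] else [G.apex d]) ++
    (if G.EndsBlock d then [G.head (G.blockKid d)] else [])

/-- The vertices of the first `k` steps of the enumeration `q`. -/
noncomputable def visited (G : EmbeddedDigraph n) (q : ℕ → Fin n × Fin n) (k : ℕ) : List (Fin n) :=
  [G.tail (q 0), G.head (q 0)] ++ (List.range k).flatMap fun j => G.freshVertices (q j)

lemma visited_succ (q : ℕ → Fin n × Fin n) (k : ℕ) :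
    G.visited q (k + 1) = G.visited q k ++ G.freshVertices (q k) := by
  simp [visited, List.range_succ]

/-- A breadth-first enumeration of the arcs of `G`. -/
structure IsArcOrder (G : EmbeddedDigraph n) (m : ℕ) (q : ℕ → Fin n × Fin n) (first : ℕ → ℕ) :
    Prop where
  bfs : IsBreadthFirst G.kids (q 0) m q first
  root : G.IsRoot (q 0)
  entry : ∀ k < m, G.IsEntry (q k)
  surj : ∀ e, G.IsEntry e → ∃ k < m, q k = e

namespace IsArcOrder

variable {m : ℕ} {q : ℕ → Fin n × Fin n} {first : ℕ → ℕ}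

lemma first_le_total (ho : G.IsArcOrder m q first) {k : ℕ} (hk : k ≤ m) : first k ≤ m := by
  have := ho.bfs.first_le hk le_rfl
  rwa [ho.bfs.first_last] at this

/-- The kids of the triangle at `q k`. -/
lemma triangle_kids (ho : G.IsArcOrder m q first) {k : ℕ} (hk : k < m) (hext : ¬ G.Ext (q k)) :
    q (first k) = G.tailKid (q k) ∧ q (first k + 1) = G.headKid (q k) ∧
      first k + 1 < first (k + 1) := by
  have h0 := ho.bfs.kid k hk
  have h1 := ho.bfs.first_succ k hk
  have hl : G.kids (q k) = G.tailKid (q k) :: G.headKid (q k) ::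
      (by classical exact if G.EndsBlock (q k) then [G.blockKid (q k)] else []) := by
    simp [kids, hext]
  refine ⟨?_, ?_, ?_⟩
  · have := h0 0 (by simp [hl]); simpa [hl] using this
  · have := h0 1 (by simp [hl]); simpa [hl] using this
  · grind

open Classical in
lemma first_succ_eq (ho : G.IsArcOrder m q first) {k : ℕ} (hk : k < m) :
    first (k + 1) = first k + (if G.Ext (q k) then 0 else 2) +
      (if G.EndsBlock (q k) then 1 else 0) := by
  rw [ho.bfs.first_succ k hk]
  unfold kids
  split_ifs <;> simp

lemma block_kid (ho : G.IsArcOrder m q first) {k : ℕ} (hk : k < m) (hb : G.EndsBlock (q k)) :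
    q (first (k + 1) - 1) = G.blockKid (q k) ∧ first k < first (k + 1) := by
  have h0 := ho.bfs.kid k hk
  have h1 := ho.bfs.first_succ k hk
  have hl : (G.kids (q k)).length ≠ 0 := by simp [kids, hb]
  have h2 := h0 ((G.kids (q k)).length - 1) (by omega)
  have h3 : first (k + 1) - 1 = first k + ((G.kids (q k)).length - 1) := by omega
  rw [h3, h2]
  refine ⟨?_, by omega⟩
  unfold kids
  simp [hb]

lemma ends_mem_visited (hG : G.IsOuterplanarTriangulatedST) (ho : G.IsArcOrder m q first)
    {k : ℕ} (hk : k ≤ m) :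
    ∀ j < first k, G.tail (q j) ∈ G.visited q k ∧ G.head (q j) ∈ G.visited q k := by
  induction k with
  | zero =>
    intro j hj
    rw [ho.bfs.first_zero] at hj
    obtain rfl : j = 0 := by omega
    simp [visited]
  | succ k ih =>
    intro j hj
    have hkm : k < m := hk
    rw [visited_succ, List.mem_append, List.mem_append]
    rcases Nat.lt_or_ge j (first k) with h | h
    · grind
    · have h1 := ho.bfs.first_succ k hkm
      have h2 := ho.bfs.kid k hkm (j - first k) (by omega)
      rw [show first k + (j - first k) = j by omega] at h2
      have hmem : q j ∈ G.kids (q k) := h2 ▸ List.getElem_mem _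
      have hold := ih hkm.le k (ho.bfs.lt_first k hkm)
      have hen := ho.entry k hkm
      rcases hG.mem_kids.1 hmem with ⟨hx, he⟩ | ⟨hb, he⟩
      · have hap : G.apex (q k) ∈ G.freshVertices (q k) := by simp [freshVertices, hx]
        obtain ⟨-, -, t1, t2, -, ht⟩ := hG.triangle hen hx
        rcases he with he | he <;> rw [he]
        · grind
        · grind
      · have hbs := hG.blockKid_spec hen.1 hb
        rw [he, hbs.2.2.2.1]
        exact ⟨.inl hold.2, .inr (by simp [freshVertices, hb])⟩

lemma mem_visited (hG : G.IsOuterplanarTriangulatedST) (ho : G.IsArcOrder m q first) (v : Fin n) :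
    v ∈ G.visited q m := by
  obtain ⟨w, hw⟩ := hG.outerplanar v
  have hw' : G.IsHalfEdge (v, w) := Ext.isHalfEdge hw
  obtain ⟨e, he, hv⟩ : ∃ e, G.IsEntry e ∧ (v = G.tail e ∨ v = G.head e) := by
    have h0 : v = G.tail (v, w) ∨ v = G.head (v, w) := by
      unfold tail head; cases G.dir (v, w) <;> simp
    rcases isEntry_or_swap hw' with h | h
    · exact ⟨_, h, h0⟩
    · exact ⟨_, h, by rwa [tail_swap hw', head_swap hw']⟩
  obtain ⟨k, hk, rfl⟩ := ho.surj e he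
  have := ho.ends_mem_visited hG le_rfl k (by rw [ho.bfs.first_last]; exact hk)
  rcases hv with rfl | rfl
  · exact this.1
  · exact this.2

lemma card_arcs (ho : G.IsArcOrder m q first) : G.arcs.card = m := by
  rw [← Finset.card_range m]
  symm
  refine Finset.card_bij (fun k _ => (G.tail (q k), G.head (q k))) ?_ ?_ ?_
  · intro k hk
    have := (ho.entry k (Finset.mem_range.1 hk)).1.arc
    simpa [arcs] using this
  · intro j hj k hk h
    rw [Finset.mem_range] at hj hk
    exact ho.bfs.injOn j hj k hk ((ho.entry j hj).eq_of_arc_eq (ho.entry k hk)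
      (congrArg Prod.fst h) (congrArg Prod.snd h))
  · rintro ⟨u, v⟩ huv
    have hd : G.dir (u, v) = true := (Finset.mem_filter.1 huv).2
    have hH := isHalfEdge_of_dir hd
    have ht : G.tail (u, v) = u := by simp [tail, hd]
    have hh : G.head (u, v) = v := by simp [head, hd]
    rcases isEntry_or_swap hH with h | h
    · obtain ⟨k, hk, hq⟩ := ho.surj _ h
      exact ⟨k, Finset.mem_range.2 hk, by rw [hq, ht, hh]⟩
    · obtain ⟨k, hk, hq⟩ := ho.surj _ h
      exact ⟨k, Finset.mem_range.2 hk, by rw [hq, tail_swap hH, head_swap hH, ht, hh]⟩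

/-- Every internal face has an entry, and every entry is enumerated. -/
lemma ncard_faces_le (hG : G.IsOuterplanarTriangulatedST) (ho : G.IsArcOrder m q first) :
    by classical exact
      G.faces.ncard ≤ ((Finset.range m).filter fun k => ¬ G.Ext (q k)).card + 1 := by
  classical
  show G.faces.ncard ≤ ((Finset.range m).filter fun k => ¬ G.Ext (q k)).card + 1
  have h1 : G.faces ⊆ ↑(insert (G.face G.outer)
      (((Finset.range m).filter fun k => ¬ G.Ext (q k)).image fun k => G.face (q k))) := by
    rintro F ⟨v, w, hw, rfl⟩
    rw [Finset.coe_insert, Set.mem_insert_iff]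
    by_cases hx : G.Ext (v, w)
    · left; exact (face_eq_iff.2 (ext_iff_sameCycle.1 hx)).symm
    · right
      obtain ⟨e, hs, he⟩ := hG.exists_entry (d := (v, w)) hw hx
      obtain ⟨k, hk, rfl⟩ := ho.surj e he
      have hex : ¬ G.Ext (q k) := fun h => hx
        (ext_iff_sameCycle.2 ((ext_iff_sameCycle.1 h).trans hs.symm))
      rw [Finset.mem_coe, Finset.mem_image]
      exact ⟨k, Finset.mem_filter.2 ⟨Finset.mem_range.2 hk, hex⟩, (face_eq_iff.2 hs).symm⟩
  have h2 := Set.ncard_le_ncard h1 (Finset.finite_toSet _)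
  rw [Set.ncard_coe_finset] at h2
  exact h2.trans ((Finset.card_insert_le _ _).trans (Nat.succ_le_succ Finset.card_image_le))

open Classical in
lemma first_eq_sum (ho : G.IsArcOrder m q first) {k : ℕ} (hk : k ≤ m) :
    first k = 1 + 2 * ((Finset.range k).filter fun k => ¬ G.Ext (q k)).card +
      ((Finset.range k).filter fun k => G.EndsBlock (q k)).card := by
  induction k with
  | zero => simp [ho.bfs.first_zero]
  | succ k ih =>
    rw [ho.first_succ_eq hk, ih (by omega), Finset.range_add_one, Finset.filter_insert,
      Finset.filter_insert]
    split_ifs <;> simp [*] <;> omega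

open Classical in
lemma length_visited (k : ℕ) :
    (G.visited q k).length = 2 + ((Finset.range k).filter fun k => ¬ G.Ext (q k)).card +
      ((Finset.range k).filter fun k => G.EndsBlock (q k)).card := by
  induction k with
  | zero => simp [visited]
  | succ k ih =>
    rw [visited_succ, List.length_append, ih, Finset.range_add_one, Finset.filter_insert,
      Finset.filter_insert, freshVertices]
    split_ifs <;> simp [*] <;> omega

/-- Let there be `t` triangles and `b` further blocks in the enumeration. Then `m = 1 + 2 t + b`,
the list of vertices has length `2 + t + b`, and there are at most `t + 1` faces. Euler's formula
turns this into `2 + t + b ≤ n`, and into a linear bound on the number of arcs. -/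
lemma length_visited_le (hG : G.IsOuterplanarTriangulatedST) (ho : G.IsArcOrder m q first) :
    (G.visited q m).length ≤ n ∧ m ≤ 2 * n := by
  classical
  have h1 := ho.first_eq_sum le_rfl
  rw [ho.bfs.first_last] at h1
  have h2 := length_visited (G := G) (q := q) m
  have h3 : G.faces.ncard ≤ ((Finset.range m).filter fun k => ¬ G.Ext (q k)).card + 1 :=
    ho.ncard_faces_le hG
  have h4 := hG.planarST.plane.2
  rw [ho.card_arcs] at h4
  constructor <;> omega

/-- A list of length at most `n` that contains all `n` vertices has no repetitions. This is what
makes the third vertex of every triangle new when the triangle is drawn. -/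
lemma visited_nodup (hG : G.IsOuterplanarTriangulatedST) (ho : G.IsArcOrder m q first) :
    (G.visited q m).Nodup := by
  have h1 := (ho.length_visited_le hG).1
  have h2 : (G.visited q m).toFinset = Finset.univ := by
    ext v; simpa using ho.mem_visited hG v
  have h3 : (G.visited q m).toFinset.card = n := by rw [h2]; simp
  have h4 : (G.visited q m).toFinset.card = (G.visited q m).dedup.length := rfl
  have h5 : (G.visited q m).dedup = G.visited q m :=
    (List.dedup_sublist _).eq_of_length_le (by omega)
  rw [← h5]; exact List.nodup_dedup _

lemma visited_prefix {k l : ℕ} (h : k ≤ l) : G.visited q k <+: G.visited q l := by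
  induction l with
  | zero => rw [Nat.le_zero.1 h]
  | succ l ih =>
    rcases Nat.lt_or_ge k (l + 1) with h' | h'
    · rw [visited_succ]; exact (ih (by omega)).trans (List.prefix_append _ _)
    · rw [le_antisymm h h']

lemma fresh_nodup (hG : G.IsOuterplanarTriangulatedST) (ho : G.IsArcOrder m q first)
    {k : ℕ} (hk : k < m) :
    (G.visited q k ++ G.freshVertices (q k)).Nodup := by
  rw [← visited_succ]
  exact (ho.visited_nodup hG).sublist (visited_prefix hk).sublist

end IsArcOrder

end EmbeddedDigraph

/-! ### Inserting triangles into a drawing on the spine -/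

/-- Arcs with their tails, heads and sides, the pages on which they leave their tails and enter
their heads, the sides of the vertices, and the ladder arcs. -/
structure ArcSystem (V : Type*) where
  tl : ℕ → V
  hd : ℕ → V
  sd : ℕ → Bool
  f : ℕ → Bool
  g : ℕ → Bool
  On : Bool → V → Prop
  Lad : ℕ → Prop

namespace ArcSystem

variable {V α : Type*} [LinearOrder α] (S : ArcSystem V)

/-- The page of the arc `j` at the height `y`. -/
def page (px : ℕ → α) (j : ℕ) (y : α) : Bool :=
  if S.f j ≠ S.g j ∧ px j < y then S.g j else S.f j

/-- The segments (lower end, upper end, page) of the arc `j`. -/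
def Seg (pv : V → α) (px : ℕ → α) (j : ℕ) (l h : α) (c : Bool) : Prop :=
  (S.f j = S.g j ∧ l = pv (S.tl j) ∧ h = pv (S.hd j) ∧ c = S.f j) ∨
  (S.f j ≠ S.g j ∧ l = pv (S.tl j) ∧ h = px j ∧ c = S.f j) ∨
  (S.f j ≠ S.g j ∧ l = px j ∧ h = pv (S.hd j) ∧ c = S.g j)

/-- The points of the spine that are used by the drawing. -/
def IsPoint (made : ℕ → Prop) (placed : V → Prop) (pv : V → α) (px : ℕ → α) (t : α) : Prop :=
  (∃ v, placed v ∧ t = pv v) ∨ ∃ i, made i ∧ S.f i ≠ S.g i ∧ t = px i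

/-- The upper end of the first segment. -/
def up (pv : V → α) (px : ℕ → α) (j : ℕ) : α := if S.f j ≠ S.g j then px j else pv (S.hd j)

/-- The lower end of the last segment. -/
def lo (pv : V → α) (px : ℕ → α) (j : ℕ) : α := if S.f j ≠ S.g j then px j else pv (S.tl j)

/-- The order of the arcs of a triangle `a → b → c`, `a → c` around `a` and around `c`, where `b` is
on the side `q` of `a → c`. -/
def CornerOrder (pv : V → α) (px : ℕ → α) (q : Bool) (ab bc ac : ℕ) : Prop :=
  (S.f ac = q → S.f ab = q) ∧
  (S.f ab = S.f ac → S.f ac = q → S.up pv px ac < S.up pv px ab) ∧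
  (S.f ab = S.f ac → S.f ac ≠ q → S.up pv px ab < S.up pv px ac) ∧
  (S.g ac = q → S.g bc = q) ∧
  (S.g bc = S.g ac → S.g ac = q → S.lo pv px bc < S.lo pv px ac) ∧
  (S.g bc = S.g ac → S.g ac ≠ q → S.lo pv px ac < S.lo pv px bc)

/-- The invariant of the insertion: `made` are the arcs that have been drawn, `pending` are those
with an unexplored face on their side, `placed` are the vertices that have been placed. -/
structure Drawn (made pending : ℕ → Prop) (placed : V → Prop) (pv : V → α) (px : ℕ → α) :
    Prop where
  pend_made : ∀ j, pending j → made j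
  tl_placed : ∀ j, made j → placed (S.tl j)
  hd_placed : ∀ j, made j → placed (S.hd j)
  on_tl : ∀ j, made j → S.On (S.sd j) (S.tl j)
  sd_eq : ∀ j k, made j → made k → S.tl j = S.tl k → S.sd j = S.sd k
  arc_inj : ∀ j k, made j → made k → S.tl j = S.tl k → S.hd j = S.hd k → j = k
  upward : ∀ j, made j → pv (S.tl j) < pv (S.hd j)
  tl_lt : ∀ j, made j → S.f j ≠ S.g j → pv (S.tl j) < px j
  lt_hd : ∀ j, made j → S.f j ≠ S.g j → px j < pv (S.hd j)
  pv_inj : ∀ v w, placed v → placed w → pv v = pv w → v = w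
  px_ne : ∀ j v, made j → S.f j ≠ S.g j → placed v → px j ≠ pv v
  px_inj : ∀ j k, made j → made k → S.f j ≠ S.g j → S.f k ≠ S.g k → px j = px k → j = k
  -- Boundary vertices remain visible on the page of their side; `Drawn.exposed` turns this into a
  -- statement about segments.
  passing : ∀ j z q, made j → placed z → S.On q z → pv (S.tl j) < pv z → pv z < pv (S.hd j) →
    S.page px j (pv z) = !q
  between : ∀ j z, pending j → placed z → pv (S.tl j) < pv z → pv z < pv (S.hd j) →
    ¬ S.On (S.sd j) z
  -- Only a ladder arc can be the base of a triangle whose third vertex is above its head. Keeping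
  -- the head of the pending ladder arc highest makes room for that vertex.
  top : ∀ j z, pending j → S.Lad j → placed z → pv z ≤ pv (S.hd j)
  ladder : ∀ j, made j → ¬ S.On (S.sd j) (S.hd j) → S.Lad j
  ladder_unique : ∀ j k, pending j → pending k → S.Lad j → S.Lad k → j = k
  -- A pending arc is outermost on its side among the arcs at its tail, and by the next condition
  -- also at its head; so it must use its own page there if any arc does.
  first_page : ∀ j k, pending j → made k → S.tl k = S.tl j → S.f k = S.sd j → S.f j = S.sd j
  last_page : ∀ j k, pending j → made k → S.hd k = S.hd j → S.g k = S.sd j → S.g j = S.sd j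
  -- A pending arc that avoids its own page at both ends joins neighbouring points of the spine.
  -- Hence it does not obstruct the two arcs that will replace it, whichever pages these use.
  adjacent : ∀ j t, pending j → S.f j ≠ S.sd j → S.g j ≠ S.sd j →
    S.IsPoint made placed pv px t → pv (S.tl j) < t → pv (S.hd j) ≤ t
  planar : ∀ j k l h l' h' c, made j → made k → S.Seg pv px j l h c → S.Seg pv px k l' h' c →
    ¬ (l < l' ∧ l' < h ∧ h < h')

variable {S}
variable {made pending : ℕ → Prop} {placed : V → Prop} {pv : V → α} {px : ℕ → α}

lemma Drawn.congr (h : S.Drawn made pending placed pv px) {pv' : V → α} {px' : ℕ → α}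
    (hv : ∀ v, placed v → pv' v = pv v) (hx : ∀ j, made j → px' j = px j) :
    S.Drawn made pending placed pv' px' := by
  have h1 : ∀ j, made j → pv' (S.tl j) = pv (S.tl j) := fun j hj => hv _ (h.tl_placed j hj)
  have h2 : ∀ j, made j → pv' (S.hd j) = pv (S.hd j) := fun j hj => hv _ (h.hd_placed j hj)
  have h3 : ∀ j l u c, made j → S.Seg pv' px' j l u c → S.Seg pv px j l u c := by
    intro j l u c hj hs
    unfold Seg at *
    rwa [h1 j hj, h2 j hj, hx j hj] at hs
  exact
    { pend_made := h.pend_made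
      tl_placed := h.tl_placed
      hd_placed := h.hd_placed
      on_tl := h.on_tl
      sd_eq := h.sd_eq
      arc_inj := h.arc_inj
      upward := fun j hj => by rw [h1 j hj, h2 j hj]; exact h.upward j hj
      tl_lt := fun j hj hc => by rw [h1 j hj, hx j hj]; exact h.tl_lt j hj hc
      lt_hd := fun j hj hc => by rw [h2 j hj, hx j hj]; exact h.lt_hd j hj hc
      pv_inj := fun v w a b e => by rw [hv v a, hv w b] at e; exact h.pv_inj v w a b e
      px_ne := fun j v a b c => by rw [hv v c, hx j a]; exact h.px_ne j v a b c
      px_inj := fun j k a b c d e => by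
        rw [hx j a, hx k b] at e; exact h.px_inj j k a b c d e
      passing := fun j z q a b c d e => by
        rw [h1 j a, hv z b] at d; rw [h2 j a, hv z b] at e
        rw [hv z b]; unfold page; rw [hx j a]
        exact h.passing j z q a b c d e
      between := fun j z a b c d => by
        have := h.pend_made j a
        rw [h1 j this, hv z b] at c; rw [h2 j this, hv z b] at d
        exact h.between j z a b c d
      top := fun j z a b c => by
        rw [h2 j (h.pend_made j a), hv z c]; exact h.top j z a b c
      ladder := h.ladder
      ladder_unique := h.ladder_unique
      first_page := h.first_page
      last_page := h.last_page
      adjacent := fun j t a b c d e => by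
        have := h.pend_made j a
        rw [h1 j this] at e; rw [h2 j this]
        refine h.adjacent j t a b c ?_ e
        rcases d with ⟨v, p, q⟩ | ⟨i, p, q, r⟩
        · left; exact ⟨v, p, by rw [q, hv v p]⟩
        · right; exact ⟨i, p, q, by rw [r, hx i p]⟩
      planar := fun j k l u l' u' c a b s s' =>
        h.planar j k l u l' u' c a b (h3 j l u c a s) (h3 k l' u' c b s') }

lemma CornerOrder.congr {q : Bool} {ab bc ac : ℕ} (h : S.CornerOrder pv px q ab bc ac)
    {pv' : V → α} {px' : ℕ → α} (t : ∀ j, j = ab ∨ j = bc ∨ j = ac → pv' (S.tl j) = pv (S.tl j))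
    (d : ∀ j, j = ab ∨ j = bc ∨ j = ac → pv' (S.hd j) = pv (S.hd j))
    (x : ∀ j, j = ab ∨ j = bc ∨ j = ac → px' j = px j) : S.CornerOrder pv' px' q ab bc ac := by
  unfold CornerOrder up lo at *
  rw [t bc (by simp), t ac (by simp), d ab (by simp), d ac (by simp), x ab (by simp),
    x bc (by simp), x ac (by simp)]
  exact h

lemma Drawn.weaken (h : S.Drawn made pending placed pv px) {pending' : ℕ → Prop}
    (hp : ∀ j, pending' j → pending j) : S.Drawn made pending' placed pv px :=
  { h with
    pend_made := fun j a => h.pend_made j (hp j a)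
    between := fun j z a => h.between j z (hp j a)
    top := fun j z a => h.top j z (hp j a)
    ladder_unique := fun j k a b => h.ladder_unique j k (hp j a) (hp k b)
    first_page := fun j k a => h.first_page j k (hp j a)
    last_page := fun j k a => h.last_page j k (hp j a)
    adjacent := fun j t a => h.adjacent j t (hp j a) }

namespace Drawn

variable (h : S.Drawn made pending placed pv px)
include h

lemma isPoint_of_seg {j : ℕ} {l u : α} {c : Bool} (hj : made j) (hs : S.Seg pv px j l u c) :
    S.IsPoint made placed pv px l ∧ S.IsPoint made placed pv px u ∧ l < u ∧
      pv (S.tl j) ≤ l ∧ u ≤ pv (S.hd j) := by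
  have h1 := h.tl_placed j hj
  have h2 := h.hd_placed j hj
  rcases hs with ⟨e, rfl, rfl, -⟩ | ⟨e, rfl, rfl, -⟩ | ⟨e, rfl, rfl, -⟩
  · exact ⟨.inl ⟨_, h1, rfl⟩, .inl ⟨_, h2, rfl⟩, h.upward j hj, le_rfl, le_rfl⟩
  · exact ⟨.inl ⟨_, h1, rfl⟩, .inr ⟨j, hj, e, rfl⟩, h.tl_lt j hj e, le_rfl, (h.lt_hd j hj e).le⟩
  · exact ⟨.inr ⟨j, hj, e, rfl⟩, .inl ⟨_, h2, rfl⟩, h.lt_hd j hj e, (h.tl_lt j hj e).le, le_rfl⟩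

/-- No segment on the page `q` passes a vertex on the side `q`. -/
lemma exposed {j : ℕ} {l u : α} {z : V} {q : Bool} (hj : made j) (hz : placed z)
    (hq : S.On q z) (hs : S.Seg pv px j l u q) (h1 : l < pv z) (h2 : pv z < u) : False := by
  obtain ⟨-, -, -, h3, h4⟩ := h.isPoint_of_seg hj hs
  have := h.passing j z q hj hz hq (h3.trans_lt h1) (h2.trans_le h4)
  unfold page at this
  rcases hs with ⟨e, rfl, rfl, e'⟩ | ⟨e, rfl, rfl, e'⟩ | ⟨e, rfl, rfl, e'⟩ <;> grind

lemma first_of_seg_tl {j : ℕ} {v : V} {u : α} {c : Bool} (hj : made j) (hv : placed v)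
    (hs : S.Seg pv px j (pv v) u c) : S.tl j = v ∧ S.f j = c := by
  rcases hs with ⟨e, h1, -, e'⟩ | ⟨e, h1, -, e'⟩ | ⟨e, h1, -, -⟩
  · exact ⟨(h.pv_inj _ _ hv (h.tl_placed j hj) h1).symm, e'.symm⟩
  · exact ⟨(h.pv_inj _ _ hv (h.tl_placed j hj) h1).symm, e'.symm⟩
  · exact absurd h1.symm (h.px_ne j v hj e hv)

lemma last_of_seg_hd {j : ℕ} {v : V} {l : α} {c : Bool} (hj : made j) (hv : placed v)
    (hs : S.Seg pv px j l (pv v) c) : S.hd j = v ∧ S.g j = c := by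
  rcases hs with ⟨e, -, h1, e'⟩ | ⟨e, -, h1, -⟩ | ⟨e, -, h1, e'⟩
  · exact ⟨(h.pv_inj _ _ hv (h.hd_placed j hj) h1).symm, e'.symm ▸ e.symm⟩
  · exact absurd h1.symm (h.px_ne j v hj e hv)
  · exact ⟨(h.pv_inj _ _ hv (h.hd_placed j hj) h1).symm, e'.symm⟩

/-- Two such arcs have the same side. The lower of their heads would be passed by the other arc, so
it is not on that side; this makes its arc a ladder arc, whose head should be the highest vertex. -/
lemma tail_unique {j k : ℕ} (hj : pending j) (hk : pending k) (e : S.tl j = S.tl k) : j = k := by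
  have mj := h.pend_made j hj
  have mk := h.pend_made k hk
  have es := h.sd_eq j k mj mk e
  have key : ∀ {j k}, pending j → pending k → S.tl j = S.tl k → S.sd j = S.sd k →
      ¬ pv (S.hd j) < pv (S.hd k) := by
    intro j k hj hk e es hlt
    have mj := h.pend_made j hj
    have := h.between k (S.hd j) hk (h.hd_placed j mj) (e ▸ h.upward j mj) hlt
    rw [← es] at this
    have := h.top j (S.hd k) hj (h.ladder j mj this) (h.hd_placed k (h.pend_made k hk))
    exact absurd hlt this.not_gt
  have h1 := key hj hk e es
  have h2 := key hk hj e.symm es.symm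
  exact h.arc_inj j k mj mk e (h.pv_inj _ _ (h.hd_placed j mj) (h.hd_placed k mk)
    (le_antisymm (not_lt.1 h2) (not_lt.1 h1)))

/-- The higher of the tails would lie between the ends of the other arc although it is on the side
of that arc. -/
lemma head_unique {j k : ℕ} (hj : pending j) (hk : pending k) (e : S.hd j = S.hd k)
    (es : S.sd j = S.sd k) : j = k := by
  have mj := h.pend_made j hj
  have mk := h.pend_made k hk
  have key : ∀ {j k}, pending j → pending k → S.hd j = S.hd k → S.sd j = S.sd k →
      ¬ pv (S.tl j) < pv (S.tl k) := by
    intro j k hj hk e es hlt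
    have mk := h.pend_made k hk
    have := h.between j (S.tl k) hj (h.tl_placed k mk) hlt (e ▸ h.upward k mk)
    rw [es] at this
    exact this (h.on_tl k mk)
  have h1 := key hj hk e es
  have h2 := key hk hj e.symm es.symm
  exact h.arc_inj j k mj mk (h.pv_inj _ _ (h.tl_placed j mj) (h.tl_placed k mk)
    (le_antisymm (not_lt.1 h2) (not_lt.1 h1))) e

/-- At the end of a pending arc, no segment on the side of the arc passes. -/
lemma pending_hd {j k : ℕ} {l u : α} (hj : pending j) (hk : made k)
    (hs : S.Seg pv px k l u (S.sd j)) (h1 : l < pv (S.hd j)) (h2 : pv (S.hd j) < u) : False := by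
  have mj := h.pend_made j hj
  by_cases ho : S.On (S.sd j) (S.hd j)
  · exact h.exposed hk (h.hd_placed j mj) ho hs h1 h2
  · have := h.top j (S.hd k) hj (h.ladder j mj ho) (h.hd_placed k hk)
    exact absurd (h2.trans_le (h.isPoint_of_seg hk hs).2.2.2.2) this.not_gt

end Drawn

end ArcSystem

/-! ### A triangle whose third vertex lies between the ends of its base. -/

namespace ArcSystem

variable {V α : Type*} [LinearOrder α] {S : ArcSystem V}
variable {made pending : ℕ → Prop} {placed : V → Prop} {pv : V → α} {px : ℕ → α}

/-- Two segments of one arc do not cross. -/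
lemma seg_self {k : ℕ} {l u l' u' : α} {c : Bool} (hs : S.Seg pv px k l u c)
    (hs' : S.Seg pv px k l' u' c) : ¬ (l < l' ∧ l' < u ∧ u < u') := by
  rcases hs with ⟨e, rfl, rfl, rfl⟩ | ⟨e, rfl, rfl, rfl⟩ | ⟨e, rfl, rfl, rfl⟩ <;>
  rcases hs' with ⟨e', rfl, rfl, e''⟩ | ⟨e', rfl, rfl, e''⟩ | ⟨e', rfl, rfl, e''⟩ <;> grind

/-- The arcs `i` and `i'` replace the pending arc `j`; their common vertex is placed directly below
the end of `j` or directly above the beginning of `j`. -/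
structure MidStep (S : ArcSystem V) (made pending : ℕ → Prop) (placed : V → Prop) (pv : V → α)
    (px : ℕ → α) (j i i' : ℕ) : Prop where
  drawn : S.Drawn made pending placed pv px
  pend : pending j
  tl_left : S.tl i = S.tl j
  tl_right : S.tl i' = S.hd i
  hd_right : S.hd i' = S.hd j
  sd_left : S.sd i = S.sd j
  sd_right : S.sd i' = S.sd j
  fresh : ¬ placed (S.hd i)
  on : S.On (S.sd j) (S.hd i)
  not_on : ¬ S.On (!S.sd j) (S.hd i)
  lad_left : ¬ S.Lad i
  lad_right : S.Lad i' → S.Lad j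
  lad_of_not_on : ¬ S.On (S.sd j) (S.hd j) → S.Lad i'
  first_left : S.f j = S.sd j → S.f i = S.sd j
  last_right : S.g j = S.sd j → S.g i' = S.sd j
  not_both : ¬ (S.f j = S.sd j ∧ S.g j = S.sd j)
  left_lt : px i < pv (S.hd i)
  lt_right : pv (S.hd i) < px i'
  -- If `j` leaves its tail on its own page, it enters its head on the other page, so its own side
  -- is open directly below the head. Otherwise its own side is open directly above the tail. The
  -- gap is free of old points and also has places for the crossings of both new arcs.
  slot : (S.f j = S.sd j ∧ px i' < pv (S.hd j) ∧
      ∀ t, S.IsPoint made placed pv px t → t < pv (S.hd j) → t < px i) ∨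
    (S.f j ≠ S.sd j ∧ pv (S.tl j) < px i ∧
      ∀ t, S.IsPoint made placed pv px t → pv (S.tl j) < t → px i' < t)

namespace MidStep

variable {j i i' : ℕ} (h : S.MidStep made pending placed pv px j i i')
include h

lemma made_j : made j := h.drawn.pend_made j h.pend

lemma placed_tl : placed (S.tl j) := h.drawn.tl_placed j h.made_j

lemma placed_hd : placed (S.hd j) := h.drawn.hd_placed j h.made_j

lemma pt_tl : S.IsPoint made placed pv px (pv (S.tl j)) := .inl ⟨_, h.placed_tl, rfl⟩

lemma pt_hd : S.IsPoint made placed pv px (pv (S.hd j)) := .inl ⟨_, h.placed_hd, rfl⟩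

lemma bounds : pv (S.tl j) < px i ∧ px i' < pv (S.hd j) := by
  have := h.drawn.upward j h.made_j
  rcases h.slot with ⟨-, h2, h3⟩ | ⟨-, h2, h3⟩
  · exact ⟨h3 _ h.pt_tl this, h2⟩
  · exact ⟨h2, h3 _ h.pt_hd this⟩

lemma point_cases {t : α} (ht : S.IsPoint made placed pv px t) : t < px i ∨ px i' < t := by
  rcases h.slot with ⟨-, h2, h3⟩ | ⟨-, h2, h3⟩
  · grind
  · grind

lemma point_not_mem {t : α} (ht : S.IsPoint made placed pv px t) (h1 : px i ≤ t) (h2 : t ≤ px i') :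
    False := by
  rcases h.point_cases ht with h3 | h3 <;> grind

lemma hd_left_ne_tl : S.hd i ≠ S.tl j := fun e => h.fresh (e ▸ h.placed_tl)

lemma hd_left_ne_hd : S.hd i ≠ S.hd j := fun e => h.fresh (e ▸ h.placed_hd)

lemma seg_left {l u : α} {c : Bool} (hs : S.Seg pv px i l u c) :
    (l = pv (S.tl j) ∧ px i ≤ u ∧ u ≤ pv (S.hd i) ∧ c = S.f i) ∨
      (px i ≤ l ∧ l < u ∧ u ≤ pv (S.hd i)) := by
  have := h.left_lt
  rcases hs with ⟨e, rfl, rfl, e'⟩ | ⟨e, rfl, rfl, e'⟩ | ⟨e, rfl, rfl, e'⟩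
  · exact .inl ⟨by rw [h.tl_left], this.le, le_rfl, e'⟩
  · exact .inl ⟨by rw [h.tl_left], le_rfl, this.le, e'⟩
  · exact .inr ⟨le_rfl, this, le_rfl⟩

lemma seg_right {l u : α} {c : Bool} (hs : S.Seg pv px i' l u c) :
    (u = pv (S.hd j) ∧ pv (S.hd i) ≤ l ∧ l ≤ px i' ∧ c = S.g i') ∨
      (pv (S.hd i) ≤ l ∧ l < u ∧ u ≤ px i') := by
  have := h.lt_right
  rcases hs with ⟨e, rfl, rfl, e'⟩ | ⟨e, rfl, rfl, e'⟩ | ⟨e, rfl, rfl, e'⟩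
  · exact .inl ⟨by rw [h.hd_right], by rw [h.tl_right], by rw [h.tl_right]; exact this.le,
      e'.trans e⟩
  · exact .inr ⟨by rw [h.tl_right], by rw [h.tl_right]; exact this, le_rfl⟩
  · exact .inl ⟨by rw [h.hd_right], this.le, le_rfl, e'⟩

/-- In the gap above the tail there is nothing to cross. In the gap below the head the new arc
leaves on the page of `j`. A segment there that starts below the gap and reaches above it either
ends at the head of `j`, which would put `j` on its own page at both ends, or passes that head,
which `pending_hd` excludes; and none passes the exposed tail of `j`. -/
lemma not_cross_left {k : ℕ} {t l u : α} (hk : made k) (hs : S.Seg pv px k l u (S.f i))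
    (h1 : px i ≤ t) (h2 : t ≤ px i') :
    ¬ (pv (S.tl j) < l ∧ l < t ∧ t < u) ∧ ¬ (l < pv (S.tl j) ∧ pv (S.tl j) < u ∧ u < t) := by
  obtain ⟨pl, pu, -, -, -⟩ := h.drawn.isPoint_of_seg hk hs
  rcases h.slot with ⟨fj, h3, h4⟩ | ⟨fj, h3, h4⟩
  · rw [h.first_left fj] at hs
    constructor
    · rintro ⟨a1, a2, a3⟩
      have hl : l < pv (S.hd j) := a2.trans_le (h2.trans h3.le)
      have hu : pv (S.hd j) ≤ u := by grind
      rcases hu.eq_or_lt with e | e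
      · rw [← e] at hs
        obtain ⟨e1, e2⟩ := h.drawn.last_of_seg_hd hk h.placed_hd hs
        exact h.not_both ⟨fj, h.drawn.last_page j k h.pend hk e1 e2⟩
      · exact h.drawn.pending_hd h.pend hk hs hl e
    · rintro ⟨a1, a2, -⟩
      exact h.drawn.exposed hk h.placed_tl (h.drawn.on_tl j h.made_j) hs a1 a2
  · grind

/-- Only the gap above the tail matters. On the page of `j` the ends of `j` are protected by
`pending_hd`, by exposure and by `first_page`. On the other page the new segment runs parallel to
`j`, which is then a single segment there joining neighbouring points. -/
lemma not_cross_right {k : ℕ} {t l u : α} (hk : made k) (hs : S.Seg pv px k l u (S.g i'))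
    (h1 : px i ≤ t) (h2 : t ≤ px i') :
    ¬ (t < l ∧ l < pv (S.hd j) ∧ pv (S.hd j) < u) ∧ ¬ (l < t ∧ t < u ∧ u < pv (S.hd j)) := by
  obtain ⟨pl, pu, lu, -, -⟩ := h.drawn.isPoint_of_seg hk hs
  rcases h.slot with ⟨fj, h3, h4⟩ | ⟨fj, h3, h4⟩
  · grind
  · have single : S.g i' ≠ S.sd j → S.Seg pv px j (pv (S.tl j)) (pv (S.hd j)) (S.g i') := by
      intro hg
      have e1 : S.g j ≠ S.sd j := fun e => hg (h.last_right e)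
      have e2 : S.f j = S.g i' := by
        cases hp : S.sd j <;> cases ha : S.f j <;> cases hb : S.g i' <;> simp_all
      have e3 : S.g j = S.g i' := by
        cases hp : S.sd j <;> cases ha : S.g j <;> cases hb : S.g i' <;> simp_all
      exact .inl ⟨e2.trans e3.symm, rfl, rfl, e2.symm⟩
    have ta : pv (S.tl j) < t := h3.trans_le h1
    constructor
    · rintro ⟨a1, a2, a3⟩
      by_cases hg : S.g i' = S.sd j
      · rw [hg] at hs
        exact h.drawn.pending_hd h.pend hk hs a2 a3
      · exact h.drawn.planar j k _ _ _ _ _ h.made_j hk (single hg) hs ⟨ta.trans a1, a2, a3⟩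
    · rintro ⟨a1, a2, a3⟩
      have hl : l ≤ pv (S.tl j) := by grind
      rcases hl.eq_or_lt with e | e
      · rw [e] at hs
        obtain ⟨e1, e2⟩ := h.drawn.first_of_seg_tl hk h.placed_tl hs
        by_cases hg : S.g i' = S.sd j
        · exact fj (h.drawn.first_page j k h.pend hk e1 (e2.trans hg))
        · refine absurd a3 (h.drawn.adjacent j u h.pend fj (fun e => hg (h.last_right e)) pu
            (ta.trans a2)).not_gt
      · by_cases hg : S.g i' = S.sd j
        · rw [hg] at hs
          exact h.drawn.exposed hk h.placed_tl (h.drawn.on_tl j h.made_j) hs e (ta.trans a2)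
        · exact h.drawn.planar k j _ _ _ _ _ hk h.made_j hs (single hg) ⟨e, ta.trans a2, a3⟩

lemma on_mid {q : Bool} (hq : S.On q (S.hd i)) : q = S.sd j := by
  by_contra hne
  refine h.not_on ?_
  rwa [show (!S.sd j) = q by cases q <;> cases hs : S.sd j <;> simp_all]

/-- No old point separates the new vertex from the nearby end of `j`, so an old arc passing the new
vertex also passes that end on the same page, or has that end as an end of its own. In the latter
case the outermost position of `j` gives the page. -/
lemma passing_old {k : ℕ} {q : Bool} (hk : made k) (hq : S.On q (S.hd i))
    (h1 : pv (S.tl k) < pv (S.hd i)) (h2 : pv (S.hd i) < pv (S.hd k)) :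
    S.page px k (pv (S.hd i)) = !q := by
  have hd := h.drawn
  obtain rfl := h.on_mid hq
  have b1 := h.left_lt
  have b2 := h.lt_right
  have ptt : S.IsPoint made placed pv px (pv (S.tl k)) := .inl ⟨_, hd.tl_placed k hk, rfl⟩
  have pth : S.IsPoint made placed pv px (pv (S.hd k)) := .inl ⟨_, hd.hd_placed k hk, rfl⟩
  have neg : ∀ {b : Bool}, b ≠ S.sd j → b = !S.sd j := by
    intro b hb; cases b <;> cases hs : S.sd j <;> simp_all
  rcases h.slot with ⟨fj, h3, h4⟩ | ⟨fj, h3, h4⟩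
  · have hc : pv (S.hd j) ≤ pv (S.hd k) := by
      by_contra hc
      exact absurd (h4 _ pth (not_le.1 hc)) (b1.trans h2).not_gt
    have htc : pv (S.tl k) < pv (S.hd j) := h1.trans (b2.trans h3)
    rcases hc.eq_or_lt with e | e
    · have e1 := hd.pv_inj _ _ h.placed_hd (hd.hd_placed k hk) e
      have : S.page px k (pv (S.hd i)) = S.g k := by
        unfold page
        by_cases hx : S.f k = S.g k
        · simp [hx]
        · have h5 := hd.lt_hd k hk hx
          rw [← e] at h5
          rw [if_pos ⟨hx, (h4 _ (.inr ⟨k, hk, hx, rfl⟩) h5).trans b1⟩]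
      rw [this]
      exact neg fun e' => h.not_both ⟨fj, hd.last_page j k h.pend hk e1.symm e'⟩
    · have ho : S.On (S.sd j) (S.hd j) := by
        by_contra ho
        exact absurd (hd.top j _ h.pend (hd.ladder j h.made_j ho) (hd.hd_placed k hk)) e.not_ge
      rw [← hd.passing k _ _ hk h.placed_hd ho htc e]
      unfold page
      by_cases hx : S.f k = S.g k
      · simp [hx]
      · have : px k < pv (S.hd i) ↔ px k < pv (S.hd j) :=
          ⟨fun h => h.trans (b2.trans h3), fun h' => (h4 _ (.inr ⟨k, hk, hx, rfl⟩) h').trans b1⟩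
        simp [this]
  · have hc : pv (S.tl k) ≤ pv (S.tl j) := by
      by_contra hc
      exact absurd (h4 _ ptt (not_le.1 hc)) (h1.trans b2).not_gt
    rcases hc.eq_or_lt with e | e
    · have e1 := hd.pv_inj _ _ (hd.tl_placed k hk) h.placed_tl e
      have : S.page px k (pv (S.hd i)) = S.f k := by
        unfold page
        by_cases hx : S.f k = S.g k
        · simp [hx]
        · rw [if_neg]
          rintro ⟨-, h5⟩
          have := hd.tl_lt k hk hx
          rw [e] at this
          exact absurd (h4 _ (.inr ⟨k, hk, hx, rfl⟩) this) (h5.trans b2).not_gt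
      rw [this]
      exact neg fun e' => fj (hd.first_page j k h.pend hk e1 e')
    · have hak : pv (S.tl j) < pv (S.hd k) := (h3.trans b1).trans h2
      rw [← hd.passing k _ _ hk h.placed_tl (hd.on_tl j h.made_j) e hak]
      unfold page
      by_cases hx : S.f k = S.g k
      · simp [hx]
      · have : px k < pv (S.hd i) ↔ px k < pv (S.tl j) := by
          refine ⟨fun h5 => ?_, fun h5 => h5.trans (h3.trans b1)⟩
          by_contra hc
          rcases (not_lt.1 hc).eq_or_lt with e' | e'
          · exact hd.px_ne k _ hk hx h.placed_tl e'.symm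
          · exact absurd (h4 _ (.inr ⟨k, hk, hx, rfl⟩) e') (h5.trans b2).not_gt
        simp [this]

set_option maxHeartbeats 1000000 in
theorem drawn_succ : S.Drawn (fun k => made k ∨ k = i ∨ k = i')
    (fun k => (pending k ∧ k ≠ j) ∨ k = i ∨ k = i') (fun v => placed v ∨ v = S.hd i) pv px := by
  have hd := h.drawn
  have mj := h.made_j
  have b1 := h.left_lt
  have b2 := h.lt_right
  obtain ⟨b0, b3⟩ := h.bounds
  have ptv : ∀ {v}, placed v → S.IsPoint made placed pv px (pv v) := fun hv => .inl ⟨_, hv, rfl⟩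
  have ptx : ∀ {k}, made k → S.f k ≠ S.g k → S.IsPoint made placed pv px (px k) :=
    fun hk hx => .inr ⟨_, hk, hx, rfl⟩
  have pvne : ∀ {v}, placed v → pv v ≠ pv (S.hd i) := fun hv e =>
    h.point_not_mem (ptv hv) (e ▸ b1.le) (e ▸ b2.le)
  have vne : ∀ {v}, placed v → v ≠ S.hd i := fun hv e => h.fresh (e ▸ hv)
  have ftl : ∀ k, made k → S.tl k ≠ S.hd i := fun k hk => vne (hd.tl_placed k hk)
  have fhd : ∀ k, made k → S.hd k ≠ S.hd i := fun k hk => vne (hd.hd_placed k hk)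
  have neg' : ∀ {b : Bool}, b ≠ S.sd j → S.sd j = !b := by grind
  have t1 := hd.tl_placed
  have t2 := hd.hd_placed
  have t3 := hd.pend_made
  have e1 := h.tl_left
  have e2 := h.tl_right
  have e3 := h.hd_right
  have e4 := h.sd_left
  have e5 := h.sd_right
  have e6 := h.placed_tl
  have e7 := h.placed_hd
  have e8 := h.on
  have e9 := h.pend
  have e10 := h.first_left
  have e11 := h.last_right
  have e12 := h.lad_left
  have e13 := h.lad_right
  have e14 := h.lad_of_not_on
  have e15 := hd.upward j mj
  have e16 := hd.on_tl j mj
  have old_ne : ∀ {t}, S.IsPoint made placed pv px t → t ≠ px i ∧ t ≠ px i' := fun ht =>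
    ⟨fun e => h.point_not_mem ht e.ge (e ▸ (b1.trans b2).le),
      fun e => h.point_not_mem ht (e ▸ (b1.trans b2).le) e.le⟩
  have xne : ∀ {k}, made k → S.f k ≠ S.g k → px k ≠ pv (S.hd i) := fun hk hx e =>
    h.point_not_mem (ptx hk hx) (e ▸ b1.le) (e ▸ b2.le)
  constructor
  case pend_made => grind
  case tl_placed => grind
  case hd_placed => grind
  case on_tl => have := hd.on_tl; grind
  case sd_eq => have := hd.sd_eq; grind
  case arc_inj => have := hd.arc_inj; grind
  case upward => have := hd.upward; grind
  case tl_lt => have := hd.tl_lt; grind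
  case lt_hd => have := hd.lt_hd; grind
  case pv_inj => have := hd.pv_inj; grind
  case px_ne => have := hd.px_ne; have := hd.lt_hd; grind
  case px_inj => have := hd.px_inj; grind
  case passing =>
    rintro k z q (hk | rfl | rfl) (hz | rfl) hq h1 h2
    · exact hd.passing k z q hk hz hq h1 h2
    · exact h.passing_old hk hq h1 h2
    · rw [h.tl_left] at h1
      rcases h.slot with ⟨fj, h3, h4⟩ | ⟨fj, h3, h4⟩
      · have hzc : pv z < pv (S.hd j) := h2.trans (b2.trans b3)
        have hzx := h4 _ (ptv hz) hzc
        unfold page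
        rw [if_neg (by simp [hzx.le]), h.first_left fj]
        exact neg' fun e => hd.between j z h.pend hz h1 hzc (e ▸ hq)
      · grind
    · exact absurd h2 (lt_irrefl _)
    · rw [h.tl_right] at h1
      rw [h.hd_right] at h2
      rcases h.slot with ⟨fj, h3, h4⟩ | ⟨fj, h3, h4⟩
      · grind
      · have haz := h3.trans (b1.trans h1)
        have hzx := h4 _ (ptv hz) haz
        have hg : S.g j = S.sd j := by
          by_contra hg
          exact absurd h2 (hd.adjacent j _ h.pend fj hg (ptv hz) haz).not_gt
        have : S.page px k (pv z) = S.g k := by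
          unfold page
          by_cases hx : S.f k = S.g k <;> grind
        rw [this, h.last_right hg]
        exact neg' fun e => hd.between j z h.pend hz haz h2 (e ▸ hq)
    · grind
  case between =>
    rintro k z (⟨hk, hkj⟩ | rfl | rfl) (hz | rfl) h1 h2 hq
    · exact hd.between k z hk hz h1 h2 hq
    · have es := h.on_mid hq
      have mk := hd.pend_made k hk
      rcases h.slot with ⟨fj, h3, h4⟩ | ⟨fj, h3, h4⟩
      · have hc : pv (S.hd j) ≤ pv (S.hd k) := by
          by_contra hc
          exact absurd (h4 _ (ptv (hd.hd_placed k mk)) (not_le.1 hc)) (b1.trans h2).not_gt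
        have htc : pv (S.tl k) < pv (S.hd j) := h1.trans (b2.trans h3)
        rcases hc.eq_or_lt with e | e
        · exact hkj (hd.head_unique hk h.pend
            (hd.pv_inj _ _ h.placed_hd (hd.hd_placed k mk) e).symm es)
        · have ho := hd.between k _ hk h.placed_hd htc e
          rw [es] at ho
          exact absurd (hd.top j _ h.pend (hd.ladder j mj ho) (hd.hd_placed k mk)) e.not_ge
      · have hc : pv (S.tl k) ≤ pv (S.tl j) := by
          by_contra hc
          exact absurd (h4 _ (ptv (hd.tl_placed k mk)) (not_le.1 hc)) (h1.trans b2).not_gt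
        rcases hc.eq_or_lt with e | e
        · exact hkj (hd.tail_unique hk h.pend
            (hd.pv_inj _ _ (hd.tl_placed k mk) h.placed_tl e))
        · refine hd.between k _ hk h.placed_tl e ((b0.trans b1).trans h2) ?_
          rw [es]; exact hd.on_tl j mj
    · rw [h.tl_left] at h1
      rw [h.sd_left] at hq
      exact hd.between j z h.pend hz h1 (h2.trans (b2.trans b3)) hq
    · exact absurd h2 (lt_irrefl _)
    · rw [h.tl_right] at h1
      rw [h.hd_right] at h2
      rw [h.sd_right] at hq
      exact hd.between j z h.pend hz (b0.trans (b1.trans h1)) h2 hq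
    · grind
  case top => have := hd.top; grind
  case ladder => have := hd.ladder; grind
  case ladder_unique => have := hd.ladder_unique; grind
  case first_page =>
    rintro k k' (⟨hk, hkj⟩ | rfl | rfl) (hk' | rfl | rfl) e e'
    · exact hd.first_page k k' hk hk' e e'
    · exact absurd (hd.tail_unique hk h.pend (e.symm.trans h.tl_left)) hkj
    · grind
    · rw [h.sd_left] at e' ⊢
      exact h.first_left (hd.first_page j k' h.pend hk' (e.trans h.tl_left) e')
    · exact e'
    · grind
    · grind
    · grind
    · exact e'
  case last_page =>
    rintro k k' (⟨hk, hkj⟩ | rfl | rfl) (hk' | rfl | rfl) e e'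
    · exact hd.last_page k k' hk hk' e e'
    · grind
    · have e1 : S.hd j = S.hd k := h.hd_right.symm.trans e
      by_cases es : S.sd k = S.sd j
      · exact absurd (hd.head_unique hk h.pend e1.symm es) hkj
      -- The other pending arc enters the common head from the opposite side. There `j` already uses
      -- the page of that arc: if `j` entered on its own page, so would `i'`, contrary to the choice
      -- of the page.
      · refine hd.last_page k j hk mj e1 ?_
        by_contra hg
        exact es (e' ▸ h.last_right (by
          revert hg es; cases S.g j <;> cases S.sd k <;> cases S.sd j <;> decide))
    · exact absurd e (fhd k' hk')
    · exact e'
    · grind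
    · rw [h.sd_right] at e' ⊢
      exact h.last_right (hd.last_page j k' h.pend hk' (e.trans h.hd_right) e')
    · grind
    · exact e'
  case adjacent =>
    have new : ∀ t, S.IsPoint (fun k => made k ∨ k = i ∨ k = i')
        (fun v => placed v ∨ v = S.hd i) pv px t → S.IsPoint made placed pv px t ∨
          t = pv (S.hd i) ∨ (t = px i ∧ S.f i ≠ S.g i) ∨ (t = px i' ∧ S.f i' ≠ S.g i') := by
      rintro t (⟨v, hv | rfl, rfl⟩ | ⟨k, hk | rfl | rfl, hx, rfl⟩) <;> grind
    have eqb : ∀ {b c d : Bool}, b ≠ d → c ≠ d → b = c := by decide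
    rintro k t (⟨hk, hkj⟩ | rfl | rfl) hf hg ht h1
    · have mk := hd.pend_made k hk
      -- An arc that joins neighbouring points cannot span the gap. It would have to share the head
      -- of `j` (below it) or the tail of `j` (above it), and this contradicts the uniqueness of
      -- pending arcs or the choice of pages.
      have inner : px i ≤ t → t ≤ px i' → pv (S.hd k) ≤ t := by
        intro c1 c2
        by_contra hlt
        have hlt := not_le.1 hlt
        rcases h.slot with ⟨fj, h3, h4⟩ | ⟨fj, h3, h4⟩
        · have hc : pv (S.hd j) ≤ pv (S.hd k) := by
            by_contra hc
            exact absurd (h4 _ (ptv (hd.hd_placed k mk)) (not_le.1 hc)) (c1.trans_lt hlt).not_gt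
          have := hd.adjacent k _ hk hf hg h.pt_hd (h1.trans (c2.trans_lt h3))
          have e1 := hd.pv_inj _ _ h.placed_hd (hd.hd_placed k mk) (le_antisymm hc this)
          by_cases es : S.sd k = S.sd j
          · exact hkj (hd.head_unique hk h.pend e1.symm es)
          · refine hg (hd.last_page k j hk mj e1 ?_)
            exact eqb (fun e => h.not_both ⟨fj, e⟩) es
        · have hc : pv (S.tl k) ≤ pv (S.tl j) := by
            by_contra hc
            exact absurd (h4 _ (ptv (hd.tl_placed k mk)) (not_le.1 hc)) (h1.trans_le c2).not_gt
          rcases hc.eq_or_lt with e | e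
          · exact hkj (hd.tail_unique hk h.pend
              (hd.pv_inj _ _ (hd.tl_placed k mk) h.placed_tl e))
          · have := hd.adjacent k _ hk hf hg h.pt_tl e
            exact absurd hlt (this.trans ((b0.trans_le c1)).le).not_gt
      rcases new t ht with ht | rfl | ⟨rfl, -⟩ | ⟨rfl, -⟩
      · exact hd.adjacent k t hk hf hg ht h1
      · exact inner b1.le b2.le
      · exact inner le_rfl (b1.trans b2).le
      · exact inner (b1.trans b2).le le_rfl
    · rw [h.sd_left] at hf hg
      rw [h.tl_left] at h1
      rcases new t ht with ht | rfl | ⟨rfl, hx⟩ | ⟨rfl, -⟩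
      · rcases h.slot with ⟨fj, -, -⟩ | ⟨fj, h3, h4⟩ <;> grind
      · exact le_rfl
      · exact absurd (eqb hf hg) hx
      · exact b2.le
    · rw [h.sd_right] at hf hg
      rw [h.tl_right] at h1
      rw [h.hd_right]
      rcases new t ht with ht | rfl | ⟨rfl, -⟩ | ⟨rfl, hx⟩
      · rcases h.slot with ⟨fj, h3, h4⟩ | ⟨fj, h3, h4⟩
        · grind
        · exact hd.adjacent j t h.pend fj (fun e => hg (h.last_right e)) ht
            (b0.trans (b1.trans h1))
      · exact absurd h1 (lt_irrefl _)
      · exact absurd h1 b1.not_gt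
      · exact absurd (eqb hf hg) hx
  case planar =>
    have inside : ∀ {k l u l' u' c}, made k → S.Seg pv px k l' u' c → px i ≤ l → u ≤ px i' →
        ¬ (l < l' ∧ l' < u ∧ u < u') ∧ ¬ (l' < l ∧ l < u' ∧ u' < u) := by
      intro k l u l' u' c hk hs a1 a2
      obtain ⟨pl, pu, -, -, -⟩ := hd.isPoint_of_seg hk hs
      constructor
      · rintro ⟨a3, a4, -⟩
        exact h.point_not_mem pl (a1.trans a3.le) (a4.le.trans a2)
      · rintro ⟨-, a3, a4⟩
        exact h.point_not_mem pu (a1.trans a3.le) (a4.le.trans a2)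
    have left : ∀ {k l u l' u' c}, made k → S.Seg pv px i l u c → S.Seg pv px k l' u' c →
        ¬ (l < l' ∧ l' < u ∧ u < u') ∧ ¬ (l' < l ∧ l < u' ∧ u' < u) := by
      intro k l u l' u' c hk hs hs'
      rcases h.seg_left hs with ⟨rfl, a1, a2, rfl⟩ | ⟨a1, -, a2⟩
      · exact h.not_cross_left hk hs' a1 (a2.trans b2.le)
      · exact inside hk hs' a1 (a2.trans b2.le)
    have right : ∀ {k l u l' u' c}, made k → S.Seg pv px i' l u c → S.Seg pv px k l' u' c →
        ¬ (l < l' ∧ l' < u ∧ u < u') ∧ ¬ (l' < l ∧ l < u' ∧ u' < u) := by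
      intro k l u l' u' c hk hs hs'
      rcases h.seg_right hs with ⟨rfl, a1, a2, rfl⟩ | ⟨a1, -, a2⟩
      · exact h.not_cross_right hk hs' (b1.le.trans a1) a2
      · exact inside hk hs' (b1.le.trans a1) a2
    rintro k k' l u l' u' c (hk | rfl | rfl) (hk' | rfl | rfl) hs hs'
    · exact hd.planar k k' l u l' u' c hk hk' hs hs'
    · exact (left hk hs' hs).2
    · exact (right hk hs' hs).2
    · exact (left hk' hs hs').1
    · exact seg_self hs hs'
    · rintro ⟨a1, a2, a3⟩
      have c1 : u ≤ pv (S.hd k) := by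
        rcases h.seg_left hs with ⟨-, -, c, -⟩ | ⟨-, -, c⟩ <;> exact c
      have c2 : pv (S.hd k) ≤ l' := by
        rcases h.seg_right hs' with ⟨-, c, -, -⟩ | ⟨c, -, -⟩ <;> exact c
      exact absurd a2 (c1.trans c2).not_gt
    · exact (right hk' hs hs').1
    · rintro ⟨a1, a2, a3⟩
      have c1 : u' ≤ pv (S.hd k') := by
        rcases h.seg_left hs' with ⟨-, -, c, -⟩ | ⟨-, -, c⟩ <;> exact c
      have c2 : pv (S.hd k') ≤ l := by
        rcases h.seg_right hs with ⟨-, c, -, -⟩ | ⟨c, -, -⟩ <;> exact c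
      exact absurd (a1.trans (a2.trans a3)) (c1.trans c2).not_gt
    · exact seg_self hs hs'

/-- On a common page the arcs at a vertex are nested according to their far ends. If `j` is on its
own page at its tail, its crossing lies below the gap; if it is on its own page at its head, its
crossing lies above the gap. The other cases compare with the gap in the opposite way. -/
theorem cornerOrder : S.CornerOrder pv px (S.sd j) i i' j := by
  have hd := h.drawn
  have mj := h.made_j
  have b1 := h.left_lt
  have b2 := h.lt_right
  obtain ⟨b0, b3⟩ := h.bounds
  have eqb : ∀ {b c d : Bool}, b ≠ d → c ≠ d → b = c := by decide
  have up1 : px i ≤ S.up pv px i := by unfold up; split_ifs <;> [exact le_rfl; exact b1.le]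
  have up2 : S.up pv px i ≤ pv (S.hd i) := by unfold up; split_ifs <;> [exact b1.le; exact le_rfl]
  have lo1 : S.lo pv px i' ≤ px i' := by
    unfold lo; rw [h.tl_right]; split_ifs <;> [exact le_rfl; exact b2.le]
  have lo2 : pv (S.hd i) ≤ S.lo pv px i' := by
    unfold lo; rw [h.tl_right]; split_ifs <;> [exact b2.le; exact le_rfl]
  refine ⟨h.first_left, fun _ fj => ?_, fun _ fj => ?_, h.last_right, fun _ gj => ?_,
    fun _ gj => ?_⟩
  · have hx : S.f j ≠ S.g j := fun e => h.not_both ⟨fj, e.symm.trans fj⟩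
    rcases h.slot with ⟨-, h3, h4⟩ | ⟨fj', -, -⟩
    · refine lt_of_lt_of_le ?_ up1
      unfold up
      rw [if_pos hx]
      exact h4 _ (.inr ⟨j, mj, hx, rfl⟩) (hd.lt_hd j mj hx)
    · exact absurd fj fj'
  · rcases h.slot with ⟨fj', -, -⟩ | ⟨-, h3, h4⟩
    · exact absurd fj' fj
    · refine up2.trans_lt (b2.trans ?_)
      unfold up
      split_ifs with hx
      · exact h4 _ (.inr ⟨j, mj, hx, rfl⟩) (hd.tl_lt j mj hx)
      · exact b3
  · have fj : S.f j ≠ S.sd j := fun e => h.not_both ⟨e, gj⟩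
    have hx : S.f j ≠ S.g j := fun e => fj (e.trans gj)
    rcases h.slot with ⟨fj', -, -⟩ | ⟨-, h3, h4⟩
    · exact absurd fj' fj
    · refine lo1.trans_lt ?_
      unfold lo
      rw [if_pos hx]
      exact h4 _ (.inr ⟨j, mj, hx, rfl⟩) (hd.tl_lt j mj hx)
  · refine lt_of_lt_of_le ?_ lo2
    unfold lo
    split_ifs with hx
    · rcases h.slot with ⟨fj, h3, h4⟩ | ⟨fj, h3, h4⟩
      · exact (h4 _ (.inr ⟨j, mj, hx, rfl⟩) (hd.lt_hd j mj hx)).trans b1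
      · exact absurd (eqb fj gj) hx
    · exact b0.trans b1

end MidStep

/-! ### A triangle whose third vertex lies above its base. -/

/-- The arcs `i` and `i'` form a triangle with the pending arc `j` below them; their common head is
placed on top of the drawing. -/
structure TopStep (S : ArcSystem V) (made pending : ℕ → Prop) (placed : V → Prop) (pv : V → α)
    (px : ℕ → α) (j i i' : ℕ) : Prop where
  drawn : S.Drawn made pending placed pv px
  pend : pending j
  lad : S.Lad j
  not_on : ¬ S.On (S.sd j) (S.hd j)
  on : S.On (!S.sd j) (S.hd j)
  tl_left : S.tl i = S.tl j
  tl_right : S.tl i' = S.hd j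
  hd_right : S.hd i' = S.hd i
  sd_left : S.sd i = S.sd j
  sd_right : S.sd i' = !S.sd j
  fresh : ¬ placed (S.hd i)
  lad_of_not_on : ¬ S.On (S.sd j) (S.hd i) → S.Lad i
  lad_of_not_on' : ¬ S.On (!S.sd j) (S.hd i) → S.Lad i'
  lad_unique : ¬ (S.Lad i ∧ S.Lad i')
  first_left : S.f j = S.sd j → S.f i = S.sd j
  last_right : S.g i ≠ S.sd j → S.g i' ≠ S.sd j
  some_page : S.f i = S.sd j ∨ S.g i = S.sd j
  lt_right : pv (S.hd j) < px i'
  right_lt : px i' < pv (S.hd i)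
  above : S.f i = S.sd j → px i' < px i ∧ px i < pv (S.hd i)
  below : S.f i ≠ S.sd j → pv (S.tl j) < px i ∧
    ∀ t, S.IsPoint made placed pv px t → pv (S.tl j) < t → px i < t

namespace TopStep

variable {j i i' : ℕ} (h : S.TopStep made pending placed pv px j i i')
include h

lemma made_j : made j := h.drawn.pend_made j h.pend

lemma placed_tl : placed (S.tl j) := h.drawn.tl_placed j h.made_j

lemma placed_hd : placed (S.hd j) := h.drawn.hd_placed j h.made_j

/-- Since `j` is the pending ladder arc, its head is above all placed vertices, and crossings are
below the heads of their arcs. -/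
lemma point_le {t : α} (ht : S.IsPoint made placed pv px t) : t ≤ pv (S.hd j) := by
  rcases ht with ⟨v, hv, rfl⟩ | ⟨k, hk, hx, rfl⟩
  · exact h.drawn.top j v h.pend h.lad hv
  · exact (h.drawn.lt_hd k hk hx).le.trans
      (h.drawn.top j _ h.pend h.lad (h.drawn.hd_placed k hk))

lemma not_tl {k : ℕ} (hk : made k) : S.tl k ≠ S.hd j := fun e =>
  absurd (h.drawn.upward k hk)
    (e ▸ h.drawn.top j _ h.pend h.lad (h.drawn.hd_placed k hk)).not_gt

lemma tl_ne_hd : S.tl j ≠ S.hd j := h.not_tl h.made_j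

/-- Between the ends of the arc `j` and at its head, the arc `i` is on the side of `j`. -/
lemma page_left {z : V} (hz : placed z) (h1 : pv (S.tl j) < pv z) :
    S.page px i (pv z) = S.sd j := by
  have hz' := h.point_le (.inl ⟨z, hz, rfl⟩)
  unfold page
  by_cases hf : S.f i = S.sd j
  · rw [if_neg, hf]
    rintro ⟨-, h2⟩
    exact absurd (h.lt_right.trans (h.above hf).1) (h2.trans_le hz').not_gt
  · have hg := h.some_page.resolve_left hf
    rw [if_pos ⟨fun e => hf (e.trans hg), (h.below hf).2 _ (.inl ⟨z, hz, rfl⟩) h1⟩, hg]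

lemma not_on_of_lt {z : V} (hz : placed z) (h1 : pv (S.tl j) < pv z) : ¬ S.On (S.sd j) z := by
  rcases (h.point_le (.inl ⟨z, hz, rfl⟩)).eq_or_lt with e | e
  · rw [h.drawn.pv_inj _ _ hz h.placed_hd e]; exact h.not_on
  · exact h.drawn.between j z h.pend hz h1 e

lemma px_bounds : pv (S.tl j) < px i ∧ px i < pv (S.hd i) := by
  have b1 := h.lt_right
  have b2 := h.right_lt
  have b0 := h.drawn.upward j h.made_j
  by_cases hf : S.f i = S.sd j
  · exact ⟨b0.trans (b1.trans (h.above hf).1), (h.above hf).2⟩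
  · exact ⟨(h.below hf).1, ((h.below hf).2 _ (.inl ⟨_, h.placed_hd, rfl⟩) b0).trans (b1.trans b2)⟩

-- Everything old ends at or below the head of `j`, and `i'` starts there. So only `i` can interfere
-- with old arcs. It passes the vertices above its tail on the page of `j`, and none of those
-- vertices is on that side.
set_option maxHeartbeats 1000000 in
theorem drawn_succ : S.Drawn (fun k => made k ∨ k = i ∨ k = i')
    (fun k => (pending k ∧ k ≠ j) ∨ k = i ∨ k = i') (fun v => placed v ∨ v = S.hd i) pv px := by
  have hd := h.drawn
  have mj := h.made_j
  have b0 := hd.upward j mj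
  have b1 := h.lt_right
  have b2 := h.right_lt
  have b12 := b1.trans b2
  obtain ⟨b3, b4⟩ := h.px_bounds
  have ptv : ∀ {v}, placed v → S.IsPoint made placed pv px (pv v) := fun hv => .inl ⟨_, hv, rfl⟩
  have ptx : ∀ {k}, made k → S.f k ≠ S.g k → S.IsPoint made placed pv px (px k) :=
    fun hk hx => .inr ⟨_, hk, hx, rfl⟩
  have le : ∀ {v}, placed v → pv v ≤ pv (S.hd j) := fun hv => h.point_le (ptv hv)
  have lt : ∀ {v}, placed v → pv v < pv (S.hd i) := fun hv => (le hv).trans_lt b12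
  have vne : ∀ {v}, placed v → v ≠ S.hd i := fun hv e => h.fresh (e ▸ hv)
  have ftl : ∀ k, made k → S.tl k ≠ S.hd i := fun k hk => vne (hd.tl_placed k hk)
  have fhd : ∀ k, made k → S.hd k ≠ S.hd i := fun k hk => vne (hd.hd_placed k hk)
  have old_ne : ∀ {t}, S.IsPoint made placed pv px t → t ≠ px i := by
    rintro t ht rfl
    by_cases hf : S.f i = S.sd j
    · exact absurd (h.point_le ht) (b1.trans (h.above hf).1).not_ge
    · exact absurd ((h.below hf).2 _ ht (h.below hf).1) (lt_irrefl _)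
  have old_ne' : ∀ {t}, S.IsPoint made placed pv px t → t ≠ px i' := by
    rintro t ht rfl
    exact absurd (h.point_le ht) b1.not_ge
  have xne : px i ≠ px i' := by
    intro e
    by_cases hf : S.f i = S.sd j
    · exact absurd e (h.above hf).1.ne'
    · have := (h.below hf).2 _ (ptv h.placed_hd) b0
      rw [e] at this
      exact absurd this b1.not_gt
  have neg' : ∀ {b : Bool}, b ≠ S.sd j → S.sd j = !b := by grind
  have eqb : ∀ {b c d : Bool}, b ≠ d → c ≠ d → b = c := by decide
  have t1 := hd.tl_placed
  have t2 := hd.hd_placed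
  have t3 := hd.pend_made
  have e1 := h.tl_left
  have e2 := h.tl_right
  have e3 := h.hd_right
  have e4 := h.sd_left
  have e5 := h.sd_right
  have e6 := h.placed_tl
  have e7 := h.placed_hd
  have e8 := h.on
  have e9 := h.pend
  have e10 := h.first_left
  have e11 := h.last_right
  have e12 := h.lad
  have e13 := h.lad_unique
  have e14 := h.lad_of_not_on
  have e15 := h.lad_of_not_on'
  have e16 := hd.on_tl j mj
  have ntl := @h.not_tl
  constructor
  case pend_made => grind
  case tl_placed => grind
  case hd_placed => grind
  case on_tl => have := hd.on_tl; grind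
  case sd_eq => have := hd.sd_eq; grind
  case arc_inj => have := hd.arc_inj; grind
  case upward => have := hd.upward; grind
  case tl_lt => have := hd.tl_lt; grind
  case lt_hd => have := hd.lt_hd; grind
  case pv_inj => have := hd.pv_inj; grind
  case px_ne => have := hd.px_ne; have := hd.lt_hd; grind
  case px_inj => have := hd.px_inj; grind
  case passing =>
    rintro k z q (hk | rfl | rfl) (hz | rfl) hq h1 h2
    · exact hd.passing k z q hk hz hq h1 h2
    · grind
    · rw [h.tl_left] at h1
      rw [h.page_left hz h1]
      exact neg' fun e => h.not_on_of_lt hz h1 (e ▸ hq)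
    · exact absurd h2 (lt_irrefl _)
    · grind
    · grind
  case between =>
    rintro k z (⟨hk, -⟩ | rfl | rfl) (hz | rfl) h1 h2
    · exact hd.between k z hk hz h1 h2
    · grind
    · rw [h.tl_left] at h1
      rw [h.sd_left]
      exact h.not_on_of_lt hz h1
    · exact absurd h2 (lt_irrefl _)
    · grind
    · grind
  case top =>
    rintro k z (⟨hk, hkj⟩ | rfl | rfl) hl (hz | rfl)
    · exact absurd (hd.ladder_unique k j hk h.pend hl h.lad) hkj
    · exact absurd (hd.ladder_unique k j hk h.pend hl h.lad) hkj
    · exact (lt hz).le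
    · exact le_rfl
    · rw [h.hd_right]; exact (lt hz).le
    · rw [h.hd_right]
  case ladder => have := hd.ladder; grind
  case ladder_unique => have := hd.ladder_unique; grind
  case first_page =>
    rintro k k' (⟨hk, hkj⟩ | rfl | rfl) (hk' | rfl | rfl) e e'
    · exact hd.first_page k k' hk hk' e e'
    · exact absurd (hd.tail_unique hk h.pend (e.symm.trans h.tl_left)) hkj
    · grind
    · rw [h.sd_left] at e' ⊢
      exact h.first_left (hd.first_page j k' h.pend hk' (e.trans h.tl_left) e')
    · exact e'
    · grind
    · grind
    · grind
    · exact e'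
  case last_page => have := hd.last_page; grind
  case adjacent =>
    rintro k t (⟨hk, hkj⟩ | rfl | rfl) hf hg ht h1
    · have mk := hd.pend_made k hk
      rcases ht with ⟨v, hv | rfl, rfl⟩ | ⟨k', hk' | rfl | rfl, hx, rfl⟩
      · exact hd.adjacent k _ hk hf hg (ptv hv) h1
      · exact (lt (hd.hd_placed k mk)).le
      · exact hd.adjacent k _ hk hf hg (ptx hk' hx) h1
      · by_cases hfi : S.f k' = S.sd j
        · exact (le (hd.hd_placed k mk)).trans (b1.trans (h.above hfi).1).le
        · have hc : pv (S.tl k) ≤ pv (S.tl j) := by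
            by_contra hc
            exact absurd ((h.below hfi).2 _ (ptv (hd.tl_placed k mk)) (not_le.1 hc)) h1.not_gt
          rcases hc.eq_or_lt with e | e
          · exact absurd (hd.tail_unique hk h.pend
              (hd.pv_inj _ _ (hd.tl_placed k mk) h.placed_tl e)) hkj
          · exact (hd.adjacent k _ hk hf hg (ptv h.placed_tl) e).trans (h.below hfi).1.le
      · grind
    · rw [h.sd_left] at hf hg
      exact absurd h.some_page (by simp [hf, hg])
    · rw [h.sd_right] at hf hg
      rw [h.tl_right] at h1
      rw [h.hd_right]
      rcases ht with ⟨v, hv | rfl, rfl⟩ | ⟨k', hk' | rfl | rfl, hx, rfl⟩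
      · exact absurd (le hv) h1.not_ge
      · exact le_rfl
      · exact absurd (h.point_le (ptx hk' hx)) h1.not_ge
      · by_cases hfi : S.f k' = S.sd j
        · grind
        · exact absurd ((h.below hfi).2 _ (ptv h.placed_hd) b0) h1.not_gt
      · exact absurd (eqb hf hg) hx
  case planar =>
    have seg : ∀ {l u c}, S.Seg pv px i l u c →
        (l = pv (S.tl j) ∧ pv (S.hd j) < u ∧ c = S.sd j) ∨
        (l = px i ∧ u = pv (S.hd i) ∧ px i' < l ∧ c ≠ S.sd j ∧ S.g i' ≠ S.sd j) ∨
        (l = pv (S.tl j) ∧ u = px i ∧ S.f i ≠ S.sd j) ∨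
        (l = px i ∧ u = pv (S.hd i) ∧ c = S.sd j ∧ S.f i ≠ S.sd j) := by
      rintro l u c (⟨e, rfl, rfl, rfl⟩ | ⟨e, rfl, rfl, rfl⟩ | ⟨e, rfl, rfl, rfl⟩)
      · refine .inl ⟨by rw [h.tl_left], b12, ?_⟩
        exact h.some_page.elim id e.trans
      · by_cases hf : S.f i = S.sd j
        · exact .inl ⟨by rw [h.tl_left], b1.trans (h.above hf).1, hf⟩
        · grind
      · by_cases hf : S.f i = S.sd j
        · have hg : S.g i ≠ S.sd j := fun e' => e (hf.trans e'.symm)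
          exact .inr (.inl ⟨rfl, rfl, (h.above hf).1, hg, h.last_right hg⟩)
        · grind
    have segR : ∀ {l u c}, S.Seg pv px i' l u c → pv (S.hd j) ≤ l ∧ u ≤ pv (S.hd i) ∧ l < u ∧
        (u = pv (S.hd i) ∧ c = S.g i' ∨ u = px i') := by
      rintro l u c (⟨e, rfl, rfl, rfl⟩ | ⟨e, rfl, rfl, rfl⟩ | ⟨e, rfl, rfl, rfl⟩) <;>
        simp only [h.tl_right, h.hd_right]
      · grind
      · exact ⟨le_rfl, b2.le, b1, .inr trivial⟩
      · grind
    have left : ∀ {k l u l' u' c}, made k → S.Seg pv px i l u c → S.Seg pv px k l' u' c →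
        ¬ (l < l' ∧ l' < u ∧ u < u') ∧ ¬ (l' < l ∧ l < u' ∧ u' < u) := by
      intro k l u l' u' c hk hs hs'
      obtain ⟨pl, pu, -, -, -⟩ := hd.isPoint_of_seg hk hs'
      have ul := h.point_le pu
      have ona := hd.on_tl j mj
      rcases seg hs with ⟨rfl, c1, rfl⟩ | ⟨rfl, rfl, c1, c2⟩ | ⟨rfl, rfl, c1⟩ | ⟨rfl, rfl, rfl, c1⟩
      · refine ⟨fun a => ?_, fun a => hd.exposed hk h.placed_tl ona hs' a.1 a.2.1⟩
        exact absurd ul (c1.trans a.2.2).not_ge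
      · grind
      · have := (h.below c1).2
        exact ⟨fun a => absurd (this _ pl a.1) a.2.1.not_gt,
          fun a => absurd (this _ pu a.2.1) a.2.2.not_gt⟩
      · refine ⟨fun a => absurd ul (b12.trans a.2.2).not_ge, fun a => ?_⟩
        have hc : l' ≤ pv (S.tl j) := by
          by_contra hc
          exact absurd ((h.below c1).2 _ pl (not_le.1 hc)) a.1.not_gt
        have hau := (h.below c1).1.trans a.2.1
        rcases hc.eq_or_lt with e | e
        · rw [e] at hs'
          obtain ⟨e1, e2⟩ := hd.first_of_seg_tl hk h.placed_tl hs'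
          exact c1 (h.first_left (hd.first_page j k h.pend hk e1 e2))
        · exact hd.exposed hk h.placed_tl ona hs' e hau
    have right : ∀ {k l u l' u' c}, made k → S.Seg pv px i' l u c → S.Seg pv px k l' u' c →
        ¬ (l < l' ∧ l' < u ∧ u < u') ∧ ¬ (l' < l ∧ l < u' ∧ u' < u) := by
      intro k l u l' u' c hk hs hs'
      obtain ⟨pl, pu, -, -, -⟩ := hd.isPoint_of_seg hk hs'
      obtain ⟨c1, -⟩ := segR hs
      exact ⟨fun a => absurd (h.point_le pl) (c1.trans_lt a.1).not_ge,
        fun a => absurd (h.point_le pu) (c1.trans_lt a.2.1).not_ge⟩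
    have both : ∀ {l u l' u' c}, S.Seg pv px i l u c → S.Seg pv px i' l' u' c →
        ¬ (l < l' ∧ l' < u ∧ u < u') ∧ ¬ (l' < l ∧ l < u' ∧ u' < u) := by
      intro l u l' u' c hs hs'
      obtain ⟨c1, c2, c3, c4⟩ := segR hs'
      rcases seg hs with ⟨rfl, d1, d2⟩ | ⟨rfl, rfl, d1, d2, d3⟩ | ⟨rfl, rfl, d1⟩ |
        ⟨rfl, rfl, rfl, d1⟩
      · refine ⟨fun a => ?_, fun a => absurd c1 (a.1.trans b0).not_ge⟩
        rcases hs with ⟨e, -, e2, e3⟩ | ⟨e, -, e2, e3⟩ | ⟨e, e2, -, -⟩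
        · exact absurd c2 (e2 ▸ a.2.2).not_ge
        · have hf : S.f i = S.sd j := e3.symm.trans d2
          rcases c4 with ⟨-, c4⟩ | c4
          · grind
          · have := (h.above hf).1
            rw [e2, c4] at a
            exact absurd this a.2.2.not_gt
        · exact absurd e2 b3.ne
      · refine ⟨fun a => absurd c2 a.2.2.not_ge, fun a => ?_⟩
        rcases c4 with ⟨c4, -⟩ | c4
        · exact absurd a.2.2 (c4 ▸ lt_irrefl _)
        · exact absurd (c4 ▸ a.2.1) d1.not_gt
      · have := (h.below d1).2 _ (ptv h.placed_hd) b0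
        exact ⟨fun a => absurd (this.trans_le c1) a.2.1.not_gt,
          fun a => absurd c1 (a.1.trans b0).not_ge⟩
      · have := (h.below d1).2 _ (ptv h.placed_hd) b0
        exact ⟨fun a => absurd c2 a.2.2.not_ge,
          fun a => absurd c1 (a.1.trans this).not_ge⟩
    rintro k k' l u l' u' c (hk | rfl | rfl) (hk' | rfl | rfl) hs hs'
    · exact hd.planar k k' l u l' u' c hk hk' hs hs'
    · exact (left hk hs' hs).2
    · exact (right hk hs' hs).2
    · exact (left hk' hs hs').1
    · exact seg_self hs hs'
    · exact (both hs hs').1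
    · exact (right hk' hs hs').1
    · exact (both hs' hs).2
    · exact seg_self hs hs'

theorem cornerOrder : S.CornerOrder pv px (!S.sd j) j i' i := by
  have hd := h.drawn
  have mj := h.made_j
  have b0 := hd.upward j mj
  have b1 := h.lt_right
  have b2 := h.right_lt
  -- The middle vertex of the triangle is now the head of `j`, on the side opposite to `j`, and the
  -- longest arc is `i`; hence the conditions refer to the other page.
  have n1 : ∀ {b : Bool}, b ≠ S.sd j ↔ b = !S.sd j := by
    intro b; cases b <;> cases S.sd j <;> decide
  have n2 : ∀ {b : Bool}, b ≠ (!S.sd j) ↔ b = S.sd j := by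
    intro b; cases b <;> cases S.sd j <;> decide
  have upj : S.IsPoint made placed pv px (S.up pv px j) := by
    unfold up
    split_ifs with hx
    · exact .inr ⟨j, mj, hx, rfl⟩
    · exact .inl ⟨_, h.placed_hd, rfl⟩
  have upj' : pv (S.tl j) < S.up pv px j := by
    unfold up
    split_ifs with hx
    · exact hd.tl_lt j mj hx
    · exact b0
  have lo1 : pv (S.hd j) ≤ S.lo pv px i' := by
    unfold lo; rw [h.tl_right]; split_ifs <;> [exact b1.le; exact le_rfl]
  have lo2 : S.lo pv px i' ≤ px i' := by
    unfold lo; rw [h.tl_right]; split_ifs <;> [exact le_rfl; exact b1.le]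
  refine ⟨fun e => ?_, fun _ e => ?_, fun _ e => ?_, fun e => ?_, fun _ e => ?_, fun _ e => ?_⟩
  · rw [← n1] at e ⊢
    exact fun e' => e (h.first_left e')
  · rw [← n1] at e
    have hx : S.f i ≠ S.g i := fun e' => e (e'.trans (h.some_page.resolve_left e))
    rw [show S.up pv px i = px i by unfold up; rw [if_pos hx]]
    exact (h.below e).2 _ upj upj'
  · rw [n2] at e
    refine (h.point_le upj).trans_lt (b1.trans ?_)
    unfold up
    split_ifs
    · exact (h.above e).1
    · exact b2
  · rw [← n1] at e ⊢
    exact h.last_right e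
  · rw [← n1] at e
    have hf := h.some_page.resolve_right e
    refine lo2.trans_lt ?_
    unfold lo
    rw [if_pos fun e' => e (e'.symm.trans hf)]
    exact (h.above hf).1
  · rw [n2] at e
    refine lt_of_lt_of_le ?_ lo1
    unfold lo
    split_ifs with hx
    · exact (h.below fun e' => hx (e'.trans e.symm)).2 _ (.inl ⟨_, h.placed_hd, rfl⟩) b0
    · rw [h.tl_left]; exact b0

end TopStep

/-- A drawing is continued with an uncrossed arc at its highest vertex. -/
theorem Drawn.extend_top (hd : S.Drawn made pending placed pv px) {i : ℕ}
    (htl : placed (S.tl i)) (hmax : ∀ z, placed z → pv z ≤ pv (S.tl i))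
    (hlad : ∀ k, pending k → ¬ S.Lad k) (hfresh : ¬ placed (S.hd i)) (hfg : S.f i = S.g i)
    (hon : S.On (S.sd i) (S.tl i)) (hlad' : ¬ S.On (S.sd i) (S.hd i) → S.Lad i)
    (hlt : pv (S.tl i) < pv (S.hd i)) :
    S.Drawn (fun k => made k ∨ k = i) (fun k => pending k ∨ k = i)
      (fun v => placed v ∨ v = S.hd i) pv px := by
  have lt : ∀ {v}, placed v → pv v < pv (S.hd i) := fun hv => (hmax _ hv).trans_lt hlt
  have vne : ∀ {v}, placed v → v ≠ S.hd i := fun hv e => hfresh (e ▸ hv)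
  have ftl : ∀ k, made k → S.tl k ≠ S.tl i := fun k hk e =>
    absurd (hd.upward k hk) (e ▸ hmax _ (hd.hd_placed k hk)).not_gt
  have fhd : ∀ k, made k → S.hd k ≠ S.hd i := fun k hk => vne (hd.hd_placed k hk)
  have ptx : ∀ {t}, S.IsPoint made placed pv px t → t ≤ pv (S.tl i) := by
    rintro t (⟨v, hv, rfl⟩ | ⟨k, hk, hx, rfl⟩)
    · exact hmax v hv
    · exact (hd.lt_hd k hk hx).le.trans (hmax _ (hd.hd_placed k hk))
  have t1 := hd.tl_placed
  have t2 := hd.hd_placed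
  have t3 := hd.pend_made
  constructor
  case pend_made => exact fun k => Or.imp_left (hd.pend_made k)
  case tl_placed => grind
  case hd_placed => grind
  case on_tl => have := hd.on_tl; grind
  case sd_eq => have := hd.sd_eq; grind
  case arc_inj => have := hd.arc_inj; grind
  case upward => have := hd.upward; grind
  case tl_lt => have := hd.tl_lt; grind
  case lt_hd => have := hd.lt_hd; grind
  case pv_inj => have := hd.pv_inj; grind
  case px_ne => have := hd.px_ne; have := hd.lt_hd; grind
  case px_inj => have := hd.px_inj; grind
  case passing =>
    rintro k z q (hk | rfl) (hz | rfl) hq h1 h2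
    · exact hd.passing k z q hk hz hq h1 h2
    · grind
    · exact absurd h1 (hmax _ hz).not_gt
    · exact absurd h2 (lt_irrefl _)
  case between =>
    rintro k z (hk | rfl) (hz | rfl) h1 h2
    · exact hd.between k z hk hz h1 h2
    · grind
    · exact absurd h1 (hmax _ hz).not_gt
    · exact absurd h2 (lt_irrefl _)
  case top => have := hd.top; grind
  case ladder => have := hd.ladder; grind
  case ladder_unique => have := hd.ladder_unique; grind
  case first_page => have := hd.first_page; grind
  case last_page => have := hd.last_page; grind
  case adjacent =>
    rintro k t (hk | rfl) hf hg (⟨v, hv | rfl, rfl⟩ | ⟨k', hk' | rfl, hx, rfl⟩) h1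
    · exact hd.adjacent k _ hk hf hg (.inl ⟨v, hv, rfl⟩) h1
    · grind
    · exact hd.adjacent k _ hk hf hg (.inr ⟨k', hk', hx, rfl⟩) h1
    · exact absurd hfg hx
    · exact absurd (hmax _ hv) h1.not_ge
    · exact le_rfl
    · exact absurd (ptx (.inr ⟨k', hk', hx, rfl⟩)) h1.not_ge
    · exact absurd hfg hx
  case planar =>
    have seg : ∀ {l u c}, S.Seg pv px i l u c → l = pv (S.tl i) ∧ u = pv (S.hd i) := by
      rintro l u c (⟨e, rfl, rfl, rfl⟩ | ⟨e, -⟩ | ⟨e, -⟩) <;> grind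
    rintro k k' l u l' u' c (hk | rfl) (hk' | rfl) hs hs' ⟨a1, a2, a3⟩
    · exact hd.planar k k' l u l' u' c hk hk' hs hs' ⟨a1, a2, a3⟩
    · obtain ⟨rfl, rfl⟩ := seg hs'
      exact absurd (ptx (hd.isPoint_of_seg hk hs).2.1) a2.not_ge
    · obtain ⟨rfl, rfl⟩ := seg hs
      exact absurd (ptx (hd.isPoint_of_seg hk' hs').1) a1.not_ge
    · grind

/-- The drawing that consists of a single vertex. -/
theorem Drawn.single (s : V) :
    S.Drawn (fun _ => False) (fun _ => False) (fun v => v = s) pv px := by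
  constructor <;> first | (intros; contradiction) | skip
  case pv_inj => rintro v w rfl rfl -; rfl

end ArcSystem

/-! ### Optimal pages by dynamic programming -/

/-- The children of the nodes `0, …, m - 1` of a tree in breadth-first order: nodes of kind `1` or
`2` have two children, and nodes with `extra` have one further child. -/
structure BlockForest (m : ℕ) (first kind : ℕ → ℕ) (extra : ℕ → Prop) : Prop where
  first_zero : first 0 = 1
  lt_first : ∀ k < m, k < first k
  triangle : ∀ k < m, kind k ≠ 0 → first k + 1 < first (k + 1)
  leaf : ∀ k < m, kind k = 0 → ¬ extra k → first (k + 1) = first k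
  leaf_extra : ∀ k < m, kind k = 0 → extra k → first (k + 1) = first k + 1
  two : ∀ k < m, kind k ≠ 0 → ¬ extra k → first (k + 1) = first k + 2
  three : ∀ k < m, kind k ≠ 0 → extra k → first (k + 1) = first k + 3
  first_last : first m = m

/-- The minimal numbers of crossings below each node, for every state of the node. -/
structure PageTable where
  c11 : ℕ → ℕ
  c10 : ℕ → ℕ
  c01 : ℕ → ℕ
  c00 : ℕ → ℕ

namespace PageTable

def val (T : PageTable) (k : ℕ) (F G : Bool) : ℕ :=
  bif F then (bif G then T.c11 k else T.c10 k) else (bif G then T.c01 k else T.c00 k)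

/-- `T` satisfies the recursion; the value `top` marks impossible states. -/
structure IsSolution (T : PageTable) (m top : ℕ) (first kind : ℕ → ℕ) (extra : ℕ → Prop)
    (x : ℕ → ℕ) : Prop where
  no_extra : ∀ k < m, ¬ extra k → x k = 0
  extra : ∀ k < m, extra k → x k = T.c00 (first (k + 1) - 1)
  leaf : ∀ k < m, kind k = 0 →
    T.c11 k = x k ∧ T.c10 k = 1 + x k ∧ T.c01 k = 1 + x k ∧ T.c00 k = x k
  -- A child on which the state of the base imposes nothing contributes `c00`, its least value by
  -- `BlockForest.c00_le`.
  one : ∀ k < m, kind k = 1 →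
    T.c11 k = top ∧
    T.c10 k = 1 + min (T.c11 (first k)) (T.c10 (first k)) + T.c00 (first k + 1) + x k ∧
    T.c01 k = 1 + T.c00 (first k) + min (T.c11 (first k + 1)) (T.c01 (first k + 1)) + x k ∧
    T.c00 k = T.c00 (first k) + T.c00 (first k + 1) + x k
  -- `K` is the cheapest pair of children whose first member leaves the common tail on its own page.
  -- The alternative, in which it does not, is available only if the base does not leave there on
  -- its own page either. The page on which the base enters its head affects only the crossing of
  -- the base itself.
  two : ∀ k < m, kind k = 2 → ∃ K,
    K = min (T.c11 (first k) + T.c00 (first k + 1))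
      (T.c10 (first k) + min (T.c11 (first k + 1)) (T.c01 (first k + 1))) ∧
    T.c11 k = K + x k ∧ T.c10 k = 1 + K + x k ∧
    T.c00 k = min K (T.c01 (first k) + T.c00 (first k + 1)) + x k ∧
    T.c01 k = 1 + min K (T.c01 (first k) + T.c00 (first k + 1)) + x k

end PageTable

/-- The condition on the states of a triangle whose third vertex is between the ends of the base:
base `j`, lower child `i`, upper child `i'`. -/
def MidStates (F G : ℕ → Bool) (j i i' : ℕ) : Prop :=
  (F j = true → F i = true) ∧ (G j = true → G i' = true) ∧ ¬ (F j = true ∧ G j = true)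

/-- The condition on the states of a triangle whose third vertex is above the base. -/
def TopStates (F G : ℕ → Bool) (j i i' : ℕ) : Prop :=
  (F j = true → F i = true) ∧ (G i = false → G i' = true) ∧ (F i = true ∨ G i = true)

structure IsPaging (m : ℕ) (first kind : ℕ → ℕ) (F G : ℕ → Bool) : Prop where
  one : ∀ k < m, kind k = 1 → MidStates F G k (first k) (first k + 1)
  two : ∀ k < m, kind k = 2 → TopStates F G k (first k) (first k + 1)

open Classical in
/-- The value at the further child. -/
noncomputable def extraTerm (first : ℕ → ℕ) (extra : ℕ → Prop) (y : ℕ → ℕ) (k : ℕ) : ℕ :=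
  if extra k then y (first (k + 1) - 1) else 0

lemma extraTerm_pos {first : ℕ → ℕ} {extra : ℕ → Prop} {y : ℕ → ℕ} {k : ℕ} (h : extra k) :
    extraTerm first extra y k = y (first (k + 1) - 1) := if_pos h

lemma extraTerm_neg {first : ℕ → ℕ} {extra : ℕ → Prop} {y : ℕ → ℕ} {k : ℕ} (h : ¬ extra k) :
    extraTerm first extra y k = 0 := if_neg h

/-- With at most one crossing per arc, a crossing is the same as a change of page between the two
ends. -/
def pagingCost (F G : ℕ → Bool) (k : ℕ) : ℕ := if F k = G k then 0 else 1

namespace BlockForest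

variable {m top : ℕ} {first kind : ℕ → ℕ} {extra : ℕ → Prop} {T : PageTable} {x : ℕ → ℕ}

lemma first_le (h : BlockForest m first kind extra) {k : ℕ} (hk : k < m) :
    first k ≤ first (k + 1) := by
  by_cases h1 : kind k = 0 <;> by_cases h2 : extra k
  · rw [h.leaf_extra k hk h1 h2]; omega
  · rw [h.leaf k hk h1 h2]
  · rw [h.three k hk h1 h2]; omega
  · rw [h.two k hk h1 h2]; omega

lemma first_le_last (h : BlockForest m first kind extra) {k : ℕ} (hk : k ≤ m) : first k ≤ m := by
  induction hk using Nat.decreasingInduction with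
  | self => exact h.first_last.le
  | of_succ k hk ih => exact (h.first_le hk).trans ih

lemma extra_bounds (h : BlockForest m first kind extra) {k : ℕ} (hk : k < m) (he : extra k) :
    k < first (k + 1) - 1 ∧ first (k + 1) - 1 < m ∧ first k < first (k + 1) := by
  have h1 := h.lt_first k hk
  have h2 := h.first_le_last (k := k + 1) hk
  by_cases h3 : kind k = 0
  · have := h.leaf_extra k hk h3 he; omega
  · have := h.three k hk h3 he; omega

lemma triangle_bounds (h : BlockForest m first kind extra) {k : ℕ} (hk : k < m) (h3 : kind k ≠ 0) :
    k < first k ∧ first k + 1 < m :=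
  ⟨h.lt_first k hk, (h.triangle k hk h3).trans_le (h.first_le_last (k := k + 1) hk)⟩

/-- The sum over the children of a node. -/
lemma sum_children (h : BlockForest m first kind extra) (y : ℕ → ℕ) {k : ℕ} (hk : k < m) :
    ∑ j ∈ Finset.Ico (first k) (first (k + 1)), y j =
      (if kind k = 0 then 0 else y (first k) + y (first k + 1)) + extraTerm first extra y k := by
  by_cases h1 : kind k = 0 <;> by_cases h2 : extra k
  · rw [extraTerm_pos h2, h.leaf_extra k hk h1 h2]; simp [h1]
  · rw [extraTerm_neg h2, h.leaf k hk h1 h2]; simp [h1]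
  · rw [extraTerm_pos h2, h.three k hk h1 h2, if_neg h1]
    rw [Finset.sum_Ico_succ_top (by omega), Finset.sum_Ico_succ_top (by omega),
      Finset.sum_Ico_succ_top (by omega)]
    simp
  · rw [extraTerm_neg h2, h.two k hk h1 h2, if_neg h1]
    rw [Finset.sum_Ico_succ_top (by omega), Finset.sum_Ico_succ_top (by omega)]
    simp

/-- A function that is at most one plus its sum over the children is bounded by the size. -/
lemma sum_le (h : BlockForest m first kind extra) {y : ℕ → ℕ}
    (hy : ∀ k < m, y k ≤ 1 + ∑ j ∈ Finset.Ico (first k) (first (k + 1)), y j) {k : ℕ} (hk : k ≤ m) :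
    ∑ j ∈ Finset.Ico k (first k), y j ≤ m - k := by
  induction hk using Nat.decreasingInduction with
  | self => simp [h.first_last]
  | of_succ k hk ih =>
    have h1 := h.lt_first k hk
    have h2 := h.first_le hk
    rw [Finset.sum_eq_sum_Ico_succ_bot h1]
    rw [← Finset.sum_Ico_consecutive _ (Nat.succ_le_of_lt h1) h2] at ih
    have := hy k hk
    simp only [Nat.succ_eq_add_one] at ih
    omega

lemma sum_children_le (h : BlockForest m first kind extra) {y : ℕ → ℕ}
    (hy : ∀ k < m, y k ≤ 1 + ∑ j ∈ Finset.Ico (first k) (first (k + 1)), y j) {k : ℕ} (hk : k < m) :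
    ∑ j ∈ Finset.Ico (first k) (first (k + 1)), y j ≤ m - (k + 1) := by
  have h1 := h.sum_le hy (k := k + 1) hk
  have h2 := h.lt_first k hk
  rw [← Finset.sum_Ico_consecutive _ (Nat.succ_le_of_lt h2) (h.first_le hk)] at h1
  simp only [Nat.succ_eq_add_one] at h1
  omega

/-- Telescoping over a tree in breadth-first order. -/
lemma sum_all_children (h : BlockForest m first kind extra) (y : ℕ → ℕ) (hm : 0 < m) :
    ∑ k ∈ Finset.range m, y k =
      y 0 + ∑ k ∈ Finset.range m, ∑ j ∈ Finset.Ico (first k) (first (k + 1)), y j := by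
  have key : ∀ l ≤ m, ∑ k ∈ Finset.range l, ∑ j ∈ Finset.Ico (first k) (first (k + 1)), y j =
      ∑ j ∈ Finset.Ico 1 (first l), y j := by
    intro l hl
    induction l with
    | zero => simp [h.first_zero]
    | succ l ih =>
      rw [Finset.sum_range_succ, ih (by omega)]
      have h1 : 1 ≤ first l := by have := h.lt_first l hl; omega
      exact Finset.sum_Ico_consecutive _ h1 (h.first_le hl)
  rw [key m le_rfl, h.first_last, Finset.range_eq_Ico, Finset.sum_eq_sum_Ico_succ_bot hm]

section Table

variable (h : BlockForest m first kind extra) (hT : T.IsSolution m top first kind extra x)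
  (hkind : ∀ k < m, kind k ≤ 2)
include h hT hkind

/-- The largest value of a possible state. -/
lemma exists_bound : ∃ y : ℕ → ℕ,
    (∀ k, T.c10 k ≤ y k ∧ T.c01 k ≤ y k ∧ T.c00 k ≤ y k ∧ (kind k ≠ 1 → T.c11 k ≤ y k)) ∧
    ∀ k < m, y k ≤ 1 + ∑ j ∈ Finset.Ico (first k) (first (k + 1)), y j := by
  let y : ℕ → ℕ := fun k => max (max (T.c10 k) (T.c01 k)) (max (T.c00 k)
    (if kind k = 1 then 0 else T.c11 k))
  have hy : ∀ k, T.c10 k ≤ y k ∧ T.c01 k ≤ y k ∧ T.c00 k ≤ y k ∧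
      (kind k ≠ 1 → T.c11 k ≤ y k) := by grind
  refine ⟨y, hy, fun k hk => ?_⟩
  rw [h.sum_children y hk]
  have hx : x k ≤ extraTerm first extra y k := by
    by_cases he : extra k
    · rw [extraTerm_pos he]; rw [hT.extra k hk he]; exact (hy _).2.2.1
    · rw [extraTerm_neg he]; rw [hT.no_extra k hk he]
  have hi := hy (first k)
  have hi' := hy (first k + 1)
  have hk2 := hkind k hk
  generalize extraTerm first extra y k = X at *
  have : y k = max (max (T.c10 k) (T.c01 k)) (max (T.c00 k)
    (if kind k = 1 then 0 else T.c11 k)) := rfl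
  rw [this]
  interval_cases hkk : kind k
  · obtain ⟨e1, e2, e3, e4⟩ := hT.leaf k hk hkk
    rw [e1, e2, e3, e4]; simp; omega
  · obtain ⟨e1, e2, e3, e4⟩ := hT.one k hk hkk
    rw [e2, e3, e4]; simp; omega
  · obtain ⟨K, e0, e1, e2, e3, e4⟩ := hT.two k hk hkk
    rw [e1, e2, e3, e4]
    have : K ≤ T.c10 (first k) + T.c01 (first k + 1) := by omega
    simp; omega

/-- A possible state costs at most one crossing for each arc below it, and the children occupy
disjoint parts of the enumeration. The bound separates possible values from `top` and also bounds
the words that the machine writes. -/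
lemma val_bounds : ∀ k < m, T.c10 k ≤ m ∧ T.c01 k ≤ m ∧ T.c00 k ≤ m ∧
    (kind k ≠ 1 → T.c11 k ≤ m) ∧ x k ≤ m ∧ (kind k ≠ 0 →
      T.c10 (first k) + T.c01 (first k + 1) + x k ≤ m) := by
  intro k hk
  obtain ⟨y, hy, hsum⟩ := h.exists_bound hT hkind
  have h1 := h.sum_children_le hsum hk
  have h2 := hsum k hk
  have hyk := hy k
  rw [h.sum_children y hk] at h1 h2
  have hx : x k ≤ extraTerm first extra y k := by
    by_cases he : extra k
    · rw [extraTerm_pos he]; rw [hT.extra k hk he]; exact (hy _).2.2.1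
    · rw [extraTerm_neg he]; rw [hT.no_extra k hk he]
  have hi := hy (first k)
  have hi' := hy (first k + 1)
  generalize extraTerm first extra y k = X at *
  refine ⟨by omega, by omega, by omega, fun hne => ?_, by omega, fun hne => ?_⟩ <;> grind

/-- Leaving both ends off the own page needs no crossing and imposes least on the children. This can
be read off for kinds 0 and 2; for kind 1 the constrained child is relaxed by induction, and the
impossible state costs at least `m`. -/
lemma c00_le (htop : m ≤ top) {k : ℕ} (hk : k < m) (F G : Bool) : T.c00 k ≤ T.val k F G := by
  obtain ⟨hb1, hb2, hb3, hb4, hb5, hb6⟩ := h.val_bounds hT hkind k hk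
  have hk2 := hkind k hk
  suffices h : T.c00 k ≤ T.c11 k ∧ T.c00 k ≤ T.c10 k ∧ T.c00 k ≤ T.c01 k by
    cases F <;> cases G <;> simp [PageTable.val, h]
  induction hk' : m - k using Nat.strong_induction_on generalizing k with
  | _ d ih =>
    interval_cases hkk : kind k
    · obtain ⟨e1, e2, e3, e4⟩ := hT.leaf k hk hkk; omega
    · obtain ⟨e1, e2, e3, e4⟩ := hT.one k hk hkk
      obtain ⟨t1, t2⟩ := h.triangle_bounds hk (by omega)
      have a : ∀ l, k < l → l < m →
          T.c00 l ≤ T.c11 l ∧ T.c00 l ≤ T.c10 l ∧ T.c00 l ≤ T.c01 l := by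
        intro l h1 h2
        obtain ⟨b1, b2, b3, b4, b5, b6⟩ := h.val_bounds hT hkind l h2
        exact ih (m - l) (by omega) h2 b1 b2 b3 b4 b5 b6 (hkind l h2) rfl
      have a1 := a (first k) t1 (by omega)
      have a2 := a (first k + 1) (by omega) t2
      omega
    · obtain ⟨K, e0, e1, e2, e3, e4⟩ := hT.two k hk hkk; omega

/-- The value of the table is a lower bound. -/
theorem le_cost (htop : m ≤ top) (hm : 0 < m) {F G : ℕ → Bool} (hp : IsPaging m first kind F G) :
    T.c00 0 ≤ ∑ k ∈ Finset.range m, pagingCost F G k := by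
  -- Locally the value of a node is at most its own crossing plus the values of its children. Summed
  -- over all nodes this telescopes, since every node except the root is a child exactly once.
  have step : ∀ k < m, T.val k (F k) (G k) ≤ pagingCost F G k +
      ∑ j ∈ Finset.Ico (first k) (first (k + 1)), T.val j (F j) (G j) := by
    intro k hk
    have min00 : ∀ j < m, T.c00 j ≤ T.val j (F j) (G j) :=
      fun j hj => h.c00_le hT hkind htop hj _ _
    rw [h.sum_children _ hk]
    have hx : x k ≤ extraTerm first extra (fun j => T.val j (F j) (G j)) k := by
      by_cases he : extra k
      · rw [extraTerm_pos he]; rw [hT.extra k hk he]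
        exact min00 _ (h.extra_bounds hk he).2.1
      · rw [extraTerm_neg he]; rw [hT.no_extra k hk he]
    generalize extraTerm first extra (fun j => T.val j (F j) (G j)) k = X at *
    have hk2 := hkind k hk
    interval_cases hkk : kind k
    · obtain ⟨e1, e2, e3, e4⟩ := hT.leaf k hk hkk
      simp only [if_true]
      unfold PageTable.val pagingCost
      cases F k <;> cases G k <;> simp [e1, e2, e3, e4] <;> omega
    · obtain ⟨e1, e2, e3, e4⟩ := hT.one k hk hkk
      obtain ⟨t1, t2⟩ := h.triangle_bounds hk (by omega)
      have m1 := min00 (first k) (by omega)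
      have m2 := min00 (first k + 1) t2
      obtain ⟨p1, p2, p3⟩ := hp.one k hk hkk
      rw [if_neg (by omega)]
      unfold PageTable.val pagingCost at *
      cases hF : F k <;> cases hG : G k <;> simp only [hF, hG] at p1 p2 p3
      · simp only [cond_false, if_true]; omega
      · grind
      · grind
      · simp at p3
    · obtain ⟨K, e0, e1, e2, e3, e4⟩ := hT.two k hk hkk
      obtain ⟨t1, t2⟩ := h.triangle_bounds hk (by omega)
      have m1 := min00 (first k) (by omega)
      have m2 := min00 (first k + 1) t2
      obtain ⟨p1, p2, p3⟩ := hp.two k hk hkk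
      rw [if_neg (by omega)]
      unfold PageTable.val pagingCost at *
      cases hF : F k <;> cases hG : G k <;> cases hF1 : F (first k) <;>
        cases hG1 : G (first k) <;> cases hF2 : F (first k + 1) <;>
        cases hG2 : G (first k + 1) <;> simp [hF, hF1, hG1, hG2] at p1 p2 p3 <;>
        simp only [hF1, hG1, hF2, hG2, cond_false, cond_true, Bool.false_eq_true, reduceCtorEq,
          if_false, if_true] at * <;> omega
  have h1 := Finset.sum_le_sum fun k hk => step k (Finset.mem_range.1 hk)
  rw [Finset.sum_add_distrib, h.sum_all_children _ hm] at h1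
  have h2 := h.c00_le hT hkind htop hm (F 0) (G 0)
  omega

end Table

end BlockForest

/-! ### Reading an optimal assignment off the table. -/

/-- The states are chosen according to the table. -/
structure PageTable.IsChoice (T : PageTable) (m : ℕ) (first kind : ℕ → ℕ) (extra : ℕ → Prop)
    (F G : ℕ → Bool) : Prop where
  root : F 0 = false ∧ G 0 = false
  extra : ∀ k < m, extra k → F (first (k + 1) - 1) = false ∧ G (first (k + 1) - 1) = false
  one : ∀ k < m, kind k = 1 →
    F (first k) = F k ∧
    G (first k) = (F k && decide (T.c11 (first k) ≤ T.c10 (first k))) ∧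
    F (first k + 1) = (G k && decide (T.c11 (first k + 1) ≤ T.c01 (first k + 1))) ∧
    G (first k + 1) = G k
  two : ∀ k < m, kind k = 2 → ∃ A B : ℕ,
    A = T.c11 (first k) + T.c00 (first k + 1) ∧
    B = T.c10 (first k) + min (T.c11 (first k + 1)) (T.c01 (first k + 1)) ∧
    ((F k = false ∧ T.c01 (first k) + T.c00 (first k + 1) ≤ min A B ∧
      F (first k) = false ∧ G (first k) = true ∧
      F (first k + 1) = false ∧ G (first k + 1) = false) ∨
    (¬ (F k = false ∧ T.c01 (first k) + T.c00 (first k + 1) ≤ min A B) ∧ A ≤ B ∧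
      F (first k) = true ∧ G (first k) = true ∧
      F (first k + 1) = false ∧ G (first k + 1) = false) ∨
    (¬ (F k = false ∧ T.c01 (first k) + T.c00 (first k + 1) ≤ min A B) ∧ ¬ A ≤ B ∧
      F (first k) = true ∧ G (first k) = false ∧
      F (first k + 1) = decide (T.c11 (first k + 1) ≤ T.c01 (first k + 1)) ∧
      G (first k + 1) = true))

namespace BlockForest

variable {m top : ℕ} {first kind : ℕ → ℕ} {extra : ℕ → Prop} {T : PageTable} {x : ℕ → ℕ}

variable (h : BlockForest m first kind extra) (hT : T.IsSolution m top first kind extra x)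
  (hkind : ∀ k < m, kind k ≤ 2) {F G : ℕ → Bool} (hc : T.IsChoice m first kind extra F G)
include h

/-- Every node is the root or the child of another node. -/
lemma exists_parent_index {j : ℕ} (hj : j < m) (h0 : j ≠ 0) :
    ∃ k < m, k < j ∧ ((kind k ≠ 0 ∧ (j = first k ∨ j = first k + 1)) ∨
      (extra k ∧ j = first (k + 1) - 1)) := by
  have key : ∀ l ≤ m, j < first l → ∃ k < l, first k ≤ j ∧ j < first (k + 1) := by
    intro l
    induction l with
    | zero => intro _ hl; rw [h.first_zero] at hl; omega
    | succ l ih =>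
      intro hl hjl
      by_cases h1 : j < first l <;> grind
  obtain ⟨k, hk, h1, h2⟩ := key m le_rfl (h.first_last.symm ▸ hj)
  refine ⟨k, hk, (h.lt_first k hk).trans_le h1, ?_⟩
  by_cases h3 : kind k = 0 <;> by_cases h4 : extra k
  · have := h.leaf_extra k hk h3 h4
    exact .inr ⟨h4, by omega⟩
  · have := h.leaf k hk h3 h4; omega
  · have := h.three k hk h3 h4
    rcases Nat.lt_or_ge j (first k + 2) with h5 | h5 <;> grind
  · have := h.two k hk h3 h4
    exact .inl ⟨h3, by omega⟩

include hT hkind hc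

/-- The impossible states are not chosen. -/
lemma not_both_of_choice (htop : m < top) {k : ℕ} (hk : k < m) (h1 : kind k = 1) :
    ¬ (F k = true ∧ G k = true) := by
  have e := (hT.one k hk h1).1
  have bd := h.val_bounds hT hkind
  have bk := bd k hk
  rintro ⟨hF, hG⟩
  by_cases h0 : k = 0
  · subst h0; rw [hc.root.1] at hF; cases hF
  -- The state of `k` was chosen at its parent. Being on the own page at both ends has the value
  -- `top > m` here, so in each comparison the parent found an alternative of value at most `m` and
  -- preferred it.
  obtain ⟨l, hl, hlk, h2 | ⟨h2, rfl⟩⟩ := h.exists_parent_index hk h0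
  · obtain ⟨h2, h3⟩ := h2
    have bl := (bd l hl).2.2.2.2.2 h2
    have t := h.triangle_bounds hl h2
    have bi := bd (first l) (by omega)
    have bi' := bd (first l + 1) t.2
    have hl2 := hkind l hl
    interval_cases hll : kind l
    · exact h2 rfl
    · obtain ⟨a1, a2, a3, a4⟩ := hc.one l hl hll
      rcases h3 with rfl | rfl
      · grind
      · grind
    · obtain ⟨A, B, rfl, rfl, a | a | a⟩ := hc.two l hl hll
      · obtain ⟨-, -, a1, a2, a3, a4⟩ := a
        rcases h3 with rfl | rfl <;> simp_all
      · obtain ⟨-, a0, a1, a2, a3, a4⟩ := a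
        rcases h3 with rfl | rfl
        · omega
        · simp_all
      · obtain ⟨-, a0, a1, a2, a3, a4⟩ := a
        rcases h3 with rfl | rfl
        · simp_all
        · grind
  · rw [(hc.extra l hl h2).1] at hF; cases hF

theorem isPaging_of_choice (htop : m < top) : IsPaging m first kind F G := by
  constructor
  · intro k hk h1
    obtain ⟨a1, a2, a3, a4⟩ := hc.one k hk h1
    exact ⟨fun e => a1.trans e, fun e => a4.trans e, h.not_both_of_choice hT hkind hc htop hk h1⟩
  · intro k hk h1
    obtain ⟨A, B, rfl, rfl, a | a | a⟩ := hc.two k hk h1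
    · obtain ⟨a0, -, a1, a2, a3, a4⟩ := a
      exact ⟨by simp [a0], by simp [a2], .inr a2⟩
    · obtain ⟨-, -, a1, a2, a3, a4⟩ := a
      exact ⟨by simp [a1], by simp [a2], .inl a1⟩
    · obtain ⟨-, -, a1, a2, a3, a4⟩ := a
      exact ⟨by simp [a1], by simp [a4], .inl a1⟩

/-- The chosen states attain the value of the table. -/
theorem cost_of_choice (htop : m < top) (hm : 0 < m) :
    ∑ k ∈ Finset.range m, pagingCost F G k = T.c00 0 := by
  -- The inequality used for the lower bound is an equality at every node, because the choice
  -- follows the minima of the recursion.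
  have step : ∀ k < m, T.val k (F k) (G k) = pagingCost F G k +
      ∑ j ∈ Finset.Ico (first k) (first (k + 1)), T.val j (F j) (G j) := by
    intro k hk
    rw [h.sum_children _ hk]
    have hx : x k = extraTerm first extra (fun j => T.val j (F j) (G j)) k := by
      by_cases he : extra k
      · obtain ⟨e1, e2⟩ := hc.extra k hk he
        rw [extraTerm_pos he]; rw [hT.extra k hk he, e1, e2]; rfl
      · rw [extraTerm_neg he]; rw [hT.no_extra k hk he]
    rw [← hx]
    clear hx
    have hk2 := hkind k hk
    have bd := h.val_bounds hT hkind
    interval_cases hkk : kind k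
    · obtain ⟨e1, e2, e3, e4⟩ := hT.leaf k hk hkk
      simp only [if_true]
      unfold PageTable.val pagingCost
      cases F k <;> cases G k <;> simp [e1, e2, e3, e4]
    · obtain ⟨e1, e2, e3, e4⟩ := hT.one k hk hkk
      have hn := h.not_both_of_choice hT hkind hc htop hk hkk
      obtain ⟨a1, a2, a3, a4⟩ := hc.one k hk hkk
      rw [if_neg (by omega)]
      unfold PageTable.val pagingCost
      cases hF : F k <;> cases hG : G k <;> simp only [hF, hG, Bool.false_and, Bool.true_and] at * <;>
        rw [a1, a2, a3, a4]
      · simp only [cond_false, if_true]; omega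
      · by_cases hd : T.c11 (first k + 1) ≤ T.c01 (first k + 1) <;>
          simp only [hd, decide_true, decide_false, cond_false, cond_true, reduceCtorEq, if_false] <;>
          omega
      · by_cases hd : T.c11 (first k) ≤ T.c10 (first k) <;>
          simp only [hd, decide_true, decide_false, cond_false, cond_true, reduceCtorEq, if_false] <;>
          omega
      · simp at hn
    · obtain ⟨K, e0, e1, e2, e3, e4⟩ := hT.two k hk hkk
      rw [if_neg (by omega)]
      unfold PageTable.val pagingCost
      obtain ⟨A, B, hA, hB, a | a | a⟩ := hc.two k hk hkk
      · obtain ⟨a0, a00, a1, a2, a3, a4⟩ := a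
        rw [a0, a1, a2, a3, a4]
        cases hG : G k <;> simp only [cond_false, cond_true, reduceCtorEq, if_true, if_false] <;>
          omega
      · obtain ⟨a00, a0, a1, a2, a3, a4⟩ := a
        rw [a1, a2, a3, a4]
        cases hF : F k <;> cases hG : G k <;> simp only [hF, true_and] at a00 <;>
          simp only [cond_false, cond_true, reduceCtorEq, if_true, if_false] <;> omega
      · obtain ⟨a00, a0, a1, a2, a3, a4⟩ := a
        rw [a1, a2, a3, a4]
        by_cases hd : T.c11 (first k + 1) ≤ T.c01 (first k + 1) <;>
        cases hF : F k <;> cases hG : G k <;> simp only [hF, true_and] at a00 <;>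
          simp only [hd, decide_true, decide_false, cond_false, cond_true, reduceCtorEq, if_true,
            if_false] <;> omega
  have h1 := Finset.sum_congr rfl fun k hk => step k (Finset.mem_range.1 hk)
  rw [Finset.sum_add_distrib, h.sum_all_children _ hm] at h1
  have h2 : T.val 0 (F 0) (G 0) = T.c00 0 := by rw [hc.root.1, hc.root.2]; rfl
  omega

end BlockForest

/-! ### Insertion into sorted lists -/

/-- Positions are rational, so new nodes find room without any old node moving, and what is known
about the old drawing persists. In the end only the order of the nodes matters, and ranks replace
the positions. -/
lemma exists_pos_insert (N : List ℕ) : ∀ (pos : ℕ → ℚ) (A : List ℕ) (z : ℕ) (B : List ℕ),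
    (A ++ z :: B).Pairwise (pos · < pos ·) → N.Nodup → (∀ x ∈ N, x ∉ A ++ z :: B) →
    ∃ pos' : ℕ → ℚ, (∀ x ∉ N, pos' x = pos x) ∧
      (A ++ z :: (N ++ B)).Pairwise (pos' · < pos' ·) := by
  induction N with
  | nil => intro pos A z B h _ _; exact ⟨pos, fun _ _ => rfl, h⟩
  | cons y N ih =>
    intro pos A z B h hN hfresh
    have hy := hfresh y (by simp)
    obtain ⟨r, hr1, hr2⟩ : ∃ r : ℚ, pos z < r ∧ ∀ t ∈ B, r < pos t := by
      cases B with
      | nil => exact ⟨pos z + 1, by linarith, by simp⟩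
      | cons c B =>
        have h1 := (List.pairwise_append.1 h).2.1
        have h2 := List.rel_of_pairwise_cons h1 (List.mem_cons_self)
        obtain ⟨r, hr1, hr2⟩ := exists_between h2
        refine ⟨r, hr1, fun t ht => ?_⟩
        rcases List.mem_cons.1 ht with rfl | ht
        · exact hr2
        · exact hr2.trans (List.rel_of_pairwise_cons (List.pairwise_cons.1 h1).2 ht)
    let pos1 : ℕ → ℚ := Function.update pos y r
    have e : ∀ x, x ≠ y → pos1 x = pos x := fun x hx => Function.update_of_ne hx _ _
    have ey : pos1 y = r := Function.update_self _ _ _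
    have eo : ∀ x ∈ A ++ z :: B, pos1 x = pos x := fun x hx => e x (fun h => hy (h ▸ hx))
    have h' : (A ++ z :: B).Pairwise (pos1 · < pos1 ·) := by
      refine h.imp_of_mem fun ha hb hab => ?_
      rw [eo _ ha, eo _ hb]; exact hab
    obtain ⟨p1, p2, p3⟩ := List.pairwise_append.1 h'
    obtain ⟨p4, p5⟩ := List.pairwise_cons.1 p2
    have ez : pos1 z = pos z := eo z (by simp)
    have hs : ((A ++ [z]) ++ y :: B).Pairwise (pos1 · < pos1 ·) := by
      rw [List.pairwise_append]
      refine ⟨?_, ?_, ?_⟩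
      · rw [List.pairwise_append]
        refine ⟨p1, by simp, fun a ha b hb => ?_⟩
        rw [List.mem_singleton] at hb
        exact p3 a ha b (by simp [hb])
      · rw [List.pairwise_cons]
        refine ⟨fun t ht => ?_, p5⟩
        rw [ey, eo t (by simp [ht])]; exact hr2 t ht
      · intro a ha b hb
        have haz : pos1 a ≤ pos z := by
          rcases List.mem_append.1 ha with ha | ha
          · grind
          · grind
        rcases List.mem_cons.1 hb with rfl | hb
        · rw [ey]; exact haz.trans_lt hr1
        · grind
    obtain ⟨pos', q1, q2⟩ := ih pos1 (A ++ [z]) y B hs (List.nodup_cons.1 hN).2 (by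
      intro x hx hx'
      have h1 : x ≠ y := fun e => (List.nodup_cons.1 hN).1 (e ▸ hx)
      refine hfresh x (List.mem_cons_of_mem _ hx) ?_
      simp only [List.mem_append, List.mem_cons, List.not_mem_nil,
        or_false] at hx' ⊢
      tauto)
    refine ⟨pos', fun x hx => ?_, by simpa using q2⟩
    rw [q1 x (fun h => hx (List.mem_cons_of_mem _ h)), e x (fun h => hx (h ▸ List.mem_cons_self))]

lemma pairwise_split {pos : ℕ → ℚ} {A N B : List ℕ} {z : ℕ}
    (h : (A ++ z :: (N ++ B)).Pairwise (pos · < pos ·)) :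
    (∀ t ∈ A ++ [z], ∀ x ∈ N ++ B, pos t < pos x) ∧ (∀ x ∈ N, ∀ t ∈ B, pos x < pos t) ∧
      N.Pairwise (pos · < pos ·) ∧ (∀ t ∈ A, pos t < pos z) := by
  obtain ⟨p1, p2, p3⟩ := List.pairwise_append.1 h
  obtain ⟨p4, p5⟩ := List.pairwise_cons.1 p2
  obtain ⟨p6, p7, p8⟩ := List.pairwise_append.1 p5
  refine ⟨fun t ht x hx => ?_, p8, p6, fun t ht => p3 t ht z (by simp)⟩
  rcases List.mem_append.1 ht with ht | ht <;> grind

namespace EmbeddedDigraph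

variable {n : ℕ} {G : EmbeddedDigraph n}

/-! ### The stages of the incremental drawing -/

/-- The arcs of `G` in the order `q`, with pages given relative to their sides. -/
noncomputable def arcSystem (G : EmbeddedDigraph n) (q : ℕ → Fin n × Fin n) (F E : ℕ → Bool) :
    ArcSystem (Fin n) where
  tl k := G.tail (q k)
  hd k := G.head (q k)
  sd k := G.dir (q k)
  f k := F k == G.dir (q k)
  g k := E k == G.dir (q k)
  On p v := G.OnSide p v
  Lad k := G.OnLadder (q k)

open Classical in
/-- The kind of the triangle at a half-edge. -/
noncomputable def triangleKind (G : EmbeddedDigraph n) (d : Fin n × Fin n) : ℕ :=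
  if G.Ext d then 0 else if G.MidApex d then 1 else 2

lemma triangleKind_eq_zero {d : Fin n × Fin n} : G.triangleKind d = 0 ↔ G.Ext d := by
  unfold triangleKind; split_ifs <;> simp [*]

lemma triangleKind_eq_one {d : Fin n × Fin n} :
    G.triangleKind d = 1 ↔ ¬ G.Ext d ∧ G.MidApex d := by
  unfold triangleKind; split_ifs <;> simp [*]

lemma triangleKind_eq_two {d : Fin n × Fin n} :
    G.triangleKind d = 2 ↔ ¬ G.Ext d ∧ ¬ G.MidApex d := by
  unfold triangleKind; split_ifs <;> simp [*]

lemma triangleKind_le {d : Fin n × Fin n} : G.triangleKind d ≤ 2 := by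
  unfold triangleKind; split_ifs <;> simp

lemma IsArcOrder.blockForest {m : ℕ} {q : ℕ → Fin n × Fin n} {first : ℕ → ℕ}
    (ho : G.IsArcOrder m q first) :
    BlockForest m first (fun k => G.triangleKind (q k)) (fun k => G.EndsBlock (q k)) where
  first_zero := ho.bfs.first_zero
  lt_first := ho.bfs.lt_first
  triangle k hk h := (ho.triangle_kids hk (fun h' => h (triangleKind_eq_zero.2 h'))).2.2
  leaf k hk h h' := by
    rw [ho.first_succ_eq hk, if_pos (triangleKind_eq_zero.1 h), if_neg h']
    rfl
  leaf_extra k hk h h' := by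
    rw [ho.first_succ_eq hk, if_pos (triangleKind_eq_zero.1 h), if_pos h']
  two k hk h h' := by
    rw [ho.first_succ_eq hk, if_neg (fun h' => h (triangleKind_eq_zero.2 h')), if_neg h']
  three k hk h h' := by
    rw [ho.first_succ_eq hk, if_neg (fun h' => h (triangleKind_eq_zero.2 h')), if_pos h']
  first_last := ho.bfs.first_last

/-- The drawing of the first `b` arcs, of which those below `k` have been processed, as a list of
nodes: `v + 1` for a vertex `v`, and `n + 1 + i` for the crossing of the arc `i`. -/
structure Stage (G : EmbeddedDigraph n) (q : ℕ → Fin n × Fin n) (first : ℕ → ℕ) (F E : ℕ → Bool)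
    (b k : ℕ) (vs : List (Fin n)) (l : List ℕ) (pos : ℕ → ℚ) : Prop where
  sorted : l.Pairwise (pos · < pos ·)
  mem : ∀ x, x ∈ l ↔ (∃ v ∈ vs, x = v.val + 1) ∨ ∃ i < b, F i ≠ E i ∧ x = n + 1 + i
  drawn : (G.arcSystem q F E).Drawn (· < b) (fun j => k ≤ j ∧ j < b) (· ∈ vs)
    (fun v => pos (v.val + 1)) (fun i => pos (n + 1 + i))
  corners : ∀ j < k, ¬ G.Ext (q j) →
    (G.MidApex (q j) → (G.arcSystem q F E).CornerOrder (fun v => pos (v.val + 1))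
      (fun i => pos (n + 1 + i)) (G.dir (q j)) (first j) (first j + 1) j) ∧
    (¬ G.MidApex (q j) → (G.arcSystem q F E).CornerOrder (fun v => pos (v.val + 1))
      (fun i => pos (n + 1 + i)) (!G.dir (q j)) j (first j + 1) (first j))

lemma beq_ne_beq {a b c : Bool} : ((a == c) ≠ (b == c)) ↔ a ≠ b := by
  cases a <;> cases b <;> cases c <;> decide

lemma beq_eq_right {a c : Bool} : (a == c) = c ↔ a = true := by
  cases a <;> cases c <;> decide

lemma beq_ne_right {a c : Bool} : (a == c) ≠ c ↔ a = false := by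
  cases a <;> cases c <;> decide

namespace Stage

variable {q : ℕ → Fin n × Fin n} {first : ℕ → ℕ} {F E : ℕ → Bool} {b k m : ℕ}
  {vs : List (Fin n)} {l : List ℕ} {pos : ℕ → ℚ}

lemma isPoint_iff (h : G.Stage q first F E b k vs l pos) {t : ℚ} :
    (G.arcSystem q F E).IsPoint (· < b) (· ∈ vs) (fun v => pos (v.val + 1))
      (fun i => pos (n + 1 + i)) t ↔ ∃ x ∈ l, t = pos x := by
  constructor
  · rintro (⟨v, hv, rfl⟩ | ⟨i, hi, hx, rfl⟩)
    · exact ⟨_, (h.mem _).2 (.inl ⟨v, hv, rfl⟩), rfl⟩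
    · exact ⟨_, (h.mem _).2 (.inr ⟨i, hi, beq_ne_beq.1 hx, rfl⟩), rfl⟩
  · rintro ⟨x, hx, rfl⟩
    rcases (h.mem x).1 hx with ⟨v, hv, rfl⟩ | ⟨i, hi, hne, rfl⟩
    · exact .inl ⟨v, hv, rfl⟩
    · exact .inr ⟨i, hi, beq_ne_beq.2 hne, rfl⟩

lemma vertex_not_mem (h : G.Stage q first F E b k vs l pos) {v : Fin n} (hv : v ∉ vs) :
    v.val + 1 ∉ l := by
  intro hx
  rcases (h.mem _).1 hx with ⟨w, hw, e⟩ | ⟨i, -, -, e⟩ <;> grind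

lemma crossing_not_mem (h : G.Stage q first F E b k vs l pos) {i : ℕ} (hi : b ≤ i) :
    n + 1 + i ∉ l := by
  intro hx
  rcases (h.mem _).1 hx with ⟨w, hw, e⟩ | ⟨j, hj, -, e⟩
  · have := w.isLt; omega
  · omega

/-- The positions of the old nodes are kept when new nodes are positioned. -/
lemma congr (h : G.Stage q first F E b k vs l pos) (hk : k ≤ b) (hf : ∀ j < k, ¬ G.Ext (q j) →
    first j + 1 < b) {pos' : ℕ → ℚ} (he : ∀ v ∈ vs, pos' (v.val + 1) = pos (v.val + 1))
    (he' : ∀ i < b, pos' (n + 1 + i) = pos (n + 1 + i)) :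
    G.Stage q first F E b k vs l pos' := by
  have hl : ∀ x ∈ l, pos' x = pos x := by
    intro x hx
    rcases (h.mem x).1 hx with ⟨v, hv, rfl⟩ | ⟨i, hi, -, rfl⟩ <;> grind
  refine ⟨?_, h.mem, h.drawn.congr (fun v hv => he v hv) (fun j hj => he' j hj), ?_⟩
  · refine h.sorted.imp_of_mem fun ha hb hab => ?_
    rw [hl _ ha, hl _ hb]; exact hab
  · intro j hj hext
    obtain ⟨c1, c2⟩ := h.corners j hj hext
    have hfj := hf j hj hext
    have t : ∀ i < b, pos' ((G.tail (q i)).val + 1) = pos ((G.tail (q i)).val + 1) :=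
      fun i hi => he _ (h.drawn.tl_placed i hi)
    have d : ∀ i < b, pos' ((G.head (q i)).val + 1) = pos ((G.head (q i)).val + 1) :=
      fun i hi => he _ (h.drawn.hd_placed i hi)
    refine ⟨fun hm => (c1 hm).congr ?_ ?_ ?_, fun hm => (c2 hm).congr ?_ ?_ ?_⟩ <;>
      rintro i (rfl | rfl | rfl) <;>
      first
      | exact t _ (by omega)
      | exact d _ (by omega)
      | exact he' _ (by omega)

/-- The head of a pending ladder arc is the last node. -/
lemma last_of_ladder (h : G.Stage q first F E b k vs l pos) (hk : k < b)
    (hl : G.OnLadder (q k)) {A B : List ℕ} (e : l = A ++ ((G.head (q k)).val + 1) :: B) :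
    B = [] := by
  cases B with
  | nil => rfl
  | cons t B =>
    have h1 : pos ((G.head (q k)).val + 1) < pos t := by
      have := (List.pairwise_append.1 (e ▸ h.sorted)).2.1
      exact List.rel_of_pairwise_cons this List.mem_cons_self
    have ht : t ∈ l := by rw [e]; simp
    rcases (h.mem t).1 ht with ⟨v, hv, rfl⟩ | ⟨i, hi, hx, rfl⟩
    · exact absurd (h.drawn.top k v ⟨le_rfl, hk⟩ hl hv) h1.not_ge
    · have h2 := h.drawn.lt_hd i hi (beq_ne_beq.2 hx)
      have h3 := h.drawn.top k _ ⟨le_rfl, hk⟩ hl (h.drawn.hd_placed i hi)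
      exact absurd (h1.trans h2) h3.not_gt

end Stage

/-- The node of the crossing of the arc `i`, if there is one. -/
def crossingNodes (n : ℕ) (F E : ℕ → Bool) (i : ℕ) : List ℕ :=
  if F i ≠ E i then [n + 1 + i] else []

lemma mem_crossingNodes {F E : ℕ → Bool} {i x : ℕ} :
    x ∈ crossingNodes n F E i ↔ F i ≠ E i ∧ x = n + 1 + i := by
  unfold crossingNodes; split_ifs with h <;> simp [h]

lemma crossingNodes_sublist {F E : ℕ → Bool} {i : ℕ} :
    (crossingNodes n F E i).Sublist [n + 1 + i] := by
  unfold crossingNodes; split_ifs <;> simp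

lemma mem_insert_iff {A B N : List ℕ} {z x : ℕ} :
    x ∈ A ++ z :: (N ++ B) ↔ x ∈ A ++ z :: B ∨ x ∈ N := by grind

lemma mem_three {C D : List ℕ} {x y : ℕ} : x ∈ C ++ [y] ++ D ↔ x = y ∨ x ∈ C ∨ x ∈ D := by grind

lemma mem_three' {C D : List ℕ} {x y : ℕ} : x ∈ D ++ C ++ [y] ↔ x = y ∨ x ∈ C ∨ x ∈ D := by grind

namespace Stage

variable {q : ℕ → Fin n × Fin n} {first : ℕ → ℕ} {F E : ℕ → Bool} {b k m : ℕ}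
  {vs : List (Fin n)} {l : List ℕ} {pos : ℕ → ℚ}

lemma lt_first_of_lt (ho : G.IsArcOrder m q first) (hk : k ≤ m) {j : ℕ} (hj : j < k)
    (hext : ¬ G.Ext (q j)) : first j + 1 < first k :=
  (ho.triangle_kids (hj.trans_le hk) hext).2.2.trans_le (ho.bfs.first_le hj hk)

lemma mem_succ (h : G.Stage q first F E b k vs l pos) {l' : List ℕ} {y : Fin n}
    (hmem : ∀ x, x ∈ l' ↔ x ∈ l ∨ x = y.val + 1 ∨ x ∈ crossingNodes n F E b ∨
      x ∈ crossingNodes n F E (b + 1)) (x : ℕ) :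
    x ∈ l' ↔ (∃ v ∈ vs ++ [y], x = v.val + 1) ∨ ∃ i < b + 2, F i ≠ E i ∧ x = n + 1 + i := by
  rw [hmem, h.mem x]
  simp only [List.mem_append, List.mem_cons, List.not_mem_nil, or_false, mem_crossingNodes]
  constructor
  · grind
  · grind

/-- A triangle with its third vertex between the ends of the base. -/
theorem mid (hG : G.IsOuterplanarTriangulatedST) (ho : G.IsArcOrder m q first)
    (h : G.Stage q first F E (first k) k vs l pos) (hk : k < m) (hext : ¬ G.Ext (q k))
    (hmid : G.MidApex (q k)) (hfresh : G.apex (q k) ∉ vs)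
    (hs : MidStates F E k (first k) (first k + 1)) {A B : List ℕ} {z : ℕ} (hl : l = A ++ z :: B)
    (hz : (F k = true ∧ ∃ B', B = ((G.head (q k)).val + 1) :: B') ∨
      (F k = false ∧ z = (G.tail (q k)).val + 1)) :
    ∃ pos', (∀ v ∈ vs, pos' (v.val + 1) = pos (v.val + 1)) ∧
      pos' ((G.apex (q k)).val + 1) < pos ((G.head (q k)).val + 1) ∧
      G.Stage q first F E (first k + 2) (k + 1) (vs ++ [G.apex (q k)])
        (A ++ z :: (crossingNodes n F E (first k) ++ [(G.apex (q k)).val + 1] ++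
          crossingNodes n F E (first k + 1) ++ B)) pos' := by
  obtain ⟨e1, e2, -⟩ := ho.triangle_kids hk hext
  have hkf := ho.bfs.lt_first k hk
  set i := first k with hi
  set y := (G.apex (q k)).val + 1 with hy
  have yn := (G.apex (q k)).isLt
  obtain ⟨-, -, t1, t2, t3, ht⟩ := hG.triangle (ho.entry k hk) hext
  obtain ⟨-, t4, t5, t6, t7⟩ := ht.resolve_right (fun h => h.1 hmid)
  obtain ⟨lad, -⟩ := hG.ladder_kids (ho.entry k hk) hext
  obtain ⟨l1, l2⟩ := lad hmid
  -- Positions are chosen for both crossings, whether or not the arcs cross the spine, because the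
  -- insertion step refers to both. The unused nodes are then dropped from the sorted list.
  obtain ⟨pos', p1, p2⟩ := exists_pos_insert [n + 1 + i, y, n + 1 + (i + 1)] pos A z B
    (hl ▸ h.sorted) (by simp; omega) (by
      rw [← hl]
      simp only [List.mem_cons, List.not_mem_nil, or_false]
      rintro x (rfl | rfl | rfl)
      · exact h.crossing_not_mem le_rfl
      · exact h.vertex_not_mem hfresh
      · exact h.crossing_not_mem (by omega))
  have ve : ∀ v ∈ vs, pos' (v.val + 1) = pos (v.val + 1) := by
    intro v hv
    refine p1 _ ?_
    simp only [List.mem_cons, List.not_mem_nil, or_false, hy]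
    have := v.isLt
    rintro (e | e | e)
    · omega
    · exact hfresh (by rwa [show G.apex (q k) = v from Fin.ext (by omega)])
    · omega
  have ie : ∀ j < i, pos' (n + 1 + j) = pos (n + 1 + j) := by
    intro j hj
    refine p1 _ ?_
    simp only [List.mem_cons, List.not_mem_nil, or_false]
    omega
  have h' := h.congr hkf.le (fun j hj => lt_first_of_lt ho hk.le hj) ve ie
  obtain ⟨s1, s2, s3, s4⟩ := pairwise_split p2
  have step : (G.arcSystem q F E).MidStep (· < i) (fun j => k ≤ j ∧ j < i) (· ∈ vs)
      (fun v => pos' (v.val + 1)) (fun i => pos' (n + 1 + i)) k i (i + 1) := by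
    have hd1 : (G.arcSystem q F E).hd i = G.apex (q k) := (congrArg G.head e1).trans t2
    have points : ∀ t, (G.arcSystem q F E).IsPoint (· < i) (· ∈ vs)
        (fun v => pos' (v.val + 1)) (fun i => pos' (n + 1 + i)) t →
        (∃ x ∈ A ++ [z], t = pos' x) ∨ ∃ x ∈ B, t = pos' x := by
      intro t ht
      obtain ⟨x, hx, rfl⟩ := h'.isPoint_iff.1 ht
      rw [hl] at hx
      simp only [List.mem_append, List.mem_cons, List.not_mem_nil, or_false] at hx ⊢
      rcases hx with hx | rfl | hx <;> grind
    have yx : pos' y < pos' (n + 1 + (i + 1)) :=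
      List.rel_of_pairwise_cons (List.pairwise_cons.1 s3).2 (by simp)
    refine
      { drawn := h'.drawn
        pend := ⟨le_rfl, hkf⟩
        tl_left := (congrArg G.tail e1).trans t1
        tl_right := (congrArg G.tail e2).trans (t5.trans hd1.symm)
        hd_right := (congrArg G.head e2).trans t6
        sd_left := (congrArg G.dir e1).trans t3
        sd_right := (congrArg G.dir e2).trans t7
        fresh := by rw [hd1]; exact hfresh
        on := ?_
        not_on := by rw [hd1]; exact t4
        lad_left := by show ¬ G.OnLadder (q i); rw [e1]; exact l1
        lad_right := by show G.OnLadder (q (i + 1)) → _; rw [e2]; exact l2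
        lad_of_not_on := ?_
        first_left := fun e => beq_eq_right.2 (hs.1 (beq_eq_right.1 e)) |>.trans
          ((congrArg G.dir e1).trans t3)
        last_right := fun e => beq_eq_right.2 (hs.2.1 (beq_eq_right.1 e)) |>.trans
          ((congrArg G.dir e2).trans t7)
        not_both := fun e => hs.2.2 ⟨beq_eq_right.1 e.1, beq_eq_right.1 e.2⟩
        left_lt := ?_
        lt_right := ?_
        slot := ?_ }
    · rw [hd1]
      have := hG.onSide_not_of_not t4
      rwa [Bool.not_not] at this
    · intro ho'
      have ho' : ¬ G.OnSide (G.dir (q k)) (G.head (q k)) := ho'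
      show G.OnLadder (q (i + 1))
      rw [e2]
      refine .inl ?_
      rw [t6, t7, hG.side_eq_of_not_onSide ho']
      cases G.dir (q k) <;> decide
    · grind
    · rw [hd1]; exact yx
    · rcases hz with ⟨hF, B', hB⟩ | ⟨hF, rfl⟩
      · refine .inl ⟨beq_eq_right.2 hF, s2 _ (by simp) _ (by rw [hB]; simp; exact .inl rfl), ?_⟩
        intro t ht hlt
        rcases points t ht with ⟨x, hx, rfl⟩ | ⟨x, hx, rfl⟩
        · exact s1 x hx _ (by simp)
        · have hlt : pos' x < pos' ((G.head (q k)).val + 1) := hlt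
          have p3 := (List.pairwise_append.1 p2).2.1
          rw [List.pairwise_cons, List.pairwise_append] at p3
          have p4 := p3.2.2.1
          rw [hB] at hx p4
          rcases List.mem_cons.1 hx with rfl | hx
          · exact absurd hlt (lt_irrefl _)
          · exact absurd hlt (List.rel_of_pairwise_cons p4 hx).not_gt
      · refine .inr ⟨beq_ne_right.2 hF, s1 _ (by simp; exact .inr rfl) _ (by simp), ?_⟩
        intro t ht hlt
        have hlt : pos' ((G.tail (q k)).val + 1) < t := hlt
        rcases points t ht with ⟨x, hx, rfl⟩ | ⟨x, hx, rfl⟩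
        · rcases List.mem_append.1 hx with hx | hx
          · exact absurd hlt (s4 x hx).not_gt
          · grind
        · exact s2 _ (by simp) x hx
  have hd1 : (G.arcSystem q F E).hd i = G.apex (q k) := (congrArg G.head e1).trans t2
  refine ⟨pos', ve, ?_, ?_, ?_, ?_, ?_⟩
  · have b1 := step.lt_right.trans step.bounds.2
    rw [hd1] at b1
    exact b1.trans_eq (ve _ (h.drawn.hd_placed k hkf))
  · refine p2.sublist ?_
    refine List.Sublist.append (List.Sublist.refl _) (List.Sublist.cons_cons _
      (List.Sublist.append ?_ (List.Sublist.refl _)))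
    exact ((crossingNodes_sublist.append (List.Sublist.refl [y])).append crossingNodes_sublist)
  · refine h.mem_succ fun x => ?_
    rw [mem_insert_iff, ← hl, mem_three]
  · have := step.drawn_succ
    rw [hd1] at this
    convert this using 1
    · funext j; simp only [eq_iff_iff]; omega
    · funext j; simp only [eq_iff_iff]; omega
    · funext v; simp
  · intro j hj hje
    rcases Nat.lt_or_ge j k with h1 | h1
    · exact h'.corners j h1 hje
    · obtain rfl : j = k := by omega
      exact ⟨fun _ => step.cornerOrder, fun hm => absurd hmid hm⟩

/-- A triangle with its third vertex above the base; the first case of the new list. -/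
lemma top_aux (hG : G.IsOuterplanarTriangulatedST) (ho : G.IsArcOrder m q first)
    (h : G.Stage q first F E (first k) k vs l pos) (hk : k < m) (hext : ¬ G.Ext (q k))
    (hmid : ¬ G.MidApex (q k)) (hfresh : G.apex (q k) ∉ vs)
    (hs : TopStates F E k (first k) (first k + 1)) {pos' : ℕ → ℚ} {l' : List ℕ}
    (ve : ∀ v ∈ vs, pos' (v.val + 1) = pos (v.val + 1))
    (ie : ∀ j < first k, pos' (n + 1 + j) = pos (n + 1 + j))
    (hsort : l'.Pairwise (pos' · < pos' ·))
    (hmem : ∀ x, x ∈ l' ↔ x ∈ l ∨ x = (G.apex (q k)).val + 1 ∨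
      x ∈ crossingNodes n F E (first k) ∨ x ∈ crossingNodes n F E (first k + 1))
    (lt_right : pos' ((G.head (q k)).val + 1) < pos' (n + 1 + (first k + 1)))
    (right_lt : pos' (n + 1 + (first k + 1)) < pos' ((G.apex (q k)).val + 1))
    (above : F (first k) = true → pos' (n + 1 + (first k + 1)) < pos' (n + 1 + first k) ∧
      pos' (n + 1 + first k) < pos' ((G.apex (q k)).val + 1))
    (below : F (first k) = false → pos' ((G.tail (q k)).val + 1) < pos' (n + 1 + first k) ∧
      ∀ x ∈ l, pos' ((G.tail (q k)).val + 1) < pos' x → pos' (n + 1 + first k) < pos' x) :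
    G.Stage q first F E (first k + 2) (k + 1) (vs ++ [G.apex (q k)]) l' pos' := by
  obtain ⟨e1, e2, -⟩ := ho.triangle_kids hk hext
  have hkf := ho.bfs.lt_first k hk
  set i := first k with hi
  obtain ⟨-, -, t1, t2, t3, ht⟩ := hG.triangle (ho.entry k hk) hext
  obtain ⟨-, t4, t5, t6, t7⟩ := ht.resolve_left (fun h => hmid h.1)
  obtain ⟨-, lad⟩ := hG.ladder_kids (ho.entry k hk) hext
  obtain ⟨l1, l2⟩ := lad hmid
  have h' := h.congr hkf.le (fun j hj => lt_first_of_lt ho hk.le hj) ve ie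
  have hd1 : (G.arcSystem q F E).hd i = G.apex (q k) := (congrArg G.head e1).trans t2
  have hlad : ∀ {d}, ¬ G.OnSide (G.dir d) (G.head d) → G.OnLadder d := by
    intro d hd
    refine .inl ?_
    rw [hG.side_eq_of_not_onSide hd]
    cases G.dir d <;> decide
  have step : (G.arcSystem q F E).TopStep (· < i) (fun j => k ≤ j ∧ j < i) (· ∈ vs)
      (fun v => pos' (v.val + 1)) (fun i => pos' (n + 1 + i)) k i (i + 1) := by
    refine
      { drawn := h'.drawn
        pend := ⟨le_rfl, hkf⟩
        lad := l1
        not_on := t4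
        on := hG.onSide_not_of_not t4
        tl_left := (congrArg G.tail e1).trans t1
        tl_right := (congrArg G.tail e2).trans t5
        hd_right := (congrArg G.head e2).trans (t6.trans hd1.symm)
        sd_left := (congrArg G.dir e1).trans t3
        sd_right := (congrArg G.dir e2).trans t7
        fresh := by rw [hd1]; exact hfresh
        lad_of_not_on := ?_
        lad_of_not_on' := ?_
        lad_unique := ?_
        first_left := fun e => (beq_eq_right.2 (hs.1 (beq_eq_right.1 e))).trans
          ((congrArg G.dir e1).trans t3)
        last_right := ?_
        some_page := ?_
        lt_right := lt_right
        right_lt := by rw [hd1]; exact right_lt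
        above := ?_
        below := ?_ }
    · rw [hd1]; intro hn
      show G.OnLadder (q i)
      rw [e1]
      refine hlad ?_
      rw [t2, t3]; exact hn
    · rw [hd1]; intro hn
      show G.OnLadder (q (i + 1))
      rw [e2]
      refine hlad ?_
      rw [t6, t7]; exact hn
    · show ¬ (G.OnLadder (q i) ∧ G.OnLadder (q (i + 1)))
      rw [e1, e2]; exact l2
    · intro e
      have e' : (E i == G.dir (q i)) ≠ G.dir (q k) := e
      rw [e1, t3, beq_ne_right] at e'
      show (E (i + 1) == G.dir (q (i + 1))) ≠ G.dir (q k)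
      rw [e2, t7, hs.2.1 e']
      cases G.dir (q k) <;> decide
    · show (F i == G.dir (q i)) = G.dir (q k) ∨ (E i == G.dir (q i)) = G.dir (q k)
      rw [e1, t3, beq_eq_right, beq_eq_right]; exact hs.2.2
    · intro e
      have e' : (F i == G.dir (q i)) = G.dir (q k) := e
      rw [e1, t3, beq_eq_right] at e'
      rw [hd1]; exact above e'
    · intro e
      have e' : (F i == G.dir (q i)) ≠ G.dir (q k) := e
      rw [e1, t3, beq_ne_right] at e'
      obtain ⟨a1, a2⟩ := below e'
      refine ⟨a1, fun t ht hlt => ?_⟩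
      obtain ⟨x, hx, rfl⟩ := h'.isPoint_iff.1 ht
      exact a2 x hx hlt
  refine ⟨hsort, ?_, ?_, ?_⟩
  · exact h.mem_succ hmem
  · have := step.drawn_succ
    rw [hd1] at this
    convert this using 1 <;> grind
  · intro j hj hje
    rcases Nat.lt_or_ge j k with h1 | h1
    · exact h'.corners j h1 hje
    · obtain rfl : j = k := by omega
      exact ⟨fun hm => absurd hm hmid, fun _ => step.cornerOrder⟩

/-- The longest arc leaves on its own page, so it passes all old vertices before a possible
crossing; everything new goes after the last node. -/
theorem top_first (hG : G.IsOuterplanarTriangulatedST) (ho : G.IsArcOrder m q first)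
    (h : G.Stage q first F E (first k) k vs l pos) (hk : k < m) (hext : ¬ G.Ext (q k))
    (hmid : ¬ G.MidApex (q k)) (hfresh : G.apex (q k) ∉ vs)
    (hs : TopStates F E k (first k) (first k + 1)) (hF : F (first k) = true) {A B : List ℕ}
    (hl : l = A ++ ((G.head (q k)).val + 1) :: B) :
    ∃ pos', G.Stage q first F E (first k + 2) (k + 1) (vs ++ [G.apex (q k)])
        (A ++ ((G.head (q k)).val + 1) :: (crossingNodes n F E (first k + 1) ++
          crossingNodes n F E (first k) ++ [(G.apex (q k)).val + 1] ++ B)) pos' := by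
  have hkf := ho.bfs.lt_first k hk
  have hlad := ((hG.ladder_kids (ho.entry k hk) hext).2 hmid).1
  obtain rfl := h.last_of_ladder hkf hlad hl
  obtain ⟨pos', p1, p2⟩ := exists_pos_insert
    [n + 1 + (first k + 1), n + 1 + first k, (G.apex (q k)).val + 1] pos A
    ((G.head (q k)).val + 1) [] (hl ▸ h.sorted)
    (by simp; have := (G.apex (q k)).isLt; omega) (by
      rw [← hl]
      simp only [List.mem_cons, List.not_mem_nil, or_false]
      rintro x (rfl | rfl | rfl)
      · exact h.crossing_not_mem (by omega)
      · exact h.crossing_not_mem le_rfl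
      · exact h.vertex_not_mem hfresh)
  obtain ⟨s1, s2, s3, s4⟩ := pairwise_split p2
  obtain ⟨s5, s6⟩ := List.pairwise_cons.1 s3
  have s7 := (List.pairwise_cons.1 s6).1
  refine ⟨pos', h.top_aux hG ho hk hext hmid hfresh hs ?_ ?_ ?_ ?_ ?_ ?_ ?_ ?_⟩
  · intro v hv
    refine p1 _ ?_
    simp only [List.mem_cons, List.not_mem_nil, or_false]
    have := v.isLt
    rintro (e | e | e)
    · omega
    · omega
    · exact hfresh (by rwa [show G.apex (q k) = v from Fin.ext (by omega)])
  · intro j hj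
    refine p1 _ ?_
    have := (G.apex (q k)).isLt
    simp only [List.mem_cons, List.not_mem_nil, or_false]
    omega
  · refine p2.sublist ?_
    refine List.Sublist.append (List.Sublist.refl _) (List.Sublist.cons_cons _
      (List.Sublist.append ?_ (List.Sublist.refl _)))
    exact ((crossingNodes_sublist.append crossingNodes_sublist).append (List.Sublist.refl _))
  · grind
  · exact s1 _ (by simp) _ (by simp)
  · exact s5 _ (by simp)
  · grind
  · simp [hF]

/-- The longest arc leaves on the other page and must change to its own page before it passes
anything, so its crossing goes directly above its tail. This needs a second insertion at another
place, possibly next to the nodes inserted first. -/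
theorem top_second (hG : G.IsOuterplanarTriangulatedST) (ho : G.IsArcOrder m q first)
    (h : G.Stage q first F E (first k) k vs l pos) (hk : k < m) (hext : ¬ G.Ext (q k))
    (hmid : ¬ G.MidApex (q k)) (hfresh : G.apex (q k) ∉ vs)
    (hs : TopStates F E k (first k) (first k + 1)) (hF : F (first k) = false)
    {A B A' B' : List ℕ} (hl : l = A ++ ((G.head (q k)).val + 1) :: B)
    (hl' : A ++ ((G.head (q k)).val + 1) :: (crossingNodes n F E (first k + 1) ++
          [(G.apex (q k)).val + 1] ++ B) = A' ++ ((G.tail (q k)).val + 1) :: B') :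
    ∃ pos', G.Stage q first F E (first k + 2) (k + 1) (vs ++ [G.apex (q k)])
        (A' ++ ((G.tail (q k)).val + 1) :: ([n + 1 + first k] ++ B')) pos' := by
  have hkf := ho.bfs.lt_first k hk
  have hlad := ((hG.ladder_kids (ho.entry k hk) hext).2 hmid).1
  obtain rfl := h.last_of_ladder hkf hlad hl
  have ylt := (G.apex (q k)).isLt
  obtain ⟨pos1, p1, p2⟩ := exists_pos_insert
    [n + 1 + (first k + 1), (G.apex (q k)).val + 1] pos A
    ((G.head (q k)).val + 1) [] (hl ▸ h.sorted)
    (by simp; omega) (by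
      rw [← hl]
      simp only [List.mem_cons, List.not_mem_nil, or_false]
      rintro x (rfl | rfl)
      · exact h.crossing_not_mem (by omega)
      · exact h.vertex_not_mem hfresh)
  obtain ⟨s1, s2, s3, s4⟩ := pairwise_split p2
  have hsub : (A' ++ ((G.tail (q k)).val + 1) :: B').Pairwise (pos1 · < pos1 ·) := by
    rw [← hl']
    refine p2.sublist ?_
    refine List.Sublist.append (List.Sublist.refl _) (List.Sublist.cons_cons _
      (List.Sublist.append ?_ (List.Sublist.refl _)))
    exact (crossingNodes_sublist.append (List.Sublist.refl _))
  have memb : ∀ x, x ∈ A' ++ ((G.tail (q k)).val + 1) :: B' ↔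
      x ∈ l ∨ x = (G.apex (q k)).val + 1 ∨ x ∈ crossingNodes n F E (first k + 1) := by grind
  obtain ⟨pos', p3, p4⟩ := exists_pos_insert [n + 1 + first k] pos1 A'
    ((G.tail (q k)).val + 1) B' hsub (by simp) (by
      intro x hx
      rw [List.mem_singleton] at hx
      subst hx
      rw [memb]
      rintro (e | e | e)
      · exact h.crossing_not_mem le_rfl e
      · omega
      · rw [mem_crossingNodes] at e; omega)
  obtain ⟨s5, s6, -, s7⟩ := pairwise_split p4
  have ve : ∀ v ∈ vs, pos' (v.val + 1) = pos (v.val + 1) := by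
    intro v hv
    have := v.isLt
    rw [p3 _ (by simp; omega), p1]
    simp only [List.mem_cons, List.not_mem_nil, or_false]
    rintro (e | e)
    · omega
    · exact hfresh (by rwa [show G.apex (q k) = v from Fin.ext (by omega)])
  -- An arc that does not leave on its own page has to enter on it, so here the crossing is certain.
  have hx1 : E (first k) = true := by
    rcases hs.2.2 with e | e <;> grind
  have q1 : pos' (n + 1 + (first k + 1)) = pos1 (n + 1 + (first k + 1)) :=
    p3 _ (by simp)
  have q2 : pos' ((G.apex (q k)).val + 1) = pos1 ((G.apex (q k)).val + 1) :=
    p3 _ (by simp; omega)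
  have q3 : pos' ((G.head (q k)).val + 1) = pos1 ((G.head (q k)).val + 1) :=
    p3 _ (by have := (G.head (q k)).isLt; simp; omega)
  refine ⟨pos', h.top_aux hG ho hk hext hmid hfresh hs ve ?_ p4 ?_ ?_ ?_ ?_ ?_⟩
  · grind
  · intro x
    rw [mem_insert_iff, memb x, List.mem_singleton, mem_crossingNodes (i := first k), hF, hx1]
    simp only [ne_eq, Bool.false_eq_true, not_false_eq_true, true_and]
    rw [or_assoc, or_assoc, or_comm (b := x = n + 1 + first k)]
  · grind
  · grind
  · simp [hF]
  · grind

/-- An external arc has no children. -/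
theorem leaf (h : G.Stage q first F E b k vs l pos) (hext : G.Ext (q k)) :
    G.Stage q first F E b (k + 1) vs l pos where
  sorted := h.sorted
  mem := h.mem
  drawn := h.drawn.weaken fun _ hj => ⟨by omega, hj.2⟩
  corners j hj hje := h.corners j (by
    rcases Nat.lt_or_ge j k with h1 | h1 <;> grind) hje

/-- The first arc of a block is drawn at the highest vertex. -/
theorem block (hG : G.IsOuterplanarTriangulatedST)
    (h : G.Stage q first F E b k vs l pos) (hk : k ≤ b)
    (hf : ∀ j < k, ¬ G.Ext (q j) → first j + 1 < b) (hq : G.IsEntry (q b)) (hF : F b = E b)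
    (htl : G.tail (q b) ∈ vs) (hfresh : G.head (q b) ∉ vs)
    (hmax : ∀ v ∈ vs, pos (v.val + 1) ≤ pos ((G.tail (q b)).val + 1))
    (hlad : ∀ j, k ≤ j → j < b → ¬ G.OnLadder (q j)) {A B : List ℕ}
    (hl : l = A ++ ((G.tail (q b)).val + 1) :: B) :
    ∃ pos', G.Stage q first F E (b + 1) k (vs ++ [G.head (q b)])
      (A ++ ((G.tail (q b)).val + 1) :: ([(G.head (q b)).val + 1] ++ B)) pos' := by
  have hB : B = [] := by
    cases B with
    | nil => rfl
    | cons t B =>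
      have h1 : pos ((G.tail (q b)).val + 1) < pos t := by
        have := (List.pairwise_append.1 (hl ▸ h.sorted)).2.1
        exact List.rel_of_pairwise_cons this List.mem_cons_self
      have ht : t ∈ l := by rw [hl]; simp
      rcases (h.mem t).1 ht with ⟨v, hv, rfl⟩ | ⟨i, hi, hx, rfl⟩
      · exact absurd (hmax v hv) h1.not_ge
      · have h2 := h.drawn.lt_hd i hi (beq_ne_beq.2 hx)
        exact absurd (h1.trans h2) (hmax _ (h.drawn.hd_placed i hi)).not_gt
  subst hB
  have xlt := (G.head (q b)).isLt
  obtain ⟨pos', p1, p2⟩ := exists_pos_insert [(G.head (q b)).val + 1] pos A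
    ((G.tail (q b)).val + 1) [] (hl ▸ h.sorted) (by simp) (by
      rw [← hl]
      intro x hx
      rw [List.mem_singleton] at hx
      subst hx
      exact h.vertex_not_mem hfresh)
  obtain ⟨s1, -, -, -⟩ := pairwise_split p2
  have ve : ∀ v ∈ vs, pos' (v.val + 1) = pos (v.val + 1) := by
    intro v hv
    refine p1 _ ?_
    rw [List.mem_singleton]
    intro e
    exact hfresh (by rwa [show G.head (q b) = v from Fin.ext (by omega)])
  have h' := h.congr hk hf ve (fun j hj => p1 _ (by rw [List.mem_singleton]; omega))
  have step := h'.drawn.extend_top (i := b) htl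
    (fun z hz => (ve z hz).trans_le ((hmax z hz).trans_eq (ve _ htl).symm))
    (fun j hj => hlad j hj.1 hj.2) hfresh (by show (F b == _) = (E b == _); rw [hF])
    (by show G.OnSide (G.dir (q b)) (G.tail (q b)); rw [hq.2]; exact hG.onSide_side _)
    (fun hn => by
      have hn : ¬ G.OnSide (G.dir (q b)) (G.head (q b)) := hn
      refine .inl ?_
      rw [hG.side_eq_of_not_onSide hn]
      cases G.dir (q b) <;> decide)
    (s1 _ (by simp; exact .inr rfl) _ (by simp; rfl))
  refine ⟨pos', p2, ?_, ?_, h'.corners⟩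
  · intro x
    rw [mem_insert_iff, ← hl, h.mem x, List.mem_singleton]
    simp only [List.mem_append, List.mem_singleton]
    constructor
    · grind
    · grind
  · convert step using 1
    · funext j; simp only [eq_iff_iff]; omega
    · funext j; simp only [eq_iff_iff]; omega
    · funext v; simp only [List.mem_append, List.mem_singleton]; rfl

end Stage

/-- At the end of a block, the children in the last triangle are not on the ladder. -/
lemma IsOuterplanarTriangulatedST.kids_of_endsBlock (hG : G.IsOuterplanarTriangulatedST)
    {d : Fin n × Fin n} (hd : G.IsEntry d) (hext : ¬ G.Ext d) (hb : G.EndsBlock d) :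
    G.MidApex d ∧ ¬ G.OnLadder (G.tailKid d) ∧ ¬ G.OnLadder (G.headKid d) := by
  obtain ⟨b1, b2, -⟩ := hb
  rw [rightHalf_eq] at b1 b2
  have hdir : G.dir d = true := by
    by_contra hc
    have hc : G.dir d = false := by simpa using hc
    apply hext
    have : (G.head d, G.tail d) = d := by unfold head tail; simp [hc]
    rwa [this] at b1
  obtain ⟨-, -, t1, t2, t3, ht⟩ := hG.triangle hd hext
  rcases ht with ⟨hm, -, t5, t6, t7⟩ | ⟨-, t4, -⟩
  · refine ⟨hm, ((hG.ladder_kids hd hext).1 hm).1, ?_⟩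
    rintro (h | ⟨-, h⟩)
    · rw [t6, t7, hdir] at h
      exact h (side_eq_true.2 b2)
    · exact (hG.not_ext_swap_kid hext (.inr rfl)).1 h
  · rw [hdir] at t4
    exact absurd b2 t4

section

variable (G) (q : ℕ → Fin n × Fin n) (first : ℕ → ℕ) (F E : ℕ → Bool)

/-- The list `l` is the drawing after `k` steps. -/
def StageAt (k : ℕ) (l : List ℕ) : Prop :=
  ∃ pos, G.Stage q first F E (first k) k (G.visited q k) l pos

open Classical in
/-- The list `l` is the drawing after `k` steps and the triangle of step `k`. -/
def StageMid (k : ℕ) (l : List ℕ) : Prop :=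
  ∃ pos, G.Stage q first F E (first k + if G.Ext (q k) then 0 else 2) (k + 1)
      (G.visited q k ++ if G.Ext (q k) then [] else [G.apex (q k)]) l pos ∧
    (G.EndsBlock (q k) →
      (∀ v ∈ G.visited q k ++ (if G.Ext (q k) then [] else [G.apex (q k)]),
        pos (v.val + 1) ≤ pos ((G.head (q k)).val + 1)) ∧
      ∀ j, k + 1 ≤ j → j < first k + (if G.Ext (q k) then 0 else 2) → ¬ G.OnLadder (q j))

end

variable {m : ℕ} {q : ℕ → Fin n × Fin n} {first : ℕ → ℕ} {F E : ℕ → Bool} {k : ℕ} {l : List ℕ}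

lemma Stage.nodup {b k : ℕ} {vs : List (Fin n)} {pos : ℕ → ℚ}
    (h : G.Stage q first F E b k vs l pos) : l.Nodup :=
  h.sorted.imp fun hab e => by rw [e] at hab; exact lt_irrefl _ hab

lemma StageAt.nodup (h : G.StageAt q first F E k l) : l.Nodup := by
  obtain ⟨pos, h⟩ := h; exact h.nodup

lemma StageMid.nodup (h : G.StageMid q first F E k l) : l.Nodup := by
  obtain ⟨pos, h, -⟩ := h; exact h.nodup

/-- The first arc is drawn. -/
lemma stageAt_zero (hG : G.IsOuterplanarTriangulatedST) (ho : G.IsArcOrder m q first)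
    (h0 : F 0 = E 0) :
    G.StageAt q first F E 0 [(G.tail (q 0)).val + 1, (G.head (q 0)).val + 1] := by
  have hr := (ho.entry 0 ho.bfs.pos)
  have hne : G.tail (q 0) ≠ G.head (q 0) := by
    have := hr.1.arc
    intro e
    rw [e] at this
    have h2 := G.asymm _ _ this
    rw [this] at h2; cases h2
  let pos : ℕ → ℚ := fun x => if x = (G.head (q 0)).val + 1 then 1 else 0
  have p1 : pos ((G.head (q 0)).val + 1) = 1 := if_pos rfl
  have p0 : pos ((G.tail (q 0)).val + 1) = 0 := if_neg (fun e => hne (Fin.ext (by omega)))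
  have base : G.Stage q first F E 0 0 [G.tail (q 0)] [(G.tail (q 0)).val + 1] pos := by
    refine ⟨by simp, by simp, ?_, by simp⟩
    have := ArcSystem.Drawn.single (S := G.arcSystem q F E) (pv := fun v => pos (v.val + 1))
      (px := fun i => pos (n + 1 + i)) (G.tail (q 0))
    convert this using 1 <;> grind
  obtain ⟨pos', h⟩ := base.block hG le_rfl (by simp) hr h0 (by simp)
    (by simp [hne.symm]) (by simp) (by simp) (A := []) (B := []) rfl
  refine ⟨pos', ?_⟩
  rw [ho.bfs.first_zero]
  simpa [visited] using h

/-- Before the last triangle of a block, its base is the only ladder arc and ends at the top. -/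
lemma Stage.endsBlock {b : ℕ} {vs : List (Fin n)} {pos : ℕ → ℚ}
    (hG : G.IsOuterplanarTriangulatedST) (h : G.Stage q first F E b k vs l pos) (hk : k < b)
    (hentry : G.IsHalfEdge (q k)) (hb : G.EndsBlock (q k)) :
    (∀ v ∈ vs, pos (v.val + 1) ≤ pos ((G.head (q k)).val + 1)) ∧
      ∀ j, k + 1 ≤ j → j < b → ¬ G.OnLadder (q j) := by
  have hl := (hG.blockKid_spec hentry hb).2.2.2.2.2
  refine ⟨fun v hv => h.drawn.top k v ⟨le_rfl, hk⟩ hl hv, fun j h1 h2 hj => ?_⟩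
  have := h.drawn.ladder_unique j k ⟨by omega, h2⟩ ⟨le_rfl, hk⟩ hj hl
  omega

namespace StageAt

lemma leaf (hG : G.IsOuterplanarTriangulatedST) (ho : G.IsArcOrder m q first) (hk : k < m)
    (h : G.StageAt q first F E k l) (hext : G.Ext (q k)) : G.StageMid q first F E k l := by
  obtain ⟨pos, h⟩ := h
  refine ⟨pos, ?_, fun hb => ?_⟩
  · simpa [hext] using h.leaf hext
  · simpa [hext] using h.endsBlock hG (ho.bfs.lt_first k hk) (ho.entry k hk).1 hb

lemma apex_not_mem (hG : G.IsOuterplanarTriangulatedST) (ho : G.IsArcOrder m q first) (hk : k < m)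
    (hext : ¬ G.Ext (q k)) : G.apex (q k) ∉ G.visited q k := by
  have h := ho.fresh_nodup hG hk
  intro hm
  exact (List.nodup_append.1 h).2.2 _ hm _ (by simp [freshVertices, hext]) rfl

theorem mid (hG : G.IsOuterplanarTriangulatedST) (ho : G.IsArcOrder m q first) (hk : k < m)
    (h : G.StageAt q first F E k l) (hext : ¬ G.Ext (q k)) (hmid : G.MidApex (q k))
    (hs : MidStates F E k (first k) (first k + 1)) {A B : List ℕ} {z : ℕ} (hl : l = A ++ z :: B)
    (hz : (F k = true ∧ ∃ B', B = ((G.head (q k)).val + 1) :: B') ∨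
      (F k = false ∧ z = (G.tail (q k)).val + 1)) :
    G.StageMid q first F E k (A ++ z :: (crossingNodes n F E (first k) ++
      [(G.apex (q k)).val + 1] ++ crossingNodes n F E (first k + 1) ++ B)) := by
  obtain ⟨pos, h⟩ := h
  obtain ⟨pos', h1, h2, h3⟩ := h.mid hG ho hk hext hmid (apex_not_mem hG ho hk hext) hs hl hz
  have hkf := ho.bfs.lt_first k hk
  refine ⟨pos', by simpa [hext] using h3, fun hb => ?_⟩
  obtain ⟨b1, b2⟩ := h.endsBlock hG hkf (ho.entry k hk).1 hb
  obtain ⟨e1, e2, -⟩ := ho.triangle_kids hk hext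
  obtain ⟨-, k1, k2⟩ := hG.kids_of_endsBlock (ho.entry k hk) hext hb
  have hh := h1 _ (h.drawn.hd_placed k hkf)
  have hh : pos' ((G.head (q k)).val + 1) = pos ((G.head (q k)).val + 1) := hh
  simp only [hext, if_false]
  constructor
  · grind
  · grind

theorem top_first (hG : G.IsOuterplanarTriangulatedST) (ho : G.IsArcOrder m q first) (hk : k < m)
    (h : G.StageAt q first F E k l) (hext : ¬ G.Ext (q k)) (hmid : ¬ G.MidApex (q k))
    (hs : TopStates F E k (first k) (first k + 1)) (hF : F (first k) = true) {A B : List ℕ}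
    (hl : l = A ++ ((G.head (q k)).val + 1) :: B) :
    G.StageMid q first F E k (A ++ ((G.head (q k)).val + 1) :: (crossingNodes n F E (first k + 1) ++
          crossingNodes n F E (first k) ++ [(G.apex (q k)).val + 1] ++ B)) := by
  obtain ⟨pos, h⟩ := h
  obtain ⟨pos', h'⟩ := h.top_first hG ho hk hext hmid (apex_not_mem hG ho hk hext) hs hF hl
  exact ⟨pos', by simpa [hext] using h', fun hb =>
    absurd (hG.kids_of_endsBlock (ho.entry k hk) hext hb).1 hmid⟩

theorem top_second (hG : G.IsOuterplanarTriangulatedST) (ho : G.IsArcOrder m q first) (hk : k < m)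
    (h : G.StageAt q first F E k l) (hext : ¬ G.Ext (q k)) (hmid : ¬ G.MidApex (q k))
    (hs : TopStates F E k (first k) (first k + 1)) (hF : F (first k) = false)
    {A B A' B' : List ℕ} (hl : l = A ++ ((G.head (q k)).val + 1) :: B)
    (hl' : A ++ ((G.head (q k)).val + 1) :: (crossingNodes n F E (first k + 1) ++
          [(G.apex (q k)).val + 1] ++ B) = A' ++ ((G.tail (q k)).val + 1) :: B') :
    G.StageMid q first F E k (A' ++ ((G.tail (q k)).val + 1) :: ([n + 1 + first k] ++ B')) := by
  obtain ⟨pos, h⟩ := h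
  obtain ⟨pos', h'⟩ := h.top_second hG ho hk hext hmid (apex_not_mem hG ho hk hext) hs hF hl hl'
  exact ⟨pos', by simpa [hext] using h', fun hb =>
    absurd (hG.kids_of_endsBlock (ho.entry k hk) hext hb).1 hmid⟩

lemma tail_mem (ho : G.IsArcOrder m q first) (hk : k < m)
    (h : G.StageAt q first F E k l) : (G.tail (q k)).val + 1 ∈ l := by
  obtain ⟨pos, h⟩ := h
  exact (h.mem _).2 (.inl ⟨_, h.drawn.tl_placed k (ho.bfs.lt_first k hk), rfl⟩)

lemma head_mem (ho : G.IsArcOrder m q first) (hk : k < m)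
    (h : G.StageAt q first F E k l) : (G.head (q k)).val + 1 ∈ l := by
  obtain ⟨pos, h⟩ := h
  exact (h.mem _).2 (.inl ⟨_, h.drawn.hd_placed k (ho.bfs.lt_first k hk), rfl⟩)

/-- The head of an arc is not the lowest node. -/
lemma exists_pred (ho : G.IsArcOrder m q first) (hk : k < m)
    (h : G.StageAt q first F E k l) :
    ∃ A z B, l = A ++ z :: ((G.head (q k)).val + 1) :: B := by
  have h1 := h.tail_mem ho hk
  have h2 := h.head_mem ho hk
  obtain ⟨pos, h⟩ := h
  obtain ⟨A, B, rfl⟩ := List.append_of_mem h2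
  rcases List.eq_nil_or_concat A with rfl | ⟨A, z, rfl⟩
  · have h3 : pos ((G.tail (q k)).val + 1) < pos ((G.head (q k)).val + 1) :=
      h.drawn.upward k (ho.bfs.lt_first k hk)
    rw [List.nil_append] at h1 h
    rcases List.mem_cons.1 h1 with e | e
    · grind
    · exact absurd h3 (List.rel_of_pairwise_cons h.sorted e).not_gt
  · exact ⟨A, z, B, by simp⟩

/-- The nodes of a drawing. -/
lemma mem_bound (ho : G.IsArcOrder m q first) (hk : k ≤ m)
    (h : G.StageAt q first F E k l) {x : ℕ} (hx : x ∈ l) : 0 < x ∧ x ≤ n + m := by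
  obtain ⟨pos, h⟩ := h
  have := ho.first_le_total hk
  rcases (h.mem x).1 hx with ⟨v, -, rfl⟩ | ⟨i, hi, -, rfl⟩
  · have := v.isLt; omega
  · omega

end StageAt

namespace StageMid

lemma next (ho : G.IsArcOrder m q first) (hk : k < m) (h : G.StageMid q first F E k l)
    (hb : ¬ G.EndsBlock (q k)) : G.StageAt q first F E (k + 1) l := by
  obtain ⟨pos, h, -⟩ := h
  refine ⟨pos, ?_⟩
  rw [ho.first_succ_eq hk, visited_succ]
  simpa [freshVertices, hb] using h

theorem block (hG : G.IsOuterplanarTriangulatedST) (ho : G.IsArcOrder m q first) (hk : k < m)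
    (h : G.StageMid q first F E k l) (hb : G.EndsBlock (q k))
    (hF : F (first (k + 1) - 1) = E (first (k + 1) - 1)) {A B : List ℕ}
    (hl : l = A ++ ((G.head (q k)).val + 1) :: B) :
    G.StageAt q first F E (k + 1) (A ++ ((G.head (q k)).val + 1) ::
      ([(G.head (G.blockKid (q k))).val + 1] ++ B)) := by
  classical
  obtain ⟨pos, h, hm⟩ := h
  obtain ⟨h1, h2⟩ := hm hb
  obtain ⟨c1, c2⟩ := ho.block_kid hk hb
  have hf := ho.first_succ_eq hk
  rw [if_pos hb] at hf
  set b := first k + if G.Ext (q k) then 0 else 2 with hbdef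
  have eb : first (k + 1) - 1 = b := by omega
  rw [eb] at c1 hF
  obtain ⟨s1, -, -, s4, -, -⟩ := hG.blockKid_spec (ho.entry k hk).1 hb
  have hkf := ho.bfs.lt_first k hk
  have hkb : k + 1 ≤ b := by omega
  have htl : G.tail (q b) = G.head (q k) := by rw [c1]; exact s4
  have hfresh := ho.fresh_nodup hG hk
  rw [show G.freshVertices (q k) = (if G.Ext (q k) then [] else [G.apex (q k)]) ++
    [G.head (q b)] by rw [c1]; simp [freshVertices, hb], ← List.append_assoc] at hfresh
  obtain ⟨pos', h'⟩ := h.block hG hkb (by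
      -- The triangle children of all steps up to `k`, including `k` itself, precede the index of
      -- the block child.
      intro j hj hje
      rcases Nat.lt_or_ge j k with h3 | h3
      · have := Stage.lt_first_of_lt ho hk.le h3 hje; omega
      · grind)
    (by rw [c1]; exact s1) hF
    (by
      rw [htl]
      exact List.mem_append_left _ (ho.ends_mem_visited hG hk.le k hkf).2)
    (fun hx => (List.nodup_append.1 hfresh).2.2 _ hx _ (by simp) rfl)
    (by rw [htl]; exact h1) h2 (A := A) (B := B) (by rw [htl]; exact hl)
  refine ⟨pos', ?_⟩
  rw [hf, visited_succ, show G.freshVertices (q k) = (if G.Ext (q k) then [] else [G.apex (q k)]) ++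
    [G.head (q b)] by rw [c1]; simp [freshVertices, hb], ← List.append_assoc]
  rw [htl] at h'
  rw [← c1]
  exact h'

end StageMid

end EmbeddedDigraph

/-! ### Rotating a cyclic list into sorted order -/

/-- Along the chain an element with `P` is followed only by such elements, so the list consists of a
part without `P` and a part with `P`, both increasing. Exchanging the parts sorts it. In the
application `P` selects the edges that arrive from below on the left page, which come first in the
order of directions. -/
lemma List.exists_isRotated_pairwise {α K : Type*} [LinearOrder K] (key : α → K) (P : α → Prop)
    (hP : ∀ a b, P a → ¬ P b → key a < key b) {l : List α}
    (h : l.IsChain fun a b => (P a → P b ∧ key a < key b) ∧ (¬ P a → ¬ P b → key a < key b)) :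
    ∃ L : List α, L.IsRotated l ∧ L.Pairwise fun a b => key a < key b := by
  have split : ∃ A B, l = A ++ B ∧ (∀ a ∈ A, ¬ P a) ∧ (∀ b ∈ B, P b) := by
    induction l with
    | nil => exact ⟨[], [], rfl, by simp, by simp⟩
    | cons a l ih =>
      by_cases ha : P a
      · refine ⟨[], a :: l, rfl, by simp, ?_⟩
        clear ih
        induction l generalizing a with
        | nil => simpa using ha
        | cons b l ih =>
          rw [List.isChain_cons_cons] at h
          have hb := (h.1.1 ha).1
          have := ih b h.2 hb
          intro c hc
          rcases List.mem_cons.1 hc with rfl | hc <;> grind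
      · obtain ⟨A, B, rfl, h1, h2⟩ := ih h.tail
        refine ⟨a :: A, B, rfl, fun c hc => ?_, h2⟩
        rcases List.mem_cons.1 hc with rfl | hc <;> grind
  obtain ⟨A, B, rfl, hA, hB⟩ := split
  refine ⟨B ++ A, List.isRotated_append, ?_⟩
  have mono : ∀ {C : List α}, (C.IsChain fun a b => key a < key b) →
      C.Pairwise fun a b => key a < key b := by grind
  rw [List.pairwise_append]
  refine ⟨mono ?_, mono ?_, fun b hb a ha => hP b a (hB b hb) (hA a ha)⟩
  · refine (h.right_of_append).imp_of_mem_imp fun a b ha _ hab => (hab.1 (hB a ha)).2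
  · refine (h.left_of_append).imp_of_mem_imp fun a b ha hb hab => hab.2 (hA a ha) (hA b hb)

/-- A cyclic list, cut open before `formPerm x`, is a chain for every relation that holds for all
other consecutive elements. -/
lemma List.exists_isRotated_isChain {α : Type*} [DecidableEq α] {l : List α} (hl : l.Nodup)
    {x : α} (hx : x ∈ l) {R : α → α → Prop}
    (hR : ∀ y ∈ l, y ≠ x → R y (l.formPerm y)) : ∃ l' : List α, l'.IsRotated l ∧ l'.IsChain R := by
  obtain ⟨A, B, rfl⟩ := List.append_of_mem hx
  have hrot : (B ++ (A ++ [x])).IsRotated (A ++ x :: B) := by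
    have := List.isRotated_append (l := A ++ [x]) (l' := B)
    simpa using this.symm
  have hnd : (B ++ (A ++ [x])).Nodup := hrot.nodup_iff.2 hl
  refine ⟨B ++ (A ++ [x]), hrot, ?_⟩
  have hf : (B ++ (A ++ [x])).formPerm = (A ++ x :: B).formPerm :=
    List.formPerm_eq_of_isRotated hnd hrot
  rw [List.isChain_iff_getElem]
  intro i hi
  have h1 := List.formPerm_apply_lt_getElem _ hnd i hi
  rw [← h1, hf]
  refine hR _ (hrot.mem_iff.1 (List.getElem_mem _)) fun e => ?_
  have hlast : (B ++ (A ++ [x]))[(B ++ (A ++ [x])).length - 1]'(by omega) = x := by grind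
  have := (hnd.getElem_inj_iff).1 (e.trans hlast.symm)
  omega

/-! ### The turns of a triangle in terms of the ends of its arcs. -/

namespace EmbeddedDigraph

variable {n : ℕ} {G : EmbeddedDigraph n}

lemma eq_ends_of_dir {d : Fin n × Fin n} (h : G.dir d = true) :
    d = (G.tail d, G.head d) ∧ d.swap = (G.head d, G.tail d) := by
  unfold tail head; simp only [h, if_true]; exact ⟨trivial, rfl⟩

lemma eq_ends_of_not_dir {d : Fin n × Fin n} (h : G.dir d = false) :
    d = (G.head d, G.tail d) ∧ d.swap = (G.tail d, G.head d) := by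
  unfold tail head; simp only [h, Bool.false_eq_true, if_false]; exact ⟨trivial, rfl⟩

/-- The lower and the upper corner of a triangle `a → b → c`, `a → c` with `b` on the side `s`. -/
def CornersAt (G : EmbeddedDigraph n) (s : Bool) (ab bc ac e : Fin n × Fin n) : Prop :=
  ∀ d, G.facePerm.SameCycle e d →
    (G.dir d = false → G.dir (G.facePerm d) = true →
      (s = true → d = (G.head ab, G.tail ab) ∧ G.facePerm d = (G.tail ac, G.head ac)) ∧
      (s = false → d = (G.head ac, G.tail ac) ∧ G.facePerm d = (G.tail ab, G.head ab))) ∧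
    (G.dir d = true → G.dir (G.facePerm d) = false →
      (s = true → d = (G.tail ac, G.head ac) ∧ G.facePerm d = (G.head bc, G.tail bc)) ∧
      (s = false → d = (G.tail bc, G.head bc) ∧ G.facePerm d = (G.head ac, G.tail ac)))

/-- A face has only one lower and one upper turn, so it suffices to exhibit one of each. -/
lemma cornersAt_of_eq (hG : G.IsPlanarST) {s : Bool} {ab bc ac e x y : Fin n × Fin n}
    (he : G.IsHalfEdge e) (hx : G.facePerm.SameCycle e x) (hy : G.facePerm.SameCycle e y)
    (x1 : G.dir x = false) (x2 : G.dir (G.facePerm x) = true)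
    (y1 : G.dir y = true) (y2 : G.dir (G.facePerm y) = false)
    (hx' : (s = true → x = (G.head ab, G.tail ab) ∧ G.facePerm x = (G.tail ac, G.head ac)) ∧
      (s = false → x = (G.head ac, G.tail ac) ∧ G.facePerm x = (G.tail ab, G.head ab)))
    (hy' : (s = true → y = (G.tail ac, G.head ac) ∧ G.facePerm y = (G.head bc, G.tail bc)) ∧
      (s = false → y = (G.tail bc, G.head bc) ∧ G.facePerm y = (G.head ac, G.tail ac))) :
    G.CornersAt s ab bc ac e := by
  intro d hd
  have hdH := (sameCycle_isHalfEdge hd).1 he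
  constructor
  · intro d1 d2
    rw [turn_unique hG (p := false) hdH d1 d2 x1 x2 (hd.symm.trans hx)]
    exact hx'
  · intro d1 d2
    rw [turn_unique hG (p := true) hdH d1 d2 y1 y2 (hd.symm.trans hy)]
    exact hy'

/-- The corners of the triangle at an entry half-edge. -/
lemma IsOuterplanarTriangulatedST.cornersAt (hG : G.IsOuterplanarTriangulatedST)
    {d : Fin n × Fin n} (hd : G.IsEntry d) (hext : ¬ G.Ext d) :
    (G.MidApex d → G.CornersAt (G.dir d) (G.tailKid d) (G.headKid d) d d) ∧
    (¬ G.MidApex d → G.CornersAt (!G.dir d) d (G.headKid d) (G.tailKid d) d) := by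
  obtain ⟨-, -, -, -, t3, ht⟩ := hG.triangle hd hext
  have s1 : G.facePerm.SameCycle d (G.facePerm d) := (Equiv.Perm.SameCycle.refl _ _).apply_right
  have s2 : G.facePerm.SameCycle d (G.facePerm (G.facePerm d)) := s1.apply_right
  have c := hG.facePerm_cube hd.1 hext
  have hP := hG.planarST
  cases hdir : G.dir d
  · have k1 : G.tailKid d = (G.facePerm d).swap := by unfold tailKid; simp [hdir]
    have k2 : G.headKid d = (G.facePerm (G.facePerm d)).swap := by unfold headKid; simp [hdir]
    have k1' : G.facePerm d = (G.tailKid d).swap := by rw [k1, Prod.swap_swap]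
    have k2' : G.facePerm (G.facePerm d) = (G.headKid d).swap := by rw [k2, Prod.swap_swap]
    have e0 := eq_ends_of_not_dir hdir
    have e1 := eq_ends_of_not_dir (t3.trans hdir)
    have d1 : G.dir (G.facePerm d) = true := by
      have := (isHalfEdge_facePerm.2 hd.1).dir_swap
      rw [← k1, t3, hdir] at this
      simpa using this.symm
    have hd2 : G.dir (G.facePerm (G.facePerm d)) = !G.dir (G.headKid d) := by
      rw [k2, (isHalfEdge_facePerm.2 (isHalfEdge_facePerm.2 hd.1)).dir_swap, Bool.not_not]
    rcases ht with ⟨hm, -, -, -, t7⟩ | ⟨hm, -, -, -, t7⟩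
    · refine ⟨fun _ => ?_, fun h => absurd hm h⟩
      have e2 := eq_ends_of_not_dir (t7.trans hdir)
      rw [t7, hdir] at hd2
      refine cornersAt_of_eq hP hd.1 (Equiv.Perm.SameCycle.refl _ _) s2 hdir d1 hd2
        (by rw [c]; exact hdir) ⟨by simp, fun _ => ⟨e0.1, k1'.trans e1.2⟩⟩
        ⟨by simp, fun _ => ⟨k2'.trans e2.2, c.trans e0.1⟩⟩
    · refine ⟨fun h => absurd h hm, fun _ => ?_⟩
      have e2 := eq_ends_of_dir (t7.trans (by rw [hdir]; rfl))
      rw [t7, hdir] at hd2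
      refine cornersAt_of_eq hP hd.1 (Equiv.Perm.SameCycle.refl _ _) s1 hdir d1 d1 hd2
        ⟨fun _ => ⟨e0.1, k1'.trans e1.2⟩, by simp⟩ ⟨fun _ => ⟨k1'.trans e1.2, k2'.trans e2.2⟩, by simp⟩
  · have k1 : G.headKid d = (G.facePerm d).swap := by unfold headKid; simp [hdir]
    have k2 : G.tailKid d = (G.facePerm (G.facePerm d)).swap := by unfold tailKid; simp [hdir]
    have k1' : G.facePerm d = (G.headKid d).swap := by rw [k1, Prod.swap_swap]
    have k2' : G.facePerm (G.facePerm d) = (G.tailKid d).swap := by rw [k2, Prod.swap_swap]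
    have e0 := eq_ends_of_dir hdir
    have e1 := eq_ends_of_dir (t3.trans hdir)
    have d2 : G.dir (G.facePerm (G.facePerm d)) = false := by
      have := (isHalfEdge_facePerm.2 (isHalfEdge_facePerm.2 hd.1)).dir_swap
      rw [← k2, t3, hdir] at this
      simpa using this.symm
    have hd1 : G.dir (G.facePerm d) = !G.dir (G.headKid d) := by
      rw [k1, (isHalfEdge_facePerm.2 hd.1).dir_swap, Bool.not_not]
    rcases ht with ⟨hm, -, -, -, t7⟩ | ⟨hm, -, -, -, t7⟩
    · refine ⟨fun _ => ?_, fun h => absurd hm h⟩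
      have e2 := eq_ends_of_dir (t7.trans hdir)
      rw [t7, hdir] at hd1
      refine cornersAt_of_eq hP hd.1 s2 (Equiv.Perm.SameCycle.refl _ _) d2 (by rw [c]; exact hdir)
        hdir hd1 ⟨fun _ => ⟨k2'.trans e1.2, c.trans e0.1⟩, by simp⟩
        ⟨fun _ => ⟨e0.1, k1'.trans e2.2⟩, by simp⟩
    · refine ⟨fun h => absurd h hm, fun _ => ?_⟩
      have e2 := eq_ends_of_not_dir (t7.trans (by rw [hdir]; rfl))
      rw [t7, hdir] at hd1
      refine cornersAt_of_eq hP hd.1 s2 s1 d2 (by rw [c]; exact hdir) hd1 d2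
        ⟨by simp, fun _ => ⟨k2'.trans e1.2, c.trans e0.1⟩⟩
        ⟨by simp, fun _ => ⟨k1'.trans e2.2, k2'.trans e1.2⟩⟩

/-! ### Rotations from corners -/

/-- The order of the edges around the vertices agrees with the embedding at all corners of internal
faces. -/
structure SortedCorners (G : EmbeddedDigraph n) (D : BookDrawing n) : Prop where
  lower : ∀ d, G.IsHalfEdge d → ¬ G.Ext d → G.dir d = false → G.dir (G.facePerm d) = true →
    G.direction D d.2 d.1 < G.direction D d.2 (G.facePerm d).2
  -- The keys of directions start at the downward direction. At an upper corner the clockwise order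
  -- may step over it, from the right page (group 3) to the left page (group 0), so nothing is asked
  -- in that case.
  upper : ∀ d, G.IsHalfEdge d → ¬ G.Ext d → G.dir d = true → G.dir (G.facePerm d) = false →
    ((ofLex (G.direction D d.2 d.1)).1 = 0 → (ofLex (G.direction D d.2 (G.facePerm d).2)).1 = 0 ∧
      G.direction D d.2 d.1 < G.direction D d.2 (G.facePerm d).2) ∧
    ((ofLex (G.direction D d.2 d.1)).1 ≠ 0 → (ofLex (G.direction D d.2 (G.facePerm d).2)).1 ≠ 0 →
      G.direction D d.2 d.1 < G.direction D d.2 (G.facePerm d).2)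

lemma direction_of_arc {D : BookDrawing n} {v w : Fin n} (h : G.arc v w = true) :
    (ofLex (G.direction D v w)).1 = 1 ∨ (ofLex (G.direction D v w)).1 = 2 := by
  unfold direction; rw [if_pos h]; split_ifs <;> simp

lemma direction_of_not_arc {D : BookDrawing n} {v w : Fin n} (h : G.arc v w = false) :
    (ofLex (G.direction D v w)).1 = 0 ∨ (ofLex (G.direction D v w)).1 = 3 := by
  unfold direction; rw [if_neg (by simp [h])]; split_ifs <;> simp

lemma direction_lt_of_fst_lt {x y : ℕ ×ₗ ℤ} (h : (ofLex x).1 < (ofLex y).1) : x < y :=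
  Prod.Lex.lt_iff.2 (.inl h)

/-- The special corner of the external face at a source or a sink. -/
lemma exists_turn_ext {v : Fin n} {p : Bool}
    (hv : ∀ w, G.IsHalfEdge (w, v) → G.dir (w, v) = p) (hext : G.OnExternalFace v) :
    ∃ d, G.Ext d ∧ d.2 = v ∧ G.dir d = p ∧ G.dir (G.facePerm d) = !p := by
  obtain ⟨w, hw⟩ := hext
  have hw : G.Ext (v, w) := hw
  have h2 : G.Ext (G.facePerm.symm (v, w)) := ext_facePerm_symm.2 hw
  refine ⟨_, h2, rfl, hv _ h2.isHalfEdge, ?_⟩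
  rw [Equiv.apply_symm_apply]
  have h3 := hv w hw.isHalfEdge.swap
  have h4 := hw.isHalfEdge.dir_swap
  rw [show ((v, w) : Fin n × Fin n).swap = (w, v) from rfl, h3] at h4
  rw [h4, Bool.not_not]

/-- The turns of the external face are at the source and at the sink. -/
lemma IsPlanarST.turn_of_ext (hG : G.IsPlanarST) {d : Fin n × Fin n} (hd : G.Ext d)
    (hne : G.dir d ≠ G.dir (G.facePerm d)) :
    (∀ w, G.IsHalfEdge (w, d.2) → G.dir (w, d.2) = G.dir d) ∧
      ∀ e, G.Ext e → G.dir e = G.dir d → G.dir (G.facePerm e) = !G.dir d → d = e := by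
  have hturn : G.dir (G.facePerm d) = !G.dir d := by grind
  have uniq : ∀ e, G.Ext e → G.dir e = G.dir d → G.dir (G.facePerm e) = !G.dir d → d = e :=
    fun e he h1 h2 => turn_unique hG hd.isHalfEdge rfl hturn h1 h2 (hd.sameCycle he)
  refine ⟨?_, uniq⟩
  obtain ⟨s, hs, -⟩ := hG.source
  obtain ⟨t, ht, -⟩ := hG.sink
  have s1 : ∀ w, G.IsHalfEdge (w, s) → G.dir (w, s) = false := fun w _ => hs w
  have t1 : ∀ w, G.IsHalfEdge (w, t) → G.dir (w, t) = true := by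
    intro w hw
    by_contra hc
    have := hw.arc_of_dir_false (by simpa using hc)
    have h2 : G.arc t w = false := ht w
    rw [h2] at this; cases this
  cases hdir : G.dir d
  · obtain ⟨e, e1, e2, e3, e4⟩ := exists_turn_ext s1 (hG.source_external s hs)
    rw [uniq e e1 (e3.trans hdir.symm) (by rw [hdir]; exact e4), e2]; exact s1
  · obtain ⟨e, e1, e2, e3, e4⟩ := exists_turn_ext t1 (hG.sink_external t ht)
    rw [uniq e e1 (e3.trans hdir.symm) (by rw [hdir]; exact e4), e2]; exact t1

/-- At every vertex there is a corner such that all other corners are internal or right corners of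
the external face. -/
lemma IsPlanarST.exists_cut (hG : G.IsPlanarST) (v : Fin n) (hext : G.OnExternalFace v) :
    ∃ d, G.IsHalfEdge d ∧ d.2 = v ∧ ∀ e, G.IsHalfEdge e → e.2 = v → e ≠ d →
      (G.dir e = false ∧ G.dir (G.facePerm e) = false) ∨
        (¬ G.Ext e ∧ G.dir e ≠ G.dir (G.facePerm e)) := by
  by_cases hterm : ∃ p, ∀ w, G.IsHalfEdge (w, v) → G.dir (w, v) = p
  · obtain ⟨p, hp⟩ := hterm
    obtain ⟨d, d1, d2, d3, d4⟩ := exists_turn_ext hp hext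
    refine ⟨d, d1.isHalfEdge, d2, fun e e1 e2 e3 => .inr ?_⟩
    have h1 : G.dir e = p := by grind
    have h2 : G.dir (G.facePerm e) = !p := by
      have h3 := isHalfEdge_facePerm.2 e1
      have h4 : (G.facePerm e).1 = v := e2
      have := hp (G.facePerm e).2 (by rw [← h4]; exact h3.swap)
      rw [← h4] at this
      have h5 := h3.dir_swap
      rw [show (G.facePerm e).swap = ((G.facePerm e).2, (G.facePerm e).1) from rfl, this] at h5
      rw [h5, Bool.not_not]
    have hne : G.dir e ≠ G.dir (G.facePerm e) := by rw [h1, h2]; cases p <;> decide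
    refine ⟨fun he => e3 ?_, hne⟩
    exact (hG.turn_of_ext he hne).2 d d1 (d3.trans h1.symm) (by rw [h1]; exact d4)
  · have hp : ∀ p, ∃ w, G.IsHalfEdge (w, v) ∧ G.dir (w, v) ≠ p := by simpa using hterm
    obtain ⟨u, u1, u2⟩ := hp false
    obtain ⟨w, w1, w2⟩ := hp true
    have hu : G.arc u v = true := by simpa [dir] using u2
    have hw : G.arc v w = true := w1.arc_of_dir_false (by simpa using w2)
    obtain ⟨d, d1, d2, d3, d4⟩ := exists_flat hu hw true
    refine ⟨d, d1, d2, fun e e1 e2 e3 => ?_⟩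
    by_cases hne : G.dir e = G.dir (G.facePerm e)
    · cases hdir : G.dir e
      · exact .inl ⟨rfl, hne.symm.trans hdir⟩
      · exact absurd (flat_unique hG e1 hdir (hne.symm.trans hdir) d1 d3 d4 (e2.trans d2.symm)) e3
    · refine .inr ⟨fun he => ?_, hne⟩
      have h1 := (hG.turn_of_ext he hne).1
      rw [e2] at h1
      have h3 := h1 u u1
      have h4 := h1 w w1
      rw [h4] at w2
      rw [h3] at u2
      cases h : G.dir e <;> simp_all

/-- The embedding is preserved as soon as it is preserved at the corners of the triangles. -/
theorem SortedCorners.preservesEmbedding (hG : G.IsOuterplanarTriangulatedST) {D : BookDrawing n}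
    (hD : G.SortedCorners D) (hup : ∀ u v, G.arc u v = true → D.pos u < D.pos v) :
    G.PreservesEmbedding D := by
  have hP := hG.planarST
  constructor
  · intro v
    obtain ⟨d, d1, d2, d3⟩ := hP.exists_cut v (hG.outerplanar v)
    have hmem : d.1 ∈ G.rot v := by rw [← d2]; exact d1.swap
    obtain ⟨l', h1, h2⟩ := List.exists_isRotated_isChain (G.rot_nodup v) hmem
      (R := fun a b => ((ofLex (G.direction D v a)).1 = 0 →
          (ofLex (G.direction D v b)).1 = 0 ∧ G.direction D v a < G.direction D v b) ∧
        ((ofLex (G.direction D v a)).1 ≠ 0 → (ofLex (G.direction D v b)).1 ≠ 0 →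
          G.direction D v a < G.direction D v b)) (by
        intro y hy hyd
        have hH : G.IsHalfEdge (y, v) := IsHalfEdge.swap (d := (v, y)) hy
        rcases d3 (y, v) hH rfl (fun e => hyd (by rw [← e])) with ⟨e1, e2⟩ | ⟨e1, e2⟩
        · have a1 : G.arc v y = true := hH.arc_of_dir_false e1
          have a2 : G.arc v ((G.rot v).formPerm y) = false := e2
          have b1 := direction_of_arc (D := D) a1
          have b2 := direction_of_not_arc (D := D) a2
          refine ⟨by omega, fun _ h => direction_lt_of_fst_lt (by omega)⟩
        · cases hdir : G.dir (y, v)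
          · have h2 : G.dir (G.facePerm (y, v)) = true := by
              rw [hdir] at e2; simpa using e2.symm
            have := hD.lower (y, v) hH e1 hdir h2
            have a1 : G.arc v y = true := hH.arc_of_dir_false hdir
            have b1 := direction_of_arc (D := D) a1
            exact ⟨by omega, fun _ _ => this⟩
          · have h2 : G.dir (G.facePerm (y, v)) = false := by
              rw [hdir] at e2; simpa using e2.symm
            exact hD.upper (y, v) hH e1 hdir h2)
    obtain ⟨L, h3, h4⟩ := List.exists_isRotated_pairwise (G.direction D v)
      (fun a => (ofLex (G.direction D v a)).1 = 0)
      (fun a b ha hb => direction_lt_of_fst_lt (by omega)) h2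
    exact ⟨L, h3.trans h1, h4⟩
  · intro v hv w hw hmin
    have hsrc : ∀ u, G.arc u v = false := by grind
    have hH : G.IsHalfEdge (v, w) := hw
    by_contra hne
    -- The lowest vertex is a source. If the corner before its first edge were internal, it would be
    -- a lower corner, and the edge preceding there would have a smaller direction than the first
    -- edge.
    have hne' : ¬ G.Ext (G.facePerm.symm (v, w)) := fun h => hne (ext_facePerm_symm.1 h)
    have hH' := isHalfEdge_facePerm_symm.2 hH
    have h1 : G.dir (G.facePerm.symm (v, w)) = false := hsrc _
    have h2 : G.dir (G.facePerm (G.facePerm.symm (v, w))) = true := by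
      rw [Equiv.apply_symm_apply]
      have := isHalfEdge_iff.1 hH
      simpa [hsrc, dir] using this
    have := hD.lower _ hH' hne' h1 h2
    rw [Equiv.apply_symm_apply] at this
    exact absurd (hmin _ hH'.swap) this.not_ge

end EmbeddedDigraph

namespace ArcSystem

variable {V α β : Type*} [LinearOrder α] [LinearOrder β] {S : ArcSystem V}

/-- The lower corner of a triangle, in terms of the keys of its two arcs. -/
lemma CornerOrder.map {v : V → ℕ} {x : ℕ → ℕ} {pos : ℕ → α} {r : ℕ → β} {q : Bool} {ab bc ac : ℕ}
    (h : S.CornerOrder (fun z => pos (v z)) (fun j => pos (x j)) q ab bc ac) {P : ℕ → Prop}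
    (hr : ∀ a b, P a → P b → (r a < r b ↔ pos a < pos b))
    (hP : ∀ j, j = ab ∨ j = bc ∨ j = ac → P (S.up v x j) ∧ P (S.lo v x j)) :
    S.CornerOrder (fun z => r (v z)) (fun j => r (x j)) q ab bc ac := by
  have u : ∀ j, S.up (fun z => pos (v z)) (fun j => pos (x j)) j = pos (S.up v x j) := by
    intro j; unfold up; split_ifs <;> rfl
  have u' : ∀ j, S.up (fun z => r (v z)) (fun j => r (x j)) j = r (S.up v x j) := by
    intro j; unfold up; split_ifs <;> rfl
  have w : ∀ j, S.lo (fun z => pos (v z)) (fun j => pos (x j)) j = pos (S.lo v x j) := by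
    intro j; unfold lo; split_ifs <;> rfl
  have w' : ∀ j, S.lo (fun z => r (v z)) (fun j => r (x j)) j = r (S.lo v x j) := by
    intro j; unfold lo; split_ifs <;> rfl
  unfold CornerOrder at *
  simp only [u, u', w, w'] at *
  obtain ⟨p1, p2⟩ := hP ab (by simp)
  obtain ⟨p3, p4⟩ := hP bc (by simp)
  obtain ⟨p5, p6⟩ := hP ac (by simp)
  rw [hr _ _ p5 p1, hr _ _ p1 p5, hr _ _ p4 p6, hr _ _ p6 p4]
  exact h

end ArcSystem

/-! ### From pages and a list of nodes to a book embedding. -/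

namespace EmbeddedDigraph

variable {n : ℕ} {G : EmbeddedDigraph n} {m : ℕ} {q : ℕ → Fin n × Fin n} {first : ℕ → ℕ}
  {F E : ℕ → Bool} {l : List ℕ}

/-- The drawing `D` realizes the pages and the list of nodes, with ranks `r`. -/
structure Realizes (G : EmbeddedDigraph n) (q : ℕ → Fin n × Fin n) (m : ℕ) (F E : ℕ → Bool)
    (r : ℕ → ℕ) (D : BookDrawing n) : Prop where
  pos : ∀ v : Fin n, D.pos v = r (v.val + 1)
  crossings : ∀ k < m, D.crossings (G.tail (q k)) (G.head (q k)) =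
    if F k ≠ E k then [r (n + 1 + k)] else []
  firstPage : ∀ k < m, D.firstPage (G.tail (q k)) (G.head (q k)) = (F k == G.dir (q k))

lemma IsArcOrder.exists_index (ho : G.IsArcOrder m q first) {u v : Fin n} (h : G.arc u v = true) :
    ∃ k < m, u = G.tail (q k) ∧ v = G.head (q k) := by
  have hH : G.IsHalfEdge (u, v) := isHalfEdge_of_dir h
  have e := eq_ends_of_dir (d := (u, v)) h
  rcases isEntry_or_swap hH with he | he
  · obtain ⟨k, hk, e'⟩ := ho.surj _ he
    exact ⟨k, hk, by rw [e']; exact congrArg Prod.fst e.1, by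
      rw [e']; exact congrArg Prod.snd e.1⟩
  · obtain ⟨k, hk, e'⟩ := ho.surj _ he
    refine ⟨k, hk, ?_, ?_⟩
    · rw [e', tail_swap hH]; exact congrArg Prod.fst e.1
    · rw [e', head_swap hH]; exact congrArg Prod.snd e.1

/-- The number of spine crossings, summed along an enumeration of the arcs. -/
lemma IsArcOrder.numSpineCrossings_eq (ho : G.IsArcOrder m q first) (D : BookDrawing n) :
    G.numSpineCrossings D =
      ∑ k ∈ Finset.range m, (D.crossings (G.tail (q k)) (G.head (q k))).length := by
  unfold numSpineCrossings
  symm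
  refine Finset.sum_bij (fun k _ => (G.tail (q k), G.head (q k))) ?_ ?_ ?_ ?_
  · intro k hk
    have := (ho.entry k (Finset.mem_range.1 hk)).1.arc
    simpa [arcs] using this
  · intro j hj k hk e
    rw [Finset.mem_range] at hj hk
    exact ho.bfs.injOn j hj k hk ((ho.entry j hj).eq_of_arc_eq (ho.entry k hk)
      (congrArg Prod.fst e) (congrArg Prod.snd e))
  · rintro ⟨u, v⟩ h
    obtain ⟨k, hk, rfl, rfl⟩ := ho.exists_index (by simpa [arcs] using h : G.arc u v = true)
    exact ⟨k, Finset.mem_range.2 hk, rfl⟩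
  · intro k _; rfl

section

variable {r : ℕ → ℕ} {D : BookDrawing n} (hD : G.Realizes q m F E r D)
include hD

lemma Realizes.segments {k : ℕ} (hk : k < m) : D.segments (G.tail (q k)) (G.head (q k)) =
    if F k ≠ E k then
      [(r ((G.tail (q k)).val + 1), r (n + 1 + k), (F k == G.dir (q k))),
        (r (n + 1 + k), r ((G.head (q k)).val + 1), (E k == G.dir (q k)))]
    else [(r ((G.tail (q k)).val + 1), r ((G.head (q k)).val + 1), (F k == G.dir (q k)))] := by
  unfold BookDrawing.segments
  rw [hD.pos, hD.pos, hD.crossings k hk, hD.firstPage k hk]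
  by_cases h : F k = E k
  · simp [h, BookDrawing.segmentsAux]
  · simp only [ne_eq, h, not_false_eq_true, if_true, BookDrawing.segmentsAux]
    have : (!(F k == G.dir (q k))) = (E k == G.dir (q k)) := by
      revert h; cases F k <;> cases E k <;> cases G.dir (q k) <;> decide
    rw [this]

lemma Realizes.direction_tail {k : ℕ} (hk : k < m) (ha : G.IsHalfEdge (q k)) :
    G.direction D (G.tail (q k)) (G.head (q k)) =
      if (F k == G.dir (q k)) = true then
        toLex (1, -(((G.arcSystem q F E).up (fun v => r (v.val + 1)) (fun j => r (n + 1 + j)) k :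
          ℕ) : ℤ))
      else toLex (2, ((G.arcSystem q F E).up (fun v => r (v.val + 1)) (fun j => r (n + 1 + j)) k :
          ℕ)) := by
  unfold direction
  rw [if_pos ha.arc]
  unfold BookDrawing.firstSegment
  rw [hD.segments hk]
  have hu : (G.arcSystem q F E).up (fun v => r (v.val + 1)) (fun j => r (n + 1 + j)) k =
      if F k ≠ E k then r (n + 1 + k) else r ((G.head (q k)).val + 1) := by
    unfold ArcSystem.up
    exact if_congr beq_ne_beq rfl rfl
  rw [hu]
  by_cases h : F k = E k <;> simp [h]

lemma Realizes.direction_head {k : ℕ} (hk : k < m) (ha : G.IsHalfEdge (q k)) :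
    G.direction D (G.head (q k)) (G.tail (q k)) =
      if (E k == G.dir (q k)) = true then
        toLex (0, -(((G.arcSystem q F E).lo (fun v => r (v.val + 1)) (fun j => r (n + 1 + j)) k :
          ℕ) : ℤ))
      else toLex (3, ((G.arcSystem q F E).lo (fun v => r (v.val + 1)) (fun j => r (n + 1 + j)) k :
          ℕ)) := by
  unfold direction
  rw [if_neg (by rw [G.asymm _ _ ha.arc]; decide)]
  unfold BookDrawing.lastSegment
  rw [hD.segments hk]
  have hu : (G.arcSystem q F E).lo (fun v => r (v.val + 1)) (fun j => r (n + 1 + j)) k =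
      if F k ≠ E k then r (n + 1 + k) else r ((G.tail (q k)).val + 1) := by
    unfold ArcSystem.lo
    exact if_congr beq_ne_beq rfl rfl
  rw [hu]
  by_cases h : F k = E k <;> simp [h]

/-- A triangle whose corners are in order is drawn in order. -/
lemma Realizes.sorted_of_cornersAt {s : Bool} {ab bc ac : ℕ} {e : Fin n × Fin n}
    (h1 : ab < m) (h2 : bc < m) (h3 : ac < m)
    (a1 : G.IsHalfEdge (q ab)) (a2 : G.IsHalfEdge (q bc)) (a3 : G.IsHalfEdge (q ac))
    (t1 : G.tail (q ab) = G.tail (q ac)) (t2 : G.head (q bc) = G.head (q ac))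
    (hc : G.CornersAt s (q ab) (q bc) (q ac) e)
    (ho : (G.arcSystem q F E).CornerOrder (fun v => r (v.val + 1)) (fun j => r (n + 1 + j))
      s ab bc ac) {d : Fin n × Fin n} (hd : G.facePerm.SameCycle e d) :
    (G.dir d = false → G.dir (G.facePerm d) = true →
      G.direction D d.2 d.1 < G.direction D d.2 (G.facePerm d).2) ∧
    (G.dir d = true → G.dir (G.facePerm d) = false →
      ((ofLex (G.direction D d.2 d.1)).1 = 0 → (ofLex (G.direction D d.2 (G.facePerm d).2)).1 = 0 ∧
        G.direction D d.2 d.1 < G.direction D d.2 (G.facePerm d).2) ∧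
      ((ofLex (G.direction D d.2 d.1)).1 ≠ 0 → (ofLex (G.direction D d.2 (G.facePerm d).2)).1 ≠ 0 →
        G.direction D d.2 d.1 < G.direction D d.2 (G.facePerm d).2)) := by
  obtain ⟨c1, c2, c3, c4, c5, c6⟩ := ho
  obtain ⟨k1, k2⟩ := hc d hd
  have db1 := hD.direction_tail h1 a1
  have db2 := hD.direction_head h2 a2
  have db3 := hD.direction_tail h3 a3
  have db4 := hD.direction_head h3 a3
  rw [t1] at db1
  rw [t2] at db2
  generalize (G.arcSystem q F E).up (fun v => r (v.val + 1)) (fun j => r (n + 1 + j)) ab = u1 at *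
  generalize (G.arcSystem q F E).up (fun v => r (v.val + 1)) (fun j => r (n + 1 + j)) ac = u2 at *
  generalize (G.arcSystem q F E).lo (fun v => r (v.val + 1)) (fun j => r (n + 1 + j)) bc = l1 at *
  generalize (G.arcSystem q F E).lo (fun v => r (v.val + 1)) (fun j => r (n + 1 + j)) ac = l2 at *
  change (F ac == G.dir (q ac)) = s → (F ab == G.dir (q ab)) = s at c1
  change (F ab == G.dir (q ab)) = (F ac == G.dir (q ac)) → (F ac == G.dir (q ac)) = s → _ at c2
  change (F ab == G.dir (q ab)) = (F ac == G.dir (q ac)) → (F ac == G.dir (q ac)) ≠ s → _ at c3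
  change (E ac == G.dir (q ac)) = s → (E bc == G.dir (q bc)) = s at c4
  change (E bc == G.dir (q bc)) = (E ac == G.dir (q ac)) → (E ac == G.dir (q ac)) = s → _ at c5
  change (E bc == G.dir (q bc)) = (E ac == G.dir (q ac)) → (E ac == G.dir (q ac)) ≠ s → _ at c6
  generalize (F ab == G.dir (q ab)) = f1 at *
  generalize (F ac == G.dir (q ac)) = f2 at *
  generalize (E bc == G.dir (q bc)) = g1 at *
  generalize (E ac == G.dir (q ac)) = g2 at *
  constructor
  · intro d1 d2
    obtain ⟨m1, m2⟩ := k1 d1 d2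
    cases s
    · obtain ⟨e1, e2⟩ := m2 rfl
      rw [e2, e1]
      show G.direction D (G.tail (q ac)) (G.head (q ac)) <
        G.direction D (G.tail (q ac)) (G.head (q ab))
      rw [db1, db3, Prod.Lex.lt_iff]
      cases f1 <;> cases f2 <;> simp at c1 c2 c3 ⊢ <;> omega
    · obtain ⟨e1, e2⟩ := m1 rfl
      rw [e2, e1]
      show G.direction D (G.tail (q ab)) (G.head (q ab)) <
        G.direction D (G.tail (q ab)) (G.head (q ac))
      rw [t1, db1, db3, Prod.Lex.lt_iff]
      cases f1 <;> cases f2 <;> simp at c1 c2 c3 ⊢ <;> omega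
  · intro d1 d2
    obtain ⟨m1, m2⟩ := k2 d1 d2
    cases s
    · obtain ⟨e1, e2⟩ := m2 rfl
      rw [e2, e1]
      simp only
      rw [t2, db2, db4, Prod.Lex.lt_iff]
      cases g1 <;> cases g2 <;> simp at c4 c5 c6 ⊢ <;> omega
    · obtain ⟨e1, e2⟩ := m1 rfl
      rw [e2, e1]
      simp only
      rw [db2, db4, Prod.Lex.lt_iff]
      cases g1 <;> cases g2 <;> simp at c4 c5 c6 ⊢ <;> omega

/-- A complete drawing is a book embedding that preserves the embedding. -/
theorem Realizes.isOneCrossingBookEmbedding (hG : G.IsOuterplanarTriangulatedST)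
    (ho : G.IsArcOrder m q first) {pos : ℕ → ℚ}
    (h : G.Stage q first F E m m (G.visited q m) l pos)
    (hr : ∀ a b, a ∈ l → b ∈ l → (r a < r b ↔ pos a < pos b)) :
    G.IsOneCrossingBookEmbedding D := by
  have hv : ∀ v : Fin n, v.val + 1 ∈ l := fun v => (h.mem _).2 (.inl ⟨v, ho.mem_visited hG v, rfl⟩)
  have hx : ∀ k < m, F k ≠ E k → n + 1 + k ∈ l := fun k hk e => (h.mem _).2 (.inr ⟨k, hk, e, rfl⟩)
  have hd := h.drawn
  have inj : ∀ {a b}, a ∈ l → b ∈ l → r a = r b → pos a = pos b := by grind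
  have upw : ∀ k < m, r ((G.tail (q k)).val + 1) < r ((G.head (q k)).val + 1) :=
    fun k hk => (hr _ _ (hv _) (hv _)).2 (hd.upward k hk)
  have tlx : ∀ k < m, F k ≠ E k → r ((G.tail (q k)).val + 1) < r (n + 1 + k) :=
    fun k hk e => (hr _ _ (hv _) (hx k hk e)).2 (hd.tl_lt k hk (beq_ne_beq.2 e))
  have xhd : ∀ k < m, F k ≠ E k → r (n + 1 + k) < r ((G.head (q k)).val + 1) :=
    fun k hk e => (hr _ _ (hx k hk e) (hv _)).2 (hd.lt_hd k hk (beq_ne_beq.2 e))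
  have seg : ∀ k < m, ∀ e ∈ D.segments (G.tail (q k)) (G.head (q k)),
      ∃ a b, a ∈ l ∧ b ∈ l ∧ e.1 = r a ∧ e.2.1 = r b ∧
        (G.arcSystem q F E).Seg (fun v => pos (v.val + 1)) (fun j => pos (n + 1 + j)) k
          (pos a) (pos b) e.2.2 := by
    intro k hk e he
    rw [hD.segments hk] at he
    by_cases hfe : F k = E k
    · rw [if_neg (not_not.2 hfe), List.mem_singleton] at he
      subst he
      exact ⟨_, _, hv _, hv _, rfl, rfl, .inl ⟨by show (F k == _) = (E k == _); rw [hfe],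
        rfl, rfl, rfl⟩⟩
    · rw [if_pos hfe, List.mem_cons, List.mem_singleton] at he
      rcases he with rfl | rfl
      · exact ⟨_, _, hv _, hx k hk hfe, rfl, rfl, .inr (.inl ⟨beq_ne_beq.2 hfe, rfl, rfl, rfl⟩)⟩
      · exact ⟨_, _, hx k hk hfe, hv _, rfl, rfl, .inr (.inr ⟨beq_ne_beq.2 hfe, rfl, rfl, rfl⟩)⟩
  have hup : ∀ u v, G.arc u v = true → D.pos u < D.pos v := by
    intro u v huv
    obtain ⟨k, hk, rfl, rfl⟩ := ho.exists_index huv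
    rw [hD.pos, hD.pos]; exact upw k hk
  refine ⟨⟨?_, ?_, ?_, ?_, ?_⟩, ?_, ?_⟩
  · intro u v e
    rw [hD.pos, hD.pos] at e
    exact hd.pv_inj u v (ho.mem_visited hG u) (ho.mem_visited hG v) (inj (hv u) (hv v) e)
  · intro u v huv
    obtain ⟨k, hk, rfl, rfl⟩ := ho.exists_index huv
    rw [hD.pos, hD.pos, hD.crossings k hk]
    by_cases hfe : F k = E k
    · simp [hfe, upw k hk]
    · grind
  · intro u v huv c hc w
    obtain ⟨k, hk, rfl, rfl⟩ := ho.exists_index huv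
    rw [hD.crossings k hk] at hc
    by_cases hfe : F k = E k
    · simp [hfe] at hc
    · rw [if_pos hfe, List.mem_singleton] at hc
      rw [hc, hD.pos]
      intro e
      exact hd.px_ne k w hk (beq_ne_beq.2 hfe) (ho.mem_visited hG w)
        (inj (hx k hk hfe) (hv w) e)
  · intro u v u' v' huv huv' hne c hc hc'
    obtain ⟨k, hk, rfl, rfl⟩ := ho.exists_index huv
    obtain ⟨k', hk', rfl, rfl⟩ := ho.exists_index huv'
    rw [hD.crossings k hk] at hc
    rw [hD.crossings k' hk'] at hc'
    by_cases hfe : F k = E k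
    · simp [hfe] at hc
    by_cases hfe' : F k' = E k'
    · simp [hfe'] at hc'
    rw [if_pos hfe, List.mem_singleton] at hc
    rw [if_pos hfe', List.mem_singleton] at hc'
    refine hne ?_
    rw [hd.px_inj k k' hk hk' (beq_ne_beq.2 hfe) (beq_ne_beq.2 hfe')
      (inj (hx k hk hfe) (hx k' hk' hfe') (hc.symm.trans hc'))]
  · intro u v u' v' huv huv' e he e' he' hp
    obtain ⟨k, hk, rfl, rfl⟩ := ho.exists_index huv
    obtain ⟨k', hk', rfl, rfl⟩ := ho.exists_index huv'
    obtain ⟨a, b, ha, hb, e1, e2, e3⟩ := seg k hk e he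
    obtain ⟨a', b', ha', hb', e1', e2', e3'⟩ := seg k' hk' e' he'
    rw [e1, e2, e1', e2', hr _ _ ha ha', hr _ _ ha' hb, hr _ _ hb hb']
    rw [hp] at e3
    exact hd.planar k k' _ _ _ _ _ hk hk' e3 e3'
  · refine SortedCorners.preservesEmbedding hG ?_ hup
    have up_mem : ∀ j < m,
        (G.arcSystem q F E).up (fun v => v.val + 1) (fun j => n + 1 + j) j ∈ l ∧
        (G.arcSystem q F E).lo (fun v => v.val + 1) (fun j => n + 1 + j) j ∈ l := by
      intro j hj
      unfold ArcSystem.up ArcSystem.lo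
      constructor
      · split_ifs with h1
        · exact hx j hj (beq_ne_beq.1 h1)
        · exact hv _
      · split_ifs with h1
        · exact hx j hj (beq_ne_beq.1 h1)
        · exact hv _
    -- Every internal corner belongs to the triangle of some enumerated entry, and the order of the
    -- arcs there was recorded when that triangle was inserted.
    have key : ∀ d, G.IsHalfEdge d → ¬ G.Ext d →
      (G.dir d = false → G.dir (G.facePerm d) = true →
        G.direction D d.2 d.1 < G.direction D d.2 (G.facePerm d).2) ∧
      (G.dir d = true → G.dir (G.facePerm d) = false →
        ((ofLex (G.direction D d.2 d.1)).1 = 0 →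
          (ofLex (G.direction D d.2 (G.facePerm d).2)).1 = 0 ∧
          G.direction D d.2 d.1 < G.direction D d.2 (G.facePerm d).2) ∧
        ((ofLex (G.direction D d.2 d.1)).1 ≠ 0 →
          (ofLex (G.direction D d.2 (G.facePerm d).2)).1 ≠ 0 →
          G.direction D d.2 d.1 < G.direction D d.2 (G.facePerm d).2)) := by
      intro d hdH hdE
      obtain ⟨e, he, heE⟩ := hG.exists_entry hdH hdE
      have heX : ¬ G.Ext e := fun hc =>
        hdE (ext_iff_sameCycle.2 ((ext_iff_sameCycle.1 hc).trans he.symm))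
      obtain ⟨k, hk, rfl⟩ := ho.surj e heE
      obtain ⟨e1, e2, e3⟩ := ho.triangle_kids hk heX
      have hm := e3.trans_le (ho.first_le_total (k := k + 1) hk)
      obtain ⟨c1, c2⟩ := hG.cornersAt heE heX
      obtain ⟨o1, o2⟩ := h.corners k hk heX
      obtain ⟨-, -, t1, t2, t3, ht⟩ := hG.triangle heE heX
      by_cases hmid : G.MidApex (q k)
      · obtain ⟨-, -, t5, t6, t7⟩ := ht.resolve_right (fun h => h.1 hmid)
        have c1 := c1 hmid
        rw [← e1, ← e2] at c1
        rw [← e1] at t1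
        rw [← e2] at t6
        refine hD.sorted_of_cornersAt (by omega) hm hk (ho.entry _ (by omega)).1
          (ho.entry _ hm).1 heE.1 t1 t6 c1 ((o1 hmid).map hr ?_) he.symm
        rintro j (rfl | rfl | rfl) <;> exact up_mem _ (by omega)
      · obtain ⟨-, -, t5, t6, t7⟩ := ht.resolve_left (fun h => hmid h.1)
        have c2 := c2 hmid
        rw [← e1, ← e2] at c2
        rw [← e1] at t1 t2
        rw [← e2, ← t2] at t6
        refine hD.sorted_of_cornersAt hk hm (by omega) heE.1
          (ho.entry _ hm).1 (ho.entry _ (by omega)).1 t1.symm t6 c2 ((o2 hmid).map hr ?_) he.symm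
        rintro j (rfl | rfl | rfl) <;> exact up_mem _ (by omega)
    exact ⟨fun d h1 h2 => (key d h1 h2).1, fun d h1 h2 => (key d h1 h2).2⟩
  · intro u v huv
    obtain ⟨k, hk, rfl, rfl⟩ := ho.exists_index huv
    rw [hD.crossings k hk]
    split_ifs <;> simp

lemma Realizes.numSpineCrossings_eq (ho : G.IsArcOrder m q first) :
    G.numSpineCrossings D = ∑ k ∈ Finset.range m, pagingCost F E k := by
  rw [ho.numSpineCrossings_eq]
  refine Finset.sum_congr rfl fun k hk => ?_
  rw [hD.crossings k (Finset.mem_range.1 hk)]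
  unfold pagingCost
  split_ifs <;> simp_all

end

end EmbeddedDigraph

/-! ### Necessary conditions: consequences of planarity in an arbitrary drawing. -/

namespace ArcSystem

variable {V : Type*} {S : ArcSystem V} {m : ℕ} {pv : V → ℕ} {px : ℕ → ℕ}

/-- The arcs `0, …, m - 1` are drawn upwards and without crossings. -/
structure IsBook (S : ArcSystem V) (m : ℕ) (pv : V → ℕ) (px : ℕ → ℕ) : Prop where
  upward : ∀ j < m, pv (S.tl j) < pv (S.hd j)
  tl_lt : ∀ j < m, S.f j ≠ S.g j → pv (S.tl j) < px j
  lt_hd : ∀ j < m, S.f j ≠ S.g j → px j < pv (S.hd j)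
  pv_inj : ∀ v w, pv v = pv w → v = w
  px_ne : ∀ j < m, ∀ v, S.f j ≠ S.g j → px j ≠ pv v
  px_inj : ∀ j < m, ∀ k < m, S.f j ≠ S.g j → S.f k ≠ S.g k → px j = px k → j = k
  planar : ∀ j < m, ∀ k < m, ∀ l h l' h' c, S.Seg pv px j l h c → S.Seg pv px k l' h' c →
    ¬ (l < l' ∧ l' < h ∧ h < h')

/-- No segment on the page `p` passes `v`. -/
def Exposed (S : ArcSystem V) (m : ℕ) (pv : V → ℕ) (px : ℕ → ℕ) (p : Bool) (v : V) : Prop :=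
  ∀ k < m, ∀ l u, S.Seg pv px k l u p → ¬ (l < pv v ∧ pv v < u)

namespace IsBook

lemma seg_cover {j y : ℕ} (h1 : pv (S.tl j) < y) (h2 : y < pv (S.hd j))
    (h3 : S.f j ≠ S.g j → y ≠ px j) : ∃ l u c, S.Seg pv px j l u c ∧ l < y ∧ y < u := by
  by_cases hc : S.f j = S.g j
  · exact ⟨_, _, _, .inl ⟨hc, rfl, rfl, rfl⟩, h1, h2⟩
  · rcases lt_or_gt_of_ne (h3 hc) with h4 | h4
    · exact ⟨_, _, _, .inr (.inl ⟨hc, rfl, rfl, rfl⟩), h1, h4⟩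
    · exact ⟨_, _, _, .inr (.inr ⟨hc, rfl, rfl, rfl⟩), h4, h2⟩

variable (h : S.IsBook m pv px)
include h

lemma seg_bounds {j : ℕ} (hj : j < m) {l u : ℕ} {c : Bool} (hs : S.Seg pv px j l u c) :
    pv (S.tl j) ≤ l ∧ l < u ∧ u ≤ pv (S.hd j) := by
  rcases hs with ⟨e, rfl, rfl, -⟩ | ⟨e, rfl, rfl, -⟩ | ⟨e, rfl, rfl, -⟩
  · exact ⟨le_rfl, h.upward j hj, le_rfl⟩
  · exact ⟨le_rfl, h.tl_lt j hj e, (h.lt_hd j hj e).le⟩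
  · exact ⟨(h.tl_lt j hj e).le, h.lt_hd j hj e, le_rfl⟩

lemma seg_tl {j : ℕ} (hj : j < m) {v : V} {u : ℕ} {c : Bool} (hs : S.Seg pv px j (pv v) u c) :
    S.tl j = v ∧ S.f j = c ∧ S.up pv px j = u := by
  unfold up
  rcases hs with ⟨e, h1, rfl, e'⟩ | ⟨e, h1, rfl, e'⟩ | ⟨e, h1, -, -⟩
  · exact ⟨(h.pv_inj _ _ h1).symm, e'.symm, if_neg (not_not.2 e)⟩
  · exact ⟨(h.pv_inj _ _ h1).symm, e'.symm, if_pos e⟩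
  · exact absurd h1.symm (h.px_ne j hj v e)

/-- A crossing point belongs to one arc only and is not a vertex, so no other arc has a segment
starting there. -/
lemma seg_lower_ne {j k : ℕ} (hj : j < m) (hk : k < m) (hjk : k ≠ j) (e : S.f j ≠ S.g j) {u : ℕ}
    {c : Bool} (hs : S.Seg pv px k (px j) u c) : False := by
  rcases hs with ⟨-, h1, -, -⟩ | ⟨-, h1, -, -⟩ | ⟨e', h1, -, -⟩
  · exact h.px_ne j hj _ e h1
  · exact h.px_ne j hj _ e h1
  · exact hjk (h.px_inj j hj k hk e e' h1).symm

/-- The side of a triangle that passes the third vertex does so on the other page. -/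
theorem triangle {q : Bool} {ab bc ac : ℕ} (h1 : ab < m) (h2 : bc < m) (h3 : ac < m)
    (ta : S.tl ab = S.tl ac) (tb : S.hd ab = S.tl bc) (tc : S.hd bc = S.hd ac)
    (hb : S.Exposed m pv px q (S.hd ab)) :
    (S.f ac = q → S.f ab = q) ∧ (S.g ac = q → S.g bc = q) ∧ ¬ (S.f ac = q ∧ S.g ac = q) := by
  have u1 := h.upward ab h1
  have u2 := h.upward bc h2
  have x1 := h.tl_lt ab h1
  have y1 := h.lt_hd ab h1
  have x2 := h.tl_lt bc h2
  have y2 := h.lt_hd bc h2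
  rw [ta] at u1 x1
  rw [tb] at u1 y1
  rw [tc] at u2 y2
  rw [tb] at hb
  have hpl := h.planar
  have hne1 : ab ≠ ac := by grind
  have hne2 : bc ≠ ac := by grind
  have neg : ∀ {c : Bool}, c ≠ q → c = !q := by intro c; cases c <;> cases q <;> decide
  have neg' : ∀ {c d : Bool}, c ≠ q → c ≠ d → d = q := by
    intro c d; cases c <;> cases d <;> cases q <;> decide
  have n1 : (!q) ≠ q := by cases q <;> decide
  refine ⟨fun hf => ?_, fun hg => ?_, fun hfg => ?_⟩
  -- The first segment of `ac` on page `q` must end before the exposed vertex `b`, so from its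
  -- crossing on `ac` passes `b` on the other page. If `ab` leaves on that other page, then, without
  -- a crossing or with a crossing above that of `ac`, its first segment meets the second segment of
  -- `ac`; with a lower crossing its second segment meets the first segment of `ac`.
  · by_contra hab
    by_cases hx : S.f ac = S.g ac
    · exact hb ac h3 _ _ (.inl ⟨hx, rfl, rfl, hf.symm⟩) ⟨u1, u2⟩
    have z1 := h.tl_lt ac h3 hx
    have z2 := h.lt_hd ac h3 hx
    have s1 : S.Seg pv px ac _ _ q := .inr (.inl ⟨hx, rfl, rfl, hf.symm⟩)
    have gne : S.g ac = !q := neg fun e => hx (hf.trans e.symm)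
    have s2 : S.Seg pv px ac _ _ (!q) := .inr (.inr ⟨hx, rfl, rfl, gne.symm⟩)
    have hlt : px ac < pv (S.tl bc) := by
      have := hb ac h3 _ _ s1
      have := h.px_ne ac h3 (S.tl bc) hx
      omega
    by_cases hx' : S.f ab = S.g ab
    · have s3 : S.Seg pv px ab _ _ (!q) := .inl ⟨hx', rfl, rfl, (neg hab).symm⟩
      rw [ta, tb] at s3
      exact hpl ab h1 ac h3 _ _ _ _ _ s3 s2 ⟨z1, hlt, u2⟩
    · have s3 : S.Seg pv px ab _ _ (!q) := .inr (.inl ⟨hx', rfl, rfl, (neg hab).symm⟩)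
      have s4 : S.Seg pv px ab _ _ q := .inr (.inr ⟨hx', rfl, rfl, (neg' hab hx').symm⟩)
      rw [ta] at s3
      rw [tb] at s4
      have x1 := x1 hx'
      have y1 := y1 hx'
      have hne : px ab ≠ px ac := fun e => hne1 (h.px_inj ab h1 ac h3 hx' hx e)
      rcases lt_or_gt_of_ne hne with h5 | h5
      · grind
      · grind
  -- The mirror image of the previous case, with the lower and the upper ends exchanged.
  · by_contra hbc
    by_cases hx : S.f ac = S.g ac
    · exact hb ac h3 _ _ (.inl ⟨hx, rfl, rfl, (hx.trans hg).symm⟩) ⟨u1, u2⟩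
    have z1 := h.tl_lt ac h3 hx
    have z2 := h.lt_hd ac h3 hx
    have s2 : S.Seg pv px ac _ _ q := .inr (.inr ⟨hx, rfl, rfl, hg.symm⟩)
    have fne : S.f ac = !q := neg fun e => hx (e.trans hg.symm)
    have s1 : S.Seg pv px ac _ _ (!q) := .inr (.inl ⟨hx, rfl, rfl, fne.symm⟩)
    have hlt : pv (S.tl bc) < px ac := by
      have := hb ac h3 _ _ s2
      have := h.px_ne ac h3 (S.tl bc) hx
      omega
    by_cases hx' : S.f bc = S.g bc
    · have s3 : S.Seg pv px bc _ _ (!q) := .inl ⟨hx', rfl, rfl, (neg (hx' ▸ hbc)).symm⟩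
      rw [tc] at s3
      exact hpl ac h3 bc h2 _ _ _ _ _ s1 s3 ⟨u1, hlt, z2⟩
    · have s3 : S.Seg pv px bc _ _ q := .inr (.inl ⟨hx', rfl, rfl, (neg' hbc (Ne.symm hx')).symm⟩)
      have s4 : S.Seg pv px bc _ _ (!q) := .inr (.inr ⟨hx', rfl, rfl, (neg hbc).symm⟩)
      rw [tc] at s4
      have x2 := x2 hx'
      have y2 := y2 hx'
      have hne : px bc ≠ px ac := fun e => hne2 (h.px_inj bc h2 ac h3 hx' hx e)
      rcases lt_or_gt_of_ne hne with h5 | h5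
      · grind
      · grind
  · exact hb ac h3 _ _ (.inl ⟨hfg.1.trans hfg.2.symm, rfl, rfl, hfg.1.symm⟩) ⟨u1, u2⟩

/-- The end of the outermost arc on the side `p` at an exposed vertex is exposed. -/
theorem exposed_hd {p : Bool} {j : ℕ} (hj : j < m) (hv : S.Exposed m pv px p (S.tl j))
    (hext : ∀ k < m, S.tl k = S.tl j →
      (S.f k = p → S.f j = p ∧ S.up pv px k ≤ S.up pv px j) ∧
      (S.f j ≠ p → S.f k ≠ p ∧ S.up pv px j ≤ S.up pv px k))
    (hin : ∀ z, pv (S.tl j) < pv z → ∃ k < m, S.hd k = z) :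
    S.Exposed m pv px p (S.hd j) := by
  have neg : ∀ {c : Bool}, c ≠ p → c = !p := by intro c; cases c <;> cases p <;> decide
  have n1 : ∀ {c : Bool}, c = !p → c ≠ p := by intro c; cases c <;> cases p <;> decide
  -- the point at the lower end of a segment is the upper end of another one
  have arrive : ∀ k < m, ∀ l u c, S.Seg pv px k l u c → pv (S.tl j) < l →
      ∃ k' < m, ∃ l' c', S.Seg pv px k' l' l c' ∧ (k' = k ∨ pv (S.hd k') = l) := by
    intro k hk l u c hs hl
    have key : ∀ z, pv (S.tl j) < pv z → ∃ k' < m, ∃ l' c', S.Seg pv px k' l' (pv z) c' ∧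
        (k' = k ∨ pv (S.hd k') = pv z) := by
      intro z hz
      obtain ⟨k', hk', rfl⟩ := hin z hz
      by_cases hx : S.f k' = S.g k'
      · exact ⟨k', hk', _, _, .inl ⟨hx, rfl, rfl, rfl⟩, .inr rfl⟩
      · exact ⟨k', hk', _, _, .inr (.inr ⟨hx, rfl, rfl, rfl⟩), .inr rfl⟩
    rcases hs with ⟨e, rfl, -, -⟩ | ⟨e, rfl, -, -⟩ | ⟨e, rfl, -, -⟩
    · exact key _ hl
    · exact key _ hl
    · exact ⟨k, hk, _, _, .inr (.inl ⟨e, rfl, rfl, rfl⟩), .inl rfl⟩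
  -- No other arc can arrive at a point under a segment of `j` on the far page. Following incoming
  -- segments downwards from such a point never escapes: leaving the enclosed interval would cross
  -- `j`, pass the exposed tail, or contradict that `j` is outermost. Positions are natural numbers,
  -- so the descent ends.
  have claim : ∀ y, ∀ α β, S.Seg pv px j α β (!p) → α < y → y < β →
      ∀ k < m, k ≠ j → ∀ y' c, S.Seg pv px k y' y c → False := by
    intro y
    induction y using Nat.strong_induction_on with
    | _ y ih =>
    intro α β hs hα hβ k hk hkj y' c hk'
    obtain ⟨b1, b2, b3⟩ := h.seg_bounds hj hs
    obtain ⟨-, c2, -⟩ := h.seg_bounds hk hk'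
    have descend : α < y' → False := by
      intro hy'
      obtain ⟨k', hk'', l', c', hs', hor⟩ := arrive k hk y' y c hk' (by omega)
      refine ih y' c2 α β hs hy' (by omega) k' hk'' ?_ l' c' hs'
      rintro rfl
      rcases hor with rfl | hor
      · exact hkj rfl
      · omega
    have low : S.f j ≠ S.g j → α = px j → y' = α → False := by
      intro e e1 e2
      rw [e2, e1] at hk'
      exact h.seg_lower_ne hj hk hkj e hk'
    by_cases hc : c = p
    · subst hc
      rcases Nat.lt_trichotomy y' (pv (S.tl j)) with h1 | h1 | h1
      · exact hv k hk _ _ hk' ⟨h1, by omega⟩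
      · rw [h1] at hk'
        obtain ⟨e1, e2, e3⟩ := h.seg_tl hk hk'
        obtain ⟨e4, e5⟩ := (hext k hk e1).1 e2
        rcases hs with ⟨e, -, -, e'⟩ | ⟨e, -, -, e'⟩ | ⟨e, e6, -, -⟩
        · exact n1 e'.symm e4
        · exact n1 e'.symm e4
        · rw [show S.up pv px j = px j from if_pos e] at e5; omega
      · rcases Nat.lt_trichotomy y' α with h2 | h2 | h2
        · rcases hs with ⟨e, e6, -, e'⟩ | ⟨e, e6, -, e'⟩ | ⟨e, e6, -, e'⟩
          · omega
          · omega
          · have hf : S.f j = c := by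
              by_contra hf; exact e ((neg hf).trans e')
            exact h.planar j hj k hk _ _ _ _ _ (.inr (.inl ⟨e, rfl, rfl, hf.symm⟩)) hk'
              ⟨h1, by omega, by omega⟩
        · rcases hs with ⟨e, e6, -, e'⟩ | ⟨e, e6, -, e'⟩ | ⟨e, e6, -, e'⟩
          · omega
          · omega
          · exact low e e6 h2
        · exact descend h2
    · obtain rfl := neg hc
      rcases Nat.lt_trichotomy y' α with h2 | h2 | h2
      · exact h.planar k hk j hj _ _ _ _ _ hk' hs ⟨h2, hα, hβ⟩
      · by_cases hlow : α = pv (S.tl j)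
        · rw [h2, hlow] at hk'
          obtain ⟨e1, e2, e3⟩ := h.seg_tl hk hk'
          rw [hlow] at hs
          obtain ⟨-, e5, e6⟩ := h.seg_tl hj hs
          have := ((hext k hk e1).2 (n1 e5)).2
          omega
        · rcases hs with ⟨e, e6, -, e'⟩ | ⟨e, e6, -, e'⟩ | ⟨e, e6, -, e'⟩
          · exact hlow e6
          · exact hlow e6
          · exact low e e6 h2
      · exact descend h2
  intro k hk l u hs hlu
  obtain ⟨h1, h2⟩ := hlu
  have hkj : k ≠ j := by
    rintro rfl
    have := h.seg_bounds hk hs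
    omega
  have hup : S.up pv px j ≤ pv (S.hd j) := by
    unfold up; split_ifs with e
    · exact (h.lt_hd j hj e).le
    · exact le_rfl
  have huj := h.upward j hj
  -- A segment on page `p` that passes the head of `j` cannot start below the exposed tail, nor at
  -- the tail, as `j` is outermost there. If it starts higher, it starts under a segment of `j`: on
  -- page `p` the two cross, and on the other page the claim is violated, since something arrives at
  -- its lower end.
  rcases Nat.lt_trichotomy l (pv (S.tl j)) with h3 | h3 | h3
  · exact hv k hk _ _ hs ⟨h3, by omega⟩
  · rw [h3] at hs
    obtain ⟨e1, e2, e3⟩ := h.seg_tl hk hs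
    have := ((hext k hk e1).1 e2).2
    omega
  · obtain ⟨α, β, c, hs', h4, h5⟩ := seg_cover h3 h1 (fun e e' => by
      rw [e'] at hs; exact h.seg_lower_ne hj hk hkj e hs)
    obtain ⟨-, -, b3⟩ := h.seg_bounds hj hs'
    by_cases hc : c = p
    · subst hc
      exact h.planar j hj k hk _ _ _ _ _ hs' hs ⟨h4, h5, by omega⟩
    · obtain rfl := neg hc
      obtain ⟨k', hk', l', c', hs'', hor⟩ := arrive k hk l u p hs h3
      refine claim l α β hs' h4 h5 k' hk' ?_ l' c' hs''
      rintro rfl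
      rcases hor with rfl | hor
      · exact hkj rfl
      · omega

end IsBook

end ArcSystem

/-- In a list that is sorted by a key, the cyclic successor has the next greater key. -/
lemma List.Pairwise.formPerm_key {α K : Type*} [DecidableEq α] [LinearOrder K] {key : α → K}
    {L : List α} (hL : L.Pairwise fun a b => key a < key b) {x : α} (hx : x ∈ L) :
    (∀ y ∈ L, key y ≤ key x ∨ key (L.formPerm x) ≤ key y) ∧
    (key x < key (L.formPerm x) ∨ ∀ y ∈ L, key y ≤ key x ∧ key (L.formPerm x) ≤ key y) := by
  have hnd : L.Nodup := hL.imp fun h e => by rw [e] at h; exact lt_irrefl _ h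
  have mono : ∀ i j (hi : i < L.length) (hj : j < L.length), i ≤ j → key L[i] ≤ key L[j] := by
    intro i j hi hj hij
    rcases hij.eq_or_lt with rfl | h
    · exact le_rfl
    · exact (List.pairwise_iff_getElem.1 hL i j hi hj h).le
  obtain ⟨i, hi, rfl⟩ := List.getElem_of_mem hx
  rw [List.formPerm_apply_getElem _ hnd]
  by_cases h : i + 1 < L.length
  · simp only [Nat.mod_eq_of_lt h]
    refine ⟨fun y hy => ?_, .inl (List.pairwise_iff_getElem.1 hL _ _ hi h (by omega))⟩
    obtain ⟨j, hj, rfl⟩ := List.getElem_of_mem hy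
    rcases Nat.lt_or_ge i j with h' | h' <;> grind
  · have e : i + 1 = L.length := by omega
    have hall : ∀ y ∈ L, key y ≤ key L[i] ∧ key (L[(i + 1) % L.length]'(Nat.mod_lt _ (by omega))) ≤
        key y := by
      intro y hy
      obtain ⟨j, hj, rfl⟩ := List.getElem_of_mem hy
      refine ⟨mono _ _ _ _ (by omega), mono _ _ _ _ ?_⟩
      rw [e, Nat.mod_self]; omega
    exact ⟨fun y hy => .inl (hall y hy).1, .inr hall⟩

/-! ### The order of the edges around the vertices of an arbitrary drawing. -/

namespace EmbeddedDigraph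

variable {n : ℕ} {G : EmbeddedDigraph n} {m : ℕ} {q : ℕ → Fin n × Fin n} {first : ℕ → ℕ}
  {D : BookDrawing n}

/-- Consecutive edges around a vertex, in a drawing. -/
lemma PreservesEmbedding.facePerm_direction (hP : G.PreservesEmbedding D) {d : Fin n × Fin n}
    (hd : G.IsHalfEdge d) :
    (∀ y ∈ G.rot d.2, G.direction D d.2 y ≤ G.direction D d.2 d.1 ∨
      G.direction D d.2 (G.facePerm d).2 ≤ G.direction D d.2 y) ∧
    (G.direction D d.2 d.1 < G.direction D d.2 (G.facePerm d).2 ∨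
      ∀ y ∈ G.rot d.2, G.direction D d.2 y ≤ G.direction D d.2 d.1 ∧
        G.direction D d.2 (G.facePerm d).2 ≤ G.direction D d.2 y) := by
  obtain ⟨L, hL, hs⟩ := hP.rotation d.2
  have hm : d.1 ∈ L := hL.mem_iff.2 hd.swap
  have e : (G.facePerm d).2 = L.formPerm d.1 := by
    rw [facePerm_apply]
    show (G.rot d.2).formPerm d.1 = _
    rw [List.formPerm_eq_of_isRotated (G.rot_nodup _) hL.symm]
  obtain ⟨h1, h2⟩ := hs.formPerm_key hm
  rw [e]
  exact ⟨fun y hy => h1 y (hL.mem_iff.2 hy), h2.imp id fun h y hy => h y (hL.mem_iff.2 hy)⟩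

section

lemma IsOneCrossingBookEmbedding.pos_lt (hD : G.IsOneCrossingBookEmbedding D) {u v : Fin n} (h : G.arc u v = true) :
    D.pos u < D.pos v := by
  have := hD.book.upward u v h
  rw [List.pairwise_cons] at this
  exact this.1 _ (by simp)

variable (hG : G.IsOuterplanarTriangulatedST) (hD : G.IsOneCrossingBookEmbedding D)
include hG hD

/-- The lowest vertex has no incoming arc, since arcs run upwards, and there is only one source. -/
lemma IsOneCrossingBookEmbedding.source_lowest {s : Fin n} (hs : G.IsSource s) (u : Fin n) :
    D.pos s ≤ D.pos u := by
  obtain ⟨x, -, hx⟩ := Finset.exists_min_image Finset.univ D.pos ⟨s, Finset.mem_univ _⟩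
  have hsx : G.IsSource x := by
    intro y
    by_contra h
    have h1 := hD.pos_lt (u := y) (v := x) (by simpa using h)
    have := hx y (Finset.mem_univ _)
    omega
  rw [hG.planarST.source.unique hs hsx]
  exact hx u (Finset.mem_univ _)

/-- At the source, the edges start at the external face. -/
lemma IsOneCrossingBookEmbedding.turn_direction {d : Fin n × Fin n} (hd : G.Ext d)
    (h1 : G.dir d = false) (h2 : G.dir (G.facePerm d) = true) :
    ∀ y ∈ G.rot d.2, G.direction D d.2 (G.facePerm d).2 ≤ G.direction D d.2 y ∧
      G.direction D d.2 y ≤ G.direction D d.2 d.1 := by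
  obtain ⟨t1, t2⟩ := hG.planarST.turn_of_ext hd (by rw [h1, h2]; decide)
  have hs : G.IsSource d.2 := by
    intro u
    by_contra h
    have h : G.dir (u, d.2) = true := by
      cases hc : G.dir (u, d.2)
      · exact absurd hc h
      · rfl
    have := t1 u (isHalfEdge_of_dir h)
    rw [h, h1] at this; cases this
  have hmem : d.1 ∈ G.rot d.2 := hd.isHalfEdge.swap
  obtain ⟨x, hx, hmin⟩ := Finset.exists_min_image (G.rot d.2).toFinset (G.direction D d.2)
    ⟨d.1, List.mem_toFinset.2 hmem⟩
  rw [List.mem_toFinset] at hx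
  have hmin : ∀ y ∈ G.rot d.2, G.direction D d.2 x ≤ G.direction D d.2 y :=
    fun y hy => hmin y (List.mem_toFinset.2 hy)
  have hext : G.Ext (d.2, x) :=
    hD.preserves.external d.2 (hD.source_lowest hG hs) x hx hmin
  have hext' := ext_facePerm_symm.2 hext
  -- The drawing has the external face to the left of the first edge at its lowest vertex, so the
  -- corner before this edge is the unique lower turn of the external face.
  have e : d = G.facePerm.symm (d.2, x) := by
    refine t2 _ hext' ?_ ?_
    · exact t1 _ hext'.isHalfEdge
    · rw [Equiv.apply_symm_apply, h1]
      have h3 := hext.isHalfEdge.dir_swap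
      rw [show ((d.2, x) : Fin n × Fin n).swap = (x, d.2) from rfl,
        t1 x hext.isHalfEdge.swap, h1] at h3
      simpa using h3.symm
  have e2 : (G.facePerm d).2 = x := by
    rw [e, Equiv.apply_symm_apply]
  rw [e2]
  refine fun y hy => ⟨hmin y hy, ?_⟩
  rcases (hD.preserves.facePerm_direction hd.isHalfEdge).2 with h | h
  · grind
  · exact (h y hy).1

/-- An arc on the left of which is the external face leaves first. -/
lemma IsOneCrossingBookEmbedding.direction_left {d : Fin n × Fin n} (hd : G.Ext d)
    (h1 : G.dir d = true) {y : Fin n} (hy : G.arc d.1 y = true) :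
    G.direction D d.1 d.2 ≤ G.direction D d.1 y := by
  have hc := ext_facePerm_symm.2 hd
  have e : G.facePerm (G.facePerm.symm d) = d := G.facePerm.apply_symm_apply d
  have e2 : (G.facePerm.symm d).2 = d.1 := rfl
  have hym : y ∈ G.rot d.1 := isHalfEdge_of_dir (d := (d.1, y)) hy
  have key := hD.preserves.facePerm_direction hc.isHalfEdge
  rw [e, e2] at key
  cases h : G.dir (G.facePerm.symm d)
  · have := hD.turn_direction hG hc h (by rw [e]; exact h1)
    rw [e, e2] at this
    exact (this y hym).1
  -- The edge just before `d` arrives from below. If its key is smaller, it is on the left page and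
  -- all outgoing edges come after it, hence not before its successor `d`. Otherwise the cyclic
  -- order wraps at this corner and `d` is first.
  · rcases key.2 with h3 | h3
    · rcases key.1 y hym with h4 | h4
      · have a1 := direction_of_not_arc (D := D) (G.asymm _ _ h)
        rw [e2] at a1
        have a2 := direction_of_arc (D := D) h1
        have a3 := direction_of_arc (D := D) hy
        rw [Prod.Lex.le_iff] at h4
        rw [Prod.Lex.lt_iff] at h3
        omega
      · exact h4
    · exact (h3 y hym).2

/-- An arc on the right of which is the external face leaves last. -/
lemma IsOneCrossingBookEmbedding.direction_right {d : Fin n × Fin n} (hd : G.Ext d)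
    (h1 : G.dir d = false) {y : Fin n} (hy : G.arc d.2 y = true) :
    G.direction D d.2 y ≤ G.direction D d.2 d.1 := by
  have hc := ext_facePerm.2 hd
  have hym : y ∈ G.rot d.2 := isHalfEdge_of_dir (d := (d.2, y)) hy
  have key := hD.preserves.facePerm_direction hd.isHalfEdge
  cases h : G.dir (G.facePerm d)
  · rcases key.2 with h3 | h3
    · rcases key.1 y hym with h4 | h4
      · exact h4
      · have a1 := direction_of_not_arc (D := D) h
        have a2 := direction_of_arc (D := D) (hd.isHalfEdge.arc_of_dir_false h1)
        have a3 := direction_of_arc (D := D) hy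
        rw [show (G.facePerm d).1 = d.2 from rfl] at a1
        rw [Prod.Lex.le_iff] at h4
        rw [Prod.Lex.lt_iff] at h3
        omega
    · exact (h3 y hym).1
  · exact (hD.turn_direction hG hd h1 h y hym).2

end

/-! ### The pages of a drawing -/

/-- Whether the arc of `q k` leaves its tail on its own side. -/
def drawnFirst (G : EmbeddedDigraph n) (q : ℕ → Fin n × Fin n) (D : BookDrawing n) (k : ℕ) : Bool :=
  D.firstPage (G.tail (q k)) (G.head (q k)) == G.dir (q k)

/-- Whether the arc of `q k` enters its head on its own side. -/
def drawnLast (G : EmbeddedDigraph n) (q : ℕ → Fin n × Fin n) (D : BookDrawing n) (k : ℕ) : Bool :=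
  G.drawnFirst q D k == (D.crossings (G.tail (q k)) (G.head (q k))).isEmpty

/-- The spine points of the drawing. -/
def drawnRank (G : EmbeddedDigraph n) (q : ℕ → Fin n × Fin n) (D : BookDrawing n) (x : ℕ) : ℕ :=
  if h : x - 1 < n then D.pos ⟨x - 1, h⟩
  else (D.crossings (G.tail (q (x - 1 - n))) (G.head (q (x - 1 - n)))).headD 0

/-- Because a page changes at every crossing, the last page is the first one exactly if the arc has
no crossing. So any admissible drawing is described by two bits per arc and a position for each
node. -/
lemma IsOneCrossingBookEmbedding.realizes (hD : G.IsOneCrossingBookEmbedding D)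
    (ho : G.IsArcOrder m q first) :
    G.Realizes q m (G.drawnFirst q D) (G.drawnLast q D) (G.drawnRank q D) D := by
  refine ⟨fun v => ?_, fun k hk => ?_, fun k hk => ?_⟩
  · simp [drawnRank]
  · have h1 := hD.atMostOne _ _ (ho.entry k hk).1.arc
    have e : G.drawnRank q D (n + 1 + k) =
        (D.crossings (G.tail (q k)) (G.head (q k))).headD 0 := by
      unfold drawnRank
      rw [dif_neg (by omega), show n + 1 + k - 1 - n = k by omega]
    rw [e]
    unfold drawnLast
    generalize D.crossings (G.tail (q k)) (G.head (q k)) = c at *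
    rcases c with _ | ⟨a, _ | ⟨b, c⟩⟩
    · simp
    · simp
    · simp at h1
  · unfold drawnFirst
    cases D.firstPage (G.tail (q k)) (G.head (q k)) <;> cases G.dir (q k) <;> rfl

lemma Realizes.mem_segments {F E : ℕ → Bool} {r : ℕ → ℕ} (hR : G.Realizes q m F E r D) {k : ℕ}
    (hk : k < m) {a b : ℕ} {c : Bool}
    (h : (G.arcSystem q F E).Seg (fun v => r (v.val + 1)) (fun j => r (n + 1 + j)) k a b c) :
    (a, b, c) ∈ D.segments (G.tail (q k)) (G.head (q k)) := by
  rw [hR.segments hk]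
  rcases h with ⟨e, rfl, rfl, rfl⟩ | ⟨e, rfl, rfl, rfl⟩ | ⟨e, rfl, rfl, rfl⟩
  · rw [if_neg (fun hc => beq_ne_beq.2 hc e)]; exact List.mem_singleton.2 rfl
  · rw [if_pos (beq_ne_beq.1 e)]; exact List.mem_cons_self ..
  · rw [if_pos (beq_ne_beq.1 e)]; exact List.mem_cons_of_mem _ (List.mem_singleton.2 rfl)

lemma IsOneCrossingBookEmbedding.isBook
    (hD : G.IsOneCrossingBookEmbedding D) (ho : G.IsArcOrder m q first) {F E : ℕ → Bool}
    {r : ℕ → ℕ} (hR : G.Realizes q m F E r D) :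
    (G.arcSystem q F E).IsBook m (fun v => r (v.val + 1)) (fun j => r (n + 1 + j)) := by
  have harc : ∀ k < m, G.arc (G.tail (q k)) (G.head (q k)) = true :=
    fun k hk => (ho.entry k hk).1.arc
  have hc : ∀ k < m, (G.arcSystem q F E).f k ≠ (G.arcSystem q F E).g k →
      D.crossings (G.tail (q k)) (G.head (q k)) = [r (n + 1 + k)] :=
    fun k hk h => by rw [hR.crossings k hk, if_pos (beq_ne_beq.1 h)]
  have up := fun k hk => hD.book.upward _ _ (harc k hk)
  refine ⟨fun k hk => ?_, fun k hk h => ?_, fun k hk h => ?_, fun v w h => ?_,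
    fun k hk v h => ?_, fun j hj k hk h h' e => ?_, fun j hj k hk a b a' b' c h h' => ?_⟩
  · have := hD.pos_lt (harc k hk)
    rwa [hR.pos, hR.pos] at this
  · have := up k hk
    rw [hc k hk h, hR.pos, hR.pos] at this
    simp only [List.singleton_append, List.pairwise_cons] at this
    exact this.1 _ (by simp)
  · have := up k hk
    rw [hc k hk h, hR.pos, hR.pos] at this
    simp only [List.singleton_append, List.pairwise_cons] at this
    exact this.2.1 _ (List.mem_singleton.2 rfl)
  · exact hD.book.pos_injective (by rw [hR.pos, hR.pos]; exact h)
  · have := hD.book.crossing_ne_vertex _ _ (harc k hk) (r (n + 1 + k))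
      (by rw [hc k hk h]; exact List.mem_singleton.2 rfl) v
    rwa [hR.pos] at this
  · by_contra hne
    refine hD.book.crossing_disjoint _ _ _ _ (harc j hj) (harc k hk) (fun e' => hne ?_)
      (r (n + 1 + j)) (by rw [hc j hj h]; exact List.mem_singleton.2 rfl)
      (by rw [hc k hk h']; exact List.mem_singleton.2 e)
    exact ho.bfs.injOn j hj k hk ((ho.entry j hj).eq_of_arc_eq (ho.entry k hk)
      (congrArg Prod.fst e') (congrArg Prod.snd e'))
  · exact hD.book.planar _ _ _ _ (harc j hj) (harc k hk) _ (hR.mem_segments hj h) _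
      (hR.mem_segments hk h') rfl

section

variable (hG : G.IsOuterplanarTriangulatedST) (hD : G.IsOneCrossingBookEmbedding D)
  (ho : G.IsArcOrder m q first) {F E : ℕ → Bool} {r : ℕ → ℕ} (hR : G.Realizes q m F E r D)
include hG hD ho hR

/-- The vertices on a side of the embedding are exposed on the page of that side. -/
theorem Realizes.exposed {p : Bool} (v : Fin n) (hv : G.OnSide p v) :
    (G.arcSystem q F E).Exposed m (fun v => r (v.val + 1)) (fun j => r (n + 1 + j)) p v := by
  have hB := hD.isBook ho hR
  -- Exposure is passed on from `u` to the head of its first outgoing arc (on the left side) or its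
  -- last one (on the right side); comparing the keys of directions shows that this arc is outermost
  -- on the page.
  have step : ∀ u w, G.OnSide p u → (∀ x, G.arc u x = true →
      if p = true then G.direction D u w ≤ G.direction D u x
      else G.direction D u x ≤ G.direction D u w) → G.arc u w = true →
      (G.arcSystem q F E).Exposed m (fun v => r (v.val + 1)) (fun j => r (n + 1 + j)) p u →
      (G.arcSystem q F E).Exposed m (fun v => r (v.val + 1)) (fun j => r (n + 1 + j)) p w := by
    intro u w hu hdir huw hexp
    obtain ⟨j, hj, rfl, rfl⟩ := ho.exists_index huw
    refine hB.exposed_hd (j := j) hj hexp ?_ ?_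
    · intro k hk htl
      change G.tail (q k) = G.tail (q j) at htl
      have h1 := hR.direction_tail hk (ho.entry k hk).1
      have h2 := hR.direction_tail hj (ho.entry j hj).1
      have h3 := hdir (G.head (q k)) (by rw [← htl]; exact (ho.entry k hk).1.arc)
      rw [htl] at h1
      rw [h1, h2] at h3
      generalize (G.arcSystem q F E).up (fun v => r (v.val + 1)) (fun j => r (n + 1 + j)) k = a at *
      generalize (G.arcSystem q F E).up (fun v => r (v.val + 1)) (fun j => r (n + 1 + j)) j = b at *
      change ((F k == G.dir (q k)) = p → (F j == G.dir (q j)) = p ∧ a ≤ b) ∧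
        ((F j == G.dir (q j)) ≠ p → (F k == G.dir (q k)) ≠ p ∧ b ≤ a)
      rw [Prod.Lex.le_iff, Prod.Lex.le_iff] at h3
      generalize (F k == G.dir (q k)) = fk at *
      generalize (F j == G.dir (q j)) = fj at *
      cases p <;> cases fk <;> cases fj <;> simp at h3 ⊢ <;> omega
    · intro z hz
      have hz : D.pos (G.tail (q j)) < D.pos z := by rw [hR.pos, hR.pos]; exact hz
      by_contra hno
      push Not at hno
      have : G.IsSource z := by
        intro y
        by_contra hy
        obtain ⟨k, hk, -, e⟩ := ho.exists_index (by simpa using hy : G.arc y z = true)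
        exact hno k hk e.symm
      have := hD.source_lowest hG this (G.tail (q j))
      omega
  -- Induction on the position. A vertex other than the source is entered by an external arc of its
  -- side, whose tail is lower and on the same side; the source has nothing below it that could pass
  -- it.
  suffices H : ∀ N, ∀ v, D.pos v = N → G.OnSide p v →
      (G.arcSystem q F E).Exposed m (fun v => r (v.val + 1)) (fun j => r (n + 1 + j)) p v from
    H _ v rfl hv
  intro N
  induction N using Nat.strong_induction_on with
  | _ N ih =>
  intro v hN hv
  by_cases hs : G.IsSource v
  · intro k hk l u hseg hlu
    obtain ⟨b1, b2, b3⟩ := hB.seg_bounds hk hseg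
    have h1 := hD.source_lowest hG hs (G.tail (q k))
    rw [hR.pos, hR.pos] at h1
    change r ((G.tail (q k)).val + 1) ≤ l at b1
    have := hlu.1
    simp only at this
    omega
  · have hs : ∃ u, G.arc u v = true := by
      unfold IsSource at hs
      push Not at hs
      obtain ⟨u, hu⟩ := hs
      exact ⟨u, by simpa using hu⟩
    -- an external arc of the given side enters `v`
    have : ∃ u, G.arc u v = true ∧
        (p = true → G.Ext (u, v)) ∧ (p = false → G.Ext (v, u)) := by
      by_cases ht : ∃ w, G.arc v w = true
      · obtain ⟨d, d1, d2, d3, rfl⟩ := hG.planarST.onSide_flat hv hs.choose_spec ht.choose_spec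
        cases p
        · refine ⟨(G.facePerm d).2, ?_, by simp, fun _ => ext_facePerm.2 d1⟩
          have := (isHalfEdge_facePerm.2 d1.isHalfEdge).arc_of_dir_false d3
          exact this
        · exact ⟨d.1, d2, fun _ => d1, by simp⟩
      · push Not at ht
        obtain ⟨d, d1, d2, d3⟩ := hv
        cases p
        · rcases d3 with d3 | d3
          · refine ⟨d.2, ?_, by simp, fun _ => by rw [← d3]; exact d1⟩
            rw [← d3]; exact d1.isHalfEdge.arc_of_dir_false d2
          · have := d1.isHalfEdge.arc_of_dir_false d2
            rw [d3] at this
            exact absurd this (ht _)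
        · rcases d3 with d3 | d3
          · have : G.arc d.1 d.2 = true := d2
            rw [d3] at this
            exact absurd this (ht _)
          · refine ⟨d.1, ?_, fun _ => by rw [← d3]; exact d1, by simp⟩
            rw [← d3]; exact d2
    obtain ⟨u, huv, e1, e2⟩ := this
    have hu : G.OnSide p u := by
      cases p
      · exact ⟨_, e2 rfl, G.asymm _ _ huv, .inr rfl⟩
      · exact ⟨_, e1 rfl, huv, .inl rfl⟩
    refine step u v hu (fun x hx => ?_) huv (ih _ (hN ▸ hD.pos_lt huv) u rfl hu)
    cases p
    · simp only [Bool.false_eq_true, if_false]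
      exact hD.direction_right hG (e2 rfl) (G.asymm _ _ huv) hx
    · simp only [if_true]
      exact hD.direction_left hG (e1 rfl) huv hx

/-- The pages of the arcs of a drawing satisfy the conditions at all triangles. -/
theorem Realizes.isPaging : IsPaging m first (fun k => G.triangleKind (q k)) F E := by
  have hB := hD.isBook ho hR
  constructor
  · intro k hk h1
    obtain ⟨h0, h1⟩ := triangleKind_eq_one.1 h1
    obtain ⟨e1, e2, e3⟩ := ho.triangle_kids hk h0
    have hm := e3.trans_le (ho.first_le_total (k := k + 1) hk)
    obtain ⟨-, -, t1, t2, t3, ht⟩ := hG.triangle (ho.entry k hk) h0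
    obtain ⟨-, t4, t5, t6, t7⟩ := ht.resolve_right (fun h => h.1 h1)
    rw [← e1] at t1 t2 t3
    rw [← e2] at t5 t6 t7
    have hon : G.OnSide (G.dir (q k)) (G.head (q (first k))) := by
      rw [t2]
      have := hG.onSide_or (G.apex (q k))
      revert t4 this
      cases G.dir (q k) <;> simp <;> tauto
    obtain ⟨r1, r2, r3⟩ := hB.triangle (ab := first k) (bc := first k + 1) (ac := k) (by omega) hm hk
      t1 (t2.trans t5.symm) t6 (hR.exposed hG hD ho _ hon)
    change ((F k == _) = _ → (F (first k) == _) = _) at r1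
    change ((E k == _) = _ → (E (first k + 1) == _) = _) at r2
    change ¬ ((F k == _) = _ ∧ (E k == _) = _) at r3
    rw [t3] at r1
    rw [t7] at r2
    revert r1 r2 r3
    unfold MidStates
    cases G.dir (q k) <;> simp
    all_goals tauto
  · intro k hk h1
    obtain ⟨h0, h1⟩ := triangleKind_eq_two.1 h1
    obtain ⟨e1, e2, e3⟩ := ho.triangle_kids hk h0
    have hm := e3.trans_le (ho.first_le_total (k := k + 1) hk)
    obtain ⟨-, -, t1, t2, t3, ht⟩ := hG.triangle (ho.entry k hk) h0
    obtain ⟨-, t4, t5, t6, t7⟩ := ht.resolve_left (fun h => h1 h.1)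
    rw [← e1] at t1 t2 t3
    rw [← e2] at t5 t6 t7
    -- Here the middle vertex of the triangle is the head of the base, which is on the opposite
    -- side, so the planarity conditions are read on the other page.
    have hon : G.OnSide (!G.dir (q k)) (G.head (q k)) := by
      have := hG.onSide_or (G.head (q k))
      revert t4 this
      cases G.dir (q k) <;> simp <;> tauto
    obtain ⟨r1, r2, r3⟩ := hB.triangle (ab := k) (bc := first k + 1) (ac := first k) hk hm (by omega)
      t1.symm t5.symm (t6.trans t2.symm) (hR.exposed hG hD ho _ hon)
    change ((F (first k) == _) = _ → (F k == _) = _) at r1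
    change ((E (first k) == _) = _ → (E (first k + 1) == _) = _) at r2
    change ¬ ((F (first k) == _) = _ ∧ (E (first k) == _) = _) at r3
    rw [t3] at r1 r3
    rw [t3, t7] at r2
    revert r1 r2 r3
    unfold TopStates
    cases G.dir (q k) <;> simp
    all_goals cases F k <;> cases F (first k) <;> cases E (first k) <;> simp

end

/-- No drawing has fewer spine crossings than the solution of the recurrence. -/
theorem IsOneCrossingBookEmbedding.le_numSpineCrossings (hG : G.IsOuterplanarTriangulatedST)
    (hD : G.IsOneCrossingBookEmbedding D) (ho : G.IsArcOrder m q first) (hm : 0 < m)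
    {T : PageTable} {top : ℕ} {x : ℕ → ℕ}
    (hT : T.IsSolution m top first (fun k => G.triangleKind (q k)) (fun k => G.EndsBlock (q k)) x)
    (htop : m ≤ top) : T.c00 0 ≤ G.numSpineCrossings D := by
  have hR := hD.realizes ho
  rw [hR.numSpineCrossings_eq ho]
  exact ho.blockForest.le_cost hT (fun k _ => triangleKind_le) htop hm (hR.isPaging hG hD ho)

end EmbeddedDigraph

/-! ### Program logic for the machine -/

namespace RAM

def Cmd.block : List Cmd → Cmd
  | [] => .skip
  | c :: cs => .seq c (block cs)

/-- Whether the program stores into the array `a`. -/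
def Cmd.stores (a : ℕ) : Cmd → Bool
  | .skip => false
  | .assign _ _ => false
  | .store b _ _ => a == b
  | .seq c d => c.stores a || d.stores a
  | .ite _ c d => c.stores a || d.stores a
  | .while _ c => c.stores a

/-- Whether the program assigns the register `x`. -/
def Cmd.assigns (x : ℕ) : Cmd → Bool
  | .skip => false
  | .assign y _ => x == y
  | .store _ _ _ => false
  | .seq c d => c.assigns x || d.assigns x
  | .ite _ c d => c.assigns x || d.assigns x
  | .while _ c => c.assigns x

/-- `τ` differs from `σ` only where the program writes. -/
structure Frame (c : Cmd) (σ τ : State) : Prop where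
  arr : ∀ a, c.stores a = false → τ.arr a = σ.arr a
  var : ∀ x, c.assigns x = false → τ.var x = σ.var x

lemma Frame.refl (c : Cmd) (σ : State) : Frame c σ σ := ⟨fun _ _ => rfl, fun _ _ => rfl⟩

lemma Frame.trans {c : Cmd} {σ τ υ : State} (h : Frame c σ τ) (h' : Frame c τ υ) : Frame c σ υ :=
  ⟨fun a ha => (h'.arr a ha).trans (h.arr a ha), fun x hx => (h'.var x hx).trans (h.var x hx)⟩

lemma Frame.weaken {c d : Cmd} {σ τ : State} (h : Frame c σ τ)
    (h1 : ∀ a, d.stores a = false → c.stores a = false)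
    (h2 : ∀ a, d.assigns a = false → c.assigns a = false) : Frame d σ τ :=
  ⟨fun a ha => h.arr a (h1 a ha), fun x hx => h.var x (h2 x hx)⟩

/-- What a program may write is visible from its text, so for the concrete programs the preservation
of an array or a register is decided by computation. -/
lemma Runs.frame {W : ℕ} {c : Cmd} {σ τ : State} {T : ℕ} (h : Runs W c σ τ T) : Frame c σ τ := by
  induction h with
  | skip σ => exact .refl _ _
  | assign x e σ h =>
    exact ⟨fun _ _ => rfl, fun y hy => Function.update_of_ne (by simpa [Cmd.assigns] using hy) _ _⟩
  | store a i e σ h =>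
    exact ⟨fun b hb => Function.update_of_ne (by simpa [Cmd.stores] using hb) _ _, fun _ _ => rfl⟩
  | seq _ _ ih1 ih2 =>
    exact Frame.trans (ih1.weaken (fun _ h => (Bool.or_eq_false_iff.1 h).1)
      fun _ h => (Bool.or_eq_false_iff.1 h).1)
      (ih2.weaken (fun _ h => (Bool.or_eq_false_iff.1 h).2) fun _ h => (Bool.or_eq_false_iff.1 h).2)
  | ite_true _ _ ih =>
    exact ih.weaken (fun _ h => (Bool.or_eq_false_iff.1 h).1) fun _ h => (Bool.or_eq_false_iff.1 h).1
  | ite_false _ _ ih =>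
    exact ih.weaken (fun _ h => (Bool.or_eq_false_iff.1 h).2) fun _ h => (Bool.or_eq_false_iff.1 h).2
  | while_false _ => exact .refl _ _
  | while_true _ _ _ ih1 ih2 => exact Frame.trans (c := .while _ _) ⟨ih1.arr, ih1.var⟩ ih2

/-- Started in `σ`, the program halts within `t` steps in a state with the property `Q`. -/
def Reaches (W : ℕ) (c : Cmd) (σ : State) (t : ℕ) (Q : State → Prop) : Prop :=
  ∃ τ T, Runs W c σ τ T ∧ T ≤ t ∧ Q τ

variable {W : ℕ} {c d : Cmd} {b : Test} {σ : State} {t t' : ℕ} {Q Q' : State → Prop}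

lemma Reaches.mono (h : Reaches W c σ t Q) (ht : t ≤ t') (hQ : ∀ τ, Frame c σ τ → Q τ → Q' τ) :
    Reaches W c σ t' Q' := by
  obtain ⟨τ, T, h1, h2, h3⟩ := h
  exact ⟨τ, T, h1, h2.trans ht, hQ τ h1.frame h3⟩

lemma Reaches.seq (h : Reaches W c σ t Q)
    (h' : ∀ τ, Frame c σ τ → Q τ → Reaches W d τ t' Q') : Reaches W (.seq c d) σ (t + t') Q' := by
  obtain ⟨τ, T, h1, h2, h3⟩ := h
  obtain ⟨υ, T', h4, h5, h6⟩ := h' τ h1.frame h3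
  exact ⟨υ, _, .seq h1 h4, by omega, h6⟩

/-- A loop that runs `N` times. -/
lemma Reaches.loop (N : ℕ) (I : ℕ → State → Prop) (h0 : I 0 σ)
    (hb : ∀ i ≤ N, ∀ τ, Frame c σ τ → I i τ → (b.eval τ ↔ i < N))
    (hc : ∀ i < N, ∀ τ, Frame c σ τ → I i τ → Reaches W c τ t (I (i + 1))) :
    Reaches W (.while b c) σ (N * (t + 1) + 1) (I N) := by
  suffices H : ∀ k ≤ N, ∀ τ, Frame c σ τ → I (N - k) τ →
      Reaches W (.while b c) τ (k * (t + 1) + 1) (I N) by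
    have := H N le_rfl σ (.refl _ _) (by rwa [Nat.sub_self])
    exact this
  intro k
  induction k with
  | zero =>
    intro _ τ hf hi
    refine ⟨τ, 1, .while_false fun hc => ?_, by omega, by simpa using hi⟩
    exact absurd ((hb _ le_rfl τ hf hi).1 hc) (lt_irrefl _)
  | succ k ih =>
    intro hk τ hf hi
    have hlt : N - (k + 1) < N := by omega
    obtain ⟨υ, T, h1, h2, h3⟩ := hc _ hlt τ hf hi
    rw [show N - (k + 1) + 1 = N - k by omega] at h3
    obtain ⟨φ, T', h4, h5, h6⟩ := ih (by omega) υ (hf.trans h1.frame) h3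
    refine ⟨φ, _, .while_true ((hb _ hlt.le τ hf hi).2 hlt) h1 h4, ?_, h6⟩
    rw [Nat.succ_mul]; omega

/-- The weakest precondition of a program without loops. -/
def wp (W : ℕ) : Cmd → (State → Prop) → State → Prop
  | .skip, Q, σ => Q σ
  | .assign x e, Q, σ => e.eval σ ≤ W ∧ Q (σ.setVar x (e.eval σ))
  | .store a i e, Q, σ => e.eval σ ≤ W ∧ Q (σ.setArr a (i.eval σ) (e.eval σ))
  | .seq c d, Q, σ => wp W c (wp W d Q) σ
  | .ite b c d, Q, σ => (b.eval σ → wp W c Q σ) ∧ (¬ b.eval σ → wp W d Q σ)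
  | .while _ _, _, _ => False

/-- A bound on the number of steps of a program without loops. -/
def Cmd.steps : Cmd → ℕ
  | .skip => 0
  | .assign _ _ => 1
  | .store _ _ _ => 1
  | .seq c d => c.steps + d.steps
  | .ite _ c d => c.steps + d.steps + 1
  | .while _ _ => 0

/-- The bound `Cmd.steps` adds up both branches of a conditional and thus does not depend on the
state. Loops satisfy no such precondition; they are treated by `Reaches.loop`. -/
lemma Reaches.of_wp (h : wp W c Q σ) : Reaches W c σ c.steps Q := by
  induction c generalizing σ Q with
  | skip => exact ⟨_, _, .skip _, le_rfl, h⟩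
  | assign x e => exact ⟨_, _, .assign x e σ h.1, le_rfl, h.2⟩
  | store a i e => exact ⟨_, _, .store a i e σ h.1, le_rfl, h.2⟩
  | seq c d ih1 ih2 => exact (ih1 h).seq fun _ _ h' => ih2 h'
  | ite b c d ih1 ih2 =>
    by_cases hb : b.eval σ
    · obtain ⟨τ, T, h1, h2, h3⟩ := ih1 (h.1 hb)
      exact ⟨τ, _, .ite_true hb h1, by simp only [Cmd.steps]; omega, h3⟩
    · obtain ⟨τ, T, h1, h2, h3⟩ := ih2 (h.2 hb)
      exact ⟨τ, _, .ite_false hb h1, by simp only [Cmd.steps]; omega, h3⟩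
  | _ => exact h.elim

lemma setVar_var (σ : State) (x m y : ℕ) :
    (σ.setVar x m).var y = if y = x then m else σ.var y := Function.update_apply ..

lemma setVar_arr (σ : State) (x m a i : ℕ) : (σ.setVar x m).arr a i = σ.arr a i := rfl

lemma setArr_var (σ : State) (a i m y : ℕ) : (σ.setArr a i m).var y = σ.var y := rfl

lemma setArr_arr (σ : State) (a i m b j : ℕ) :
    (σ.setArr a i m).arr b j = if b = a ∧ j = i then m else σ.arr b j := by
  unfold State.setArr
  simp only [Function.update_apply]
  split_ifs with h1 <;> first | rfl | (subst h1; simp_all) | simp_all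

attribute [simp] Cmd.block wp Expr.eval Test.eval setVar_var setVar_arr setArr_var setArr_arr

end RAM

/-! ### The half-edge data structure -/

namespace EmbeddedDigraph

variable {n : ℕ} {G : EmbeddedDigraph n}

/-- The index of a half-edge. -/
def ix (G : EmbeddedDigraph n) (d : Fin n × Fin n) : ℕ := G.halfEdges.idxOf d

/-- The index of the first half-edge at a vertex. -/
def startIx (G : EmbeddedDigraph n) (k : ℕ) : ℕ :=
  (((List.finRange n).take k).map fun u => (G.rot u).length).sum

lemma mem_halfEdges {d : Fin n × Fin n} : d ∈ G.halfEdges ↔ G.IsHalfEdge d := by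
  obtain ⟨v, w⟩ := d
  simp [halfEdges, IsHalfEdge]

lemma nodup_halfEdges : G.halfEdges.Nodup := by
  unfold halfEdges
  rw [List.nodup_flatMap]
  refine ⟨fun v _ => (G.rot_nodup v).map fun _ _ h => (Prod.mk.inj h).2, ?_⟩
  refine (List.nodup_finRange n).imp fun {a b} hab => ?_
  rintro ⟨x, y⟩ h1 h2
  simp only [List.mem_map, Prod.mk.injEq] at h1 h2
  obtain ⟨_, _, rfl, _⟩ := h1
  obtain ⟨_, _, rfl, _⟩ := h2
  exact hab rfl

lemma startIx_succ (v : Fin n) : G.startIx (v.val + 1) = G.startIx v + (G.rot v).length := by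
  unfold startIx
  rw [List.take_succ_eq_append_getElem (by simp), List.map_append, List.sum_append]
  simp

lemma startIx_length : G.startIx n = G.halfEdges.length := by
  unfold startIx halfEdges
  rw [List.take_of_length_le (by simp), List.length_flatMap]
  simp

lemma halfEdges_split (v : Fin n) :
    ∃ A B, G.halfEdges = A ++ ((G.rot v).map fun w => (v, w)) ++ B ∧ A.length = G.startIx v := by
  have h : List.finRange n = (List.finRange n).take v ++ v :: (List.finRange n).drop (v + 1) := by
    have := List.take_append_drop v.val (List.finRange n)
    rw [List.drop_eq_getElem_cons (by simp)] at this
    simpa using this.symm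
  refine ⟨((List.finRange n).take v).flatMap fun v => (G.rot v).map fun w => (v, w),
    ((List.finRange n).drop (v + 1)).flatMap fun v => (G.rot v).map fun w => (v, w), ?_, ?_⟩
  · unfold halfEdges
    conv_lhs => rw [h]
    simp [List.flatMap_append]
  · unfold startIx
    rw [List.length_flatMap]; simp

lemma ix_rot (v : Fin n) {i : ℕ} (hi : i < (G.rot v).length) :
    G.ix (v, (G.rot v)[i]) = G.startIx v + i := by
  obtain ⟨A, B, h, hA⟩ := G.halfEdges_split v
  have hnd := G.nodup_halfEdges
  have hlen : A.length + i < G.halfEdges.length := by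
    rw [h]; simp; omega
  have e : G.halfEdges[A.length + i] = (v, (G.rot v)[i]) := by grind
  rw [← hA, ← e]
  exact hnd.idxOf_getElem _ hlen

lemma ix_lt {d : Fin n × Fin n} (hd : G.IsHalfEdge d) : G.ix d < G.halfEdges.length :=
  List.idxOf_lt_length_of_mem (mem_halfEdges.2 hd)

lemma getElem_ix {d : Fin n × Fin n} (hd : G.IsHalfEdge d) : G.halfEdges[G.ix d]? = some d := by
  rw [List.getElem?_eq_getElem (ix_lt hd)]
  exact congrArg some (List.getElem_idxOf (ix_lt hd))

lemma ix_inj {d e : Fin n × Fin n} (hd : G.IsHalfEdge d) (he : G.IsHalfEdge e)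
    (h : G.ix d = G.ix e) : d = e := by
  have := getElem_ix hd
  rw [h, getElem_ix he] at this
  exact (Option.some.inj this).symm

lemma exists_ix {k : ℕ} (hk : k < G.halfEdges.length) : ∃ d, G.IsHalfEdge d ∧ G.ix d = k :=
  ⟨_, mem_halfEdges.1 (List.getElem_mem hk), G.nodup_halfEdges.idxOf_getElem _ hk⟩

/-- The half-edges at the head of `d` are stored in clockwise order, so the successor of `d` on its
face follows the reversal of `d` in this group; after the last one it is the first of the group. -/
lemma ix_facePerm {d : Fin n × Fin n} (hd : G.IsHalfEdge d) :
    G.ix (G.facePerm d) = if G.ix d.swap + 1 < G.startIx (d.2.val + 1) then G.ix d.swap + 1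
      else G.startIx d.2 := by
  have hm : d.1 ∈ G.rot d.2 := hd.swap
  obtain ⟨i, hi, e⟩ := List.getElem_of_mem hm
  have h1 : G.ix d.swap = G.startIx d.2 + i := by
    rw [← ix_rot d.2 hi, e]; rfl
  have h2 : G.facePerm d = (d.2, (G.rot d.2)[(i + 1) % (G.rot d.2).length]'
      (Nat.mod_lt _ (by omega))) := by
    rw [facePerm_apply, ← List.formPerm_apply_getElem _ (G.rot_nodup _) i hi, e]
  rw [h2, ix_rot, h1, startIx_succ]
  by_cases h : i + 1 < (G.rot d.2).length
  · rw [Nat.mod_eq_of_lt h, if_pos (by omega)]; omega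
  · rw [if_neg (by omega), show i + 1 = (G.rot d.2).length by omega, Nat.mod_self, Nat.add_zero]

lemma length_halfEdges_le : G.halfEdges.length ≤ 2 * G.arcs.card := by
  have h1 : G.halfEdges.toFinset ⊆ G.arcs ∪ G.arcs.image Prod.swap := by
    intro d hd
    have hd := mem_halfEdges.1 (List.mem_toFinset.1 hd)
    rw [Finset.mem_union, Finset.mem_image]
    cases h : G.dir d
    · exact .inr ⟨d.swap, by simpa [arcs] using hd.arc_of_dir_false h, Prod.swap_swap d⟩
    · exact .inl (Finset.mem_filter.2 ⟨Finset.mem_univ _, h⟩)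
  have h2 := Finset.card_le_card h1
  rw [List.toFinset_card_of_nodup G.nodup_halfEdges] at h2
  have := Finset.card_union_le G.arcs (G.arcs.image Prod.swap)
  have := Finset.card_image_le (s := G.arcs) (f := Prod.swap)
  omega

/-- The arrays 1, 2, 3, 23, 24 of the memory hold the targets, the directions, the opposites, the
successors and the predecessors of the half-edges. -/
structure HalfEdgeMemory (G : EmbeddedDigraph n) (σ : RAM.State) : Prop where
  target : ∀ d, G.IsHalfEdge d → σ.arr 1 (G.ix d) = d.2
  dir : ∀ d, G.IsHalfEdge d → σ.arr 2 (G.ix d) = (G.dir d).toNat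
  opp : ∀ d, G.IsHalfEdge d → σ.arr 3 (G.ix d) = G.ix d.swap
  next : ∀ d, G.IsHalfEdge d → σ.arr 23 (G.ix d) = G.ix (G.facePerm d)
  prev : ∀ d, G.IsHalfEdge d → σ.arr 24 (G.ix d) = G.ix (G.facePerm.symm d)

lemma HalfEdgeMemory.congr {σ τ : RAM.State} (h : G.HalfEdgeMemory σ) (h1 : τ.arr 1 = σ.arr 1)
    (h2 : τ.arr 2 = σ.arr 2) (h3 : τ.arr 3 = σ.arr 3) (h4 : τ.arr 23 = σ.arr 23)
    (h5 : τ.arr 24 = σ.arr 24) : G.HalfEdgeMemory τ :=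
  ⟨h1 ▸ h.target, h2 ▸ h.dir, h3 ▸ h.opp, h4 ▸ h.next, h5 ▸ h.prev⟩

end EmbeddedDigraph

namespace RAM

/-- The body of the loop that computes the successors and the predecessors of the half-edges. -/
def faceBody : Cmd := .block [
  -- The first half-edge of the group is stored as the default, for the case that the clockwise
  -- order wraps; it is overwritten if the next index is still in the group.
  .store 23 (.var 3) (.get 0 (.get 1 (.var 3))),
  .ite (.le (.add (.get 3 (.var 3)) (.lit 2)) (.get 0 (.add (.get 1 (.var 3)) (.lit 1))))
    (.store 23 (.var 3) (.add (.get 3 (.var 3)) (.lit 1))) .skip,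
  .store 24 (.get 23 (.var 3)) (.var 3),
  .assign 3 (.add (.var 3) (.lit 1))]

def faceLoop : Cmd := .while (.le (.add (.var 3) (.lit 1)) (.get 0 (.var 0))) faceBody

end RAM

namespace EmbeddedDigraph

variable {n : ℕ} {G : EmbeddedDigraph n}

open RAM

lemma input_zero {k : ℕ} (hk : k ≤ n) : G.input.arr 0 k = G.startIx k := by
  simp [input, startIx, hk]

structure FaceInv (G : EmbeddedDigraph n) (i : ℕ) (τ : State) : Prop where
  var : τ.var 3 = i
  next : ∀ d, G.IsHalfEdge d → G.ix d < i → τ.arr 23 (G.ix d) = G.ix (G.facePerm d)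
  prev : ∀ d, G.IsHalfEdge d → G.ix d < i → τ.arr 24 (G.ix (G.facePerm d)) = G.ix d

theorem reaches_faceLoop {W : ℕ} (hW : G.halfEdges.length ≤ W) :
    Reaches W faceLoop G.input (G.halfEdges.length * (faceBody.steps + 1) + 1)
      G.HalfEdgeMemory := by
  have mono : ∀ v : Fin n, G.startIx v ≤ G.halfEdges.length := by
    intro v
    obtain ⟨A, B, h, hA⟩ := G.halfEdges_split v
    rw [h]; simp; omega
  refine (Reaches.loop (t := faceBody.steps) G.halfEdges.length G.FaceInv
    ⟨by simp [input], by simp, by simp⟩ ?_ ?_).mono le_rfl ?_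
  · rintro i hi τ hf ⟨h1, -, -⟩
    have h0 : τ.arr 0 = _ := hf.arr 0 rfl
    have hn : τ.var 0 = n := hf.var 0 rfl
    simp only [Test.eval, Expr.eval, h1, h0, hn, input_zero le_rfl, startIx_length]
    omega
  · rintro i hi τ hf ⟨h1, h2, h3⟩
    obtain ⟨d, hd, rfl⟩ := exists_ix hi
    have h0 : τ.arr 0 = _ := hf.arr 0 rfl
    have e1 : τ.arr 1 (G.ix d) = d.2 := by
      rw [hf.arr 1 rfl]; simp [input, getElem_ix hd]
    have e3 : τ.arr 3 (G.ix d) = G.ix d.swap := by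
      rw [hf.arr 3 rfl]; simp [input, getElem_ix hd]; rfl
    have e4 : G.input.arr 0 d.2.val = G.startIx d.2 := input_zero d.2.isLt.le
    have e5 : G.input.arr 0 (d.2.val + 1) = G.startIx (d.2.val + 1) := input_zero d.2.isLt
    have e6 := ix_facePerm hd
    have hlt := ix_lt hd.swap
    have hm := mono d.2
    apply Reaches.of_wp
    have fin : ∀ υ : State, υ.var 3 = G.ix d + 1 → (∀ j, υ.arr 23 j = if j = G.ix d then
        G.ix (G.facePerm d) else τ.arr 23 j) → (∀ j, υ.arr 24 j = if j = G.ix (G.facePerm d) then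
        G.ix d else τ.arr 24 j) → G.FaceInv (G.ix d + 1) υ := by
      intro υ u1 u2 u3
      have hne : ∀ e, G.IsHalfEdge e → G.ix e < G.ix d →
          G.ix (G.facePerm e) ≠ G.ix (G.facePerm d) := by
        intro e he h h'
        rw [G.facePerm.injective
            (ix_inj (isHalfEdge_facePerm.2 he) (isHalfEdge_facePerm.2 hd) h')] at h
        exact lt_irrefl _ h
      refine ⟨u1, fun e he hle => ?_, fun e he hle => ?_⟩ <;>
        rcases Nat.lt_succ_iff_lt_or_eq.1 hle with h | h
      · rw [u2, if_neg h.ne]; exact h2 e he h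
      · rw [ix_inj he hd h, u2, if_pos rfl]
      · grind
      · rw [ix_inj he hd h, u3, if_pos rfl]
    by_cases hc : G.ix d.swap + 2 ≤ G.startIx (d.2.val + 1)
    · rw [if_pos (by omega)] at e6
      simp [faceBody, h1, h0, e1, e3, e4, e5, hc]
      refine ⟨by omega, by omega, by omega, by omega, fin _ (by simp) (fun j => ?_) (fun j => ?_)⟩ <;> simp_all
    · rw [if_neg (by omega)] at e6
      simp [faceBody, h1, h0, e1, e3, e4, e5, hc]
      exact ⟨by omega, by omega, by omega, fin _ (by simp) (by simp [e6]) (by simp [e6])⟩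
  · rintro τ hf ⟨-, h2, h3⟩
    refine ⟨fun d hd => ?_, fun d hd => ?_, fun d hd => ?_, fun d hd => ?_, fun d hd => ?_⟩
    · rw [hf.arr 1 rfl]; simp [input, getElem_ix hd]
    · rw [hf.arr 2 rfl]; simp [input, getElem_ix hd, EmbeddedDigraph.dir]
      cases G.arc d.1 d.2 <;> rfl
    · rw [hf.arr 3 rfl]; simp [input, getElem_ix hd]; rfl
    · exact h2 d hd (ix_lt hd)
    · have hd' := isHalfEdge_facePerm_symm.2 hd
      have := h3 _ hd' (ix_lt hd')
      rwa [Equiv.apply_symm_apply] at this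

end EmbeddedDigraph

/-! ### The external face -/

namespace RAM

def extBody : Cmd := .block [
  .store 7 (.var 10) (.lit 1),
  .ite (.eq (.get 2 (.var 10)) (.lit 1))
    (.block [.store 8 (.get 1 (.var 10)) (.lit 1), .store 8 (.get 1 (.get 3 (.var 10))) (.lit 1)])
    (.ite (.eq (.get 2 (.get 23 (.var 10))) (.lit 1)) (.assign 11 (.get 3 (.var 10))) .skip),
  .assign 10 (.get 23 (.var 10)),
  .assign 3 (.add (.var 3) (.lit 1))]

/-- Walks around the external face; marks its half-edges in array 7 and the vertices of the left
side in array 8, and finds the root arc. -/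
def extLoop : Cmd := .seq (.block [.assign 10 (.var 1), .assign 3 (.lit 0)])
  (.while (.le (.add (.var 3) (.lit 1)) (.get 0 (.var 0))) extBody)

end RAM

namespace EmbeddedDigraph

variable {n : ℕ} {G : EmbeddedDigraph n}

open RAM

lemma isHalfEdge_outer : G.IsHalfEdge G.outer := G.outer_mem

lemma isHalfEdge_iterate {d : Fin n × Fin n} (hd : G.IsHalfEdge d) (j : ℕ) :
    G.IsHalfEdge (G.facePerm^[j] d) := by
  induction j with
  | zero => exact hd
  | succ j ih => rw [Function.iterate_succ_apply']; exact isHalfEdge_facePerm.2 ih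

/-- By the pigeonhole principle the walk around the external face repeats within as many steps as
there are half-edges. So a loop of that fixed length visits the whole face, and visiting parts of it
again does no harm. -/
lemma ext_iff_exists_iterate {d : Fin n × Fin n} :
    G.Ext d ↔ ∃ j < G.halfEdges.length, G.facePerm^[j] G.outer = d := by
  constructor
  · rintro ⟨k, hk⟩
    have hk : G.facePerm^[k] G.outer = d := hk
    obtain ⟨i, hi, j, hj, hne, e⟩ := Finset.exists_ne_map_eq_of_card_lt_of_maps_to
      (s := Finset.range (G.halfEdges.length + 1)) (t := Finset.range G.halfEdges.length)
      (f := fun i => G.ix (G.facePerm^[i] G.outer)) (by simp)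
      (fun i _ => Finset.mem_coe.2 (Finset.mem_range.2 (ix_lt (isHalfEdge_iterate isHalfEdge_outer i))))
    replace e : G.facePerm^[i] G.outer = G.facePerm^[j] G.outer :=
      ix_inj (isHalfEdge_iterate isHalfEdge_outer i) (isHalfEdge_iterate isHalfEdge_outer j) e
    wlog hij : i < j generalizing i j
    · grind
    have hp : Function.IsPeriodicPt G.facePerm (j - i) G.outer := by
      have h1 : j = i + (j - i) := by omega
      rw [h1, Function.iterate_add_apply] at e
      exact ((G.facePerm.injective.iterate i) e).symm
    refine ⟨k % (j - i), ?_, by rw [hp.iterate_mod_apply, hk]⟩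
    have := Nat.mod_lt k (show j - i > 0 by omega)
    have := Finset.mem_range.1 hj
    omega
  · rintro ⟨j, -, rfl⟩
    exact ⟨j, rfl⟩

open Classical in
structure ExtInv (G : EmbeddedDigraph n) (i : ℕ) (τ : State) : Prop where
  var : τ.var 3 = i
  cur : τ.var 10 = G.ix (G.facePerm^[i] G.outer)
  ext : ∀ d, G.IsHalfEdge d →
    τ.arr 7 (G.ix d) = if ∃ j < i, G.facePerm^[j] G.outer = d then 1 else 0
  left : ∀ v : Fin n, τ.arr 8 v = if ∃ j < i, G.dir (G.facePerm^[j] G.outer) = true ∧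
    ((G.facePerm^[j] G.outer).1 = v ∨ (G.facePerm^[j] G.outer).2 = v) then 1 else 0
  root : ∀ j < i, G.dir (G.facePerm^[j] G.outer) = false →
    G.dir (G.facePerm^[j + 1] G.outer) = true → τ.var 11 = G.ix (G.facePerm^[j] G.outer).swap

open Classical in
/-- The result of the walk around the external face. -/
structure ExternalMemory (G : EmbeddedDigraph n) (τ : State) : Prop where
  ext : ∀ d, G.IsHalfEdge d → τ.arr 7 (G.ix d) = if G.Ext d then 1 else 0
  left : ∀ v : Fin n, τ.arr 8 v = if G.OnSide true v then 1 else 0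

theorem reaches_extLoop (hG : G.IsOuterplanarTriangulatedST) {W : ℕ} (hW : G.halfEdges.length ≤ W) (hW' : 1 ≤ W)
    {σ : State} (hm : G.HalfEdgeMemory σ) (h0 : σ.arr 0 n = G.halfEdges.length) (hn : σ.var 0 = n)
    (hv : σ.var 1 = G.ix G.outer) (h7 : ∀ i, σ.arr 7 i = 0) (h8 : ∀ i, σ.arr 8 i = 0) :
    Reaches W extLoop σ (2 + (G.halfEdges.length * (extBody.steps + 1) + 1)) fun τ =>
      G.ExternalMemory τ ∧ ∀ r, G.IsRoot r → τ.var 11 = G.ix r := by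
  classical
  refine (Reaches.seq (Q := G.ExtInv 0) (t := 2) (Reaches.of_wp (c := .block _) ?_)
    fun υ hfυ hυ => (Reaches.loop (t := extBody.steps) G.halfEdges.length G.ExtInv hυ ?_ ?_)).mono
    le_rfl ?_
  · have := ix_lt G.isHalfEdge_outer
    simp [hv]
    exact ⟨by omega, ⟨by simp, by simp, by simp [h7], by simp [h8], by simp⟩⟩
  · intro i hi τ hf hτ
    have e1 : τ.arr 0 = _ := hf.arr 0 rfl
    have e2 : υ.arr 0 = _ := hfυ.arr 0 rfl
    have e3 : τ.var 0 = _ := hf.var 0 rfl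
    have e4 : υ.var 0 = _ := hfυ.var 0 rfl
    simp [hτ.var, e1, e2, e3, e4, h0, hn]
  · intro i hi τ hf hτ
    have hm : G.HalfEdgeMemory τ := (hm.congr (hfυ.arr 1 rfl) (hfυ.arr 2 rfl) (hfυ.arr 3 rfl)
      (hfυ.arr 23 rfl) (hfυ.arr 24 rfl)).congr (hf.arr 1 rfl) (hf.arr 2 rfl) (hf.arr 3 rfl)
      (hf.arr 23 rfl) (hf.arr 24 rfl)
    have hd := isHalfEdge_iterate isHalfEdge_outer (G := G) i
    have hE : G.Ext (G.facePerm^[i] G.outer) := ⟨i, rfl⟩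
    obtain ⟨v1, v2, v3, v4, v5⟩ := hτ
    have hit := Function.iterate_succ_apply' G.facePerm i G.outer
    have fin : ∀ υ' : State, υ'.var 3 = i + 1 → υ'.var 10 = G.ix (G.facePerm^[i + 1] G.outer) →
        (∀ j, υ'.arr 7 j = if j = G.ix (G.facePerm^[i] G.outer) then 1 else τ.arr 7 j) →
        (∀ v : Fin n, υ'.arr 8 v = if G.dir (G.facePerm^[i] G.outer) = true ∧
          ((G.facePerm^[i] G.outer).1 = v ∨ (G.facePerm^[i] G.outer).2 = v) then 1
          else τ.arr 8 v) →
        υ'.var 11 = (if G.dir (G.facePerm^[i] G.outer) = false ∧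
          G.dir (G.facePerm^[i + 1] G.outer) = true then G.ix (G.facePerm^[i] G.outer).swap
          else τ.var 11) → G.ExtInv (i + 1) υ' := by
      intro υ' u1 u2 u3 u4 u5
      refine ⟨u1, u2, fun d hd' => ?_, fun v => ?_, fun j hj j1 j2 => ?_⟩
      · rw [u3, v3 d hd']
        by_cases h : d = G.facePerm^[i] G.outer
        · rw [if_pos (by rw [h]), if_pos ⟨i, by omega, h.symm⟩]
        · rw [if_neg (fun h' => h (ix_inj hd' hd h'))]
          refine if_congr ⟨fun ⟨j, h1, h2⟩ => ⟨j, by omega, h2⟩, fun ⟨j, h1, h2⟩ => ⟨j, ?_, h2⟩⟩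
            rfl rfl
          have : j ≠ i := by rintro rfl; exact h h2.symm
          omega
      · rw [u4, v4]
        by_cases h : G.dir (G.facePerm^[i] G.outer) = true ∧
          ((G.facePerm^[i] G.outer).1 = v ∨ (G.facePerm^[i] G.outer).2 = v)
        · rw [if_pos h, if_pos ⟨i, by omega, h⟩]
        · rw [if_neg h]
          refine if_congr ⟨fun ⟨j, h1, h2⟩ => ⟨j, by omega, h2⟩, fun ⟨j, h1, h2⟩ => ⟨j, ?_, h2⟩⟩
            rfl rfl
          have : j ≠ i := by rintro rfl; exact h h2
          omega
      · rw [u5]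
        by_cases h : G.dir (G.facePerm^[i] G.outer) = false ∧
          G.dir (G.facePerm^[i + 1] G.outer) = true
        · rw [if_pos h]
          rw [hit] at h
          have hne : G.dir (G.facePerm^[i] G.outer) ≠ G.dir (G.facePerm (G.facePerm^[i] G.outer)) := by
            rw [h.1, h.2]; decide
          -- The external face has only one lower turn, so register 11 gets the same value each time
          -- it is written.
          rw [(hG.planarST.turn_of_ext hE hne).2 (G.facePerm^[j] G.outer) ⟨j, rfl⟩ (j1.trans h.1.symm)
            (by rw [← Function.iterate_succ_apply' G.facePerm, j2, h.1]; rfl)]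
        · grind
    rw [hit] at fin
    generalize G.facePerm^[i] G.outer = d at *
    have e1 := hm.target d hd
    have e2 := hm.dir d hd
    have e3 := hm.opp d hd
    have e4 := hm.next d hd
    have e5 := hm.target d.swap hd.swap
    have e6 := hm.dir _ (isHalfEdge_facePerm.2 hd)
    have l1 := ix_lt hd.swap
    have l2 := ix_lt (isHalfEdge_facePerm.2 hd)
    apply Reaches.of_wp
    cases hdir : G.dir d
    · rw [hdir] at e2
      cases hdir' : G.dir (G.facePerm d) <;> rw [hdir'] at e6
      all_goals
        simp [extBody, v1, v2, e1, e2, e3, e4, e5, e6]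
        repeat refine ⟨by omega, ?_⟩
        exact fin _ (by simp) (by simp) (by simp) (by simp [hdir]) (by simp [hdir, hdir'])
    · rw [hdir] at e2
      simp [extBody, v1, v2, e1, e2, e3, e4, e5, e6]
      repeat refine ⟨by omega, ?_⟩
      refine fin _ (by simp) (by simp) (by simp) (fun v => ?_) (by simp [hdir])
      simp [hdir, Fin.ext_iff, eq_comm]
      grind
  · rintro τ - h
    refine ⟨⟨fun d hd => ?_, fun v => ?_⟩, fun r hr => ?_⟩
    · rw [h.ext d hd]
      exact if_congr ext_iff_exists_iterate.symm rfl rfl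
    · rw [h.left]
      refine if_congr ⟨fun ⟨j, _, h1, h2⟩ => ⟨_, ⟨j, rfl⟩, h1, h2⟩, fun ⟨d, h1, h2, h3⟩ => ?_⟩ rfl rfl
      obtain ⟨j, hj, rfl⟩ := ext_iff_exists_iterate.1 h1
      exact ⟨j, hj, h2, h3⟩
    · obtain ⟨r1, r2, r3⟩ := hr
      obtain ⟨j, hj, e⟩ := ext_iff_exists_iterate.1 r2
      have hne : G.dir r.swap = false := by
        rw [r1.1.dir_swap, hG.dir_of_ext_swap r1 r2]; rfl
      rw [h.root j hj (by rw [e]; exact hne) (by rw [Function.iterate_succ_apply', e]; exact r3), e]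
      rfl

end EmbeddedDigraph

/-! ### The breadth-first order of the arcs -/

namespace RAM

/-- The record of the arc at the counter: its half-edges and its ends. -/
def arcRecord : Cmd := .block [
  .store 10 (.var 3) (.var 4),
  .store 11 (.var 3) (.lit 0),
  .store 12 (.var 3) (.lit 0),
  .assign 10 (.get 9 (.var 3)),
  .store 27 (.var 3) (.get 2 (.var 10)),
  .ite (.eq (.get 2 (.var 10)) (.lit 1)) (.assign 11 (.var 10)) (.assign 11 (.get 3 (.var 10))),
  .store 22 (.var 3) (.var 11),
  .store 25 (.var 3) (.add (.get 1 (.get 3 (.var 11))) (.lit 1)),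
  .store 26 (.var 3) (.add (.get 1 (.var 11)) (.lit 1)),
  .store 21 (.var 3) (.add (.get 1 (.get 23 (.var 10))) (.lit 1))]

/-- Appends the sides of the triangle to the queue. -/
def triangleRecord : Cmd := .ite (.eq (.get 7 (.var 10)) (.lit 0)) (.block [
  .ite (.eq (.get 2 (.var 10)) (.lit 1))
    (.block [.store 9 (.var 4) (.get 3 (.get 23 (.get 23 (.var 10)))),
      .store 9 (.add (.var 4) (.lit 1)) (.get 3 (.get 23 (.var 10)))])
    (.block [.store 9 (.var 4) (.get 3 (.get 23 (.var 10))),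
      .store 9 (.add (.var 4) (.lit 1)) (.get 3 (.get 23 (.get 23 (.var 10))))]),
  .ite (.eq (.get 2 (.get 9 (.add (.var 4) (.lit 1)))) (.get 2 (.var 10)))
    (.store 11 (.var 3) (.lit 1)) (.store 11 (.var 3) (.lit 2)),
  .assign 4 (.add (.var 4) (.lit 2))]) .skip

/-- Appends the root arc of the next block to the queue. -/
def blockRecord : Cmd := .block [
  .ite (.and (.eq (.get 7 (.get 3 (.var 11))) (.lit 1)) (.and
      (.eq (.get 8 (.get 1 (.var 11))) (.lit 1)) (.eq (.get 2 (.get 24 (.get 3 (.var 11)))) (.lit 0))))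
    (.block [.store 12 (.var 3) (.var 4),
      .store 9 (.var 4) (.get 3 (.get 24 (.get 3 (.var 11)))),
      .assign 4 (.add (.var 4) (.lit 1))]) .skip,
  .assign 3 (.add (.var 3) (.lit 1))]

def orderBody : Cmd := .seq arcRecord (.seq triangleRecord blockRecord)

def orderLoop : Cmd := .seq (.block [.store 9 (.lit 0) (.var 11), .assign 3 (.lit 0),
  .assign 4 (.lit 1)]) (.while (.le (.add (.var 3) (.lit 1)) (.var 4)) orderBody)

end RAM

namespace EmbeddedDigraph

variable {n : ℕ} {G : EmbeddedDigraph n} {m : ℕ} {q : ℕ → Fin n × Fin n} {first : ℕ → ℕ}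

open RAM

/-- The half-edge of the arc of `d` in the direction of the arc. -/
def upHalf (G : EmbeddedDigraph n) (d : Fin n × Fin n) : Fin n × Fin n := (G.tail d, G.head d)

open Classical in
/-- The memory after the first `k` steps of the breadth-first search. -/
structure OrderMemory (G : EmbeddedDigraph n) (q : ℕ → Fin n × Fin n) (first : ℕ → ℕ) (k : ℕ)
    (τ : State) : Prop where
  queue : ∀ j < first k, τ.arr 9 j = G.ix (q j)
  kids : ∀ j < k, τ.arr 10 j = first j
  kind : ∀ j < k, τ.arr 11 j = G.triangleKind (q j)
  extra : ∀ j < k, τ.arr 12 j = if G.EndsBlock (q j) then first (j + 1) - 1 else 0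
  apex : ∀ j < k, τ.arr 21 j = (G.apex (q j)).val + 1
  up : ∀ j < k, τ.arr 22 j = G.ix (G.upHalf (q j))
  tail : ∀ j < k, τ.arr 25 j = (G.tail (q j)).val + 1
  head : ∀ j < k, τ.arr 26 j = (G.head (q j)).val + 1
  dir : ∀ j < k, τ.arr 27 j = (G.dir (q j)).toNat

/-- Register 3 counts the expanded arcs and register 4 is the length of the queue, which is also the
index that the first child of the next arc receives. -/
structure OrderInv (G : EmbeddedDigraph n) (q : ℕ → Fin n × Fin n) (first : ℕ → ℕ) (k : ℕ)
    (τ : State) : Prop where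
  var : τ.var 3 = k
  tot : τ.var 4 = first k
  mem : G.OrderMemory q first k τ

/-- The state after the record of arc `k`. -/
structure ArcRecorded (G : EmbeddedDigraph n) (d : Fin n × Fin n) (k t : ℕ) (σ τ : State) :
    Prop where
  var : τ.var 3 = k
  tot : τ.var 4 = t
  cur : τ.var 10 = G.ix d
  upHalf : τ.var 11 = G.ix (G.upHalf d)
  a9 : ∀ j, τ.arr 9 j = σ.arr 9 j
  a10 : ∀ j, τ.arr 10 j = if j = k then t else σ.arr 10 j
  a11 : ∀ j, τ.arr 11 j = if j = k then 0 else σ.arr 11 j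
  a12 : ∀ j, τ.arr 12 j = if j = k then 0 else σ.arr 12 j
  a21 : ∀ j, τ.arr 21 j = if j = k then (G.apex d).val + 1 else σ.arr 21 j
  a22 : ∀ j, τ.arr 22 j = if j = k then G.ix (G.upHalf d) else σ.arr 22 j
  a25 : ∀ j, τ.arr 25 j = if j = k then (G.tail d).val + 1 else σ.arr 25 j
  a26 : ∀ j, τ.arr 26 j = if j = k then (G.head d).val + 1 else σ.arr 26 j
  a27 : ∀ j, τ.arr 27 j = if j = k then (G.dir d).toNat else σ.arr 27 j

lemma IsHalfEdge.upHalf {d : Fin n × Fin n} (hd : G.IsHalfEdge d) : G.IsHalfEdge (G.upHalf d) :=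
  isHalfEdge_of_dir (d := (G.tail d, G.head d)) hd.arc

lemma swap_upHalf {d : Fin n × Fin n} : (G.upHalf d).swap = G.rightHalf d := rightHalf_eq.symm

lemma wp_arcRecord {W : ℕ} (hW : G.halfEdges.length ≤ W) (hn : n ≤ W) {σ : State}
    (hm : G.HalfEdgeMemory σ) {k : ℕ} (hk : σ.var 3 = k) {t : ℕ} (ht : σ.var 4 = t) (htW : t ≤ W)
    {d : Fin n × Fin n} (hd : G.IsHalfEdge d) (hq : σ.arr 9 k = G.ix d) :
    wp W arcRecord (G.ArcRecorded d k t σ) σ := by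
  have e1 := hm.target d hd
  have e2 := hm.dir d hd
  have e3 := hm.opp d hd
  have e4 := hm.next d hd
  have e5 := hm.target _ (isHalfEdge_facePerm.2 hd)
  have e6 := hm.target d.swap hd.swap
  have e7 := hm.opp d.swap hd.swap
  have l1 := ix_lt hd.swap
  have l2 := ix_lt hd
  have b1 := (G.apex d).isLt
  have b2 := d.1.isLt
  have b3 := d.2.isLt
  have b4 : (G.dir d).toNat ≤ W := by have := Bool.toNat_le (G.dir d); omega
  change σ.arr 1 (G.ix (G.facePerm d)) = (G.apex d).val at e5
  cases hdir : G.dir d <;> rw [hdir] at e2 <;>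
    simp [arcRecord, hk, ht, hq, e1, e2, e3, e4, e5, e6, e7] <;> repeat refine ⟨by omega, ?_⟩
  all_goals
    constructor <;> simp [hdir, ht, hk, upHalf, tail, head, Prod.swap]

open Classical in
/-- The memory after the triangle of arc `k` has been examined. -/
structure TriangleRecorded (G : EmbeddedDigraph n) (q : ℕ → Fin n × Fin n) (first : ℕ → ℕ) (k : ℕ)
    (τ : State) : Prop where
  var : τ.var 3 = k
  tot : τ.var 4 = first k + if G.Ext (q k) then 0 else 2
  upHalf : τ.var 11 = G.ix (G.upHalf (q k))
  queue : ∀ j < first k + (if G.Ext (q k) then 0 else 2), τ.arr 9 j = G.ix (q j)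
  kids : ∀ j < k + 1, τ.arr 10 j = first j
  kind : ∀ j < k + 1, τ.arr 11 j = G.triangleKind (q j)
  extra : ∀ j < k, τ.arr 12 j = if G.EndsBlock (q j) then first (j + 1) - 1 else 0
  no_extra : τ.arr 12 k = 0
  apex : ∀ j < k + 1, τ.arr 21 j = (G.apex (q j)).val + 1
  up : ∀ j < k + 1, τ.arr 22 j = G.ix (G.upHalf (q j))
  tail : ∀ j < k + 1, τ.arr 25 j = (G.tail (q j)).val + 1
  head : ∀ j < k + 1, τ.arr 26 j = (G.head (q j)).val + 1
  dir : ∀ j < k + 1, τ.arr 27 j = (G.dir (q j)).toNat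

lemma ArcRecorded.step {k : ℕ} {σ τ : State} {x : ℕ} {a : ℕ} {f : ℕ → ℕ}
    (h : ∀ j, τ.arr a j = if j = k then x else σ.arr a j) (h' : ∀ j < k, σ.arr a j = f j)
    (hx : x = f k) : ∀ j < k + 1, τ.arr a j = f j := by grind

lemma wp_triangleRecord {W : ℕ} (hW : G.halfEdges.length ≤ W) (hmW : m + 2 ≤ W) {σ σ' : State}
    (ho : G.IsArcOrder m q first) (hm : G.HalfEdgeMemory σ) {k : ℕ} (hk : k < m)
    (h : G.ArcRecorded (q k) k (first k) σ' σ) (he : G.ExternalMemory σ)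
    (ho' : G.OrderMemory q first k σ') :
    wp W triangleRecord (G.TriangleRecorded q first k) σ := by
  classical
  have hd := (ho.entry k hk).1
  have fin : ∀ τ : State, τ.var 3 = k → τ.var 11 = σ.var 11 →
      τ.var 4 = first k + (if G.Ext (q k) then 0 else 2) →
      (∀ j < first k, τ.arr 9 j = σ.arr 9 j) →
      (¬ G.Ext (q k) → τ.arr 9 (first k) = G.ix (G.tailKid (q k)) ∧
        τ.arr 9 (first k + 1) = G.ix (G.headKid (q k))) →
      (∀ j, τ.arr 11 j = if j = k then G.triangleKind (q k) else σ.arr 11 j) →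
      (∀ a, a = 10 ∨ a = 12 ∨ a = 21 ∨ a = 22 ∨ a = 25 ∨ a = 26 ∨ a = 27 → ∀ j,
        τ.arr a j = σ.arr a j) → G.TriangleRecorded q first k τ := by
    intro τ t1 t2 t3 t4 t5 t6 t7
    have t7' : ∀ a, a = 10 ∨ a = 12 ∨ a = 21 ∨ a = 22 ∨ a = 25 ∨ a = 26 ∨ a = 27 →
        ∀ x, (∀ j, σ.arr a j = if j = k then x else σ'.arr a j) →
        ∀ j, τ.arr a j = if j = k then x else σ'.arr a j :=
      fun a ha x hx j => (t7 a ha j).trans (hx j)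
    refine ⟨t1, t3, t2.trans h.upHalf, fun j hj => ?_,
      ArcRecorded.step (t7' 10 (by simp) _ h.a10) ho'.kids rfl, ?_, fun j hj => ?_, ?_,
      ArcRecorded.step (t7' 21 (by simp) _ h.a21) ho'.apex rfl,
      ArcRecorded.step (t7' 22 (by simp) _ h.a22) ho'.up rfl,
      ArcRecorded.step (t7' 25 (by simp) _ h.a25) ho'.tail rfl,
      ArcRecorded.step (t7' 26 (by simp) _ h.a26) ho'.head rfl,
      ArcRecorded.step (t7' 27 (by simp) _ h.a27) ho'.dir rfl⟩
    · by_cases hj' : j < first k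
      · rw [t4 j hj', h.a9, ho'.queue j hj']
      · by_cases hx : G.Ext (q k)
        · rw [if_pos hx] at hj; omega
        · obtain ⟨k1, k2, -⟩ := ho.triangle_kids hk hx
          obtain ⟨t5, t5'⟩ := t5 hx
          rw [if_neg hx] at hj
          obtain rfl | rfl : j = first k ∨ j = first k + 1 := (by omega) <;> grind
    · refine ArcRecorded.step (σ := σ') (fun j => ?_) ho'.kind rfl
      rw [t6, h.a11]
      split_ifs <;> rfl
    · rw [t7' 12 (by simp) _ h.a12, if_neg hj.ne]
      exact ho'.extra j hj
    · rw [t7' 12 (by simp) _ h.a12, if_pos rfl]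
  have v1 := h.var
  have v2 := h.tot
  have v3 := h.cur
  have e1 := he.ext _ hd
  by_cases hx : G.Ext (q k)
  · rw [if_pos hx] at e1
    simp [triangleRecord, v3, e1]
    refine fin σ v1 rfl (by simp [v2, hx]) (by simp) (fun h => absurd hx h) (fun j => ?_) (by simp)
    rw [h.a11]
    split_ifs <;> simp [triangleKind_eq_zero.2 hx]
  · rw [if_neg hx] at e1
    have h1 := isHalfEdge_facePerm.2 hd
    have h2 := isHalfEdge_facePerm.2 h1
    have d0 := hm.dir _ hd
    have d1 := hm.dir _ h1.swap
    have d2 := hm.dir _ h2.swap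
    have n0 := hm.next _ hd
    have n1 := hm.next _ h1
    have o1 := hm.opp _ h1
    have o2 := hm.opp _ h2
    have l1 := ix_lt h1.swap
    have l2 := ix_lt h2.swap
    have hf := ho.first_le_total hk.le
    have hkid := (ho.triangle_kids hk hx).2.2.trans_le (ho.first_le_total (k := k + 1) hk)
    have hkind : ∀ c : Bool, G.dir (G.headKid (q k)) = c → G.triangleKind (q k) =
        if c = G.dir (q k) then 1 else 2 := by
      rintro _ rfl
      split_ifs with hc
      · exact triangleKind_eq_one.2 ⟨hx, hc⟩
      · exact triangleKind_eq_two.2 ⟨hx, hc⟩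
    cases hdir : G.dir (q k) <;> rw [hdir] at d0 hkind
    · have k1 : G.tailKid (q k) = (G.facePerm (q k)).swap := by unfold tailKid; simp [hdir]
      have k2 : G.headKid (q k) = (G.facePerm (G.facePerm (q k))).swap := by
        unfold headKid; simp [hdir]
      rw [k2] at hkind
      cases hd2 : G.dir (G.facePerm (G.facePerm (q k))).swap <;> rw [hd2] at d2 hkind <;>
        simp [triangleRecord, v1, v2, v3, e1, d0, d1, d2, n0, n1, o1, o2] <;>
        (repeat refine ⟨by omega, ?_⟩) <;>
        refine fin _ (by simp [v1]) (by simp) (by simp [hx]) (fun j hj => ?_)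
          (by simp [k1, k2]) (by simp [hkind _ rfl]) (by simp) <;>
        simp [hj.ne, show j ≠ first k + 1 by omega]
    · have k1 : G.headKid (q k) = (G.facePerm (q k)).swap := by unfold headKid; simp [hdir]
      have k2 : G.tailKid (q k) = (G.facePerm (G.facePerm (q k))).swap := by
        unfold tailKid; simp [hdir]
      rw [k1] at hkind
      cases hd2 : G.dir (G.facePerm (q k)).swap <;> rw [hd2] at d1 hkind <;>
        simp [triangleRecord, v1, v2, v3, e1, d0, d1, d2, n0, n1, o1, o2] <;>
        (repeat refine ⟨by omega, ?_⟩) <;>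
        refine fin _ (by simp [v1]) (by simp) (by simp [hx]) (fun j hj => ?_)
          (by simp [k1, k2]) (by simp [hkind _ rfl]) (by simp) <;>
        simp [hj.ne, show j ≠ first k + 1 by omega]

lemma wp_blockRecord {W : ℕ} (hW : G.halfEdges.length ≤ W) (hmW : m + 2 ≤ W) {σ : State}
    (ho : G.IsArcOrder m q first) (hm : G.HalfEdgeMemory σ) {k : ℕ} (hk : k < m)
    (h : G.TriangleRecorded q first k σ) (he : G.ExternalMemory σ) :
    wp W blockRecord (G.OrderInv q first (k + 1)) σ := by
  classical
  have hd := (ho.entry k hk).1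
  have hu := hd.upHalf
  have v1 := h.var
  have v2 := h.tot
  have v3 := h.upHalf
  have hs := ho.first_succ_eq hk
  have hf := ho.first_le_total (k := k + 1) hk
  have o1 := hm.opp _ hu
  rw [swap_upHalf] at o1
  have hr : G.IsHalfEdge (G.rightHalf (q k)) := by rw [← swap_upHalf]; exact hu.swap
  have hp := isHalfEdge_facePerm_symm.2 hr
  have e1 := he.ext _ hr
  have t1 := hm.target _ hu
  have l1 := he.left (G.upHalf (q k)).2
  have p1 := hm.prev _ hr
  have d1 := hm.dir _ hp
  have o2 := hm.opp _ hp
  have b1 := ix_lt hp.swap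
  by_cases hb : G.EndsBlock (q k)
  · obtain ⟨k1, k2⟩ := ho.block_kid hk hb
    obtain ⟨b1', b2, b3⟩ := id hb
    rw [← swap_upHalf] at b2
    change G.OnSide true (G.upHalf (q k)).2 at b2
    rw [if_pos b1'] at e1
    rw [if_pos b2] at l1
    rw [b3] at d1
    rw [if_pos hb] at hs
    change _ = G.ix (G.blockKid (q k)) at o2
    change G.ix (G.blockKid (q k)) < _ at b1
    simp [blockRecord, v1, v2, v3, o1, e1, t1, l1, p1, d1, o2]
    repeat refine ⟨by omega, ?_⟩
    refine ⟨by simp, by simp [hs], ⟨fun j hj => ?_, by simpa using h.kids, by simpa using h.kind,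
      fun j hj => ?_, by simpa using h.apex, by simpa using h.up, by simpa using h.tail,
      by simpa using h.head, by simpa using h.dir⟩⟩
    · by_cases hj' : j = first (k + 1) - 1
      · rw [hj', k1]
        simp [hs]
      · simp
        rw [if_neg (by omega)]
        exact h.queue j (by omega)
    · by_cases hj' : j = k
      · rw [hj', if_pos hb]; simp [hs]
      · rw [← h.extra j (by omega)]; simp [hj']
  · rw [if_neg hb] at hs
    have hcond : ¬ (σ.arr 7 (G.ix (G.rightHalf (q k))) = 1 ∧ (σ.arr 8 (G.upHalf (q k)).2 = 1 ∧
        σ.arr 2 (G.ix (G.facePerm.symm (G.rightHalf (q k)))) = 0)) := by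
      rintro ⟨c1, c2, c3⟩
      refine hb ⟨by_contra fun hc => ?_, by_contra fun hc => ?_, ?_⟩
      · rw [e1, if_neg hc] at c1; omega
      · rw [← swap_upHalf] at hc
        change ¬ G.OnSide true (G.upHalf (q k)).2 at hc
        rw [l1, if_neg hc] at c2; omega
      · grind
    simp only [blockRecord, Cmd.block, wp, Test.eval, Expr.eval, v3, o1, t1, p1, hcond,
      false_imp_iff, not_false_eq_true, true_imp_iff, true_and, v1]
    refine ⟨by omega, ⟨by simp, by simp [v2, hs], ⟨?_, by simpa using h.kids, by simpa using h.kind,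
      fun j hj => ?_, by simpa using h.apex, by simpa using h.up, by simpa using h.tail,
      by simpa using h.head, by simpa using h.dir⟩⟩⟩
    · have := h.queue
      rw [hs]
      simpa using this
    · by_cases hj' : j = k
      · rw [hj', if_neg hb]; simpa using h.no_extra
      · rw [← h.extra j (by omega)]; simp

lemma ExternalMemory.congr {σ τ : State} (h : G.ExternalMemory σ) (h1 : τ.arr 7 = σ.arr 7)
    (h2 : τ.arr 8 = σ.arr 8) : G.ExternalMemory τ :=
  ⟨h1 ▸ h.ext, h2 ▸ h.left⟩

/-- The machine computes the breadth-first order. -/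
theorem reaches_orderLoop {W : ℕ} (hW : G.halfEdges.length ≤ W) (hmW : m + 2 ≤ W) (hn : n ≤ W)
    {σ : State} (ho : G.IsArcOrder m q first) (hm : G.HalfEdgeMemory σ) (he : G.ExternalMemory σ)
    (hr : σ.var 11 = G.ix (q 0)) :
    Reaches W orderLoop σ (3 + (m * (orderBody.steps + 1) + 1)) (G.OrderInv q first m) := by
  refine Reaches.seq (Q := G.OrderInv q first 0) (t := 3) (Reaches.of_wp (c := .block _) ?_)
    fun υ hfυ hυ => (Reaches.loop (t := orderBody.steps) m (G.OrderInv q first) hυ ?_ ?_)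
  · have := ix_lt (ho.entry 0 ho.bfs.pos).1
    simp [hr]
    repeat refine ⟨by omega, ?_⟩
    refine ⟨by simp, by simp [ho.bfs.first_zero], ⟨by simp [ho.bfs.first_zero], ?_, ?_, ?_, ?_, ?_,
      ?_, ?_, ?_⟩⟩ <;> simp
  · intro i hi τ hf hτ
    simp [hτ.var, hτ.tot]
    -- The loop goes on while the queue has an unexpanded arc. This is so for `k < m`, and after `m`
    -- steps the queue has length exactly `m`.
    constructor
    · intro h
      rcases hi.lt_or_eq with h' | rfl
      · exact h'
      · rw [ho.bfs.first_last] at h; omega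
    · exact ho.bfs.lt_first i
  · intro k hk τ hf hτ
    have hm := (hm.congr (hfυ.arr 1 rfl) (hfυ.arr 2 rfl) (hfυ.arr 3 rfl)
      (hfυ.arr 23 rfl) (hfυ.arr 24 rfl)).congr (hf.arr 1 rfl) (hf.arr 2 rfl) (hf.arr 3 rfl)
      (hf.arr 23 rfl) (hf.arr 24 rfl)
    have he := (he.congr (hfυ.arr 7 rfl) (hfυ.arr 8 rfl)).congr (hf.arr 7 rfl) (hf.arr 8 rfl)
    have hle := ho.first_le_total hk.le
    refine (Reaches.of_wp (wp_arcRecord hW hn hm hτ.var hτ.tot (by omega) (ho.entry k hk).1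
      (hτ.mem.queue k (ho.bfs.lt_first k hk)))).seq fun τ1 hf1 h1 => ?_
    have hm := hm.congr (hf1.arr 1 rfl) (hf1.arr 2 rfl) (hf1.arr 3 rfl) (hf1.arr 23 rfl)
      (hf1.arr 24 rfl)
    have he := he.congr (hf1.arr 7 rfl) (hf1.arr 8 rfl)
    refine (Reaches.of_wp (wp_triangleRecord hW hmW ho hm hk h1 he hτ.mem)).seq fun τ2 hf2 h2 => ?_
    exact Reaches.of_wp (wp_blockRecord hW hmW ho (hm.congr (hf2.arr 1 rfl) (hf2.arr 2 rfl)
      (hf2.arr 3 rfl) (hf2.arr 23 rfl) (hf2.arr 24 rfl)) hk h2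
      (he.congr (hf2.arr 7 rfl) (hf2.arr 8 rfl)))

end EmbeddedDigraph

/-! ### The machine solves the recurrence -/

namespace PageTable

/-- The row of the table at `k`, from the rows of the children. -/
noncomputable def row (m top : ℕ) (first kind : ℕ → ℕ) (extra : ℕ → Prop) (k : ℕ) :
    ℕ × ℕ × ℕ × ℕ :=
  let a := if _h : k < m ∧ k < first k then row m top first kind extra (first k) else 0
  let b := if _h : k < m ∧ k < first k then row m top first kind extra (first k + 1) else 0
  let c := if _h : k < m ∧ k < first (k + 1) - 1 then
    row m top first kind extra (first (k + 1) - 1) else 0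
  open Classical in
  let x := if extra k then c.2.2.2 else 0
  let K := min (a.1 + b.2.2.2) (a.2.1 + min b.1 b.2.2.1)
  let L := min K (a.2.2.1 + b.2.2.2)
  if kind k = 0 then (x, 1 + x, 1 + x, x)
  else if kind k = 1 then (top, 1 + min a.1 a.2.1 + b.2.2.2 + x,
    1 + a.2.2.2 + min b.1 b.2.2.1 + x, a.2.2.2 + b.2.2.2 + x)
  else (K + x, 1 + K + x, 1 + L + x, L + x)
termination_by m - k

/-- Children have larger indices than their parents, so the recursion defines a table. Its existence
is independent of the machine, whose memory is then compared with it row by row. -/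
lemma exists_isSolution {m top : ℕ} {first kind : ℕ → ℕ} {extra : ℕ → Prop}
    (h : BlockForest m first kind extra) :
    ∃ (T : PageTable) (x : ℕ → ℕ), T.IsSolution m top first kind extra x := by
  classical
  set r := row m top first kind extra with hr
  refine ⟨⟨fun k => (r k).1, fun k => (r k).2.1, fun k => (r k).2.2.1, fun k => (r k).2.2.2⟩,
    fun k => if extra k then (r (first (k + 1) - 1)).2.2.2 else 0,
    fun k _ hx => if_neg hx, fun k _ hx => if_pos hx, fun k hk h0 => ?_, fun k hk h1 => ?_,
    fun k hk h2 => ⟨_, rfl, ?_⟩⟩ <;>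
  · have hlt := h.lt_first k hk
    have hx : extra k → k < first (k + 1) - 1 := by
      intro hx
      by_cases h0 : kind k = 0
      · have := h.leaf_extra k hk h0 hx; omega
      · have := h.three k hk h0 hx; omega
    have e : (if extra k then (if k < m ∧ k < first (k + 1) - 1 then r (first (k + 1) - 1)
        else 0 : ℕ × ℕ × ℕ × ℕ).2.2.2 else 0) =
        if extra k then (r (first (k + 1) - 1)).2.2.2 else 0 := by
      split_ifs with h1 h2 <;> grind
    have hrow := row.eq_1 m top first kind extra k
    simp only [← hr, dite_eq_ite, hk, hlt, and_self, if_true, true_and] at hrow e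
    rw [e] at hrow
    clear_value r
    clear hr e
    simp [*]

end PageTable

namespace RAM

/-- Truncated subtraction expresses the minimum: `e - (e - f)`. -/
def Expr.min (e f : Expr) : Expr := .sub e (.sub e f)

@[simp] lemma Expr.eval_min (σ : State) (e f : Expr) :
    (e.min f).eval σ = Min.min (e.eval σ) (f.eval σ) := by
  simp only [Expr.min, Expr.eval]; omega

/-- The counter runs down, so the rows of the children are finished first. In array 12 the entry 0
means that there is no block child, which is unambiguous because index 0 is the root. Register 11
receives the contribution of the block child, which is always in the state without own pages. -/
def tableHead : Cmd := .block [
  .assign 3 (.sub (.var 3) (.lit 1)),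
  .assign 10 (.get 10 (.var 3)),
  .ite (.eq (.get 12 (.var 3)) (.lit 0)) (.assign 11 (.lit 0))
    (.assign 11 (.get 16 (.get 12 (.var 3))))]

def tableRow : Cmd :=
  .ite (.eq (.get 11 (.var 3)) (.lit 0))
    (.block [.store 13 (.var 3) (.var 11),
      .store 14 (.var 3) (.add (.lit 1) (.var 11)),
      .store 15 (.var 3) (.add (.lit 1) (.var 11)),
      .store 16 (.var 3) (.var 11)])
    (.ite (.eq (.get 11 (.var 3)) (.lit 1))
      (.block [.store 13 (.var 3) (.var 5),
        .store 14 (.var 3) (.add (.add (.add (.lit 1) (.min (.get 13 (.var 10)) (.get 14 (.var 10))))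
          (.get 16 (.add (.var 10) (.lit 1)))) (.var 11)),
        .store 15 (.var 3) (.add (.add (.add (.lit 1) (.get 16 (.var 10)))
          (.min (.get 13 (.add (.var 10) (.lit 1))) (.get 15 (.add (.var 10) (.lit 1))))) (.var 11)),
        .store 16 (.var 3) (.add (.add (.get 16 (.var 10)) (.get 16 (.add (.var 10) (.lit 1))))
          (.var 11))])
      (.block [.assign 12 (.min (.add (.get 13 (.var 10)) (.get 16 (.add (.var 10) (.lit 1))))
          (.add (.get 14 (.var 10))
            (.min (.get 13 (.add (.var 10) (.lit 1))) (.get 15 (.add (.var 10) (.lit 1)))))),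
        .assign 14 (.min (.var 12) (.add (.get 15 (.var 10)) (.get 16 (.add (.var 10) (.lit 1))))),
        .store 13 (.var 3) (.add (.var 12) (.var 11)),
        .store 14 (.var 3) (.add (.add (.lit 1) (.var 12)) (.var 11)),
        .store 15 (.var 3) (.add (.add (.lit 1) (.var 14)) (.var 11)),
        .store 16 (.var 3) (.add (.var 14) (.var 11))]))

def tableBody : Cmd := .seq tableHead tableRow

/-- Register 5 holds `m + 1`, the mark of the impossible states, which exceeds every possible value.
Arrays 13 to 16 hold the four columns of the table. -/
def tableLoop : Cmd := .seq (.assign 5 (.add (.var 4) (.lit 1)))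
  (.while (.le (.lit 1) (.var 3)) tableBody)

end RAM

namespace EmbeddedDigraph

variable {n : ℕ} {G : EmbeddedDigraph n} {m : ℕ} {q : ℕ → Fin n × Fin n} {first : ℕ → ℕ}

open RAM

lemma OrderMemory.of_frame {c : Cmd} {k : ℕ} {σ τ : State} (h : G.OrderMemory q first k σ)
    (hf : Frame c σ τ)
    (hc : ∀ a ∈ [9, 10, 11, 12, 21, 22, 25, 26, 27], c.stores a = false) :
    G.OrderMemory q first k τ := by
  obtain ⟨h1, h2, h3, h4, h5, h6, h7, h8, h9⟩ := h
  rw [← hf.arr _ (hc _ (by simp))] at h1 h2 h3 h4 h5 h6 h7 h8 h9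
  exact ⟨h1, h2, h3, h4, h5, h6, h7, h8, h9⟩

/-- The rows of the table from `k` on are in the memory. -/
structure TableMemory (T : PageTable) (m k : ℕ) (τ : State) : Prop where
  c11 : ∀ j, k ≤ j → j < m → τ.arr 13 j = T.c11 j
  c10 : ∀ j, k ≤ j → j < m → τ.arr 14 j = T.c10 j
  c01 : ∀ j, k ≤ j → j < m → τ.arr 15 j = T.c01 j
  c00 : ∀ j, k ≤ j → j < m → τ.arr 16 j = T.c00 j

structure TableInv (T : PageTable) (m i : ℕ) (τ : State) : Prop where
  var : τ.var 3 = m - i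
  top : τ.var 5 = m + 1
  mem : TableMemory T m (m - i) τ

lemma TableMemory.of_stores {T : PageTable} {m k : ℕ} {σ τ : State} (h : TableMemory T m (k + 1) σ)
    (h1 : ∀ j, τ.arr 13 j = if j = k then T.c11 k else σ.arr 13 j)
    (h2 : ∀ j, τ.arr 14 j = if j = k then T.c10 k else σ.arr 14 j)
    (h3 : ∀ j, τ.arr 15 j = if j = k then T.c01 k else σ.arr 15 j)
    (h4 : ∀ j, τ.arr 16 j = if j = k then T.c00 k else σ.arr 16 j) : TableMemory T m k τ := by
  refine ⟨fun j hj hm => ?_, fun j hj hm => ?_, fun j hj hm => ?_, fun j hj hm => ?_⟩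
  · rw [h1]; split_ifs with e
    · rw [e]
    · exact h.c11 j (by omega) hm
  · rw [h2]; split_ifs with e
    · rw [e]
    · exact h.c10 j (by omega) hm
  · rw [h3]; split_ifs with e
    · rw [e]
    · exact h.c01 j (by omega) hm
  · rw [h4]; split_ifs with e
    · rw [e]
    · exact h.c00 j (by omega) hm

/-- The entries of the table are small. -/
lemma IsArcOrder.table_le (ho : G.IsArcOrder m q first) {T : PageTable} {x : ℕ → ℕ}
    (hT : T.IsSolution m (m + 1) first (fun k => G.triangleKind (q k))
      (fun k => G.EndsBlock (q k)) x) {k : ℕ} (hk : k < m) :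
    T.c11 k ≤ m + 1 ∧ T.c10 k ≤ m ∧ T.c01 k ≤ m ∧ T.c00 k ≤ m ∧ x k ≤ m := by
  obtain ⟨h1, h2, h3, h4, h5, -⟩ := ho.blockForest.val_bounds hT (fun _ _ => triangleKind_le) k hk
  refine ⟨?_, h1, h2, h3, h5⟩
  by_cases h : G.triangleKind (q k) = 1
  · exact (hT.one k hk h).1.le
  · exact (h4 h).trans (by omega)

theorem reaches_tableLoop {W : ℕ} (hmW : 4 * m + 8 ≤ W) {σ : State}
    (ho : G.IsArcOrder m q first) (hσ : G.OrderInv q first m σ) {T : PageTable} {x : ℕ → ℕ}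
    (hT : T.IsSolution m (m + 1) first (fun k => G.triangleKind (q k))
      (fun k => G.EndsBlock (q k)) x) :
    Reaches W tableLoop σ (1 + (m * (tableBody.steps + 1) + 1)) (TableMemory T m 0) := by
  classical
  have htot := hσ.tot
  rw [ho.bfs.first_last] at htot
  refine (Reaches.seq (Q := TableInv T m 0) (t := 1) (Reaches.of_wp (c := .assign _ _) ?_)
    fun υ hfυ hυ => (Reaches.loop (t := tableBody.steps) m (TableInv T m) hυ ?_ ?_)).mono le_rfl
    fun τ _ h => by simpa using h.mem
  · simp [htot]
    refine ⟨by omega, by simp [hσ.var], by simp, ?_⟩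
    constructor <;> (intro j h1 h2; omega)
  · intro i hi τ hf hτ
    simp [hτ.var]
    omega
  · intro i hi τ hf hτ
    have hmem := (hσ.mem.of_frame hfυ (by decide)).of_frame hf (by decide)
    obtain ⟨v1, v2, mem⟩ := hτ
    obtain ⟨k, hk⟩ : ∃ k, m - i = k + 1 := ⟨m - i - 1, by omega⟩
    have hkm : k < m := by omega
    have hki : m - (i + 1) = k := by omega
    rw [hk] at v1 mem
    have a10 := hmem.kids k hkm
    have a11 := hmem.kind k hkm
    have a12 := hmem.extra k hkm
    have hlt := ho.bfs.lt_first k hkm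
    obtain ⟨b1, b2, b3, b4, b5⟩ := ho.table_le hT hkm
    have hxv : ∃ c, (τ.arr 12 k = c ∧ ((c = 0 ∧ x k = 0) ∨ (c ≠ 0 ∧ τ.arr 16 c = x k))) := by
      refine ⟨_, rfl, ?_⟩
      rw [a12]
      by_cases hb : G.EndsBlock (q k)
      · have hlt' := (ho.block_kid hkm hb).2
        have := ho.first_le_total (k := k + 1) hkm
        rw [if_pos hb]
        refine .inr ⟨by omega, ?_⟩
        rw [mem.c00 _ (by omega) (by omega), hT.extra k hkm hb]
      · rw [if_neg hb]
        exact .inl ⟨rfl, hT.no_extra k hkm hb⟩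
    obtain ⟨c, a12', hc⟩ := hxv
    have hle := ho.first_le_total hkm.le
    refine (Reaches.of_wp (c := tableHead) (Q := fun τ' => τ'.var 3 = k ∧ τ'.var 10 = first k ∧
      τ'.var 11 = x k ∧ τ'.var 5 = m + 1) ?_).seq fun τ' hf' ⟨u1, u2, u3, u4⟩ =>
        Reaches.of_wp ?_
    · rcases hc with ⟨rfl, hx⟩ | ⟨hc, hx⟩
      · simp [tableHead, v1, v2, a10, a12', hx]
        omega
      · simp [tableHead, v1, v2, a10, a12', hx, hc]
        omega
    have fin : ∀ υ : State, υ.var 3 = τ'.var 3 → υ.var 5 = τ'.var 5 → TableMemory T m k υ →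
        TableInv T m (i + 1) υ := by
      intro υ w1 w2 w3
      exact ⟨by rw [hki, w1]; exact u1, w2.trans u4, by rw [hki]; exact w3⟩
    rw [← hf'.arr 11 rfl] at a11
    replace mem : TableMemory T m (k + 1) τ' := by
      obtain ⟨h1, h2, h3, h4⟩ := mem
      rw [← hf'.arr _ (by decide)] at h1 h2 h3 h4
      exact ⟨h1, h2, h3, h4⟩
    by_cases k0 : G.triangleKind (q k) = 0
    · obtain ⟨t1, t2, t3, t4⟩ := hT.leaf k hkm k0
      rw [k0] at a11
      simp [tableRow, u1, u3, a11]
      repeat refine ⟨by omega, ?_⟩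
      exact fin _ (by simp) (by simp) (mem.of_stores (by simp [t1]) (by simp [t2]) (by simp [t3])
        (by simp [t4]))
    · have hkid := (ho.triangle_kids hkm (fun h => k0 (triangleKind_eq_zero.2 h))).2.2.trans_le
        (ho.first_le_total (k := k + 1) hkm)
      have m1 := mem.c11 (first k) hlt (by omega)
      have m2 := mem.c10 (first k) hlt (by omega)
      have m3 := mem.c01 (first k) hlt (by omega)
      have m4 := mem.c00 (first k) hlt (by omega)
      have m5 := mem.c11 (first k + 1) (by omega) hkid
      have m7 := mem.c01 (first k + 1) (by omega) hkid
      have m8 := mem.c00 (first k + 1) (by omega) hkid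
      have d1 := ho.table_le hT (k := first k) (by omega)
      have d2 := ho.table_le hT (k := first k + 1) hkid
      have n1 : first k ≠ k := by omega
      have n2 : first k + 1 ≠ k := by omega
      by_cases k1 : G.triangleKind (q k) = 1
      · obtain ⟨t1, t2, t3, t4⟩ := hT.one k hkm k1
        rw [k1] at a11
        simp [tableRow, u1, u2, u3, u4, a11, m1, m2, m4, m5, m7, m8, n1, n2]
        repeat refine ⟨by omega, ?_⟩
        exact fin _ (by simp) (by simp) (mem.of_stores (by simp [t1]) (by simp [t2])
          (by simp [t3]) (by simp [t4]))
      · have k2 : G.triangleKind (q k) = 2 := by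
          have := G.triangleKind_le (d := q k)
          omega
        obtain ⟨K, hK, t1, t2, t3, t4⟩ := hT.two k hkm k2
        rw [k2] at a11
        simp only [tableRow, Cmd.block, wp, Test.eval, Expr.eval, Expr.eval_min, setVar_var, setVar_arr,
          setArr_arr, setArr_var, u1, u2, u3, u4, a11, m1, m2, m4, m5, m7, m8, ← hK]
        simp
        repeat refine ⟨by omega, ?_⟩
        exact fin _ (by simp) (by simp) (mem.of_stores (by simp [t1]) (by simp [t2])
          (by simp [t4, m3, m8]) (by simp [t3, m3, m8]))

end EmbeddedDigraph

/-! ### The machine chooses the pages -/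

namespace RAM

/-- For bits `a` and `b` the expression `1 - (a - b) - (b - a)` is 1 exactly if they are equal. It
converts the page relative to the side of the arc into the actual page. -/
def choiceHead : Cmd := .block [
  .assign 10 (.get 10 (.var 3)),
  .store 6 (.get 22 (.var 3)) (.sub (.sub (.lit 1) (.sub (.get 17 (.var 3)) (.get 27 (.var 3))))
    (.sub (.get 27 (.var 3)) (.get 17 (.var 3))))]

/-- For a bit `b` the expression `b - (x - y)` is the conjunction of `b` and `x ≤ y`. Arrays 17 and
18 are 0 at first, so some of the bits that are to be false, and both bits of a block child, need no
store. -/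
def choiceKids : Cmd :=
  .ite (.eq (.get 11 (.var 3)) (.lit 1))
    (.block [.store 17 (.var 10) (.get 17 (.var 3)),
      .store 18 (.var 10) (.sub (.get 17 (.var 3)) (.sub (.get 13 (.var 10)) (.get 14 (.var 10)))),
      .store 17 (.add (.var 10) (.lit 1)) (.sub (.get 18 (.var 3))
        (.sub (.get 13 (.add (.var 10) (.lit 1))) (.get 15 (.add (.var 10) (.lit 1))))),
      .store 18 (.add (.var 10) (.lit 1)) (.get 18 (.var 3))])
    (.ite (.eq (.get 11 (.var 3)) (.lit 2)) (.block [
      .assign 12 (.add (.get 13 (.var 10)) (.get 16 (.add (.var 10) (.lit 1)))),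
      .assign 13 (.add (.get 14 (.var 10))
        (.min (.get 13 (.add (.var 10) (.lit 1))) (.get 15 (.add (.var 10) (.lit 1))))),
      .ite (.and (.eq (.get 17 (.var 3)) (.lit 0))
          (.le (.add (.get 15 (.var 10)) (.get 16 (.add (.var 10) (.lit 1))))
            (.min (.var 12) (.var 13))))
        (.store 18 (.var 10) (.lit 1))
        (.ite (.le (.var 12) (.var 13))
          (.block [.store 17 (.var 10) (.lit 1), .store 18 (.var 10) (.lit 1)])
          (.block [.store 17 (.var 10) (.lit 1),
            .store 17 (.add (.var 10) (.lit 1)) (.sub (.lit 1)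
              (.sub (.get 13 (.add (.var 10) (.lit 1))) (.get 15 (.add (.var 10) (.lit 1))))),
            .store 18 (.add (.var 10) (.lit 1)) (.lit 1)]))]) .skip)

def choiceBody : Cmd := .seq choiceHead (.seq choiceKids (.assign 3 (.add (.var 3) (.lit 1))))

def choiceLoop : Cmd := .seq (.block [.assign 2 (.get 16 (.lit 0)), .assign 3 (.lit 0)])
  (.while (.le (.add (.var 3) (.lit 1)) (.var 4)) choiceBody)

end RAM

namespace EmbeddedDigraph

variable {n : ℕ} {G : EmbeddedDigraph n} {m : ℕ} {q : ℕ → Fin n × Fin n} {first : ℕ → ℕ}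

open RAM

/-- The lower pages that are in the memory. -/
def memF (τ : State) (j : ℕ) : Bool := τ.arr 17 j == 1

/-- The upper pages that are in the memory. -/
def memE (τ : State) (j : ℕ) : Bool := τ.arr 18 j == 1

/-- After `k` steps the states of all arcs up to index `first k` are fixed, and the later ones still
have the default 0. Register 2 keeps the optimal value, which is the required number of crossings.
-/
structure ChoiceInv (G : EmbeddedDigraph n) (q : ℕ → Fin n × Fin n) (first : ℕ → ℕ)
    (T : PageTable) (k : ℕ) (τ : State) : Prop where
  var : τ.var 3 = k
  two : τ.var 2 = T.c00 0
  le : ∀ j, τ.arr 17 j ≤ 1 ∧ τ.arr 18 j ≤ 1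
  zero : ∀ j, first k ≤ j → τ.arr 17 j = 0 ∧ τ.arr 18 j = 0
  choice : T.IsChoice k first (fun k => G.triangleKind (q k)) (fun k => G.EndsBlock (q k))
    (memF τ) (memE τ)
  page : ∀ j < k, τ.arr 6 (G.ix (G.upHalf (q j))) = (memF τ j == G.dir (q j)).toNat

lemma IsArcOrder.upHalf_inj (ho : G.IsArcOrder m q first) {j k : ℕ} (hj : j < m) (hk : k < m)
    (h : G.ix (G.upHalf (q j)) = G.ix (G.upHalf (q k))) : j = k := by
  have e := ix_inj (ho.entry j hj).1.upHalf (ho.entry k hk).1.upHalf h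
  exact ho.bfs.injOn j hj k hk ((ho.entry j hj).eq_of_arc_eq (ho.entry k hk)
    (congrArg Prod.fst e) (congrArg Prod.snd e))

lemma toNat_beq_sub (b c : Bool) {x : ℕ} (h : x = b.toNat) :
    1 - (x - c.toNat) - (c.toNat - x) = ((x == 1) == c).toNat := by
  subst h; cases b <;> cases c <;> rfl

lemma sub_beq_one {F : ℕ} (hF : F ≤ 1) (a b : ℕ) :
    ((F - (a - b)) == 1) = ((F == 1) && decide (a ≤ b)) := by grind

/-- The effect of one step of the choice. -/
lemma ChoiceInv.succ (ho : G.IsArcOrder m q first) {T : PageTable} {k : ℕ} (hk : k < m)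
    {τ υ : State} (h : G.ChoiceInv q first T k τ) (h1 : υ.var 3 = k + 1) (h2 : υ.var 2 = τ.var 2)
    (h6 : ∀ j, υ.arr 6 j = if j = G.ix (G.upHalf (q k)) then (memF τ k == G.dir (q k)).toNat
      else τ.arr 6 j)
    (hle : ∀ j, υ.arr 17 j ≤ 1 ∧ υ.arr 18 j ≤ 1)
    (heq : ∀ j, (G.triangleKind (q k) ≠ 0 → j ≠ first k ∧ j ≠ first k + 1) →
      υ.arr 17 j = τ.arr 17 j ∧ υ.arr 18 j = τ.arr 18 j)
    (one : G.triangleKind (q k) = 1 → memF υ (first k) = memF τ k ∧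
      memE υ (first k) = (memF τ k && decide (T.c11 (first k) ≤ T.c10 (first k))) ∧
      memF υ (first k + 1) = (memE τ k && decide (T.c11 (first k + 1) ≤ T.c01 (first k + 1))) ∧
      memE υ (first k + 1) = memE τ k)
    (two : G.triangleKind (q k) = 2 → ∃ A B : ℕ,
      A = T.c11 (first k) + T.c00 (first k + 1) ∧
      B = T.c10 (first k) + min (T.c11 (first k + 1)) (T.c01 (first k + 1)) ∧
      ((memF τ k = false ∧ T.c01 (first k) + T.c00 (first k + 1) ≤ min A B ∧
        memF υ (first k) = false ∧ memE υ (first k) = true ∧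
        memF υ (first k + 1) = false ∧ memE υ (first k + 1) = false) ∨
      (¬ (memF τ k = false ∧ T.c01 (first k) + T.c00 (first k + 1) ≤ min A B) ∧ A ≤ B ∧
        memF υ (first k) = true ∧ memE υ (first k) = true ∧
        memF υ (first k + 1) = false ∧ memE υ (first k + 1) = false) ∨
      (¬ (memF τ k = false ∧ T.c01 (first k) + T.c00 (first k + 1) ≤ min A B) ∧ ¬ A ≤ B ∧
        memF υ (first k) = true ∧ memE υ (first k) = false ∧
        memF υ (first k + 1) = decide (T.c11 (first k + 1) ≤ T.c01 (first k + 1)) ∧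
        memE υ (first k + 1) = true))) :
    G.ChoiceInv q first T (k + 1) υ := by
  have hlt := ho.bfs.lt_first
  have hsk := ho.first_succ_eq hk
  have heq' : ∀ j < first k, memF υ j = memF τ j ∧ memE υ j = memE τ j := by
    intro j hj
    obtain ⟨e1, e2⟩ := heq j (fun _ => by omega)
    unfold memF memE
    rw [e1, e2]; exact ⟨rfl, rfl⟩
  have hz : ∀ j, first k ≤ j → (G.triangleKind (q k) ≠ 0 → first k + 2 ≤ j) →
      υ.arr 17 j = 0 ∧ υ.arr 18 j = 0 := by
    intro j hj hj'
    obtain ⟨e1, e2⟩ := heq j (fun hc => by have := hj' hc; omega)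
    rw [e1, e2]; exact h.zero j hj
  have hkid : ∀ j < m, G.triangleKind (q j) ≠ 0 → first j + 1 < first (j + 1) :=
    fun j hj hc => (ho.triangle_kids hj (fun hx => hc (triangleKind_eq_zero.2 hx))).2.2
  have hmono : ∀ j < k, first (j + 1) ≤ first k := fun j hj => ho.bfs.first_le hj hk.le
  have hk' := hlt k hk
  refine ⟨h1, h2.trans h.two, hle, fun j hj => ?_, ⟨?_, fun j hj hx => ?_, fun j hj k1 => ?_,
    fun j hj k2 => ?_⟩, fun j hj => ?_⟩
  · refine hz j (by omega) fun hc => ?_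
    have := hkid k hk hc
    omega
  · rw [(heq' 0 (by omega)).1, (heq' 0 (by omega)).2]; exact h.choice.root
  · obtain ⟨-, b1⟩ := ho.block_kid (k := j) (by omega) hx
    rcases Nat.lt_succ_iff_lt_or_eq.1 hj with hj | rfl
    · have := hmono j hj
      rw [(heq' _ (by omega)).1, (heq' _ (by omega)).2]
      exact h.choice.extra j hj hx
    · obtain ⟨e1, e2⟩ := hz (first (j + 1) - 1) (by omega) fun hc => by
        rw [if_neg (fun hx => hc (triangleKind_eq_zero.2 hx)), if_pos hx] at hsk
        omega
      unfold memF memE; rw [e1, e2]; exact ⟨rfl, rfl⟩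
  · rcases Nat.lt_succ_iff_lt_or_eq.1 hj with hj | rfl
    · have := hmono j hj
      have h3 := hkid j (by omega) (by rw [k1]; decide)
      obtain ⟨a1, a2⟩ := heq' j (by omega)
      obtain ⟨a3, a4⟩ := heq' (first j) (by omega)
      obtain ⟨a5, a6⟩ := heq' (first j + 1) (by omega)
      rw [a1, a2, a3, a4, a5, a6]
      exact h.choice.one j hj k1
    · grind
  · rcases Nat.lt_succ_iff_lt_or_eq.1 hj with hj | rfl
    · have := hmono j hj
      have h3 := hkid j (by omega) (by rw [k2]; decide)
      obtain ⟨a1, a2⟩ := heq' j (by omega)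
      obtain ⟨a3, a4⟩ := heq' (first j) (by omega)
      obtain ⟨a5, a6⟩ := heq' (first j + 1) (by omega)
      rw [a1, a3, a4, a5, a6]
      exact h.choice.two j hj k2
    · rw [(heq' j hk').1]; exact two k2
  · rw [(heq' j (by omega)).1, h6]
    split_ifs with e
    · rw [ho.upHalf_inj (by omega) hk e]
    · refine h.page j (lt_of_le_of_ne (by omega) ?_)
      rintro rfl; exact e rfl

theorem reaches_choiceLoop {W : ℕ} (hmW : 4 * m + 8 ≤ W) {σ : State}
    (ho : G.IsArcOrder m q first) (hσ : G.OrderMemory q first m σ) (htot : σ.var 4 = m)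
    {T : PageTable} {x : ℕ → ℕ}
    (hT : T.IsSolution m (m + 1) first (fun k => G.triangleKind (q k))
      (fun k => G.EndsBlock (q k)) x) (hmem : TableMemory T m 0 σ)
    (h17 : ∀ j, σ.arr 17 j = 0) (h18 : ∀ j, σ.arr 18 j = 0) :
    Reaches W choiceLoop σ (2 + (m * (choiceBody.steps + 1) + 1)) (G.ChoiceInv q first T m) := by
  have hm := ho.bfs.pos
  refine Reaches.seq (Q := G.ChoiceInv q first T 0) (t := 2) (Reaches.of_wp (c := .block _) ?_)
    fun υ hfυ hυ => (Reaches.loop (t := choiceBody.steps) m (G.ChoiceInv q first T) hυ ?_ ?_)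
  · have := ho.table_le hT hm
    have e := hmem.c00 0 le_rfl hm
    simp [e]
    refine ⟨by omega, by simp, by simp, by simp [h17, h18], by simp [h17, h18],
      ⟨by simp [memF, memE, h17, h18], ?_, ?_, ?_⟩, ?_⟩ <;> (intro j hj; omega)
  · intro i hi τ hf hτ
    have e1 : τ.var 4 = _ := hf.var 4 rfl
    have e2 : υ.var 4 = _ := hfυ.var 4 rfl
    simp [hτ.var, e1, e2, htot]
  · intro k hk τ hf hτ
    have hmem' : TableMemory T m 0 τ := by
      obtain ⟨h1, h2, h3, h4⟩ := hmem
      rw [← hfυ.arr _ (by decide), ← hf.arr _ (by decide)] at h1 h2 h3 h4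
      exact ⟨h1, h2, h3, h4⟩
    have hσ := (hσ.of_frame hfυ (by decide)).of_frame hf (by decide)
    have hle := ho.first_le_total (k := k + 1) hk
    have hlt := ho.bfs.lt_first k hk
    have v1 := hτ.var
    have a10 := hσ.kids k hk
    have a11 := hσ.kind k hk
    have a22 := hσ.up k hk
    have a27 := hσ.dir k hk
    have bF := (hτ.le k).1
    have bE := (hτ.le k).2
    have z0 := hτ.zero (first k) le_rfl
    have z1 := hτ.zero (first k + 1) (by omega)
    have hb : ∀ {x : ℕ}, x ≤ 1 → x = (x == 1).toNat := by
      intro x hx; interval_cases x <;> rfl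
    have hF := toNat_beq_sub (memF τ k) (G.dir (q k)) (hb bF)
    have hF' : (memF τ k == G.dir (q k)).toNat ≤ 1 := Bool.toNat_le _
    have t0 := ho.table_le hT (k := first k)
    have t1 := ho.table_le hT (k := first k + 1)
    have hkid : G.triangleKind (q k) ≠ 0 → first k + 1 < m := fun hc =>
      (ho.triangle_kids hk (fun h => hc (triangleKind_eq_zero.2 h))).2.2.trans_le hle
    refine (Reaches.of_wp (c := choiceHead) (Q := fun τ' => (∀ a, a ≠ 6 → τ'.arr a = τ.arr a) ∧
      τ'.var 3 = k ∧ τ'.var 2 = τ.var 2 ∧ τ'.var 10 = first k ∧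
      ∀ j, τ'.arr 6 j = if j = G.ix (G.upHalf (q k)) then (memF τ k == G.dir (q k)).toNat
      else τ.arr 6 j) ?_).seq fun τ' hf' ⟨u0, u1, u2, u3, u6⟩ => Reaches.of_wp ?_
    · obtain ⟨P, hP⟩ : ∃ P : State → Prop, ∀ υ, P υ ↔ ((∀ a, a ≠ 6 → υ.arr a = τ.arr a) ∧
          υ.var 3 = k ∧ υ.var 2 = τ.var 2 ∧ υ.var 10 = first k ∧
          ∀ j, υ.arr 6 j = if j = G.ix (G.upHalf (q k)) then (memF τ k == G.dir (q k)).toNat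
            else τ.arr 6 j) := ⟨_, fun _ => Iff.rfl⟩
      simp only [← hP]
      simp [choiceHead, v1, a10, a22, a27]
      have := ho.first_le_total hk.le
      refine ⟨by omega, by omega, (hP _).2 ⟨fun a ha => ?_, by simp [v1], by simp, by simp,
        fun j => by simp [← hF, memF]⟩⟩
      ext j
      simp [ha]
    · have fin := fun (υ : State) => hτ.succ (υ := υ) ho hk
      rw [← u2] at fin
      rw [← u0 17 (by decide)] at bF
      rw [← u0 18 (by decide)] at bE
      rw [← u0 11 (by decide)] at a11
      have hle' := hτ.le
      rw [← u0 17 (by decide), ← u0 18 (by decide)] at z0 z1 hle'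
      have eF : memF τ k = (τ'.arr 17 k == 1) := by unfold memF; rw [u0 17 (by decide)]
      have eE : memE τ k = (τ'.arr 18 k == 1) := by unfold memE; rw [u0 18 (by decide)]
      rw [eE, eF, ← u0 17 (by decide), ← u0 18 (by decide)] at fin
      rw [eF] at u6 
      have s1 := sub_beq_one bF (T.c11 (first k)) (T.c10 (first k))
      have s2 := sub_beq_one bE (T.c11 (first k + 1)) (T.c01 (first k + 1))
      have s3 := sub_beq_one le_rfl (T.c11 (first k + 1)) (T.c01 (first k + 1))
      by_cases k0 : G.triangleKind (q k) = 0
      · rw [k0] at a11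
        simp [choiceKids, u1, a11]
        refine ⟨by omega, fin _ (by simp) (by simp) (by simp [u6]) (by simpa using hle') (by simp)
          (by simp [k0]) (by simp [k0])⟩
      · have hk1 := hkid k0
        replace t0 := t0 (by omega)
        replace t1 := t1 hk1
        have m1 := hmem'.c11 (first k) (by omega) (by omega)
        have m2 := hmem'.c10 (first k) (by omega) (by omega)
        have m3 := hmem'.c01 (first k) (by omega) (by omega)
        have m5 := hmem'.c11 (first k + 1) (by omega) hk1
        have m7 := hmem'.c01 (first k + 1) (by omega) hk1
        have m8 := hmem'.c00 (first k + 1) (by omega) hk1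
        rw [← u0 _ (by decide)] at m1 m2 m3 m5 m7 m8
        have n1 : k ≠ first k := by omega
        have n2 : k ≠ first k + 1 := by omega
        by_cases k1 : G.triangleKind (q k) = 1
        · rw [k1] at a11
          simp [choiceKids, u1, u3, a11, m1, m2, m5, m7, n1, n2]
          repeat refine ⟨by omega, ?_⟩
          refine fin _ (by simp) (by simp) (by simp [u6]) (fun j => ?_) (fun j hj => ?_)
            (fun _ => ?_) (by simp [k1])
          · have := hle' j
            simp; constructor <;> split_ifs <;> omega
          · simp [hj k0]
          · simp [memF, memE, s1, s2]
        · have k2 : G.triangleKind (q k) = 2 := by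
            have := G.triangleKind_le (d := q k)
            omega
          rw [k2] at a11
          have fin' := fun (υ : State) f1 f2 f6 hle heq two => fin υ f1 f2 f6 hle heq
            (fun h => absurd h k1) fun _ => ⟨_, _, rfl, rfl, two⟩
          have eF' : (τ'.arr 17 k == 1) = false ↔ τ'.arr 17 k = 0 := by grind
          rw [eF'] at fin'
          generalize hA : T.c11 (first k) + T.c00 (first k + 1) = A at fin'
          generalize hB : T.c10 (first k) + min (T.c11 (first k + 1)) (T.c01 (first k + 1)) = B
            at fin'
          by_cases c1 : τ'.arr 17 k = 0 ∧ T.c01 (first k) + T.c00 (first k + 1) ≤ min A B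
          · have c2 := le_min_iff.1 c1.2
            simp [choiceKids, u1, u3, a11, m1, m2, m3, m5, m7, m8, c1.1, hA, hB, c2]
            repeat refine ⟨by omega, ?_⟩
            refine fin' _ (by simp) (by simp) (by simp [u6]) (fun j => ?_) (fun j hj => ?_)
              (.inl ⟨c1.1, c1.2, ?_⟩)
            · have := hle' j
              simp; split_ifs <;> omega
            · simp [hj k0]
            · simp [memF, memE, z0, z1]
          · have c2 : ¬ (τ'.arr 17 k = 0 ∧ T.c01 (first k) + T.c00 (first k + 1) ≤ A ∧
                T.c01 (first k) + T.c00 (first k + 1) ≤ B) := by rwa [← le_min_iff]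
            by_cases c3 : A ≤ B
            · simp only [choiceKids, wp, Cmd.block, Test.eval]
              simp [u1, u3, a11, m1, m2, m3, m5, m7, m8, hA, hB, c3]
              refine ⟨by omega, by omega, fun h1 h2 => absurd ⟨h1, h2, h2.trans c3⟩ c2, fun _ => ?_⟩
              repeat refine ⟨by omega, ?_⟩
              refine fin' _ (by simp) (by simp) (by simp [u6]) (fun j => ?_) (fun j hj => ?_)
                (.inr (.inl ⟨c1, c3, ?_⟩))
              · have := hle' j
                simp; split_ifs <;> omega
              · simp [hj k0]
              · simp [memF, memE, z1]
            · simp only [choiceKids, wp, Cmd.block, Test.eval]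
              simp [u1, u3, a11, m1, m2, m3, m5, m7, m8, hA, hB, c3]
              refine ⟨by omega, by omega, fun h1 h2 h3 => absurd ⟨h1, h2, h3⟩ c2, fun _ => ?_⟩
              repeat refine ⟨by omega, ?_⟩
              refine fin' _ (by simp) (by simp) (by simp [u6]) (fun j => ?_) (fun j hj => ?_)
                (.inr (.inr ⟨c1, c3, ?_⟩))
              · have := hle' j
                simp; split_ifs <;> omega
              · simp [hj k0]
              · simp [memF, memE, z0, s3]

end EmbeddedDigraph

/-! ### The machine builds the list of nodes -/

namespace RAM

/-- Insert the node `e` after the cursor, and move the cursor to it. -/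
def insertNode (b : Test) (e : Expr) : Cmd := .ite b (.block [
  .assign 6 e, .store 19 (.var 6) (.get 19 (.var 5)), .store 20 (.var 6) (.var 5),
  .store 20 (.get 19 (.var 6)) (.var 6), .store 19 (.var 5) (.var 6), .assign 5 (.var 6)]) .skip

def insertNodes : List (Test × Expr) → Cmd
  | [] => .skip
  | p :: L => .seq (insertNode p.1 p.2) (insertNodes L)

open Classical in
/-- The nodes that are inserted. -/
noncomputable def newNodes (σ : State) (L : List (Test × Expr)) : List ℕ :=
  L.flatMap fun p => if p.1.eval σ then [p.2.eval σ] else []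

/-- The doubly linked list in the memory; `0` marks its end. -/
structure Linked (l : List ℕ) (σ : State) : Prop where
  chain : (l ++ [0]).IsChain fun a b => σ.arr 19 a = b ∧ σ.arr 20 b = a

lemma Linked.congr {l : List ℕ} {σ τ : State} (h : Linked l σ) (h1 : τ.arr 19 = σ.arr 19)
    (h2 : τ.arr 20 = σ.arr 20) : Linked l τ := ⟨by rw [h1, h2]; exact h.chain⟩

/-- Only the pointers between `p`, `y` and `c` change, and the absence of repetitions keeps all
other links intact. -/
lemma isChain_insert {nx pv nx' pv' : ℕ → ℕ} {P R : List ℕ} {p c y : ℕ}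
    (h : (P ++ p :: c :: R).IsChain fun a b => nx a = b ∧ pv b = a)
    (hnd : (P ++ p :: y :: c :: R).Nodup)
    (h1 : ∀ a, nx' a = if a = p then y else if a = y then c else nx a)
    (h2 : ∀ b, pv' b = if b = c then y else if b = y then p else pv b) :
    (P ++ p :: y :: c :: R).IsChain fun a b => nx' a = b ∧ pv' b = a := by
  simp only [List.nodup_append, List.nodup_cons, List.mem_cons, not_or] at hnd
  obtain ⟨-, ⟨⟨n1, n2, n3⟩, ⟨n4, n5⟩, n6, -⟩, n7⟩ := hnd
  rw [List.isChain_append_cons_cons] at h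
  obtain ⟨a1, -, a3⟩ := h
  rw [List.isChain_append] at a1
  obtain ⟨a1, -, a2⟩ := a1
  have m7 : ∀ a ∈ P, a ≠ p ∧ a ≠ y ∧ a ≠ c := fun a ha =>
    ⟨n7 a ha p (.inl rfl), n7 a ha y (.inr (.inl rfl)), n7 a ha c (.inr (.inr (.inl rfl)))⟩
  rw [List.isChain_append_cons_cons, List.isChain_cons_cons, List.isChain_append]
  refine ⟨⟨a1.imp_of_mem_imp fun a b ha hb hab => ?_, by simp, fun x hx b hb => ?_⟩, ?_, ?_, ?_⟩
  · grind
  · grind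
  · rw [h1, h2, if_pos rfl, if_neg n4, if_pos rfl]; exact ⟨rfl, rfl⟩
  · rw [h1, h2, if_neg (Ne.symm n1), if_pos rfl, if_pos rfl]; exact ⟨rfl, rfl⟩
  · refine a3.imp_of_mem_tail_imp fun a b ha hb hab => ?_
    have hb : b ∈ R := hb
    have k1 : a ≠ p := by
      rintro rfl
      rcases List.mem_cons.1 ha with e | e
      exacts [n2 e, n3 e]
    have k2 : a ≠ y := by
      rintro rfl
      rcases List.mem_cons.1 ha with e | e
      exacts [n4 e, n5 e]
    rw [h1, h2, if_neg k1, if_neg k2, if_neg (by rintro rfl; exact n6 hb),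
      if_neg (by rintro rfl; exact n5 hb)]
    exact hab

/-- The cursor is at the end of `P` in the list `P ++ B`. -/
structure Cursor (P B : List ℕ) (σ : State) : Prop where
  linked : Linked (P ++ B) σ
  last : P.getLast? = some (σ.var 5)

open Classical in
lemma reaches_insertNode {W : ℕ} {b : Test} {e : Expr} {σ : State} {P B : List ℕ}
    (h : Cursor P B σ) (hnd : (P ++ (if b.eval σ then [e.eval σ] else []) ++ B).Nodup)
    (hW : ∀ x ∈ P ++ (if b.eval σ then [e.eval σ] else []) ++ B, 0 < x ∧ x ≤ W) :
    Reaches W (insertNode b e) σ 7 (Cursor (P ++ if b.eval σ then [e.eval σ] else []) B) := by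
  refine (Reaches.of_wp ?_).mono (t := (insertNode b e).steps) le_rfl fun _ _ h => h
  by_cases hb : b.eval σ
  swap
  · simpa [insertNode, hb] using h
  simp only [hb, if_true] at hnd hW ⊢
  obtain ⟨P, rfl⟩ : ∃ P', P = P' ++ [σ.var 5] := by
    have := h.last
    rcases List.eq_nil_or_concat P with rfl | ⟨P', z, rfl⟩
    · simp at this
    · grind
  -- The node after the cursor may be the end mark 0. Its backward pointer is kept like that of any
  -- node, so insertion at the end is no special case.
  obtain ⟨c, R, hc⟩ : ∃ c R, B ++ [0] = c :: R := by cases B <;> simp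
  have hch := h.linked.chain
  rw [show P ++ [σ.var 5] ++ B ++ [0] = P ++ σ.var 5 :: c :: R by simp [← hc]] at hch
  have e1 : σ.arr 19 (σ.var 5) = c := (List.isChain_append_cons_cons.1 hch).2.1.1
  have hcW : c ≤ W := by
    have : c ∈ B ++ [0] := by rw [hc]; simp
    rcases List.mem_append.1 this with hm | hm
    · exact (hW c (by simp [hm])).2
    · simp at hm; omega
  have hy := hW (e.eval σ) (by simp)
  have hp := hW (σ.var 5) (by simp)
  generalize hyy : e.eval σ = y at *
  have hnd' : (P ++ σ.var 5 :: y :: c :: R).Nodup := by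
    rw [← hc]
    have : (P ++ [σ.var 5] ++ [y] ++ B ++ [0]).Nodup :=
      List.nodup_append.2 ⟨hnd, by simp, fun a ha b hb e => by
        have := (hW a ha).1
        simp at hb; omega⟩
    simpa using this
  have fin : ∀ υ : State, υ.var 5 = y →
      (∀ a, υ.arr 19 a = if a = σ.var 5 then y else if a = y then c else σ.arr 19 a) →
      (∀ a, υ.arr 20 a = if a = c then y else if a = y then σ.var 5 else σ.arr 20 a) →
      Cursor (P ++ [σ.var 5, y]) B υ := by
    intro υ w1 w2 w3
    refine ⟨⟨?_⟩, by simp [w1]⟩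
    have := isChain_insert hch hnd' w2 w3
    rw [← hc] at this
    simpa using this
  have hne : σ.var 5 ≠ y := by
    rintro e
    rw [e] at hnd'
    simpa using (List.nodup_append.1 hnd').2.1
  simp [insertNode, hb, hyy, e1]
  refine ⟨hy.2, hcW, hp.2, hy.2, fin _ (by simp) (fun a => by simp) (fun a => by simp)⟩

/-- Insert a sequence of nodes, none of which is affected by the insertion of the others. -/
theorem reaches_insertNodes {W : ℕ} {L : List (Test × Expr)} {σ : State} {P B : List ℕ}
    (h : Cursor P B σ)
    (hL : ∀ τ, Frame (insertNode (.eq (.lit 0) (.lit 0)) (.lit 0)) σ τ →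
      ∀ p ∈ L, (p.1.eval τ ↔ p.1.eval σ) ∧ p.2.eval τ = p.2.eval σ)
    (hnd : (P ++ newNodes σ L ++ B).Nodup)
    (hW : ∀ x ∈ P ++ newNodes σ L ++ B, 0 < x ∧ x ≤ W) :
    Reaches W (insertNodes L) σ (7 * L.length) (Linked (P ++ newNodes σ L ++ B)) := by
  classical
  induction L generalizing σ P with
  | nil => exact ⟨σ, 0, .skip σ, le_rfl, by simpa [newNodes] using h.linked⟩
  | cons p L ih =>
    have e1 : newNodes σ (p :: L) =
        (if p.1.eval σ then [p.2.eval σ] else []) ++ newNodes σ L := by simp [newNodes]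
    rw [e1] at hnd hW ⊢
    set ys := if p.1.eval σ then [p.2.eval σ] else []
    have hsub : (P ++ ys ++ B).Sublist (P ++ (ys ++ newNodes σ L) ++ B) :=
      (List.Sublist.append_left (List.sublist_append_left _ _) P).append_right B
    refine (Reaches.seq (reaches_insertNode h (hnd.sublist hsub)
      fun x hx => hW x (hsub.subset hx)) fun τ hf hτ => ?_).mono (t := 7 + 7 * L.length)
      (by simp; omega) fun _ _ h => h
    have hf' : Frame (insertNode (.eq (.lit 0) (.lit 0)) (.lit 0)) σ τ := ⟨hf.arr, hf.var⟩
    have e2 : newNodes τ L = newNodes σ L := by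
      refine List.flatMap_congr fun x hx => ?_
      obtain ⟨h1, h2⟩ := hL τ hf' x (by simp [hx])
      simp only [h1, h2]
    have := ih (σ := τ) hτ (fun υ hυ x hx => by
      obtain ⟨h1, h2⟩ := hL τ hf' x (by simp [hx])
      rw [h1, h2]
      exact hL υ (hf'.trans hυ) x (by simp [hx])) (by rw [e2]; simpa using hnd)
      (by rw [e2]; simpa only [List.append_assoc] using hW)
    rw [e2] at this
    simpa using this

end RAM

/-! ### The machine inserts the nodes of all triangles -/

namespace RAM

def crossingTest (i : Expr) : Test := .not (.eq (.get 17 i) (.get 18 i))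

def crossingNode (i : Expr) : Expr := .add (.add (.var 0) (.lit 1)) i

/-- The new nodes go directly below the head of the base if the base leaves on its own page, hence
after the predecessor of the head; otherwise they go directly above the tail. -/
def midStart : Cmd := .ite (.eq (.get 17 (.var 3)) (.lit 1))
  (.assign 5 (.get 20 (.get 26 (.var 3)))) (.assign 5 (.get 25 (.var 3)))

def midNodes : List (Test × Expr) := [(crossingTest (.var 8), crossingNode (.var 8)),
  (.eq (.lit 0) (.lit 0), .get 21 (.var 3)),
  (crossingTest (.add (.var 8) (.lit 1)), crossingNode (.add (.var 8) (.lit 1)))]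

/-- The crossing of the longest arc is placed here only if that arc leaves on its own page;
otherwise it belongs directly above the tail and is left to `lowNodes`. -/
def topNodes : List (Test × Expr) := [
  (crossingTest (.add (.var 8) (.lit 1)), crossingNode (.add (.var 8) (.lit 1))),
  (.and (crossingTest (.var 8)) (.eq (.get 17 (.var 8)) (.lit 1)), crossingNode (.var 8)),
  (.eq (.lit 0) (.lit 0), .get 21 (.var 3))]

/-- Testing the lower page suffices: an arc above the base that does not leave on its own page
enters on it, so it crosses the spine. -/
def lowNodes : List (Test × Expr) := [(.eq (.get 17 (.var 8)) (.lit 0), crossingNode (.var 8))]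

def blockNodes : List (Test × Expr) :=
  [(.not (.eq (.get 12 (.var 3)) (.lit 0)), .get 26 (.get 12 (.var 3)))]

def triangleInsert : Cmd := .ite (.eq (.get 11 (.var 3)) (.lit 1))
  (.seq midStart (insertNodes midNodes))
  (.ite (.eq (.get 11 (.var 3)) (.lit 2))
    (.seq (.assign 5 (.get 26 (.var 3))) (.seq (insertNodes topNodes)
      (.seq (.assign 5 (.get 25 (.var 3))) (insertNodes lowNodes)))) .skip)

def blockInsert : Cmd := .seq (.assign 5 (.get 26 (.var 3))) (insertNodes blockNodes)

def insertBody : Cmd := .seq (.assign 8 (.get 10 (.var 3))) (.seq triangleInsert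
  (.seq blockInsert (.assign 3 (.add (.var 3) (.lit 1)))))

def insertLoop : Cmd := .seq (.block [.assign 3 (.lit 0), .store 19 (.get 25 (.lit 0))
  (.get 26 (.lit 0)), .store 20 (.get 26 (.lit 0)) (.get 25 (.lit 0)),
  .store 19 (.get 26 (.lit 0)) (.lit 0), .store 20 (.lit 0) (.get 26 (.lit 0))])
  (.while (.le (.add (.var 3) (.lit 1)) (.var 4)) insertBody)

end RAM

namespace EmbeddedDigraph

variable {n : ℕ} {G : EmbeddedDigraph n} {m : ℕ} {q : ℕ → Fin n × Fin n} {first : ℕ → ℕ}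
  {F E : ℕ → Bool}

open RAM

/-- The arc order and the pages are in the memory. -/
structure PagedMemory (G : EmbeddedDigraph n) (q : ℕ → Fin n × Fin n) (first : ℕ → ℕ) (m : ℕ)
    (F E : ℕ → Bool) (τ : State) : Prop where
  order : G.OrderMemory q first m τ
  lower : memF τ = F
  upper : memE τ = E
  le : ∀ j, τ.arr 17 j ≤ 1 ∧ τ.arr 18 j ≤ 1
  size : τ.var 0 = n

lemma PagedMemory.of_frame {c : Cmd} {σ τ : State} (h : G.PagedMemory q first m F E σ)
    (hf : Frame c σ τ) (hc : ∀ a ∈ [9, 10, 11, 12, 17, 18, 21, 22, 25, 26, 27],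
      c.stores a = false) (h0 : c.assigns 0 = false) : G.PagedMemory q first m F E τ := by
  have e17 := hf.arr 17 (hc 17 (by decide))
  have e18 := hf.arr 18 (hc 18 (by decide))
  refine ⟨h.order.of_frame hf fun a ha => hc a ?_, ?_, ?_, ?_, (hf.var 0 h0).trans h.size⟩
  · revert a; decide
  · rw [← h.lower]; unfold memF; rw [e17]
  · rw [← h.upper]; unfold memE; rw [e18]
  · rw [e17, e18]; exact h.le

namespace PagedMemory

variable {τ : State} (h : G.PagedMemory q first m F E τ)
include h

lemma lower_eq (j : ℕ) : (τ.arr 17 j = 1 ↔ F j = true) ∧ (τ.arr 17 j = 0 ↔ F j = false) := by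
  rw [← h.lower]
  have := (h.le j).1
  unfold memF
  constructor <;> grind

lemma crossing_iff (j : ℕ) : τ.arr 17 j = τ.arr 18 j ↔ F j = E j := by
  rw [← h.lower, ← h.upper]
  have h1 := (h.le j).1
  have h2 := (h.le j).2
  unfold memF memE
  rw [Bool.eq_iff_iff, beq_iff_eq, beq_iff_eq]
  omega

lemma newNodes_mid {k : ℕ} (hk : k < m) (h3 : τ.var 3 = k) (h8 : τ.var 8 = first k) :
    newNodes τ midNodes = crossingNodes n F E (first k) ++ [(G.apex (q k)).val + 1] ++
      crossingNodes n F E (first k + 1) := by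
  simp [newNodes, midNodes, crossingTest, crossingNode, crossingNodes, h.crossing_iff, h3, h8,
    h.size, h.order.apex k hk]

lemma newNodes_top {k : ℕ} (hk : k < m) (h3 : τ.var 3 = k) (h8 : τ.var 8 = first k) :
    newNodes τ topNodes = crossingNodes n F E (first k + 1) ++
      (if F (first k) = true then crossingNodes n F E (first k) else []) ++
        [(G.apex (q k)).val + 1] := by
  by_cases hF : F (first k) = true <;>
  simp [newNodes, topNodes, crossingTest, crossingNode, crossingNodes, h.crossing_iff, h3, h8,
    h.size, h.order.apex k hk, (h.lower_eq (first k)).1, hF]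

lemma newNodes_low {k : ℕ} (h8 : τ.var 8 = first k) :
    newNodes τ lowNodes = if F (first k) = false then [n + 1 + first k] else [] := by
  simp [newNodes, lowNodes, crossingNode, h8, h.size, (h.lower_eq (first k)).2]

open Classical in
lemma newNodes_block (ho : G.IsArcOrder m q first) {k : ℕ} (hk : k < m) (h3 : τ.var 3 = k) :
    newNodes τ blockNodes =
      if G.EndsBlock (q k) then [(G.head (G.blockKid (q k))).val + 1] else [] := by
  have h12 := h.order.extra k hk
  by_cases hb : G.EndsBlock (q k)
  · obtain ⟨h1, h2⟩ := ho.block_kid hk hb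
    have hlt := ho.bfs.lt_first k hk
    have hle := ho.first_le_total (k := k + 1) hk
    rw [if_pos hb] at h12
    have h26 := h.order.head (first (k + 1) - 1) (by omega)
    rw [h1] at h26
    have : first (k + 1) - 1 ≠ 0 := by omega
    simp [newNodes, blockNodes, h3, h12, h26, hb, this]
  · rw [if_neg hb] at h12
    simp [newNodes, blockNodes, h3, h12, hb]

end PagedMemory

lemma StageMid.mem_bound (ho : G.IsArcOrder m q first) {k : ℕ} {l : List ℕ} (hk : k < m)
    (h : G.StageMid q first F E k l) {x : ℕ} (hx : x ∈ l) : 0 < x ∧ x ≤ n + m := by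
  obtain ⟨pos, h, -⟩ := h
  have h1 := ho.first_le_total (k := k + 1) hk
  have h2 := ho.first_succ_eq hk
  rcases (h.mem x).1 hx with ⟨v, -, rfl⟩ | ⟨i, hi, -, rfl⟩
  · have := v.isLt; omega
  · omega

/-- The nodes inserted so far are in the memory. -/
def ListAt (G : EmbeddedDigraph n) (q : ℕ → Fin n × Fin n) (S : List ℕ → Prop) (τ : State) : Prop :=
  ∃ l, S l ∧ l.head? = some ((G.tail (q 0)).val + 1) ∧ Linked l τ

lemma head?_insert {A ys B : List ℕ} {z : ℕ} :
    (A ++ z :: (ys ++ B)).head? = (A ++ z :: B).head? := by cases A <;> simp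

lemma reaches_insertNodes_list {W : ℕ} {S : List ℕ → Prop} {L : List (Test × Expr)} {σ : State}
    {A B ys : List ℕ} {z : ℕ}
    (hl : Linked (A ++ z :: B) σ) (hz : σ.var 5 = z) (hys : newNodes σ L = ys)
    (hh : (A ++ z :: B).head? = some ((G.tail (q 0)).val + 1))
    (hL : ∀ τ, Frame (insertNode (.eq (.lit 0) (.lit 0)) (.lit 0)) σ τ →
      ∀ p ∈ L, (p.1.eval τ ↔ p.1.eval σ) ∧ p.2.eval τ = p.2.eval σ)
    (hS : S (A ++ z :: (ys ++ B))) (hnd : (A ++ z :: (ys ++ B)).Nodup)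
    (hW : ∀ x ∈ A ++ z :: (ys ++ B), 0 < x ∧ x ≤ W) :
    Reaches W (insertNodes L) σ (7 * L.length) (G.ListAt q S) := by
  have e : A ++ [z] ++ ys ++ B = A ++ z :: (ys ++ B) := by simp
  subst hys
  refine (reaches_insertNodes (P := A ++ [z]) (B := B) ⟨by simpa using hl, by simp [hz]⟩ hL
    (by rwa [e]) (by rwa [e])).mono le_rfl fun τ _ hτ => ?_
  rw [e] at hτ
  exact ⟨_, hS, head?_insert.trans hh, hτ⟩

end EmbeddedDigraph

namespace EmbeddedDigraph

variable {n : ℕ} {G : EmbeddedDigraph n} {m : ℕ} {q : ℕ → Fin n × Fin n} {first : ℕ → ℕ}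
  {F E : ℕ → Bool} {W k : ℕ} {τ : RAM.State}

open RAM

/-- Insertions change only the pointer arrays 19 and 20 and the registers 5 and 6, none of which the
tests and the node expressions read. -/
lemma stable_nodes {L : List (Test × Expr)} (hL : L ∈ [midNodes, topNodes, lowNodes, blockNodes])
    {σ τ : State} (hf : Frame (insertNode (.eq (.lit 0) (.lit 0)) (.lit 0)) σ τ) :
    ∀ p ∈ L, (p.1.eval τ ↔ p.1.eval σ) ∧ p.2.eval τ = p.2.eval σ := by
  have e1 := hf.arr 12 rfl
  have e2 := hf.arr 17 rfl
  have e3 := hf.arr 18 rfl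
  have e4 := hf.arr 21 rfl
  have e5 := hf.arr 26 rfl
  have e6 := hf.var 0 rfl
  have e7 := hf.var 3 rfl
  have e8 := hf.var 8 rfl
  simp only [List.mem_cons, List.not_mem_nil, or_false] at hL
  rcases hL with rfl | rfl | rfl | rfl <;>
  simp [midNodes, topNodes, lowNodes, blockNodes, crossingTest, crossingNode, e1, e2, e3, e4, e5,
    e6, e7, e8]

/-- The triangle of step `k` whose third vertex is in the middle is inserted. -/
lemma reaches_midNodes (hW : n + m ≤ W) (hG : G.IsOuterplanarTriangulatedST)
    (ho : G.IsArcOrder m q first) (hk : k < m) (hτ : G.PagedMemory q first m F E τ)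
    (h3 : τ.var 3 = k) (h8 : τ.var 8 = first k) (hext : ¬ G.Ext (q k)) (hmid : G.MidApex (q k))
    (hs : MidStates F E k (first k) (first k + 1))
    (h : G.ListAt q (G.StageAt q first F E k) τ) :
    Reaches W (.seq midStart (insertNodes midNodes)) τ (midStart.steps + 7 * midNodes.length)
      (G.ListAt q (G.StageMid q first F E k)) := by
  obtain ⟨l, hst, hh, hl⟩ := h
  obtain ⟨P, hP⟩ : ∃ P : State → Prop, ∀ υ, P υ ↔ ∃ A z B, l = A ++ z :: B ∧
      ((F k = true ∧ ∃ B', B = ((G.head (q k)).val + 1) :: B') ∨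
        (F k = false ∧ z = (G.tail (q k)).val + 1)) ∧ υ.var 5 = z := ⟨_, fun _ => Iff.rfl⟩
  have key : Reaches W midStart τ midStart.steps P := by
    refine .of_wp ?_
    by_cases hF : F k = true
    · obtain ⟨A, z, B, rfl⟩ := hst.exists_pred ho hk
      have hz := hst.mem_bound ho hk.le (x := z) (by simp)
      have hc := hl.chain
      rw [List.append_assoc, List.cons_append, List.cons_append, List.isChain_append_cons_cons] at hc
      simp [midStart, h3, (hτ.lower_eq k).1, hτ.order.head k hk, hc.2.1.2, hF]
      exact ⟨by omega, (hP _).2 ⟨A, z, _, rfl, .inl ⟨hF, B, rfl⟩, by simp⟩⟩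
    · have hm := hst.tail_mem ho hk
      have hz := hst.mem_bound ho hk.le hm
      obtain ⟨A, B, rfl⟩ := List.append_of_mem hm
      simp [midStart, h3, (hτ.lower_eq k).1, hτ.order.tail k hk, hF]
      exact ⟨by omega, (hP _).2 ⟨A, _, B, rfl, .inr ⟨by simpa using hF, rfl⟩, by simp⟩⟩
  refine key.seq fun υ hf hυ => ?_
  obtain ⟨A, z, B, e, hz, h5⟩ := (hP υ).1 hυ
  subst e
  have hυ := hτ.of_frame hf (by decide) rfl
  have hst' := hst.mid hG ho hk hext hmid hs rfl hz
  exact reaches_insertNodes_list (hl.congr (hf.arr _ rfl) (hf.arr _ rfl)) h5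
    (hυ.newNodes_mid hk ((hf.var 3 rfl).trans h3) ((hf.var 8 rfl).trans h8)) hh
    (fun _ h => stable_nodes (by simp) h) hst' hst'.nodup
    fun x hx => (hst'.mem_bound ho hk hx).imp_right (le_trans · hW)

/-- The triangle of step `k` whose third vertex is on top is inserted. -/
lemma reaches_topNodes (hW : n + m ≤ W) (hG : G.IsOuterplanarTriangulatedST)
    (ho : G.IsArcOrder m q first) (hk : k < m) (hτ : G.PagedMemory q first m F E τ)
    (h3 : τ.var 3 = k) (h8 : τ.var 8 = first k) (hext : ¬ G.Ext (q k)) (hmid : ¬ G.MidApex (q k))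
    (hs : TopStates F E k (first k) (first k + 1))
    (h : G.ListAt q (G.StageAt q first F E k) τ) :
    Reaches W (.seq (.assign 5 (.get 26 (.var 3))) (.seq (insertNodes topNodes)
      (.seq (.assign 5 (.get 25 (.var 3))) (insertNodes lowNodes)))) τ
      (1 + (7 * topNodes.length + (1 + 7 * lowNodes.length)))
      (G.ListAt q (G.StageMid q first F E k)) := by
  obtain ⟨l, hst, hh, hl⟩ := h
  have hm := hst.head_mem ho hk
  have hmW := hst.mem_bound ho hk.le hm
  have htW := hst.mem_bound ho hk.le (hst.tail_mem ho hk)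
  have hm' := hst.tail_mem ho hk
  obtain ⟨A, B, rfl⟩ := List.append_of_mem hm
  -- the list after the first part and after the second part
  obtain ⟨ys, hys⟩ : ∃ ys, ys = crossingNodes n F E (first k + 1) ++
      (if F (first k) = true then crossingNodes n F E (first k) else []) ++
        [(G.apex (q k)).val + 1] := ⟨_, rfl⟩
  obtain ⟨A', B', hAB⟩ : ∃ A' B', A ++ ((G.head (q k)).val + 1) :: (ys ++ B) =
      A' ++ ((G.tail (q k)).val + 1) :: B' := by
    apply List.append_of_mem
    rcases List.mem_append.1 hm' with h | h <;> grind
  have hst' : G.StageMid q first F E k (A' ++ ((G.tail (q k)).val + 1) ::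
      ((if F (first k) = false then [n + 1 + first k] else []) ++ B')) := by
    by_cases hF : F (first k) = true
    · have := hst.top_first hG ho hk hext hmid hs hF rfl
      rw [if_pos hF] at hys
      rw [← hys, hAB] at this
      simpa [hF] using this
    · have hF : F (first k) = false := by simpa using hF
      rw [hF] at hys
      simp only [Bool.false_eq_true, if_false, List.append_nil] at hys
      rw [if_pos hF]
      rw [hys] at hAB
      exact hst.top_second hG ho hk hext hmid hs hF rfl hAB
  have hsub : (A ++ ((G.head (q k)).val + 1) :: (ys ++ B)).Sublist (A' ++ ((G.tail (q k)).val + 1) ::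
      ((if F (first k) = false then [n + 1 + first k] else []) ++ B')) := by grind
  refine Reaches.seq (Q := fun υ => υ.var 5 = (G.head (q k)).val + 1) (.of_wp (c := .assign _ _) ?_)
    fun υ hf h5 => Reaches.seq (Q := G.ListAt q fun l => l = A ++ ((G.head (q k)).val + 1) ::
      (ys ++ B)) ?_ fun φ hf' ⟨l, e, hh', hl'⟩ => Reaches.seq
        (Q := fun υ => υ.var 5 = (G.tail (q k)).val + 1) (t := 1) (.of_wp (c := .assign _ _) ?_)
        fun χ hf'' h5' => ?_
  · simp [h3, hτ.order.head k hk]; omega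
  · have hυ := hτ.of_frame hf (by decide) rfl
    exact reaches_insertNodes_list (hl.congr (hf.arr _ rfl) (hf.arr _ rfl)) h5
      ((hυ.newNodes_top hk ((hf.var 3 rfl).trans h3) ((hf.var 8 rfl).trans h8)).trans hys.symm) hh
      (fun _ h => stable_nodes (by simp) h) rfl (hst'.nodup.sublist hsub)
      fun x hx => (hst'.mem_bound ho hk (hsub.subset hx)).imp_right (le_trans · hW)
  · have e3 := (hf'.var 3 rfl).trans ((hf.var 3 rfl).trans h3)
    have := ((hτ.of_frame hf (by decide) rfl).of_frame hf' (by decide) rfl).order.tail k hk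
    simp [e3, this]; omega
  · have hχ := ((hτ.of_frame hf (by decide) rfl).of_frame hf' (by decide) rfl).of_frame hf''
      (by decide) rfl
    have e8 := (hf''.var 8 rfl).trans ((hf'.var 8 rfl).trans ((hf.var 8 rfl).trans h8))
    subst e
    rw [hAB] at hh' hl'
    exact reaches_insertNodes_list (hl'.congr (hf''.arr _ rfl) (hf''.arr _ rfl)) h5'
      (hχ.newNodes_low e8) hh' (fun _ h => stable_nodes (by simp) h) hst' hst'.nodup
      fun x hx => (hst'.mem_bound ho hk hx).imp_right (le_trans · hW)

/-- The arc above the block that ends at step `k` is inserted. -/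
lemma reaches_blockInsert (hW : n + m ≤ W) (hG : G.IsOuterplanarTriangulatedST)
    (ho : G.IsArcOrder m q first) (hk : k < m) (hτ : G.PagedMemory q first m F E τ)
    (h3 : τ.var 3 = k) (hF : G.EndsBlock (q k) → F (first (k + 1) - 1) = E (first (k + 1) - 1))
    (h : G.ListAt q (G.StageMid q first F E k) τ) :
    Reaches W blockInsert τ (1 + 7 * blockNodes.length)
      (G.ListAt q (G.StageAt q first F E (k + 1))) := by
  classical
  obtain ⟨l, hst, hh, hl⟩ := h
  have hm : (G.head (q k)).val + 1 ∈ l := by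
    obtain ⟨pos, h, -⟩ := hst
    exact (h.mem _).2 (.inl ⟨_, List.mem_append_left _
      (ho.ends_mem_visited hG hk.le k (ho.bfs.lt_first k hk)).2, rfl⟩)
  have hmW := hst.mem_bound ho hk hm
  obtain ⟨A, B, rfl⟩ := List.append_of_mem hm
  have hst' : G.StageAt q first F E (k + 1) (A ++ ((G.head (q k)).val + 1) ::
      ((if G.EndsBlock (q k) then [(G.head (G.blockKid (q k))).val + 1] else []) ++ B)) := by
    by_cases hb : G.EndsBlock (q k)
    · rw [if_pos hb]; exact hst.block hG ho hk hb (hF hb) rfl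
    · rw [if_neg hb]; exact hst.next ho hk hb
  refine Reaches.seq (Q := fun υ => υ.var 5 = (G.head (q k)).val + 1) (.of_wp (c := .assign _ _) ?_)
    fun υ hf h5 => ?_
  · simp [h3, hτ.order.head k hk]; omega
  · have hυ := hτ.of_frame hf (by decide) rfl
    exact reaches_insertNodes_list (hl.congr (hf.arr _ rfl) (hf.arr _ rfl)) h5
      (hυ.newNodes_block ho hk ((hf.var 3 rfl).trans h3)) hh
      (fun _ h => stable_nodes (by simp) h) hst' hst'.nodup
      fun x hx => (hst'.mem_bound ho hk hx).imp_right (le_trans · hW)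

end EmbeddedDigraph

namespace RAM

variable {W : ℕ} {c d : Cmd} {b : Test} {σ : State} {t : ℕ} {Q : State → Prop}

lemma Reaches.ite_true (hb : b.eval σ) (h : Reaches W c σ t Q) :
    Reaches W (.ite b c d) σ (t + 1) Q := by
  obtain ⟨τ, T, h1, h2, h3⟩ := h
  exact ⟨τ, _, .ite_true hb h1, by omega, h3⟩

lemma Reaches.ite_false (hb : ¬ b.eval σ) (h : Reaches W d σ t Q) :
    Reaches W (.ite b c d) σ (t + 1) Q := by
  obtain ⟨τ, T, h1, h2, h3⟩ := h
  exact ⟨τ, _, .ite_false hb h1, by omega, h3⟩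

end RAM

namespace EmbeddedDigraph

variable {n : ℕ} {G : EmbeddedDigraph n} {m : ℕ} {q : ℕ → Fin n × Fin n} {first : ℕ → ℕ}
  {F E : ℕ → Bool} {W k : ℕ} {τ : RAM.State}

open RAM

lemma ListAt.of_frame {S : List ℕ → Prop} {c : Cmd} {σ τ : State} (h : G.ListAt q S σ)
    (hf : Frame c σ τ) (h1 : c.stores 19 = false) (h2 : c.stores 20 = false) :
    G.ListAt q S τ := by
  obtain ⟨l, a, b, hl⟩ := h
  exact ⟨l, a, b, hl.congr (hf.arr _ h1) (hf.arr _ h2)⟩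

/-- The bound is attained for a third vertex above the base: two tests, two cursor assignments and
four insertions of at most 7 steps each. -/
lemma reaches_triangleInsert (hW : n + m ≤ W) (hG : G.IsOuterplanarTriangulatedST)
    (ho : G.IsArcOrder m q first) (hk : k < m) (hτ : G.PagedMemory q first m F E τ)
    (h3 : τ.var 3 = k) (h8 : τ.var 8 = first k)
    (hp : IsPaging m first (fun k => G.triangleKind (q k)) F E)
    (h : G.ListAt q (G.StageAt q first F E k) τ) :
    Reaches W triangleInsert τ 32 (G.ListAt q (G.StageMid q first F E k)) := by
  have h11 := hτ.order.kind k hk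
  have hle := G.triangleKind_le (d := q k)
  by_cases k1 : G.triangleKind (q k) = 1
  · obtain ⟨hext, hmid⟩ := triangleKind_eq_one.1 k1
    exact (Reaches.ite_true (by simp [h3, h11, k1])
      (reaches_midNodes hW hG ho hk hτ h3 h8 hext hmid (hp.one k hk k1) h)).mono (by decide)
      fun _ _ h => h
  by_cases k2 : G.triangleKind (q k) = 2
  · obtain ⟨hext, hmid⟩ := triangleKind_eq_two.1 k2
    exact (Reaches.ite_false (by simp [h3, h11, k1]) (Reaches.ite_true (by simp [h3, h11, k2])
      (reaches_topNodes hW hG ho hk hτ h3 h8 hext hmid (hp.two k hk k2) h))).mono (by decide)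
      fun _ _ h => h
  · have hext := triangleKind_eq_zero.1 (show G.triangleKind (q k) = 0 by omega)
    obtain ⟨l, a, b, hl⟩ := h
    exact (Reaches.ite_false (by simp [h3, h11, k1]) (Reaches.ite_false (by simp [h3, h11, k2])
      (t := 0) ⟨τ, 0, .skip τ, le_rfl, l, a.leaf hG ho hk hext, b, hl⟩)).mono (by decide)
      fun _ _ h => h

structure InsertInv (G : EmbeddedDigraph n) (q : ℕ → Fin n × Fin n) (first : ℕ → ℕ)
    (F E : ℕ → Bool) (k : ℕ) (τ : State) : Prop where
  var : τ.var 3 = k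
  list : G.ListAt q (G.StageAt q first F E k) τ

theorem reaches_insertLoop (hW : n + m ≤ W) (hG : G.IsOuterplanarTriangulatedST)
    (ho : G.IsArcOrder m q first) {σ : State} (hσ : G.PagedMemory q first m F E σ)
    (htot : σ.var 4 = m) (hp : IsPaging m first (fun k => G.triangleKind (q k)) F E)
    (hroot : F 0 = E 0)
    (hextra : ∀ k < m, G.EndsBlock (q k) → F (first (k + 1) - 1) = E (first (k + 1) - 1)) :
    Reaches W insertLoop σ (5 + (m * (42 + 1) + 1)) (G.ListAt q (G.StageAt q first F E m)) := by
  have hm := ho.bfs.pos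
  refine (Reaches.seq (Q := G.InsertInv q first F E 0) (t := 5) (Reaches.of_wp (c := .block _) ?_)
    fun υ hfυ hυ => (Reaches.loop (t := 42) m (G.InsertInv q first F E) hυ ?_ ?_)).mono le_rfl
    fun _ _ h => h.list
  · have h0 := stageAt_zero (F := F) (E := E) hG ho hroot
    have hne : (G.tail (q 0)).val + 1 ≠ (G.head (q 0)).val + 1 := by simpa using h0.nodup
    have t0 := (G.tail (q 0)).isLt
    have t1 := (G.head (q 0)).isLt
    have e1 := hσ.order.tail 0 hm
    have e2 := hσ.order.head 0 hm
    have fin : ∀ υ : State, υ.var 3 = 0 →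
        υ.arr 19 ((G.tail (q 0)).val + 1) = (G.head (q 0)).val + 1 →
        υ.arr 20 ((G.head (q 0)).val + 1) = (G.tail (q 0)).val + 1 →
        υ.arr 19 ((G.head (q 0)).val + 1) = 0 → υ.arr 20 0 = (G.head (q 0)).val + 1 →
        G.InsertInv q first F E 0 υ := fun υ w1 w2 w3 w4 w5 =>
      ⟨w1, _, h0, rfl, ⟨by simp [w2, w3, w4, w5]⟩⟩
    generalize ha : (G.tail (q 0)).val + 1 = a at *
    generalize hb : (G.head (q 0)).val + 1 = b at *
    simp [e1, e2]
    exact ⟨by omega, by omega, by omega, fin _ (by simp) (by simp [hne]) (by simp; omega) (by simp)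
      (by simp)⟩
  · intro i hi τ hf hτ
    have e1 : τ.var 4 = _ := hf.var 4 rfl
    have e2 : υ.var 4 = _ := hfυ.var 4 rfl
    simp [hτ.var, e1, e2, htot]
  · intro k hk τ hf hτ
    have hτ' := (hσ.of_frame hfυ (by decide) rfl).of_frame hf (by decide) rfl
    have h3 := hτ.var
    have hle := ho.first_le_total hk.le
    refine (Reaches.seq (Q := fun υ => υ.var 8 = first k)
      (Reaches.of_wp (c := .assign 8 _) ?_) fun υ hf1 h8 => Reaches.seq
        (reaches_triangleInsert hW hG ho hk (hτ'.of_frame hf1 (by decide) rfl)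
          ((hf1.var 3 rfl).trans h3) h8 hp (hτ.list.of_frame hf1 rfl rfl)) fun φ hf2 hφ =>
        Reaches.seq (reaches_blockInsert hW hG ho hk ((hτ'.of_frame hf1 (by decide) rfl).of_frame
          hf2 (by decide) rfl) ((hf2.var 3 rfl).trans ((hf1.var 3 rfl).trans h3)) (hextra k hk) hφ)
        fun χ hf3 hχ => Reaches.of_wp (c := .assign 3 _) ?_).mono (by decide) fun _ _ h => h
    · simp [h3, hτ'.order.kids k hk]; omega
    · have e3 := (hf3.var 3 rfl).trans ((hf2.var 3 rfl).trans ((hf1.var 3 rfl).trans h3))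
      have fin : ∀ ψ : State, ψ.var 3 = k + 1 → ψ.arr = χ.arr → G.InsertInv q first F E (k + 1) ψ :=
        fun ψ w1 w2 => ⟨w1, by
          obtain ⟨l, a, b, hl⟩ := hχ
          exact ⟨l, a, b, hl.congr (by rw [w2]) (by rw [w2])⟩⟩
      simp [e3]
      exact ⟨by omega, fin _ (by simp) rfl⟩

end EmbeddedDigraph

/-! ### The machine computes the places on the spine -/

namespace RAM

/-- A node up to `n` is a vertex, shifted by 1; a larger node is a crossing and gives the index of
its arc. Ranks start at 1, so 0 remains free to mean that an arc has no crossing. -/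
def rankBody : Cmd := .block [
  .ite (.le (.var 5) (.var 0)) (.store 4 (.sub (.var 5) (.lit 1)) (.var 7))
    (.store 5 (.get 22 (.sub (.sub (.var 5) (.var 0)) (.lit 1))) (.var 7)),
  .assign 5 (.get 19 (.var 5)), .assign 7 (.add (.var 7) (.lit 1))]

def rankLoop : Cmd := .seq (.block [.assign 5 (.get 25 (.lit 0)), .assign 7 (.lit 1)])
  (.while (.not (.eq (.var 5) (.lit 0))) rankBody)

end RAM

namespace EmbeddedDigraph

variable {n : ℕ} {G : EmbeddedDigraph n} {m : ℕ} {q : ℕ → Fin n × Fin n} {first : ℕ → ℕ}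
  {F E : ℕ → Bool} {W k : ℕ} {τ : RAM.State}

open RAM

/-- The places of the first `j` nodes are in the memory. -/
structure RankInv (G : EmbeddedDigraph n) (q : ℕ → Fin n × Fin n) (m : ℕ) (l : List ℕ) (j : ℕ)
    (τ : State) : Prop where
  cur : (l ++ [0])[j]? = some (τ.var 5)
  rank : τ.var 7 = j + 1
  vertex : ∀ v : Fin n, l.idxOf (v.val + 1) < j → τ.arr 4 v = l.idxOf (v.val + 1) + 1
  crossing : ∀ k < m, τ.arr 5 (G.ix (G.upHalf (q k))) =
    if l.idxOf (n + 1 + k) < j then l.idxOf (n + 1 + k) + 1 else 0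

theorem reaches_rankLoop (hW : n + m + 1 ≤ W) (ho : G.IsArcOrder m q first) {σ : State}
    (hσ : G.PagedMemory q first m F E σ) {l : List ℕ} (hnd : l.Nodup)
    (hl : ∀ x ∈ l, 0 < x ∧ x ≤ n + m) (hh : l.head? = some ((G.tail (q 0)).val + 1))
    (hlink : Linked l σ) (h5 : ∀ j, σ.arr 5 j = 0) :
    Reaches W rankLoop σ (2 + ((n + m) * (rankBody.steps + 1) + 1)) (G.RankInv q m l l.length) := by
  have hm := ho.bfs.pos
  -- The nodes are distinct numbers between 1 and `n + m`; this bounds the number of passes of the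
  -- loop.
  have hlen : l.length ≤ n + m := by
    have h1 : l.toFinset ⊆ Finset.Icc 1 (n + m) := fun x hx => by
      rw [Finset.mem_Icc]; exact hl x (List.mem_toFinset.1 hx)
    have h2 := Finset.card_le_card h1
    rwa [List.toFinset_card_of_nodup hnd, Nat.card_Icc, Nat.add_sub_cancel] at h2
  refine (Reaches.seq (Q := G.RankInv q m l 0) (t := 2) (Reaches.of_wp (c := .block _) ?_)
    fun υ hfυ hυ => (Reaches.loop (t := rankBody.steps) l.length (G.RankInv q m l) hυ ?_ ?_)).mono
      (by gcongr) fun _ _ h => h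
  · have e1 := hσ.order.tail 0 hm
    have := (G.tail (q 0)).isLt
    have e2 : (l ++ [0])[0]? = some ((G.tail (q 0)).val + 1) := by
      cases l <;> simp_all
    simp [e1]
    exact ⟨by omega, by omega, by simpa using e2, by simp, by simp, by simp [h5]⟩
  · intro j hj τ hf hτ
    have hc := hτ.cur
    rcases hj.eq_or_lt with rfl | hj
    · simp at hc
      simp [← hc]
    · rw [List.getElem?_append_left hj, List.getElem?_eq_getElem hj, Option.some.injEq] at hc
      have := hl _ (List.getElem_mem hj)
      simp [← hc, hj]
      omega
  · intro j hj τ hf hτ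
    have hτ' := (hσ.of_frame hfυ (by decide) rfl).of_frame hf (by decide) rfl
    have hlink' := (hlink.congr (hfυ.arr 19 rfl) (hfυ.arr 20 rfl)).congr (hf.arr 19 rfl)
      (hf.arr 20 rfl)
    obtain ⟨hc, hr, hv, hx⟩ := hτ
    rw [List.getElem?_append_left hj, List.getElem?_eq_getElem hj, Option.some.injEq] at hc
    have hb := hl _ (List.getElem_mem hj)
    have hidx : l.idxOf l[j] = j := hnd.idxOf_getElem j hj
    have hidx' : ∀ x, l.idxOf x = j → x = l[j] := by grind
    have hnext : (l ++ [0])[j + 1]? = some (τ.arr 19 l[j]) := by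
      have h1 := List.isChain_iff_getElem.1 hlink'.chain j (by simp; omega)
      rw [List.getElem_append_left hj] at h1
      rw [List.getElem?_eq_getElem (by simp; omega), ← h1.1]
    have hnW : τ.arr 19 l[j] ≤ W := by
      have := List.mem_of_getElem? hnext
      rcases List.mem_append.1 this with h | h
      · have := hl _ h; omega
      · simp at h; omega
    have e0 := hτ'.size
    generalize l[j] = x at *
    have fin : ∀ υ : State, υ.var 5 = τ.arr 19 x → υ.var 7 = j + 1 + 1 →
        (∀ v : Fin n, υ.arr 4 v = if x = v.val + 1 then j + 1 else τ.arr 4 v) →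
        (∀ k < m, υ.arr 5 (G.ix (G.upHalf (q k))) = if x = n + 1 + k then j + 1 else
          τ.arr 5 (G.ix (G.upHalf (q k)))) → G.RankInv q m l (j + 1) υ := by
      intro υ w1 w2 w3 w4
      refine ⟨hnext.trans (by rw [w1]), w2, fun v hvj => ?_, fun k hk => ?_⟩
      · rw [w3]
        split_ifs with h
        · rw [← h, hidx]
        · grind
      · rw [w4 k hk, hx k hk]
        by_cases h : x = n + 1 + k
        · rw [← h, hidx]; simp
        · grind
    refine .of_wp ?_
    by_cases hxn : x ≤ n
    · simp [rankBody, ← hc, hr, e0, hxn]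
      exact ⟨by omega, hnW, by omega, fin _ (by simp) (by simp)
        (fun v => by simp; congr 1; simp; omega) fun k hk => by simp; omega⟩
    · obtain ⟨i, rfl⟩ : ∃ i, x = n + 1 + i := ⟨x - n - 1, by omega⟩
      have hi : i < m := by omega
      have e1 : n + 1 + i - n - 1 = i := by omega
      have e22 := hτ'.order.up i hi
      simp [rankBody, ← hc, hr, e0, hxn, e1, e22]
      refine ⟨by omega, hnW, by omega, fin _ (by simp) (by simp) (fun v => ?_) fun k hk => ?_⟩
      · have := v.isLt
        simp; omega
      · simp
        congr 1
        exact propext ⟨fun h => (ho.upHalf_inj hk hi h).symm, fun h => by rw [h]⟩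

end EmbeddedDigraph

/-! ### The algorithm -/

namespace EmbeddedDigraph

variable {n : ℕ} {G : EmbeddedDigraph n} {m : ℕ} {q : ℕ → Fin n × Fin n} {first : ℕ → ℕ}
  {F E : ℕ → Bool} {τ : RAM.State}

open RAM

/-- The drawing that is read off from the memory realizes the chosen pages. -/
lemma RankInv.realizes {l : List ℕ} (h : G.RankInv q m l l.length τ)
    (hv : ∀ v : Fin n, v.val + 1 ∈ l) (hx : ∀ k < m, n + 1 + k ∈ l ↔ F k ≠ E k)
    (h6 : ∀ k < m, τ.arr 6 (G.ix (G.upHalf (q k))) = (F k == G.dir (q k)).toNat) :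
    G.Realizes q m F E (fun x => l.idxOf x + 1) (G.output τ) := by
  refine ⟨fun v => h.vertex v (List.idxOf_lt_length_iff.2 (hv v)), fun k hk => ?_, fun k hk => ?_⟩
  · have := h.crossing k hk
    change (if τ.arr 5 (G.ix (G.upHalf (q k))) = 0 then [] else
      [τ.arr 5 (G.ix (G.upHalf (q k)))]) = _
    simp only [List.idxOf_lt_length_iff, hx k hk] at this
    rw [this]
    split_ifs <;> simp_all
  · change (τ.arr 6 (G.ix (G.upHalf (q k))) == 1) = _
    rw [h6 k hk]
    cases F k == G.dir (q k) <;> rfl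

lemma idxOf_lt_idxOf_iff {l : List ℕ} {pos : ℕ → ℚ} (h : l.Pairwise (pos · < pos ·)) {a b : ℕ}
    (ha : a ∈ l) (hb : b ∈ l) : l.idxOf a < l.idxOf b ↔ pos a < pos b := by
  have key : ∀ {a b}, a ∈ l → b ∈ l → l.idxOf a < l.idxOf b → pos a < pos b := by
    intro a b ha hb hab
    have := List.pairwise_iff_getElem.1 h _ _ (List.idxOf_lt_length_iff.2 ha)
      (List.idxOf_lt_length_iff.2 hb) hab
    simpa using this
  refine ⟨key ha hb, fun hp => ?_⟩
  rcases lt_trichotomy (l.idxOf a) (l.idxOf b) with hlt | heq | hgt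
  · exact hlt
  · rw [(List.idxOf_inj ha).1 heq] at hp
    exact absurd hp (lt_irrefl _)
  · exact absurd hp (key hb ha hgt).not_gt

end EmbeddedDigraph

namespace RAM

/-- The algorithm. -/
def bookProgram : Cmd := .seq faceLoop (.seq extLoop (.seq orderLoop (.seq tableLoop
  (.seq choiceLoop (.seq insertLoop rankLoop)))))

/-- Every loop makes at most `4 * n` passes: there are at most `2 * n` arcs and `4 * n` half-edges.
The summand 250 covers the loop tests, the insertions and the initializations, and it makes the
constant large enough for the word bound `16 * n` as well. -/
def bookTime : ℕ := 4 * (faceBody.steps + extBody.steps + orderBody.steps + tableBody.steps +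
  choiceBody.steps + rankBody.steps) + 250

end RAM

namespace EmbeddedDigraph

variable {n : ℕ} {G : EmbeddedDigraph n}

open RAM

theorem reaches_bookProgram (hG : G.IsOuterplanarTriangulatedST) {W : ℕ} (hW : 16 * n ≤ W) :
    Reaches W bookProgram G.input (bookTime * n) fun σ =>
      G.IsOneCrossingBookEmbedding (G.output σ) ∧
      (∀ D : BookDrawing n, G.IsOneCrossingBookEmbedding D →
        G.numSpineCrossings (G.output σ) ≤ G.numSpineCrossings D) ∧
      σ.var 2 = G.numSpineCrossings (G.output σ) := by
  obtain ⟨r, hr⟩ := hG.exists_root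
  obtain ⟨m, q, first, h1, h2, h3⟩ := hG.exists_order hr
  have hq0 : q 0 = r := h1.root
  have ho : G.IsArcOrder m q first := ⟨hq0.symm ▸ h1, hq0.symm ▸ hr, h2, h3⟩
  have hm := ho.bfs.pos
  have hn : 1 ≤ n := by have := r.1.isLt; omega
  have hm2 := (ho.length_visited_le hG).2
  have hH := G.length_halfEdges_le
  rw [ho.card_arcs] at hH
  obtain ⟨T, x, hT⟩ := PageTable.exists_isSolution (top := m + 1) ho.blockForest
  have hkind : ∀ k < m, G.triangleKind (q k) ≤ 2 := fun k _ => triangleKind_le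
  have e0 : G.input.var 0 = n := rfl
  refine Reaches.mono (t := G.halfEdges.length * (faceBody.steps + 1) + 1 +
    (2 + (G.halfEdges.length * (extBody.steps + 1) + 1) + (3 + (m * (orderBody.steps + 1) + 1) +
    (1 + (m * (tableBody.steps + 1) + 1) + (2 + (m * (choiceBody.steps + 1) + 1) +
    (5 + (m * (42 + 1) + 1) + (2 + ((n + m) * (rankBody.steps + 1) + 1)))))))) ?_ ?_
    fun _ _ h => h
  swap
  · have b1 : ∀ N s, N ≤ 4 * n → N * (s + 1) ≤ 4 * (s * n) + 4 * n := fun N s h =>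
      (Nat.mul_le_mul_right (s + 1) h).trans (by ring_nf; rfl)
    have c1 := b1 _ faceBody.steps (show G.halfEdges.length ≤ 4 * n by omega)
    have c2 := b1 _ extBody.steps (show G.halfEdges.length ≤ 4 * n by omega)
    have c3 := b1 m orderBody.steps (by omega)
    have c4 := b1 m tableBody.steps (by omega)
    have c5 := b1 m choiceBody.steps (by omega)
    have c6 := b1 (n + m) rankBody.steps (by omega)
    have c7 : bookTime * n = 4 * (faceBody.steps * n) + 4 * (extBody.steps * n) +
      4 * (orderBody.steps * n) + 4 * (tableBody.steps * n) + 4 * (choiceBody.steps * n) +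
      4 * (rankBody.steps * n) + 250 * n := by unfold bookTime; ring
    omega
  refine (reaches_faceLoop (G := G) (W := W) (by omega)).seq fun σ₁ f1 hσ₁ =>
    (reaches_extLoop hG (by omega) (by omega) hσ₁
      (by rw [f1.arr 0 rfl, input_zero le_rfl, startIx_length]) ((f1.var 0 rfl).trans e0)
      ((f1.var 1 rfl).trans rfl) (fun i => by rw [f1.arr 7 rfl]; rfl)
      (fun i => by rw [f1.arr 8 rfl]; rfl)).seq fun σ₂ f2 hσ₂ =>
    (reaches_orderLoop (by omega) (by omega) (by omega) ho
      (hσ₁.congr (f2.arr _ rfl) (f2.arr _ rfl) (f2.arr _ rfl) (f2.arr _ rfl) (f2.arr _ rfl)) hσ₂.1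
      (hσ₂.2 _ ho.root)).seq fun σ₃ f3 hσ₃ =>
    (reaches_tableLoop (by omega) ho hσ₃ hT).seq fun σ₄ f4 hσ₄ =>
    (reaches_choiceLoop (by omega) ho (hσ₃.mem.of_frame f4 (by decide))
      ((f4.var 4 rfl).trans (hσ₃.tot.trans ho.bfs.first_last)) hT hσ₄
      (fun j => by rw [f4.arr 17 rfl, f3.arr 17 rfl, f2.arr 17 rfl, f1.arr 17 rfl]; rfl)
      (fun j => by rw [f4.arr 18 rfl, f3.arr 18 rfl, f2.arr 18 rfl, f1.arr 18 rfl]; rfl)).seq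
      fun σ₅ f5 hσ₅ => ?_
  · have hp : G.PagedMemory q first m (memF σ₅) (memE σ₅) σ₅ :=
      ⟨(hσ₃.mem.of_frame f4 (by decide)).of_frame f5 (by decide), rfl, rfl, hσ₅.le, by
        rw [f5.var 0 rfl, f4.var 0 rfl, f3.var 0 rfl, f2.var 0 rfl, f1.var 0 rfl, e0]⟩
    have hc := hσ₅.choice
    have hex : ∀ k < m, G.EndsBlock (q k) →
        memF σ₅ (first (k + 1) - 1) = memE σ₅ (first (k + 1) - 1) := fun k hk hb => by
      rw [(hc.extra k hk hb).1, (hc.extra k hk hb).2]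
    refine (reaches_insertLoop (by omega) hG ho hp (by rw [f5.var 4 rfl, f4.var 4 rfl, hσ₃.tot,
      ho.bfs.first_last]) (ho.blockForest.isPaging_of_choice hT hkind hc (by omega))
      (hc.root.1.trans hc.root.2.symm) hex).seq fun σ₆ f6 hσ₆ => ?_
    obtain ⟨l, hst, hh, hl⟩ := hσ₆
    refine (reaches_rankLoop (by omega) ho (hp.of_frame f6 (by decide) rfl) hst.nodup
      (fun x hx => hst.mem_bound ho le_rfl hx) hh hl (fun j => by
        rw [f6.arr 5 rfl, f5.arr 5 rfl, f4.arr 5 rfl, f3.arr 5 rfl, f2.arr 5 rfl, f1.arr 5 rfl]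
        rfl)).mono le_rfl fun σ₇ f7 hσ₇ => ?_
    obtain ⟨pos, hst⟩ := hst
    rw [ho.bfs.first_last] at hst
    have hR : G.Realizes q m (memF σ₅) (memE σ₅) (fun x => l.idxOf x + 1) (G.output σ₇) := by
      refine hσ₇.realizes (fun v => (hst.mem _).2 (.inl ⟨v, ho.mem_visited hG v, rfl⟩))
        (fun k hk => (hst.mem _).trans ⟨?_, fun e => .inr ⟨k, hk, e, rfl⟩⟩) fun k hk => ?_
      · grind
      · rw [f7.arr 6 rfl, f6.arr 6 rfl]
        exact hσ₅.page k hk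
    have hcost : G.numSpineCrossings (G.output σ₇) = T.c00 0 :=
      (hR.numSpineCrossings_eq ho).trans
        (ho.blockForest.cost_of_choice hT hkind hc (by omega) hm)
    refine ⟨hR.isOneCrossingBookEmbedding hG ho hst fun a b ha hb => ?_, fun D hD => ?_, ?_⟩
    · rw [Nat.add_lt_add_iff_right]
      exact idxOf_lt_idxOf_iff hst.sorted ha hb
    · rw [hcost]
      -- The same solution of the recursion is attained by the output and bounds every competitor
      -- from below.
      exact hD.le_numSpineCrossings hG ho hm hT (by omega)
    · rw [hcost, f7.var 2 rfl, f6.var 2 rfl, hσ₅.two]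

end EmbeddedDigraph

theorem theorem5 :
    ∃ (P : RAM.Cmd) (C : ℕ), ∀ (n : ℕ) (G : EmbeddedDigraph n), G.IsOuterplanarTriangulatedST →
      ∃ (σ : RAM.State) (T : ℕ), RAM.Runs (C * n) P G.input σ T ∧ T ≤ C * n ∧
        G.IsOneCrossingBookEmbedding (G.output σ) ∧
        (∀ D : BookDrawing n, G.IsOneCrossingBookEmbedding D →
          G.numSpineCrossings (G.output σ) ≤ G.numSpineCrossings D) ∧
        σ.var 2 = G.numSpineCrossings (G.output σ) := by
  refine ⟨RAM.bookProgram, RAM.bookTime, fun n G hG => ?_⟩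
  exact EmbeddedDigraph.reaches_bookProgram hG
    (Nat.mul_le_mul_right n ((by decide : 16 ≤ 250).trans (Nat.le_add_left _ _)))
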